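/- **Setting.** Let $X=\{X(t),t\in[a,b]\}$, $a<b$, be a (jointly measurable) stochastic process with mean $\mu(t)=\mathbb E X(t)$ and covariance $R(s,t)=\operatorname{cov}(X(s),X(t))$. For each $n$ one observes $Y_{ij}=X_i(T_{ij})+U_{ij}$, $1\le i\le n$, $1\le j\le m_i$, where $m_i=m_{in}\ge 2$ are integers that may depend on $n$, the $X_i$ are independent copies of $X$, the $T_{ij}$ have density $f_T$ on $[a,b]$, the $U_{ij}$ are identically distributed with mean $0$ and finite variance $\sigma^2$, and all $X_i$, $T_{ij}$, $U_{ij}$ are mutually independent. Let $N_i=m_i(m_i-1)$, $\gamma_{nk}=(n^{-1}\sum_{i=1}^n m_i^{-k})^{-1}$, and let $h_\mu,h_R,h_V>0$ be bandwidths depending on $n$. Let $K_h(u)=h^{-1}K(u/h)$. **Estimators.** $\widehat\mu(t)=\widehat a_0$ and $\widehat V(t)=\widehat a_0$ where $(\widehat a_0,\widehat a_1)$ minimizes $$\frac1n\sum_{i=1}^n\frac1{m_i}\sum_{j=1}^{m_i}\{Z_{ij}-a_0-a_1(T_{ij}-t)\}^2K_h(T_{ij}-t)$$ with $Z_{ij}=Y_{ij}$,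 $h=h_\mu$ for $\widehat\mu$ and $Z_{ij}=Y_{ij}^2$, $h=h_V$ for $\widehat V$; $\widehat C(s,t)=\widehat a_0$ where $(\widehat a_0,\widehat a_1,\widehat a_2)$ minimizes $$\frac1n\sum_{i=1}^n\frac1{N_i}\sum_{k\ne j}\{Y_{ij}Y_{ik}-a_0-a_1(T_{ij}-s)-a_2(T_{ik}-t)\}^2K_{h_R}(T_{ij}-s)K_{h_R}(T_{ik}-t)$$ (any minimizer may be taken where it is not unique). Put $\widehat R(s,t)=\widehat C(s,t)-\widehat\mu(s)\widehat\mu(t)$ and $\widehat\sigma^2=(b-a)^{-1}\int_a^b\{\widehat V(t)-\widehat C(t,t)\}\,dt$. **Assumptions.** (C1) $0<m_T\le f_T\le M_T<\infty$ on $[a,b]$ for some constants, and $f_T$ is differentiable on $[a,b]$ with bounded derivative. (C2) $K$ is a symmetric probability density on $[-1,1]$, of bounded variation on $[-1,1]$. (C3) $\mu$ is twice differentiable on $[a,b]$ with bounded second derivative. (C4) All second-order partial derivatives of $R$ exist and are bounded on $[a,b]^2$. (C5) For some $\lambda_\mu\in(2,\infty)$: $\mathbb E|U_{ij}|^{\lambda_\mu}<\infty$,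 $\mathbb E\sup_t|X(t)|^{\lambda_\mu}<\infty$, $h_\mu\to0$ and $(h_\mu^2+h_\mu/\gamma_{n1})^{-1}(\log n/n)^{1-2/\lambda_\mu}\to0$. (C6) For some $\lambda_R\in(2,\infty)$: $\mathbb E|U_{ij}|^{2\lambda_R}<\infty$, $\mathbb E\sup_t|X(t)|^{2\lambda_R}<\infty$, $h_R\to0$ and $(h_R^4+h_R^3/\gamma_{n1}+h_R^2/\gamma_{n2})^{-1}(\log n/n)^{1-2/\lambda_R}\to0$. (C6$'$) As (C6), but with the last condition replaced by the weaker condition $(h_R^2+h_R/\gamma_{n1})^{-1}(\log n/n)^{1-2/\lambda_R}\to0$. (C7) For some $\lambda_V\in(2,\infty)$: $\mathbb E|U_{ij}|^{2\lambda_V}<\infty$, $\mathbb E\sup_t|X(t)|^{2\lambda_V}<\infty$, $h_V\to0$ and $(h_V^2+h_V/\gamma_{n1})^{-1}(\log n/n)^{1-2/\lambda_V}\to0$. Write $a_n\lesssim b_n$ for $a_n=O(b_n)$. "$O(r_n)$ a.s." means that, with probability one, the quantity is at most $Cr_n$ in absolute value for all large $n$, with a finite $C$ that may depend on the outcome; for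 $\widehat\sigma^2$ it includes that the integral defining it exists for all large $n$. **Corollary.** Assume (C1)–(C5) and (C7). (a) Assume (C6), and that $\max_{1\le i\le n}m_i\le M$ for some fixed $M$. If $h_R^2\lesssim h_\mu\lesssim h_R$, then $$\sup_{s,t\in[a,b]}|\widehat R(s,t)-R(s,t)|=O\bigl(h_R^2+\{\log n/(nh_R^2)\}^{1/2}\bigr)\quad\text{a.s.}$$ If $h_V+(\log n/n)^{1/3}\lesssim h_R\lesssim h_V^2\,n/\log n$, then $$\widehat\sigma^2-\sigma^2=O\bigl(h_R^2+\{\log n/(nh_R)\}^{1/2}\bigr)\quad\text{a.s.}$$ (b) Assume (C6$'$), and that $\min_{1\le i\le n}m_i\ge M_n$ for some positive sequence $M_n$ such that each of $h=h_\mu,h_R,h_V$ satisfies $M_n^{-1}\lesssim h\lesssim(\log n/n)^{1/4}$. Then both $\sup_{s,t\in[a,b]}|\widehat R(s,t)-R(s,t)|$ and $\widehat\sigma^2-\sigma^2$ are $O(\{\log n/n\}^{1/2})$ a.s. -/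

import Mathlib

open MeasureTheory ProbabilityTheory Filter Topology Asymptotics Set

namespace FunctionalData

/-! ## The process and the observations

The process `X` lives on a probability space `(S, ν)`; the independent realizations are
`X_i = X (ξ i ·)` with independent random elements `ξ i` of `S` of law `ν`.
All indices start at `0`: the `n`-th sample uses the curves `i < n` and, on curve `i`, the
observations `j < m n i`. -/

/-- The mean function `μ(t) = E X(t)`. -/
noncomputable def meanFun {S : Type*} [MeasurableSpace S] (ν : Measure S) (X : S → ℝ → ℝ)
    (t : ℝ) : ℝ :=
  ∫ x, X x t ∂ν

/-- The covariance function `R(s,t) = cov (X(s), X(t))`. -/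
noncomputable def covFun {S : Type*} [MeasurableSpace S] (ν : Measure S) (X : S → ℝ → ℝ)
    (s t : ℝ) : ℝ :=
  covariance (fun x => X x s) (fun x => X x t) ν

/-- The supremum of `|X(t)|` over `[a,b]`, as an extended nonnegative number. -/
noncomputable def pathSup {S : Type*} (a b : ℝ) (X : S → ℝ → ℝ) (x : S) : ENNReal :=
  ⨆ t ∈ Icc a b, ‖X x t‖ₑ

/-- The observations `Y_ij = X_i(T_ij) + U_ij`. -/
def obs {Ω S : Type*} (X : S → ℝ → ℝ) (ξ : ℕ → Ω → S) (T U : ℕ → ℕ → Ω → ℝ)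
    (ω : Ω) (i j : ℕ) : ℝ :=
  X (ξ i ω) (T i j ω) + U i j ω

/-- The observation model: the `X_i` are independent copies of the process `X`, the `T_ij` have
density `f` on `[a,b]`, the errors `U_ij` are identically distributed with mean zero and variance
`σ ^ 2`, and all curves, observation times and errors are mutually independent. -/
structure ObservationModel {Ω S : Type*} [MeasurableSpace Ω] [MeasurableSpace S]
    (P : Measure Ω) (ν : Measure S) (a b σ : ℝ) (f : ℝ → ℝ) (X : S → ℝ → ℝ)
    (ξ : ℕ → Ω → S) (T U : ℕ → ℕ → Ω → ℝ) : Prop where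
  measurable_process : Measurable (Function.uncurry X)
  aemeasurable_pathSup : AEMeasurable (pathSup a b X) ν
  measurable_curve : ∀ i, Measurable (ξ i)
  measurable_time : ∀ i j, Measurable (T i j)
  measurable_error : ∀ i j, Measurable (U i j)
  law_curve : ∀ i, P.map (ξ i) = ν
  law_time : ∀ i j,
    P.map (T i j) = (volume.restrict (Icc a b)).withDensity (fun t => ENNReal.ofReal (f t))
  identDistrib_error : ∀ i j, IdentDistrib (U i j) (U 0 0) P P
  memLp_error : ∀ i j, MemLp (U i j) 2 P
  mean_error : ∀ i j, ∫ ω, U i j ω ∂P = 0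
  variance_error : ∀ i j, variance (U i j) P = σ ^ 2
  indep : iIndep
    (Sum.elim (fun i : ℕ => MeasurableSpace.comap (ξ i) inferInstance)
      (Sum.elim
        (fun p : ℕ × ℕ => MeasurableSpace.comap (T p.1 p.2) inferInstance)
        (fun p : ℕ × ℕ => MeasurableSpace.comap (U p.1 p.2) inferInstance))) P

/-! ## Regularity conditions -/

/-- The design density is bounded away from zero and infinity on `[a,b]` and differentiable there
with a bounded derivative (one-sided at the end points). -/
structure DensityCond (a b : ℝ) (f : ℝ → ℝ) : Prop where
  bounds : ∃ mT MT : ℝ, 0 < mT ∧ ∀ t ∈ Icc a b, mT ≤ f t ∧ f t ≤ MT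
  deriv : ∃ (f' : ℝ → ℝ) (B : ℝ), ∀ t ∈ Icc a b,
    HasDerivWithinAt f (f' t) (Icc a b) t ∧ |f' t| ≤ B

/-- `K` is a symmetric probability density on `[-1,1]` of bounded variation on `[-1,1]`. -/
structure KernelCond (K : ℝ → ℝ) : Prop where
  nonneg : ∀ u, 0 ≤ K u
  symm : ∀ u, K (-u) = K u
  support : ∀ u, u ∉ Icc (-1 : ℝ) 1 → K u = 0
  integral_eq_one : ∫ u, K u = 1
  boundedVariation : BoundedVariationOn K (Icc (-1) 1)

/-- `g` is twice differentiable on `[a,b]` with bounded second derivative. -/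
def TwiceDiffBounded (a b : ℝ) (g : ℝ → ℝ) : Prop :=
  ∃ (g' g'' : ℝ → ℝ) (B : ℝ), ∀ t ∈ Icc a b,
    HasDerivWithinAt g (g' t) (Icc a b) t ∧
    HasDerivWithinAt g' (g'' t) (Icc a b) t ∧ |g'' t| ≤ B

/-- All second-order partial derivatives of `F` exist and are bounded on `[a,b]²`; `F₁`, `F₂` are
the first-order partial derivatives, `F₁₁`, `F₁₂`, `F₂₁`, `F₂₂` the second-order ones. -/
def SecondPartialsBounded (a b : ℝ) (F : ℝ → ℝ → ℝ) : Prop :=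
  ∃ (F₁ F₂ F₁₁ F₁₂ F₂₁ F₂₂ : ℝ → ℝ → ℝ) (B : ℝ), ∀ s ∈ Icc a b, ∀ t ∈ Icc a b,
    HasDerivWithinAt (fun u => F u t) (F₁ s t) (Icc a b) s ∧
    HasDerivWithinAt (fun v => F s v) (F₂ s t) (Icc a b) t ∧
    HasDerivWithinAt (fun u => F₁ u t) (F₁₁ s t) (Icc a b) s ∧
    HasDerivWithinAt (fun v => F₁ s v) (F₁₂ s t) (Icc a b) t ∧
    HasDerivWithinAt (fun u => F₂ u t) (F₂₁ s t) (Icc a b) s ∧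
    HasDerivWithinAt (fun v => F₂ s v) (F₂₂ s t) (Icc a b) t ∧
    |F₁₁ s t| ≤ B ∧ |F₁₂ s t| ≤ B ∧ |F₂₁ s t| ≤ B ∧ |F₂₂ s t| ≤ B

/-- `E |U_ij| ^ p < ∞` and `E (sup_{[a,b]} |X| ^ p) < ∞`. -/
def MomentCond {Ω S : Type*} [MeasurableSpace Ω] [MeasurableSpace S]
    (P : Measure Ω) (ν : Measure S) (a b : ℝ) (X : S → ℝ → ℝ) (U : ℕ → ℕ → Ω → ℝ)
    (p : ℝ) : Prop :=
  (∀ i j, Integrable (fun ω => |U i j ω| ^ p) P) ∧ ∫⁻ x, pathSup a b X x ^ p ∂ν < ⊤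

/-- `log n / n`. -/
noncomputable def logRatio (n : ℕ) : ℝ := Real.log n / n

/-- `γ_{nk}`, the `k`-th order harmonic mean of `m_1, …, m_n`. -/
noncomputable def harmonicMean (m : ℕ → ℕ → ℕ) (k n : ℕ) : ℝ :=
  ((n : ℝ)⁻¹ * ∑ i ∈ Finset.range n, ((m n i : ℝ) ^ k)⁻¹)⁻¹

/-- `(h² + h / γ_{n1})⁻¹ (log n / n)^{1 - 2/λ} → 0`. -/
def BandwidthRate₁ (m : ℕ → ℕ → ℕ) (lam : ℝ) (h : ℕ → ℝ) : Prop :=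
  Tendsto (fun n => (h n ^ 2 + h n / harmonicMean m 1 n)⁻¹ * logRatio n ^ (1 - 2 / lam))
    atTop (𝓝 0)

/-- `(h⁴ + h³ / γ_{n1} + h² / γ_{n2})⁻¹ (log n / n)^{1 - 2/λ} → 0`. -/
def BandwidthRate₂ (m : ℕ → ℕ → ℕ) (lam : ℝ) (h : ℕ → ℝ) : Prop :=
  Tendsto (fun n =>
      (h n ^ 4 + h n ^ 3 / harmonicMean m 1 n + h n ^ 2 / harmonicMean m 2 n)⁻¹ *
        logRatio n ^ (1 - 2 / lam))
    atTop (𝓝 0)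

/-! ## Local-linear estimators -/

/-- `K_h(u) = K(u / h) / h`. -/
noncomputable def scaledKernel (K : ℝ → ℝ) (h u : ℝ) : ℝ := h⁻¹ * K (u / h)

/-- The weighted least squares criterion at `t` of the univariate local-linear smoother with
responses `Z i j` at the points `τ i j`; curve `i` has `m i` observations. -/
noncomputable def loss₁ (K : ℝ → ℝ) (h : ℝ) (n : ℕ) (m : ℕ → ℕ) (τ Z : ℕ → ℕ → ℝ)
    (t a₀ a₁ : ℝ) : ℝ :=
  (n : ℝ)⁻¹ * ∑ i ∈ Finset.range n, (m i : ℝ)⁻¹ * ∑ j ∈ Finset.range (m i),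
    (Z i j - a₀ - a₁ * (τ i j - t)) ^ 2 * scaledKernel K h (τ i j - t)

/-- `a₀` is the intercept of a minimizer of the univariate local-linear criterion at `t`. -/
def IsLocalLinearFit₁ (K : ℝ → ℝ) (h : ℝ) (n : ℕ) (m : ℕ → ℕ) (τ Z : ℕ → ℕ → ℝ)
    (t a₀ : ℝ) : Prop :=
  ∃ a₁ : ℝ, ∀ c₀ c₁ : ℝ, loss₁ K h n m τ Z t a₀ a₁ ≤ loss₁ K h n m τ Z t c₀ c₁

/-- The weighted least squares criterion at `(s,t)` of the bivariate local-linear smoother with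
responses `Y i j * Y i k`, `k ≠ j`, at the points `(τ i j, τ i k)`; here
`m i * (m i - 1)` is the number of pairs on curve `i`. -/
noncomputable def loss₂ (K : ℝ → ℝ) (h : ℝ) (n : ℕ) (m : ℕ → ℕ) (τ Y : ℕ → ℕ → ℝ)
    (s t a₀ a₁ a₂ : ℝ) : ℝ :=
  (n : ℝ)⁻¹ * ∑ i ∈ Finset.range n, ((m i : ℝ) * ((m i : ℝ) - 1))⁻¹ *
    ∑ j ∈ Finset.range (m i), ∑ k ∈ (Finset.range (m i)).erase j,
      (Y i j * Y i k - a₀ - a₁ * (τ i j - s) - a₂ * (τ i k - t)) ^ 2 *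
        (scaledKernel K h (τ i j - s) * scaledKernel K h (τ i k - t))

/-- `a₀` is the intercept of a minimizer of the bivariate local-linear criterion at `(s,t)`. -/
def IsLocalLinearFit₂ (K : ℝ → ℝ) (h : ℝ) (n : ℕ) (m : ℕ → ℕ) (τ Y : ℕ → ℕ → ℝ)
    (s t a₀ : ℝ) : Prop :=
  ∃ a₁ a₂ : ℝ, ∀ c₀ c₁ c₂ : ℝ,
    loss₂ K h n m τ Y s t a₀ a₁ a₂ ≤ loss₂ K h n m τ Y s t c₀ c₁ c₂

/-- `μ̂`, `Ĉ` and `V̂` are the local-linear estimators of `E X(t)`, `E X(s)X(t)` and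
`E X(t)² + σ²` with bandwidths `hμ`, `hR` and `hV`. A minimizer always exists; where it is not
unique, any choice is allowed. -/
structure AreLocalLinearEstimators {Ω S : Type*} (a b : ℝ) (K : ℝ → ℝ) (m : ℕ → ℕ → ℕ)
    (hμ hR hV : ℕ → ℝ) (X : S → ℝ → ℝ) (ξ : ℕ → Ω → S) (T U : ℕ → ℕ → Ω → ℝ)
    (μhat : ℕ → Ω → ℝ → ℝ) (Chat : ℕ → Ω → ℝ → ℝ → ℝ) (Vhat : ℕ → Ω → ℝ → ℝ) : Prop where
  mean : ∀ n ω, ∀ t ∈ Icc a b,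
    IsLocalLinearFit₁ K (hμ n) n (m n) (fun i j => T i j ω) (obs X ξ T U ω) t (μhat n ω t)
  cross : ∀ n ω, ∀ s ∈ Icc a b, ∀ t ∈ Icc a b,
    IsLocalLinearFit₂ K (hR n) n (m n) (fun i j => T i j ω) (obs X ξ T U ω) s t
      (Chat n ω s t)
  square : ∀ n ω, ∀ t ∈ Icc a b,
    IsLocalLinearFit₁ K (hV n) n (m n) (fun i j => T i j ω)
      (fun i j => obs X ξ T U ω i j ^ 2) t (Vhat n ω t)

/-- `R̂(s,t) = Ĉ(s,t) - μ̂(s) μ̂(t)`. -/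
def covEst {Ω : Type*} (μhat : ℕ → Ω → ℝ → ℝ) (Chat : ℕ → Ω → ℝ → ℝ → ℝ)
    (n : ℕ) (ω : Ω) (s t : ℝ) : ℝ :=
  Chat n ω s t - μhat n ω s * μhat n ω t

/-- `σ̂² = (b - a)⁻¹ ∫_a^b {V̂(t) - Ĉ(t,t)} dt`. -/
noncomputable def errVarEst {Ω : Type*} (a b : ℝ) (Chat : ℕ → Ω → ℝ → ℝ → ℝ)
    (Vhat : ℕ → Ω → ℝ → ℝ) (n : ℕ) (ω : Ω) : ℝ :=
  (b - a)⁻¹ * ∫ t in a..b, (Vhat n ω t - Chat n ω t t)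

/-! ## Almost sure rates -/

/-- `sup_{s,t ∈ [a,b]} |D_n(s,t)| = O(r_n)` almost surely; the supremum is bounded by `C r_n`
exactly if all the values are. -/
def SupBigOAlmostSurely {Ω : Type*} [MeasurableSpace Ω] (P : Measure Ω) (a b : ℝ)
    (D : ℕ → Ω → ℝ → ℝ → ℝ) (r : ℕ → ℝ) : Prop :=
  ∀ᵐ ω ∂P, ∃ C : ℝ, ∀ᶠ n in atTop, ∀ s ∈ Icc a b, ∀ t ∈ Icc a b, |D n ω s t| ≤ C * r n

/-- Almost surely, the integral that defines `σ̂²` is a genuine one for all large `n`, and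
`σ̂² - σ² = O(r_n)`. -/
def ErrVarBigOAlmostSurely {Ω : Type*} [MeasurableSpace Ω] (P : Measure Ω) (a b σ : ℝ)
    (Chat : ℕ → Ω → ℝ → ℝ → ℝ) (Vhat : ℕ → Ω → ℝ → ℝ) (r : ℕ → ℝ) : Prop :=
  ∀ᵐ ω ∂P,
    (∀ᶠ n in atTop, IntervalIntegrable (fun t => Vhat n ω t - Chat n ω t t) volume a b) ∧
    (fun n => errVarEst a b Chat Vhat n ω - σ ^ 2) =O[atTop] r

end FunctionalData

open FunctionalData

open FunctionalData

set_option linter.unusedSectionVars false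

/-! ## Uniform deviations of row-wise independent averages -/

/-! All three smoothers are weighted least-squares fits, so the argument separates into
deterministic linear algebra and a uniform law of large numbers. With slopes rescaled by the
bandwidth `h`, the normal equations have a Gram matrix close to a population Gram matrix that is
coercive uniformly in `h` and in the point of the fit; at the ends of `[a,b]` one half of the
symmetric kernel still lies inside (`exists_local_quadratic_le`). Subtracting the Taylor polynomial
of the target leaves kernel averages of centred noise and a remainder of order `h²`
(`least_squares_error`). If all kernel averages deviate from their means by `O(ρ)`, uniformly, the
fit has error `O(ρ + h²)`, and up to `O(ρ² + h²)` the error is an explicit linear function of the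
noise averages (`ae_localFitRate`).

Write `r = log n / n`. Averages over independent curves whose summands have second moments `O(v)`
are truncated at `√(v/r)`; a Bernstein bound and Borel–Cantelli then give deviations `O(√(v r))`
over polynomially many statistics at once (`ae_uniform_deviation`). The step to all points of
`[a,b]` uses bounded variation: increments of `K(u) u^p` are dominated by those of a bounded
monotone function, so `n²` grid points yield brackets of mean `O(1/n)` (`exists_kernel_bracket`,
`FamilyLaw.ae_uniform`).

What the truncation removes is controlled in two ways. For sparse data the moment of order `λ` and
the strong law suffice; the exponent `1 - 2/λ` of the bandwidth conditions is exactly what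
`truncation_rate` needs, with `v = 1/h` for single observations and `v = 1/h²` for pairs
(`familyLaw_sparse`). For dense data `m_i h` is bounded below, so averaging within a curve keeps
second moments bounded and `v = 1`; exponential tails show that the curve averages eventually stay
below the truncation level, so nothing is removed (`familyLaw_dense_single`,
`familyLaw_dense_pair`). The moment orders these laws require follow from the bandwidth conditions
(`dense_bandwidth`).

The rate of `R̂` combines the rates of `Ĉ` and `μ̂`. For `σ̂²` with sparse data the uniform rates
are too crude: the linear parts are first integrated over `t`. The resulting weights are of size
`1/h_R` rather than `1/h_R²` along the diagonal (`integral_weight₂_diag_le`), which gives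
`√(r/h_R)`, and the conditions on `h_R` and `h_V` make the quadratic remainders negligible. For
dense data the integrated uniform rates already suffice. -/

lemma exp_le_one_add_add_sq {x : ℝ} (hx : |x| ≤ 1) : Real.exp x ≤ 1 + x + x ^ 2 := by
  have := (abs_le.1 (Real.abs_exp_sub_one_sub_id_le hx)).2
  linarith

/-- The random variable cut off to zero where it exceeds `Q`. -/
noncomputable def cutoff (Q x : ℝ) : ℝ := if |x| ≤ Q then x else 0

lemma measurable_cutoff (Q : ℝ) : Measurable (cutoff Q) :=
  Measurable.ite (measurableSet_le continuous_abs.measurable measurable_const) measurable_id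
    measurable_const

lemma abs_cutoff_le {Q : ℝ} (hQ : 0 ≤ Q) (x : ℝ) : |cutoff Q x| ≤ Q := by
  unfold cutoff; split_ifs with h
  · exact h
  · simpa using hQ

lemma abs_cutoff_le_abs (Q x : ℝ) : |cutoff Q x| ≤ |x| := by
  unfold cutoff; split_ifs <;> simp

lemma cutoff_sq_le (Q x : ℝ) : cutoff Q x ^ 2 ≤ x ^ 2 :=
  sq_le_sq.2 (abs_cutoff_le_abs Q x)

section Deviation

variable {Ω : Type*} [MeasurableSpace Ω] {P : Measure Ω} [IsProbabilityMeasure P]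

lemma integrable_of_abs_le {f : Ω → ℝ} (hf : Measurable f) {C : ℝ} (h : ∀ ω, |f ω| ≤ C) :
    Integrable f P :=
  Integrable.of_bound hf.aestronglyMeasurable C (ae_of_all _ h)

/-- The condition `θ * Q ≤ 1` keeps the exponent in the range where `exp y ≤ 1 + y + y²`. Only the
uncentred second moment enters; the mean stays in the exponent and cancels once the sum is centred.
-/
lemma mgf_le_of_bounded {W : Ω → ℝ} (hW : Measurable W) {Q V θ : ℝ} (hQ : ∀ ω, |W ω| ≤ Q)
    (hV : ∫ ω, W ω ^ 2 ∂P ≤ V) (hθ : 0 ≤ θ) (hθQ : θ * Q ≤ 1) :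
    mgf W P θ ≤ Real.exp (θ * (∫ ω, W ω ∂P) + θ ^ 2 * V) := by
  have hi1 : Integrable W P := integrable_of_abs_le hW hQ
  have hi2 : Integrable (fun ω => W ω ^ 2) P :=
    integrable_of_abs_le (hW.pow_const 2) (C := Q ^ 2) fun ω => by
      rw [abs_pow]; exact pow_le_pow_left₀ (abs_nonneg _) (hQ ω) 2
  have hb : ∀ ω, |θ * W ω| ≤ 1 := fun ω => by
    rw [abs_mul, abs_of_nonneg hθ]
    exact (mul_le_mul_of_nonneg_left (hQ ω) hθ).trans hθQ
  have h1 : mgf W P θ ≤ ∫ ω, (1 + θ * W ω + θ ^ 2 * W ω ^ 2) ∂P := by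
    unfold mgf
    refine integral_mono (integrable_of_abs_le (by fun_prop) (C := Real.exp 1) fun ω => ?_)
      (((integrable_const 1).add (hi1.const_mul θ)).add (hi2.const_mul _)) fun ω => ?_
    · rw [abs_of_pos (Real.exp_pos _)]
      exact Real.exp_le_exp.2 ((le_abs_self _).trans (hb ω))
    · have := exp_le_one_add_add_sq (hb ω)
      simpa [mul_pow] using this
  have h2 : ∫ ω, (1 + θ * W ω + θ ^ 2 * W ω ^ 2) ∂P
      = 1 + θ * (∫ ω, W ω ∂P) + θ ^ 2 * ∫ ω, W ω ^ 2 ∂P := by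
    have e1 : Integrable (fun ω => 1 + θ * W ω) P := (integrable_const 1).add (hi1.const_mul θ)
    rw [integral_add e1 (hi2.const_mul _), integral_add (integrable_const 1) (hi1.const_mul θ),
      integral_const_mul, integral_const_mul]
    simp
  have h3 := mul_le_mul_of_nonneg_left hV (sq_nonneg θ)
  linarith [Real.add_one_le_exp (θ * (∫ ω, W ω ∂P) + θ ^ 2 * V)]

/-- One-sided Bernstein-type bound. -/
lemma measure_sum_sub_ge_le {W : ℕ → Ω → ℝ} (hW : ∀ i, Measurable (W i))
    (hind : iIndepFun W P) {n : ℕ} {Q V θ : ℝ} (hQ : ∀ i ω, |W i ω| ≤ Q)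
    (hV : ∀ i < n, ∫ ω, W i ω ^ 2 ∂P ≤ V) (hθ : 0 ≤ θ) (hθQ : θ * Q ≤ 1) (x : ℝ) :
    P.real {ω | x ≤ ∑ i ∈ Finset.range n, (W i ω - ∫ ω', W i ω' ∂P)}
      ≤ Real.exp (-θ * x + n * (θ ^ 2 * V)) := by
  set E := ∑ i ∈ Finset.range n, ∫ ω', W i ω' ∂P with hE
  have hsum : Measurable (∑ i ∈ Finset.range n, W i) := by fun_prop
  have hset : {ω | x ≤ ∑ i ∈ Finset.range n, (W i ω - ∫ ω', W i ω' ∂P)}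
      = {ω | x + E ≤ (∑ i ∈ Finset.range n, W i) ω} := by
    ext ω
    simp only [mem_ofPred_eq, Finset.sum_sub_distrib, Finset.sum_apply, ← hE]
    exact ⟨fun h => by linarith, fun h => by linarith⟩
  have hint : Integrable (fun ω => Real.exp (θ * (∑ i ∈ Finset.range n, W i) ω)) P := by
    refine integrable_of_abs_le (by fun_prop) (C := Real.exp (θ * (n * Q))) fun ω => ?_
    rw [abs_of_pos (Real.exp_pos _)]
    refine Real.exp_le_exp.2 (mul_le_mul_of_nonneg_left ?_ hθ)
    rw [Finset.sum_apply]
    calc ∑ i ∈ Finset.range n, W i ω ≤ ∑ i ∈ Finset.range n, Q :=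
          Finset.sum_le_sum fun i _ => (le_abs_self _).trans (hQ i ω)
      _ = n * Q := by simp
  rw [hset]
  refine (measure_ge_le_exp_mul_mgf (x + E) hθ hint).trans ?_
  rw [hind.mgf_sum hW]
  calc Real.exp (-θ * (x + E)) * ∏ i ∈ Finset.range n, mgf (W i) P θ
      ≤ Real.exp (-θ * (x + E)) *
        ∏ i ∈ Finset.range n, Real.exp (θ * (∫ ω, W i ω ∂P) + θ ^ 2 * V) := by
        refine mul_le_mul_of_nonneg_left (Finset.prod_le_prod (fun i _ => mgf_nonneg) fun i hi => ?_)
          (Real.exp_pos _).le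
        exact mgf_le_of_bounded (hW i) (hQ i) (hV i (Finset.mem_range.1 hi)) hθ hθQ
    _ = Real.exp (-θ * x + n * (θ ^ 2 * V)) := by
        rw [← Real.exp_sum, ← Real.exp_add, Finset.sum_add_distrib, ← Finset.mul_sum, ← hE]
        congr 1; simp; ring

lemma measure_abs_sum_sub_ge_le {W : ℕ → Ω → ℝ} (hW : ∀ i, Measurable (W i))
    (hind : iIndepFun W P) {n : ℕ} {Q V θ : ℝ} (hQ : ∀ i ω, |W i ω| ≤ Q)
    (hV : ∀ i < n, ∫ ω, W i ω ^ 2 ∂P ≤ V) (hθ : 0 ≤ θ) (hθQ : θ * Q ≤ 1) (x : ℝ) :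
    P.real {ω | x ≤ |∑ i ∈ Finset.range n, (W i ω - ∫ ω', W i ω' ∂P)|}
      ≤ 2 * Real.exp (-θ * x + n * (θ ^ 2 * V)) := by
  have h1 := measure_sum_sub_ge_le hW hind hQ hV hθ hθQ x
  have hind' : iIndepFun (fun i ω => -W i ω) P :=
    hind.comp (fun _ y => -y) fun _ => measurable_neg
  have h2 := measure_sum_sub_ge_le (W := fun i ω => -W i ω) (fun i => (hW i).neg) hind'
    (n := n) (Q := Q) (V := V) (fun i ω => by simpa using hQ i ω)
    (fun i hi => by simpa using hV i hi) hθ hθQ x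
  have hsub : {ω | x ≤ |∑ i ∈ Finset.range n, (W i ω - ∫ ω', W i ω' ∂P)|} ⊆
      {ω | x ≤ ∑ i ∈ Finset.range n, (W i ω - ∫ ω', W i ω' ∂P)} ∪
      {ω | x ≤ ∑ i ∈ Finset.range n, (-W i ω - ∫ ω', -W i ω' ∂P)} := by
    intro ω hω
    have : ∑ i ∈ Finset.range n, (-W i ω - ∫ ω', -W i ω' ∂P)
        = -∑ i ∈ Finset.range n, (W i ω - ∫ ω', W i ω' ∂P) := by
      rw [← Finset.sum_neg_distrib]
      exact Finset.sum_congr rfl fun i _ => by rw [integral_neg]; ring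
    simp only [mem_union, mem_ofPred_eq, this] at hω ⊢
    exact le_abs.1 hω
  have := (measureReal_mono (μ := P) hsub).trans (measureReal_union_le _ _)
  linarith

end Deviation

/-- Borel–Cantelli with a real-valued summable bound. -/
lemma ae_eventually_of_measureReal_le {Ω : Type*} [MeasurableSpace Ω] {P : Measure Ω}
    [IsFiniteMeasure P] {A : ℕ → Set Ω} {u : ℕ → ℝ} (hu : Summable u)
    (h : ∀ᶠ n in atTop, P.real (A n) ≤ u n) : ∀ᵐ ω ∂P, ∀ᶠ n in atTop, ω ∉ A n := by
  apply ae_eventually_notMem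
  have hs : Summable fun n => P.real (A n) := by
    refine Summable.of_norm_bounded_eventually_nat (g := u) hu ?_
    filter_upwards [h] with n hn
    rwa [Real.norm_of_nonneg measureReal_nonneg]
  have : (∑' n, P (A n)) = ∑' n, ENNReal.ofReal (P.real (A n)) := by
    congr 1; ext n; rw [ofReal_measureReal]
  rw [this]
  exact hs.tsum_ofReal_ne_top

lemma logRatio_pos {n : ℕ} (hn : 2 ≤ n) : 0 < logRatio n := by
  have : (2 : ℝ) ≤ n := by exact_mod_cast hn
  exact div_pos (Real.log_pos (by linarith)) (by linarith)

lemma tendsto_logRatio : Tendsto logRatio atTop (𝓝 0) := by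
  have h := (Real.isLittleO_log_id_atTop).tendsto_div_nhds_zero
  exact h.comp tendsto_natCast_atTop_atTop

section UniformDeviation

variable {Ω : Type*} [MeasurableSpace Ω] {P : Measure Ω} [IsProbabilityMeasure P]

/-- Deviations of averages of row-wise independent truncated variables, uniformly over
polynomially many of them. -/
theorem ae_uniform_deviation_cutoff {ι : Type*} (Λ : ℕ → Finset ι) (p : ℕ)
    (hΛ : ∀ᶠ n in atTop, ((Λ n).card : ℝ) ≤ (n : ℝ) ^ p) (W : ℕ → ι → ℕ → Ω → ℝ)
    (hW : ∀ n l i, Measurable (W n l i)) (hind : ∀ n l, iIndepFun (W n l) P)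
    {c : ℝ} {v : ℕ → ℝ} (hv : ∀ n, 0 < v n)
    (hsq : ∀ᶠ n in atTop, ∀ l ∈ Λ n, ∀ i < n,
      Integrable (fun ω => W n l i ω ^ 2) P ∧ ∫ ω, W n l i ω ^ 2 ∂P ≤ c * v n) :
    ∀ᵐ ω ∂P, ∀ᶠ n : ℕ in atTop, ∀ l ∈ Λ n,
      |∑ i ∈ Finset.range n, (cutoff √(v n / logRatio n) (W n l i ω) -
        ∫ ω', cutoff √(v n / logRatio n) (W n l i ω') ∂P)|
        ≤ (p + 2 + c) * (n * √(v n * logRatio n)) := by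
  set Q : ℕ → ℝ := fun n => √(v n / logRatio n)
  set D : ℕ → ι → Ω → ℝ := fun n l ω => ∑ i ∈ Finset.range n, (cutoff (Q n) (W n l i ω) -
        ∫ ω', cutoff (Q n) (W n l i ω') ∂P)
  have key : ∀ᵐ ω ∂P, ∀ᶠ n : ℕ in atTop,
      ω ∉ ⋃ l ∈ Λ n, {ω | (p + 2 + c) * (n * √(v n * logRatio n)) ≤ |D n l ω|} := by
    refine ae_eventually_of_measureReal_le (u := fun n : ℕ => 2 * ((n : ℝ) ^ 2)⁻¹)
      ((Real.summable_nat_pow_inv.2 one_lt_two).mul_left 2) ?_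
    filter_upwards [hΛ, hsq, eventually_ge_atTop 2] with n hn hs h2
    have hlr := logRatio_pos h2
    have hn0 : (0 : ℝ) < n := by positivity
    have hQ : 0 < Q n := Real.sqrt_pos.2 (div_pos (hv n) hlr)
    have hQ2 : Q n ^ 2 = v n / logRatio n := Real.sq_sqrt (div_pos (hv n) hlr).le
    -- With `θ = 1 / Q` this identity turns `θ` times the threshold into `(p + 2 + c) log n`, while
    -- the variance term is `c log n`. The remaining `(p + 2) log n` pays `n ^ p` for the union
    -- bound and `n ^ 2` for summability.
    have hρ : √(v n * logRatio n) = Q n * logRatio n := by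
      rw [← Real.sqrt_sq (mul_pos hQ hlr).le, mul_pow, hQ2]
      congr 1; field_simp
    have hlog : n * logRatio n = Real.log n := by unfold logRatio; field_simp
    have hb : ∀ l ∈ Λ n, P.real {ω | (p + 2 + c) * (n * √(v n * logRatio n)) ≤ |D n l ω|}
        ≤ 2 * ((n : ℝ) ^ (p + 2))⁻¹ := by
      intro l hl
      refine (measure_abs_sum_sub_ge_le (W := fun i ω => cutoff (Q n) (W n l i ω))
        (fun i => (measurable_cutoff _).comp (hW n l i))
        ((hind n l).comp _ fun _ => measurable_cutoff _) (n := n) (Q := Q n) (V := c * v n)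
        (θ := (Q n)⁻¹) (fun i ω => abs_cutoff_le hQ.le _) (fun i hi => ?_) (by positivity)
        (by rw [inv_mul_cancel₀ hQ.ne']) _).trans ?_
      · refine le_trans (integral_mono_of_nonneg (ae_of_all _ fun ω => sq_nonneg _)
          (hs l hl i hi).1 (ae_of_all _ fun ω => cutoff_sq_le _ _)) (hs l hl i hi).2
      · apply le_of_eq
        have : -(Q n)⁻¹ * ((p + 2 + c) * (n * √(v n * logRatio n))) +
            n * ((Q n)⁻¹ ^ 2 * (c * v n)) = -(((p + 2 : ℕ) : ℝ) * Real.log n) := by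
          rw [hρ, inv_pow, hQ2, ← hlog]
          have := (hv n).ne'
          field_simp; push_cast; ring
        rw [this, Real.exp_neg, ← Real.log_pow, Real.exp_log (by positivity)]
    refine (measureReal_biUnion_finset_le _ _).trans ((Finset.sum_le_sum hb).trans ?_)
    rw [Finset.sum_const, nsmul_eq_mul]
    calc ((Λ n).card : ℝ) * (2 * ((n : ℝ) ^ (p + 2))⁻¹)
        ≤ (n : ℝ) ^ p * (2 * ((n : ℝ) ^ (p + 2))⁻¹) := by gcongr
      _ = 2 * ((n : ℝ) ^ 2)⁻¹ := by rw [pow_add]; field_simp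
  filter_upwards [key] with ω hω
  filter_upwards [hω] with n hn l hl
  by_contra hcon
  exact hn (mem_biUnion (Finset.mem_coe.2 hl) (not_le.1 hcon).le)

/-- Deviations of averages of row-wise independent variables, uniformly over polynomially many of
them, given control of the part cut off by the truncation. -/
theorem ae_uniform_deviation {ι : Type*} (Λ : ℕ → Finset ι) (p : ℕ)
    (hΛ : ∀ᶠ n in atTop, ((Λ n).card : ℝ) ≤ (n : ℝ) ^ p) (W : ℕ → ι → ℕ → Ω → ℝ)
    (hW : ∀ n l i, Measurable (W n l i)) (hind : ∀ n l, iIndepFun (W n l) P)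
    {c : ℝ} {v : ℕ → ℝ} (hv : ∀ n, 0 < v n)
    (hsq : ∀ᶠ n in atTop, ∀ l ∈ Λ n, ∀ i < n,
      Integrable (fun ω => W n l i ω ^ 2) P ∧ ∫ ω, W n l i ω ^ 2 ∂P ≤ c * v n)
    (htail : ∀ᵐ ω ∂P, ∃ C : ℝ, ∀ᶠ n : ℕ in atTop, ∀ l ∈ Λ n,
      (n : ℝ)⁻¹ * ∑ i ∈ Finset.range n,
        |W n l i ω - cutoff √(v n / logRatio n) (W n l i ω)| ≤ C * √(v n * logRatio n)) :
    ∀ᵐ ω ∂P, ∃ C : ℝ, ∀ᶠ n : ℕ in atTop, ∀ l ∈ Λ n,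
      |(n : ℝ)⁻¹ * ∑ i ∈ Finset.range n, (W n l i ω - ∫ ω', W n l i ω' ∂P)|
        ≤ C * √(v n * logRatio n) := by
  filter_upwards [ae_uniform_deviation_cutoff Λ p hΛ W hW hind hv hsq, htail] with ω h1 ⟨C, h2⟩
  refine ⟨(p + 2 + c) + C + c, ?_⟩
  filter_upwards [h1, h2, hsq, eventually_ge_atTop 2] with n h1 h2 hs hn2 l hl
  have hlr := logRatio_pos hn2
  have hn0 : (0 : ℝ) < n := by positivity
  set Q : ℝ := √(v n / logRatio n) with hQdef
  have hQ : 0 < Q := Real.sqrt_pos.2 (div_pos (hv n) hlr)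
  have hQ2 : Q ^ 2 = v n / logRatio n := Real.sq_sqrt (div_pos (hv n) hlr).le
  have hρ : √(v n * logRatio n) = Q * logRatio n := by
    rw [← Real.sqrt_sq (mul_pos hQ hlr).le, mul_pow, hQ2]
    congr 1; field_simp
  have hvQ : v n = Q ^ 2 * logRatio n := by rw [hQ2]; field_simp
  -- Beyond the level `Q` one has `|W| ≤ W² / Q`, so truncation moves the mean by at most `c v / Q`,
  -- which equals `c √(v r)` with `r` the log ratio: the bias is of the order of the rate.
  have hbias : ∀ i < n, |(∫ ω', cutoff Q (W n l i ω') ∂P) - ∫ ω', W n l i ω' ∂P|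
      ≤ c * √(v n * logRatio n) := by
    intro i hi
    obtain ⟨hint, hle⟩ := hs l hl i hi
    have hi1 : Integrable (W n l i) P := by
      have : MemLp (W n l i) 2 P := (memLp_two_iff_integrable_sq
        (hW n l i).aestronglyMeasurable).2 hint
      exact this.integrable (by norm_num)
    have hi2 : Integrable (fun ω' => cutoff Q (W n l i ω')) P :=
      integrable_of_abs_le ((measurable_cutoff _).comp (hW n l i)) fun ω => abs_cutoff_le hQ.le _
    rw [← integral_sub hi2 hi1]
    refine (abs_integral_le_integral_abs).trans ?_
    have hpt : ∀ ω', |cutoff Q (W n l i ω') - W n l i ω'| ≤ Q⁻¹ * W n l i ω' ^ 2 := by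
      intro ω'
      unfold cutoff
      split_ifs with h
      · simp; positivity
      · push Not at h
        rw [zero_sub, abs_neg, ← sq_abs, sq, ← mul_assoc]
        refine le_mul_of_one_le_left (abs_nonneg _) ?_
        rw [inv_mul_eq_div, one_le_div hQ]; exact h.le
    refine (integral_mono (hi2.sub hi1).abs (hint.const_mul _) hpt).trans ?_
    rw [integral_const_mul, hρ]
    calc Q⁻¹ * ∫ ω', W n l i ω' ^ 2 ∂P ≤ Q⁻¹ * (c * v n) := by gcongr
      _ = c * (Q * logRatio n) := by rw [hvQ]; field_simp
  have hdec : ∑ i ∈ Finset.range n, (W n l i ω - ∫ ω', W n l i ω' ∂P) =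
      ∑ i ∈ Finset.range n, (cutoff Q (W n l i ω) - ∫ ω', cutoff Q (W n l i ω') ∂P) +
      ∑ i ∈ Finset.range n, (W n l i ω - cutoff Q (W n l i ω)) +
      ∑ i ∈ Finset.range n, ((∫ ω', cutoff Q (W n l i ω') ∂P) - ∫ ω', W n l i ω' ∂P) := by
    rw [← Finset.sum_add_distrib, ← Finset.sum_add_distrib]
    exact Finset.sum_congr rfl fun i _ => by ring
  rw [abs_mul, abs_of_pos (inv_pos.2 hn0), inv_mul_le_iff₀ hn0, hdec]
  have e1 := h1 l hl
  have e2 := h2 l hl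
  rw [inv_mul_le_iff₀ hn0] at e2
  have e2' := (Finset.abs_sum_le_sum_abs (fun i => W n l i ω - cutoff Q (W n l i ω))
    (Finset.range n)).trans e2
  have e3 : |∑ i ∈ Finset.range n, ((∫ ω', cutoff Q (W n l i ω') ∂P) - ∫ ω', W n l i ω' ∂P)|
      ≤ n * (c * √(v n * logRatio n)) := by
    refine (Finset.abs_sum_le_sum_abs _ _).trans ((Finset.sum_le_sum fun i hi =>
      hbias i (Finset.mem_range.1 hi)).trans ?_)
    simp
  refine (abs_add_le _ _).trans ((add_le_add (abs_add_le _ _) le_rfl).trans ?_)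
  linarith

end UniformDeviation

/-! ## Independence of blocks -/

/-- Induction over the blocks: the new block is disjoint from the union of the earlier ones, so
independence of two disjoint groups splits off one factor, and the intersection of the earlier
events is measurable for the union. -/
lemma iIndep_biSup_of_pairwise_disjoint {Ω ι κ : Type*} {mΩ : MeasurableSpace Ω} {P : Measure Ω}
    {m : ι → MeasurableSpace Ω} (hle : ∀ i, m i ≤ mΩ) (h : iIndep m P) {B : κ → Set ι}
    (hB : Pairwise (Function.onFun Disjoint B)) : iIndep (fun k => ⨆ i ∈ B k, m i) P := by
  classical
  have := h.isProbabilityMeasure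
  rw [iIndep_iff]
  intro s
  induction s using Finset.induction_on with
  | empty => intro f _; simp
  | insert k s hk ih =>
    intro f hf
    rw [Finset.set_biInter_insert, Finset.prod_insert hk,
      ← ih fun i hi => hf i (Finset.mem_insert_of_mem hi)]
    have hd : Disjoint (B k) (⋃ l ∈ s, B l) := by
      refine disjoint_iUnion₂_right.2 fun l hl => hB ?_
      rintro rfl; exact hk hl
    have hI := indep_iSup_of_disjoint hle h hd
    refine (Indep_iff _ _ _).1 hI _ _ (hf k (Finset.mem_insert_self _ _)) ?_
    refine Finset.measurableSet_biInter s fun l hl => ?_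
    have hl' : (⨆ i ∈ B l, m i) ≤ ⨆ i ∈ ⋃ l ∈ s, B l, m i :=
      biSup_mono fun i hi => mem_biUnion (Finset.mem_coe.2 hl) hi
    exact hl' _ (hf l (Finset.mem_insert_of_mem hl))

/-- The `σ`-algebras generated by the curves, the observation times and the errors. -/
@[reducible] def sourceAlgebra {Ω S : Type*} [MeasurableSpace S] (ξ : ℕ → Ω → S) (T U : ℕ → ℕ → Ω → ℝ) :
    ℕ ⊕ (ℕ × ℕ ⊕ ℕ × ℕ) → MeasurableSpace Ω :=
  Sum.elim (fun i : ℕ => MeasurableSpace.comap (ξ i) inferInstance)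
    (Sum.elim (fun p : ℕ × ℕ => MeasurableSpace.comap (T p.1 p.2) inferInstance)
      (fun p : ℕ × ℕ => MeasurableSpace.comap (U p.1 p.2) inferInstance))

/-- The data of one pair of observations on a curve: the curve and two errors, and two times. -/
def pairData {Ω S : Type*} (ξ : ℕ → Ω → S) (T U : ℕ → ℕ → Ω → ℝ) (ω : Ω) (i j k : ℕ) :
    (S × ℝ × ℝ) × ℝ × ℝ :=
  ((ξ i ω, U i j ω, U i k ω), (T i j ω, T i k ω))

/-- The average of `φ j k` over the ordered pairs `j ≠ k` of indices below `M`. -/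
noncomputable def pairAvg (M : ℕ) (φ : ℕ → ℕ → ℝ) : ℝ :=
  ((M : ℝ) * ((M : ℝ) - 1))⁻¹ * ∑ j ∈ Finset.range M, ∑ k ∈ (Finset.range M).erase j, φ j k

/-- The average over curves of the averages over pairs. -/
noncomputable def curveAvg (n : ℕ) (m : ℕ → ℕ) (φ : ℕ → ℕ → ℕ → ℝ) : ℝ :=
  (n : ℝ)⁻¹ * ∑ i ∈ Finset.range n, pairAvg (m i) (φ i)

/-! ### Averages over ordered pairs of distinct observations -/

section PairAvg

lemma pair_count_pos {M : ℕ} (hM : 2 ≤ M) : (0 : ℝ) < (M : ℝ) * ((M : ℝ) - 1) := by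
  have : (2 : ℝ) ≤ M := by exact_mod_cast hM
  nlinarith

lemma pair_weight_nonneg (M : ℕ) : (0 : ℝ) ≤ ((M : ℝ) * ((M : ℝ) - 1))⁻¹ := by
  rcases Nat.lt_or_ge M 2 with h | h
  -- For `M = 0` and `M = 1` there are no pairs; the weight is `0⁻¹ = 0`.
  · interval_cases M <;> simp
  · exact (inv_pos.2 (pair_count_pos h)).le

lemma pairAvg_eq_sum_offDiag (M : ℕ) (φ : ℕ → ℕ → ℝ) :
    pairAvg M φ = ∑ p ∈ (Finset.range M).offDiag,
      ((M : ℝ) * ((M : ℝ) - 1))⁻¹ * φ p.1 p.2 := by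
  rw [pairAvg, ← Finset.mul_sum, Finset.sum_sigma']
  congr 1
  refine Finset.sum_bij' (fun x _ => (x.1, x.2)) (fun x _ => ⟨x.1, x.2⟩) ?_ ?_ ?_ ?_ ?_ <;>
    simp +contextual [Finset.mem_offDiag, eq_comm]

lemma sum_pair_weight {M : ℕ} (hM : 2 ≤ M) :
    ∑ _p ∈ (Finset.range M).offDiag, ((M : ℝ) * ((M : ℝ) - 1))⁻¹ = 1 := by
  have h1 : 1 ≤ M := by omega
  have hle : M ≤ M * M := Nat.le_mul_of_pos_left M (by omega)
  rw [Finset.sum_const, Finset.offDiag_card, nsmul_eq_mul, Finset.card_range, Nat.cast_sub hle]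
  have := (pair_count_pos hM).ne'
  push_cast
  rw [show (M : ℝ) * M - M = M * (M - 1) by ring]
  exact mul_inv_cancel₀ this

/-- A statistic of single observations is an average over pairs. -/
lemma pairAvg_fst {M : ℕ} (hM : 2 ≤ M) (φ : ℕ → ℝ) :
    pairAvg M (fun j _ => φ j) = (M : ℝ)⁻¹ * ∑ j ∈ Finset.range M, φ j := by
  have h2 : (2 : ℝ) ≤ M := by exact_mod_cast hM
  have : ∀ j ∈ Finset.range M, ∑ _k ∈ (Finset.range M).erase j, φ j = ((M : ℝ) - 1) * φ j := by
    intro j hj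
    rw [Finset.sum_const, Finset.card_erase_of_mem hj, Finset.card_range, nsmul_eq_mul,
      Nat.cast_sub (by omega), Nat.cast_one]
  rw [pairAvg, Finset.sum_congr rfl this, ← Finset.mul_sum, mul_inv, mul_assoc, ← mul_assoc _ _
    (∑ j ∈ _, φ j), inv_mul_cancel₀ (by linarith), one_mul]

lemma pairAvg_add (M : ℕ) (φ ψ : ℕ → ℕ → ℝ) :
    pairAvg M (fun j k => φ j k + ψ j k) = pairAvg M φ + pairAvg M ψ := by
  simp only [pairAvg, Finset.sum_add_distrib, mul_add]

lemma pairAvg_const_mul (M : ℕ) (c : ℝ) (φ : ℕ → ℕ → ℝ) :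
    pairAvg M (fun j k => c * φ j k) = c * pairAvg M φ := by
  simp only [pairAvg, ← Finset.mul_sum]; ring

lemma pairAvg_mono {M : ℕ} {φ ψ : ℕ → ℕ → ℝ} (h : ∀ j k, φ j k ≤ ψ j k) :
    pairAvg M φ ≤ pairAvg M ψ :=
  mul_le_mul_of_nonneg_left (Finset.sum_le_sum fun j _ => Finset.sum_le_sum fun k _ => h j k)
    (pair_weight_nonneg M)

lemma abs_pairAvg_le (M : ℕ) (φ : ℕ → ℕ → ℝ) : |pairAvg M φ| ≤ pairAvg M fun j k => |φ j k| := by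
  rw [pairAvg, abs_mul, abs_of_nonneg (pair_weight_nonneg M)]
  refine mul_le_mul_of_nonneg_left ((Finset.abs_sum_le_sum_abs _ _).trans ?_)
    (pair_weight_nonneg M)
  exact Finset.sum_le_sum fun j _ => Finset.abs_sum_le_sum_abs _ _

/-- Jensen's inequality for averages over pairs. -/
lemma abs_pairAvg_rpow_le {M : ℕ} (hM : 2 ≤ M) (φ : ℕ → ℕ → ℝ) {p : ℝ} (hp : 1 ≤ p) :
    |pairAvg M φ| ^ p ≤ pairAvg M fun j k => |φ j k| ^ p := by
  refine (Real.rpow_le_rpow (abs_nonneg _) (abs_pairAvg_le M φ) (by linarith)).trans ?_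
  rw [pairAvg_eq_sum_offDiag, pairAvg_eq_sum_offDiag]
  exact Real.rpow_arith_mean_le_arith_mean_rpow _ _ _ (fun _ _ => pair_weight_nonneg M)
    (sum_pair_weight hM) (fun _ _ => abs_nonneg _) hp

lemma pairAvg_sq_le {M : ℕ} (hM : 2 ≤ M) (φ : ℕ → ℕ → ℝ) :
    pairAvg M φ ^ 2 ≤ pairAvg M fun j k => φ j k ^ 2 := by
  have := abs_pairAvg_rpow_le hM φ (p := 2) (by norm_num)
  simpa using this

/-- With boundedly many observations, the average over pairs is at most a sum over all pairs. -/
lemma pairAvg_le_sum {m M : ℕ} (hm : 2 ≤ m) (hM : m ≤ M) {φ : ℕ → ℕ → ℝ}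
    (h : ∀ j k, 0 ≤ φ j k) : pairAvg m φ ≤ ∑ p ∈ (Finset.range M).offDiag, φ p.1 p.2 := by
  rw [pairAvg_eq_sum_offDiag]
  have h1 : ((m : ℝ) * ((m : ℝ) - 1))⁻¹ ≤ 1 := by
    have : (2 : ℝ) ≤ m := by exact_mod_cast hm
    exact inv_le_one_of_one_le₀ (by nlinarith)
  refine (Finset.sum_le_sum fun p _ => mul_le_of_le_one_left (h p.1 p.2) h1).trans ?_
  exact Finset.sum_le_sum_of_subset_of_nonneg
    (Finset.offDiag_mono (Finset.range_mono hM)) fun p _ _ => h p.1 p.2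

end PairAvg

/-! ### Independence and laws of the data of a pair of observations -/

section Model

variable {Ω S : Type*} [MeasurableSpace Ω] [MeasurableSpace S]
  {P : Measure Ω} [IsProbabilityMeasure P] {ν : Measure S} [IsProbabilityMeasure ν]
  {a b σ : ℝ} {f : ℝ → ℝ} {X : S → ℝ → ℝ} {ξ : ℕ → Ω → S} {T U : ℕ → ℕ → Ω → ℝ}

lemma FunctionalData.ObservationModel.sourceAlgebra_le
    (h : ObservationModel P ν a b σ f X ξ T U) (α : ℕ ⊕ (ℕ × ℕ ⊕ ℕ × ℕ)) :
    sourceAlgebra ξ T U α ≤ ‹MeasurableSpace Ω› := by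
  rcases α with i | p | p
  · exact (h.measurable_curve i).comap_le
  · exact (h.measurable_time p.1 p.2).comap_le
  · exact (h.measurable_error p.1 p.2).comap_le

lemma measurable_curve_of_mem {B : Set (ℕ ⊕ (ℕ × ℕ ⊕ ℕ × ℕ))} {i : ℕ} (hi : Sum.inl i ∈ B) :
    Measurable[⨆ α ∈ B, sourceAlgebra ξ T U α] (ξ i) :=
  measurable_iff_comap_le.2 (le_iSup₂_of_le (f := fun α (_ : α ∈ B) => sourceAlgebra ξ T U α)
    (Sum.inl i) hi le_rfl)

lemma measurable_time_of_mem {B : Set (ℕ ⊕ (ℕ × ℕ ⊕ ℕ × ℕ))} {i j : ℕ}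
    (hi : Sum.inr (Sum.inl (i, j)) ∈ B) :
    Measurable[⨆ α ∈ B, sourceAlgebra ξ T U α] (T i j) :=
  measurable_iff_comap_le.2 (le_iSup₂_of_le (f := fun α (_ : α ∈ B) => sourceAlgebra ξ T U α)
    (Sum.inr (Sum.inl (i, j))) hi le_rfl)

lemma measurable_error_of_mem {B : Set (ℕ ⊕ (ℕ × ℕ ⊕ ℕ × ℕ))} {i j : ℕ}
    (hi : Sum.inr (Sum.inr (i, j)) ∈ B) :
    Measurable[⨆ α ∈ B, sourceAlgebra ξ T U α] (U i j) :=
  measurable_iff_comap_le.2 (le_iSup₂_of_le (f := fun α (_ : α ∈ B) => sourceAlgebra ξ T U α)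
    (Sum.inr (Sum.inr (i, j))) hi le_rfl)

/-- Independence of derived variables reduces to disjointness of the sets of sources they are built
from. -/
lemma FunctionalData.ObservationModel.iIndepFun_of_blocks
    (h : ObservationModel P ν a b σ f X ξ T U) {κ : Type*} {B : κ → Set (ℕ ⊕ (ℕ × ℕ ⊕ ℕ × ℕ))}
    (hB : Pairwise (Function.onFun Disjoint B)) {β : κ → Type*} [∀ k, MeasurableSpace (β k)]
    {W : ∀ k, Ω → β k} (hW : ∀ k, Measurable[⨆ α ∈ B k, sourceAlgebra ξ T U α] (W k)) :
    iIndepFun W P := by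
  rw [iIndepFun_iff_iIndep]
  exact iIndep_of_iIndep_of_le (iIndep_biSup_of_pairwise_disjoint h.sourceAlgebra_le h.indep hB)
    fun k => measurable_iff_comap_le.1 (hW k)

lemma FunctionalData.ObservationModel.indepFun_of_blocks
    (h : ObservationModel P ν a b σ f X ξ T U) {A B : Set (ℕ ⊕ (ℕ × ℕ ⊕ ℕ × ℕ))}
    (hAB : Disjoint A B) {β γ : Type*} [MeasurableSpace β] [MeasurableSpace γ]
    {V : Ω → β} {W : Ω → γ} (hV : Measurable[⨆ α ∈ A, sourceAlgebra ξ T U α] V)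
    (hW : Measurable[⨆ α ∈ B, sourceAlgebra ξ T U α] W) : IndepFun V W P := by
  rw [IndepFun_iff_Indep]
  exact indep_of_indep_of_le (indep_iSup_of_disjoint h.sourceAlgebra_le h.indep hAB)
    (measurable_iff_comap_le.1 hV) (measurable_iff_comap_le.1 hW)

/-- The sources of randomness of curve `i`. -/
def curveBlock (i : ℕ) : Set (ℕ ⊕ (ℕ × ℕ ⊕ ℕ × ℕ)) :=
  {α | Sum.elim id (Sum.elim Prod.fst Prod.fst) α = i}

lemma pairwise_disjoint_curveBlock : Pairwise (Function.onFun Disjoint curveBlock) := by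
  intro i i' hii
  refine disjoint_left.2 fun α h1 h2 => hii ?_
  exact Eq.trans (Eq.symm h1) h2

lemma measurable_pairData_curveBlock (i j k : ℕ) :
    Measurable[⨆ α ∈ curveBlock i, sourceAlgebra ξ T U α] (fun ω => pairData ξ T U ω i j k) := by
  let _ : MeasurableSpace Ω := ⨆ α ∈ curveBlock i, sourceAlgebra ξ T U α
  have h1 : Measurable (ξ i) := measurable_curve_of_mem (by simp [curveBlock])
  have h2 : ∀ j, Measurable (T i j) := fun j => measurable_time_of_mem (by simp [curveBlock])
  have h3 : ∀ j, Measurable (U i j) := fun j => measurable_error_of_mem (by simp [curveBlock])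
  exact (h1.prodMk ((h3 j).prodMk (h3 k))).prodMk ((h2 j).prodMk (h2 k))

/-- The law of the errors. -/
noncomputable def errorLaw (P : Measure Ω) (U : ℕ → ℕ → Ω → ℝ) : Measure ℝ := P.map (U 0 0)

/-- The law of the observation times. -/
noncomputable def timeLaw (P : Measure Ω) (T : ℕ → ℕ → Ω → ℝ) : Measure ℝ := P.map (T 0 0)

/-- The law of the data of a pair of observations. -/
noncomputable def pairLaw (P : Measure Ω) (ν : Measure S) (T U : ℕ → ℕ → Ω → ℝ) :
    Measure ((S × ℝ × ℝ) × ℝ × ℝ) :=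
  (ν.prod ((errorLaw P U).prod (errorLaw P U))).prod ((timeLaw P T).prod (timeLaw P T))

namespace FunctionalData.ObservationModel

variable (h : ObservationModel P ν a b σ f X ξ T U)
include h

lemma isProbabilityMeasure_errorLaw : IsProbabilityMeasure (errorLaw P U) :=
  Measure.isProbabilityMeasure_map (h.measurable_error 0 0).aemeasurable

lemma isProbabilityMeasure_timeLaw : IsProbabilityMeasure (timeLaw P T) :=
  Measure.isProbabilityMeasure_map (h.measurable_time 0 0).aemeasurable

lemma map_error (i j : ℕ) : P.map (U i j) = errorLaw P U := (h.identDistrib_error i j).map_eq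

lemma map_time (i j : ℕ) : P.map (T i j) = timeLaw P T := by
  rw [timeLaw, h.law_time, h.law_time]

lemma measurable_pairData (i j k : ℕ) : Measurable (fun ω => pairData ξ T U ω i j k) :=
  ((h.measurable_curve i).prodMk ((h.measurable_error i j).prodMk (h.measurable_error i k))).prodMk
    ((h.measurable_time i j).prodMk (h.measurable_time i k))

lemma map_curve_errors (i : ℕ) {j k : ℕ} (hjk : j ≠ k) :
    P.map (fun ω => (ξ i ω, U i j ω, U i k ω)) =
      ν.prod ((errorLaw P U).prod (errorLaw P U)) := by
  have h1 : IndepFun (U i j) (U i k) P := h.indepFun_of_blocks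
    (A := {Sum.inr (Sum.inr (i, j))}) (B := {Sum.inr (Sum.inr (i, k))}) (by simpa using hjk)
    (measurable_error_of_mem rfl) (measurable_error_of_mem rfl)
  have h2 : IndepFun (ξ i) (fun ω => (U i j ω, U i k ω)) P := by
    refine h.indepFun_of_blocks (A := {Sum.inl i})
      (B := {Sum.inr (Sum.inr (i, j)), Sum.inr (Sum.inr (i, k))}) (by simp)
      (measurable_curve_of_mem rfl) ?_
    exact Measurable.prodMk (measurable_error_of_mem (by simp)) (measurable_error_of_mem (by simp))
  rw [(indepFun_iff_map_prod_eq_prod_map_map (h.measurable_curve i).aemeasurable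
      ((h.measurable_error i j).prodMk (h.measurable_error i k)).aemeasurable).1 h2,
    (indepFun_iff_map_prod_eq_prod_map_map (h.measurable_error i j).aemeasurable
      (h.measurable_error i k).aemeasurable).1 h1, h.law_curve, h.map_error, h.map_error]

lemma map_times (i : ℕ) {j k : ℕ} (hjk : j ≠ k) :
    P.map (fun ω => (T i j ω, T i k ω)) = (timeLaw P T).prod (timeLaw P T) := by
  have h1 : IndepFun (T i j) (T i k) P := h.indepFun_of_blocks
    (A := {Sum.inr (Sum.inl (i, j))}) (B := {Sum.inr (Sum.inl (i, k))}) (by simpa using hjk)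
    (measurable_time_of_mem rfl) (measurable_time_of_mem rfl)
  rw [(indepFun_iff_map_prod_eq_prod_map_map (h.measurable_time i j).aemeasurable
      (h.measurable_time i k).aemeasurable).1 h1, h.map_time, h.map_time]

lemma map_pairData (i : ℕ) {j k : ℕ} (hjk : j ≠ k) :
    P.map (fun ω => pairData ξ T U ω i j k) = pairLaw P ν T U := by
  have h1 : IndepFun (fun ω => (ξ i ω, U i j ω, U i k ω)) (fun ω => (T i j ω, T i k ω)) P := by
    refine h.indepFun_of_blocks
      (A := {Sum.inl i, Sum.inr (Sum.inr (i, j)), Sum.inr (Sum.inr (i, k))})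
      (B := {Sum.inr (Sum.inl (i, j)), Sum.inr (Sum.inl (i, k))}) (by simp) ?_ ?_
    · exact Measurable.prodMk (measurable_curve_of_mem (by simp))
        (Measurable.prodMk (measurable_error_of_mem (by simp)) (measurable_error_of_mem (by simp)))
    · exact Measurable.prodMk (measurable_time_of_mem (by simp)) (measurable_time_of_mem (by simp))
  have := (indepFun_iff_map_prod_eq_prod_map_map
    ((h.measurable_curve i).prodMk
      ((h.measurable_error i j).prodMk (h.measurable_error i k))).aemeasurable
    ((h.measurable_time i j).prodMk (h.measurable_time i k)).aemeasurable).1 h1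
  rw [pairLaw, ← h.map_times i hjk, ← h.map_curve_errors i hjk, ← this]
  rfl

lemma measurable_pairAvg {F : (S × ℝ × ℝ) × ℝ × ℝ → ℝ} (hF : Measurable F) (M i : ℕ) :
    Measurable fun ω => pairAvg M fun j k => F (pairData ξ T U ω i j k) := by
  refine Measurable.const_mul (Finset.measurable_fun_sum _ fun j _ =>
    Finset.measurable_fun_sum _ fun k _ => hF.comp (h.measurable_pairData i j k)) _

lemma iIndepFun_pairAvg {F : (S × ℝ × ℝ) × ℝ × ℝ → ℝ} (hF : Measurable F) (m : ℕ → ℕ) :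
    iIndepFun (fun i ω => pairAvg (m i) fun j k => F (pairData ξ T U ω i j k)) P := by
  refine h.iIndepFun_of_blocks pairwise_disjoint_curveBlock fun i => ?_
  let _ : MeasurableSpace Ω := ⨆ α ∈ curveBlock i, sourceAlgebra ξ T U α
  exact Measurable.const_mul (Finset.measurable_fun_sum _ fun j _ =>
    Finset.measurable_fun_sum _ fun k _ => hF.comp (measurable_pairData_curveBlock i j k)) _

lemma integrable_pairData {F : (S × ℝ × ℝ) × ℝ × ℝ → ℝ}
    (hi : Integrable F (pairLaw P ν T U)) (i : ℕ) {j k : ℕ} (hjk : j ≠ k) :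
    Integrable (fun ω => F (pairData ξ T U ω i j k)) P := by
  rw [← h.map_pairData i hjk] at hi
  exact hi.comp_measurable (h.measurable_pairData i j k)

lemma integral_pairData {F : (S × ℝ × ℝ) × ℝ × ℝ → ℝ} (hF : Measurable F) (i : ℕ) {j k : ℕ}
    (hjk : j ≠ k) :
    ∫ ω, F (pairData ξ T U ω i j k) ∂P = ∫ z, F z ∂(pairLaw P ν T U) := by
  rw [← h.map_pairData i hjk, integral_map (h.measurable_pairData i j k).aemeasurable
    hF.aestronglyMeasurable]

lemma integrable_pairAvg {F : (S × ℝ × ℝ) × ℝ × ℝ → ℝ}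
    (hi : Integrable F (pairLaw P ν T U)) (M i : ℕ) :
    Integrable (fun ω => pairAvg M fun j k => F (pairData ξ T U ω i j k)) P := by
  simp only [pairAvg_eq_sum_offDiag]
  refine integrable_finsetSum _ fun p hp => (h.integrable_pairData hi i ?_).const_mul _
  exact (Finset.mem_offDiag.1 hp).2.2

lemma integral_pairAvg {F : (S × ℝ × ℝ) × ℝ × ℝ → ℝ} (hF : Measurable F)
    (hi : Integrable F (pairLaw P ν T U)) {M : ℕ} (hM : 2 ≤ M) (i : ℕ) :
    ∫ ω, (pairAvg M fun j k => F (pairData ξ T U ω i j k)) ∂P = ∫ z, F z ∂(pairLaw P ν T U) := by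
  simp only [pairAvg_eq_sum_offDiag]
  rw [integral_finsetSum _ fun p hp =>
    (h.integrable_pairData hi i (Finset.mem_offDiag.1 hp).2.2).const_mul _]
  rw [Finset.sum_congr rfl fun p hp => by
    rw [integral_const_mul, h.integral_pairData hF i (Finset.mem_offDiag.1 hp).2.2]]
  rw [← Finset.sum_mul, sum_pair_weight hM, one_mul]

/-- By Jensen's inequality a pair average has a second moment no larger than that of one pair.
Averaging within the curve gains nothing here, which is adequate for boundedly many observations;
dense data need the sharper moment bounds for local averages. -/
lemma integral_pairAvg_sq_le {F : (S × ℝ × ℝ) × ℝ × ℝ → ℝ} (hF : Measurable F)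
    (hi : Integrable (fun z => F z ^ 2) (pairLaw P ν T U)) {M : ℕ} (hM : 2 ≤ M) (i : ℕ) :
    Integrable (fun ω => (pairAvg M fun j k => F (pairData ξ T U ω i j k)) ^ 2) P ∧
    ∫ ω, (pairAvg M fun j k => F (pairData ξ T U ω i j k)) ^ 2 ∂P
      ≤ ∫ z, F z ^ 2 ∂(pairLaw P ν T U) := by
  have hi' := h.integrable_pairAvg hi M i
  have hle : ∀ ω, (pairAvg M fun j k => F (pairData ξ T U ω i j k)) ^ 2
      ≤ pairAvg M fun j k => F (pairData ξ T U ω i j k) ^ 2 := fun ω => pairAvg_sq_le hM _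
  have h1 : Integrable (fun ω => (pairAvg M fun j k => F (pairData ξ T U ω i j k)) ^ 2) P := by
    refine hi'.mono' ((h.measurable_pairAvg hF M i).pow_const 2).aestronglyMeasurable
      (ae_of_all _ fun ω => ?_)
    rw [Real.norm_of_nonneg (sq_nonneg _)]
    exact hle ω
  refine ⟨h1, (integral_mono h1 hi' hle).trans ?_⟩
  exact (h.integral_pairAvg (hF.pow_const 2) hi hM i).le

end FunctionalData.ObservationModel

end Model

/-! ## The envelope of the process -/

section Envelope

variable {S : Type*} [MeasurableSpace S] {ν : Measure S} [IsProbabilityMeasure ν]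

/-- A measurable finite envelope of the paths with the moments of their suprema. -/
lemma exists_path_envelope {a b : ℝ} {X : S → ℝ → ℝ} (hX : AEMeasurable (pathSup a b X) ν)
    {p₀ : ℝ} (hp₀ : 0 < p₀) (hfin : ∫⁻ x, pathSup a b X x ^ p₀ ∂ν < ⊤) :
    ∃ B : S → ℝ, Measurable B ∧ (∀ x, 0 ≤ B x) ∧
      (∀ᵐ x ∂ν, ∀ t ∈ Icc a b, |X x t| ≤ B x) ∧
      ∀ p : ℝ, 0 < p → ∫⁻ x, pathSup a b X x ^ p ∂ν < ⊤ → Integrable (fun x => B x ^ p) ν := by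
  have hmk : Measurable (hX.mk _) := hX.measurable_mk
  have hlt : ∀ᵐ x ∂ν, pathSup a b X x < ⊤ := by
    filter_upwards [ae_lt_top' (hX.pow_const p₀) hfin.ne] with x hx
    by_contra hcon
    rw [not_lt_top_iff.1 hcon, ENNReal.top_rpow_of_pos hp₀] at hx
    exact lt_irrefl _ hx
  refine ⟨fun x => (hX.mk _ x).toReal, hmk.ennreal_toReal, fun x => ENNReal.toReal_nonneg, ?_, ?_⟩
  · filter_upwards [hX.ae_eq_mk, hlt] with x hx hxt t ht
    rw [← hx]
    have h1 : ‖X x t‖ₑ ≤ pathSup a b X x :=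
      le_iSup₂_of_le (f := fun t (_ : t ∈ Icc a b) => ‖X x t‖ₑ) t ht le_rfl
    have := ENNReal.toReal_mono hxt.ne h1
    simpa using this
  · intro p hp hpf
    have h1 : ∫⁻ x, (hX.mk _ x) ^ p ∂ν < ⊤ := by
      rw [← lintegral_congr_ae (f := fun x => pathSup a b X x ^ p)]
      · exact hpf
      · filter_upwards [hX.ae_eq_mk] with x hx
        rw [hx]
    simp only [ENNReal.toReal_rpow]
    exact integrable_toReal_of_lintegral_ne_top (hmk.pow_const p).aemeasurable h1.ne

open Classical in
/-- The process with its values set to zero off `[a,b]` and where the envelope fails. -/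
noncomputable def clippedPath (a b : ℝ) (X : S → ℝ → ℝ) (B : S → ℝ) (x : S) (t : ℝ) : ℝ :=
  if t ∈ Icc a b ∧ |X x t| ≤ B x then X x t else 0

lemma measurable_clippedPath {a b : ℝ} {X : S → ℝ → ℝ} (hX : Measurable (Function.uncurry X))
    {B : S → ℝ} (hB : Measurable B) :
    Measurable (Function.uncurry (clippedPath a b X B)) := by
  refine Measurable.ite ?_ hX measurable_const
  exact (measurable_snd measurableSet_Icc).inter
    (measurableSet_le hX.abs (hB.comp measurable_fst))

lemma abs_clippedPath_le {a b : ℝ} {X : S → ℝ → ℝ} {B : S → ℝ} (hB : ∀ x, 0 ≤ B x) (x : S)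
    (t : ℝ) : |clippedPath a b X B x t| ≤ B x := by
  unfold clippedPath
  split_ifs with h
  · exact h.2
  · simpa using hB x

lemma clippedPath_eq {a b : ℝ} {X : S → ℝ → ℝ} {B : S → ℝ} {x : S}
    (hx : ∀ t ∈ Icc a b, |X x t| ≤ B x) {t : ℝ} (ht : t ∈ Icc a b) :
    clippedPath a b X B x t = X x t := if_pos ⟨ht, hx t ht⟩

lemma integrable_rpow_of_le {α : Type*} [MeasurableSpace α] {μ : Measure α} [IsFiniteMeasure μ]
    {g : α → ℝ} (hg : Measurable g) (h0 : ∀ x, 0 ≤ g x) {p q : ℝ} (hq : 0 ≤ q) (hqp : q ≤ p)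
    (hi : Integrable (fun x => g x ^ p) μ) : Integrable (fun x => g x ^ q) μ := by
  refine ((integrable_const (1 : ℝ)).add hi).mono' (hg.pow_const q).aestronglyMeasurable
    (ae_of_all _ fun x => ?_)
  rw [Real.norm_of_nonneg (Real.rpow_nonneg (h0 x) q)]
  rcases le_total (g x) 1 with h1 | h1
  · have := Real.rpow_le_one (h0 x) h1 hq
    have := Real.rpow_nonneg (h0 x) p
    simp only [Pi.add_apply]; linarith
  · have := Real.rpow_le_rpow_of_exponent_le h1 hqp
    simp only [Pi.add_apply]; linarith

end Envelope

/-! ## The law of the observation times -/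

section TimeLaw

variable {Ω S : Type*} [MeasurableSpace Ω] [MeasurableSpace S]
  {P : Measure Ω} [IsProbabilityMeasure P] {ν : Measure S} [IsProbabilityMeasure ν]
  {a b σ : ℝ} {f : ℝ → ℝ} {X : S → ℝ → ℝ} {ξ : ℕ → Ω → S} {T U : ℕ → ℕ → Ω → ℝ}

/-- The law `τ` lives on `[a,b]`, with density between `mT` and `MT`. -/
structure DesignLaw (a b mT MT : ℝ) (τ : Measure ℝ) : Prop where
  mT_pos : 0 < mT
  le_MT : mT ≤ MT
  lower : ENNReal.ofReal mT • volume.restrict (Icc a b) ≤ τ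
  upper : τ ≤ ENNReal.ofReal MT • volume.restrict (Icc a b)

/-- The design density enters the later estimates only through these two comparisons with Lebesgue
measure: the upper one bounds the means of kernel windows, the lower one yields coercivity of the
Gram matrices. -/
lemma FunctionalData.ObservationModel.exists_designLaw (hab : a < b)
    (h : ObservationModel P ν a b σ f X ξ T U) (hf : DensityCond a b f) :
    ∃ mT MT, DesignLaw a b mT MT (timeLaw P T) := by
  obtain ⟨mT, MT, h0, hb⟩ := hf.bounds
  refine ⟨mT, MT, h0, (hb a (left_mem_Icc.2 hab.le)).1.trans (hb a (left_mem_Icc.2 hab.le)).2,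
    ?_, ?_⟩
  · rw [timeLaw, h.law_time, ← withDensity_const]
    refine withDensity_mono ?_
    filter_upwards [ae_restrict_mem measurableSet_Icc] with t ht
    exact ENNReal.ofReal_le_ofReal (hb t ht).1
  · rw [timeLaw, h.law_time, ← withDensity_const]
    refine withDensity_mono ?_
    filter_upwards [ae_restrict_mem measurableSet_Icc] with t ht
    exact ENNReal.ofReal_le_ofReal (hb t ht).2

variable {mT MT : ℝ} {τ : Measure ℝ}

lemma DesignLaw.ae_mem (h : DesignLaw a b mT MT τ) : ∀ᵐ t ∂τ, t ∈ Icc a b := by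
  have h1 : ∀ᵐ t ∂(ENNReal.ofReal MT • volume.restrict (Icc a b)), t ∈ Icc a b :=
    Measure.ae_smul_measure (ae_restrict_mem measurableSet_Icc) _
  exact (Measure.absolutelyContinuous_of_le h.upper).ae_le h1

lemma DesignLaw.MT_pos (h : DesignLaw a b mT MT τ) : 0 < MT := h.mT_pos.trans_le h.le_MT

lemma DesignLaw.integral_le (h : DesignLaw a b mT MT τ) {q : ℝ → ℝ} (h0 : ∀ x, 0 ≤ q x)
    (hi : IntegrableOn q (Icc a b)) : ∫ x, q x ∂τ ≤ MT * ∫ x in Icc a b, q x := by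
  have h1 : Integrable q (ENNReal.ofReal MT • volume.restrict (Icc a b)) :=
    hi.smul_measure ENNReal.ofReal_ne_top
  refine (integral_mono_measure h.upper (ae_of_all _ h0) h1).trans ?_
  rw [integral_smul_measure, ENNReal.toReal_ofReal h.MT_pos.le, smul_eq_mul]

lemma DesignLaw.le_integral (h : DesignLaw a b mT MT τ) {q : ℝ → ℝ} (h0 : ∀ x, 0 ≤ q x)
    (hi : Integrable q τ) : mT * ∫ x in Icc a b, q x ≤ ∫ x, q x ∂τ := by
  refine le_trans ?_ (integral_mono_measure h.lower (ae_of_all _ h0) hi)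
  rw [integral_smul_measure, ENNReal.toReal_ofReal h.mT_pos.le, smul_eq_mul]

end TimeLaw

/-! ## The noise variables -/

section Noise

variable {Ω S : Type*} [MeasurableSpace Ω] [MeasurableSpace S]
  {P : Measure Ω} [IsProbabilityMeasure P] {ν : Measure S} [IsProbabilityMeasure ν]
  {a b σ : ℝ} {f : ℝ → ℝ} {X : S → ℝ → ℝ} {ξ : ℕ → Ω → S} {T U : ℕ → ℕ → Ω → ℝ}

/-- `E Y(s) Y(t)`. -/
noncomputable def secondMoment (ν : Measure S) (Y : S → ℝ → ℝ) (s t : ℝ) : ℝ :=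
  ∫ x, Y x s * Y x t ∂ν

/-- `Y(s) + u - E Y(s)`. -/
noncomputable def meanNoise (ν : Measure S) (Y : S → ℝ → ℝ) (z : (S × ℝ × ℝ) × ℝ × ℝ) : ℝ :=
  Y z.1.1 z.2.1 + z.1.2.1 - meanFun ν Y z.2.1

/-- `(Y(s) + u)² - E Y(s)² - σ²`. -/
noncomputable def squareNoise (ν : Measure S) (σ : ℝ) (Y : S → ℝ → ℝ)
    (z : (S × ℝ × ℝ) × ℝ × ℝ) : ℝ :=
  (Y z.1.1 z.2.1 + z.1.2.1) ^ 2 - (secondMoment ν Y z.2.1 z.2.1 + σ ^ 2)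

/-- `(Y(s) + u) (Y(t) + u') - E Y(s) Y(t)`. -/
noncomputable def crossNoise (ν : Measure S) (Y : S → ℝ → ℝ) (z : (S × ℝ × ℝ) × ℝ × ℝ) : ℝ :=
  (Y z.1.1 z.2.1 + z.1.2.1) * (Y z.1.1 z.2.2 + z.1.2.2) - secondMoment ν Y z.2.1 z.2.2

/-- A measurable process dominated by a measurable square integrable envelope. -/
structure EnvelopedPaths (ν : Measure S) (Y : S → ℝ → ℝ) (B : S → ℝ) : Prop where
  measurable : Measurable (Function.uncurry Y)
  measurable_bound : Measurable B
  abs_le : ∀ x t, |Y x t| ≤ B x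
  integrable : Integrable B ν
  integrable_sq : Integrable (fun x => B x ^ 2) ν

variable {Y : S → ℝ → ℝ} {B : S → ℝ}

namespace EnvelopedPaths

variable (hY : EnvelopedPaths ν Y B)
include hY

lemma nonneg (x : S) : 0 ≤ B x := (abs_nonneg _).trans (hY.abs_le x 0)

lemma measurable_section (t : ℝ) : Measurable fun x => Y x t :=
  hY.measurable.comp (measurable_id.prodMk measurable_const)

lemma integrable_section (t : ℝ) : Integrable (fun x => Y x t) ν :=
  hY.integrable.mono' (hY.measurable_section t).aestronglyMeasurable
    (ae_of_all _ fun x => hY.abs_le x t)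

lemma abs_mul_le (x : S) (s t : ℝ) : |Y x s * Y x t| ≤ B x ^ 2 := by
  rw [abs_mul, sq]
  exact mul_le_mul (hY.abs_le x s) (hY.abs_le x t) (abs_nonneg _) (hY.nonneg x)

lemma integrable_mul (s t : ℝ) : Integrable (fun x => Y x s * Y x t) ν :=
  hY.integrable_sq.mono'
    ((hY.measurable_section s).mul (hY.measurable_section t)).aestronglyMeasurable
    (ae_of_all _ fun x => hY.abs_mul_le x s t)

lemma abs_meanFun_le (t : ℝ) : |meanFun ν Y t| ≤ ∫ x, B x ∂ν := by
  rw [meanFun, ← Real.norm_eq_abs]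
  exact norm_integral_le_of_norm_le hY.integrable (ae_of_all _ fun x => hY.abs_le x t)

lemma abs_secondMoment_le (s t : ℝ) : |secondMoment ν Y s t| ≤ ∫ x, B x ^ 2 ∂ν := by
  rw [secondMoment, ← Real.norm_eq_abs]
  exact norm_integral_le_of_norm_le hY.integrable_sq (ae_of_all _ fun x => hY.abs_mul_le x s t)

lemma measurable_meanFun : Measurable (meanFun ν Y) := by
  have : StronglyMeasurable fun t => ∫ x, Y x t ∂ν :=
    StronglyMeasurable.integral_prod_left (f := fun x t => Y x t)
      hY.measurable.stronglyMeasurable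
  exact this.measurable

lemma measurable_secondMoment : Measurable fun q : ℝ × ℝ => secondMoment ν Y q.1 q.2 := by
  have h1 : Measurable fun w : S × ℝ × ℝ => Y w.1 w.2.1 * Y w.1 w.2.2 :=
    (hY.measurable.comp (measurable_fst.prodMk measurable_snd.fst)).mul
      (hY.measurable.comp (measurable_fst.prodMk measurable_snd.snd))
  have : StronglyMeasurable fun q : ℝ × ℝ => ∫ x, Y x q.1 * Y x q.2 ∂ν :=
    StronglyMeasurable.integral_prod_left (f := fun x (q : ℝ × ℝ) => Y x q.1 * Y x q.2)
      h1.stronglyMeasurable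
  exact this.measurable

lemma measurable_fst_obs : Measurable fun z : (S × ℝ × ℝ) × ℝ × ℝ => Y z.1.1 z.2.1 + z.1.2.1 :=
  (hY.measurable.comp (measurable_fst.fst.prodMk measurable_snd.fst)).add measurable_fst.snd.fst

lemma measurable_snd_obs : Measurable fun z : (S × ℝ × ℝ) × ℝ × ℝ => Y z.1.1 z.2.2 + z.1.2.2 :=
  (hY.measurable.comp (measurable_fst.fst.prodMk measurable_snd.snd)).add measurable_fst.snd.snd

lemma measurable_meanNoise : Measurable (meanNoise ν Y) :=
  hY.measurable_fst_obs.sub (hY.measurable_meanFun.comp measurable_snd.fst)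

lemma measurable_squareNoise (σ : ℝ) : Measurable (squareNoise ν σ Y) :=
  (hY.measurable_fst_obs.pow_const 2).sub ((hY.measurable_secondMoment.comp
    (measurable_snd.fst.prodMk measurable_snd.fst)).add_const _)

lemma measurable_crossNoise : Measurable (crossNoise ν Y) :=
  (hY.measurable_fst_obs.mul hY.measurable_snd_obs).sub
    (hY.measurable_secondMoment.comp (measurable_snd.fst.prodMk measurable_snd.snd))

end EnvelopedPaths

/-- An upper bound of a single observation and of its moments. -/
noncomputable def obsBound (ν : Measure S) (σ : ℝ) (B : S → ℝ) (x : S) (u : ℝ) : ℝ :=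
  1 + (∫ y, B y ∂ν) + (∫ y, B y ^ 2 ∂ν) + σ ^ 2 + B x + |u|

section Bounds

variable (hY : EnvelopedPaths ν Y B)
include hY

lemma one_le_obsBound (σ : ℝ) (x : S) (u : ℝ) : 1 ≤ obsBound ν σ B x u := by
  unfold obsBound
  have h1 : 0 ≤ ∫ y, B y ∂ν := integral_nonneg hY.nonneg
  have h2 : 0 ≤ ∫ y, B y ^ 2 ∂ν := integral_nonneg fun y => sq_nonneg _
  have := hY.nonneg x
  have := abs_nonneg u
  have := sq_nonneg σ
  linarith

lemma measurable_obsBound (σ : ℝ) : Measurable fun p : S × ℝ => obsBound ν σ B p.1 p.2 :=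
  ((hY.measurable_bound.comp measurable_fst).const_add _).add measurable_snd.abs

lemma abs_meanNoise_le (σ : ℝ) (z : (S × ℝ × ℝ) × ℝ × ℝ) :
    |meanNoise ν Y z| ≤ obsBound ν σ B z.1.1 z.1.2.1 := by
  have h1 := hY.abs_meanFun_le z.2.1
  have h2 : 0 ≤ ∫ y, B y ^ 2 ∂ν := integral_nonneg fun y => sq_nonneg _
  have h3 := hY.abs_le z.1.1 z.2.1
  have h4 := sq_nonneg σ
  unfold meanNoise obsBound
  have := abs_sub (Y z.1.1 z.2.1 + z.1.2.1) (meanFun ν Y z.2.1)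
  have := abs_add_le (Y z.1.1 z.2.1) z.1.2.1
  linarith

/-- The constant part of `obsBound` contains the moments that are subtracted as centring. Since it
also contains `1`, its square dominates `(B + |u|)²` and these moments together. -/
lemma abs_squareNoise_le (σ : ℝ) (z : (S × ℝ × ℝ) × ℝ × ℝ) :
    |squareNoise ν σ Y z| ≤ obsBound ν σ B z.1.1 z.1.2.1 ^ 2 := by
  have h0 : 0 ≤ ∫ y, B y ∂ν := integral_nonneg hY.nonneg
  have h1 := hY.abs_secondMoment_le z.2.1 z.2.1
  have h2 : 0 ≤ ∫ y, B y ^ 2 ∂ν := integral_nonneg fun y => sq_nonneg _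
  have h3 := hY.abs_le z.1.1 z.2.1
  have h4 := sq_nonneg σ
  have h5 := hY.nonneg z.1.1
  have h6 := abs_nonneg z.1.2.1
  unfold squareNoise obsBound
  have h7 := abs_add_le (Y z.1.1 z.2.1) z.1.2.1
  have h8 : (Y z.1.1 z.2.1 + z.1.2.1) ^ 2 ≤ (B z.1.1 + |z.1.2.1|) ^ 2 := by
    rw [← sq_abs]; gcongr; linarith
  have h9 := abs_sub ((Y z.1.1 z.2.1 + z.1.2.1) ^ 2) (secondMoment ν Y z.2.1 z.2.1 + σ ^ 2)
  have h10 := abs_add_le (secondMoment ν Y z.2.1 z.2.1) (σ ^ 2)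
  rw [abs_of_nonneg (sq_nonneg (Y z.1.1 z.2.1 + z.1.2.1))] at h9
  rw [abs_of_nonneg h4] at h10
  nlinarith [mul_nonneg h5 h6]

lemma abs_crossNoise_le (σ : ℝ) (z : (S × ℝ × ℝ) × ℝ × ℝ) :
    |crossNoise ν Y z| ≤ obsBound ν σ B z.1.1 z.1.2.1 * obsBound ν σ B z.1.1 z.1.2.2 := by
  have h0 : 0 ≤ ∫ y, B y ∂ν := integral_nonneg hY.nonneg
  have h1 := hY.abs_secondMoment_le z.2.1 z.2.2
  have h2 : 0 ≤ ∫ y, B y ^ 2 ∂ν := integral_nonneg fun y => sq_nonneg _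
  have h3 := hY.abs_le z.1.1 z.2.1
  have h3' := hY.abs_le z.1.1 z.2.2
  have h4 := sq_nonneg σ
  have h5 := hY.nonneg z.1.1
  have h6 := abs_nonneg z.1.2.1
  have h6' := abs_nonneg z.1.2.2
  unfold crossNoise obsBound
  have h7 := abs_add_le (Y z.1.1 z.2.1) z.1.2.1
  have h7' := abs_add_le (Y z.1.1 z.2.2) z.1.2.2
  have h8 : |(Y z.1.1 z.2.1 + z.1.2.1) * (Y z.1.1 z.2.2 + z.1.2.2)| ≤
      (B z.1.1 + |z.1.2.1|) * (B z.1.1 + |z.1.2.2|) := by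
    rw [abs_mul]; gcongr <;> linarith
  have h9 := abs_sub ((Y z.1.1 z.2.1 + z.1.2.1) * (Y z.1.1 z.2.2 + z.1.2.2))
    (secondMoment ν Y z.2.1 z.2.2)
  set c := (∫ y, B y ∂ν) + (∫ y, B y ^ 2 ∂ν) + σ ^ 2 with hc
  have hc0 : ∫ y, B y ^ 2 ∂ν ≤ c := by linarith
  have hcp : 0 ≤ c := by linarith
  have : (1 + c + B z.1.1 + |z.1.2.1|) * (1 + c + B z.1.1 + |z.1.2.2|) ≥
      (B z.1.1 + |z.1.2.1|) * (B z.1.1 + |z.1.2.2|) + c := by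
    nlinarith [mul_nonneg hcp (add_nonneg h5 h6), mul_nonneg hcp (add_nonneg h5 h6'),
      mul_nonneg hcp hcp]
  have e1 : 1 + (∫ y, B y ∂ν) + (∫ y, B y ^ 2 ∂ν) + σ ^ 2 = 1 + c := by rw [hc]; ring
  rw [e1]
  linarith

end Bounds

section Centered

variable (h : ObservationModel P ν a b σ f X ξ T U) (hY : EnvelopedPaths ν Y B)
include h

lemma integrable_error : Integrable (fun u => u) (errorLaw P U) := by
  have h1 : MemLp (U 0 0) 2 P := h.memLp_error 0 0
  rw [errorLaw, integrable_map_measure (by fun_prop)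
    (h.measurable_error 0 0).aemeasurable]
  exact h1.integrable (by norm_num)

lemma integrable_error_sq : Integrable (fun u => u ^ 2) (errorLaw P U) := by
  have h1 : MemLp (U 0 0) 2 P := h.memLp_error 0 0
  rw [errorLaw, integrable_map_measure (by fun_prop)
    (h.measurable_error 0 0).aemeasurable]
  exact h1.integrable_sq

lemma integral_error : ∫ u, u ∂(errorLaw P U) = 0 := by
  rw [errorLaw, integral_map (h.measurable_error 0 0).aemeasurable
    (by fun_prop)]
  exact h.mean_error 0 0

lemma integral_error_sq : ∫ u, u ^ 2 ∂(errorLaw P U) = σ ^ 2 := by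
  rw [errorLaw, integral_map (h.measurable_error 0 0).aemeasurable
    (by fun_prop), ← h.variance_error 0 0,
    variance_of_integral_eq_zero (h.measurable_error 0 0).aemeasurable (h.mean_error 0 0)]

/-- A pair function is centered if it has mean zero given the times. -/
def IsCentered (P : Measure Ω) (ν : Measure S) (U : ℕ → ℕ → Ω → ℝ)
    (ζ : (S × ℝ × ℝ) × ℝ × ℝ → ℝ) : Prop :=
  ∀ w : ℝ × ℝ, ∫ y, ζ (y, w) ∂(ν.prod ((errorLaw P U).prod (errorLaw P U))) = 0

/-- Fubini with the times held fixed: a weight that depends on the times alone factors out of the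
inner integral, which vanishes. -/
lemma IsCentered.integral_mul_eq_zero {ζ : (S × ℝ × ℝ) × ℝ × ℝ → ℝ}
    (hζ : IsCentered P ν U ζ) {g : ℝ × ℝ → ℝ}
    (hi : Integrable (fun z => ζ z * g z.2) (pairLaw P ν T U)) :
    ∫ z, ζ z * g z.2 ∂(pairLaw P ν T U) = 0 := by
  have := h.isProbabilityMeasure_errorLaw
  have := h.isProbabilityMeasure_timeLaw
  rw [pairLaw] at hi ⊢
  rw [integral_prod_symm _ hi]
  simp only [integral_mul_const]
  simp [hζ _]

include hY

lemma isCentered_meanNoise : IsCentered P ν U (meanNoise ν Y) := by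
  have := h.isProbabilityMeasure_errorLaw
  intro w
  have i1 : Integrable (fun y : S × ℝ × ℝ => Y y.1 w.1)
      (ν.prod ((errorLaw P U).prod (errorLaw P U))) := (hY.integrable_section w.1).comp_fst _
  have i2 : Integrable (fun y : S × ℝ × ℝ => y.2.1)
      (ν.prod ((errorLaw P U).prod (errorLaw P U))) :=
    ((integrable_error h).comp_fst (errorLaw P U)).comp_snd ν
  have e1 : ∫ y : S × ℝ × ℝ, Y y.1 w.1 ∂(ν.prod ((errorLaw P U).prod (errorLaw P U)))
      = meanFun ν Y w.1 := by
    rw [integral_fun_fst (fun x => Y x w.1)]; simp [meanFun]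
  have e2 : ∫ y : S × ℝ × ℝ, y.2.1 ∂(ν.prod ((errorLaw P U).prod (errorLaw P U))) = 0 := by
    rw [integral_fun_snd (fun y : ℝ × ℝ => y.1), integral_fun_fst (fun y : ℝ => y),
      integral_error h]; simp
  simp only [meanNoise]
  have i12 : Integrable (fun y : S × ℝ × ℝ => Y y.1 w.1 + y.2.1)
    (ν.prod ((errorLaw P U).prod (errorLaw P U))) := i1.add i2
  rw [integral_sub i12 (integrable_const _), integral_add i1 i2, e1, e2]
  simp

/-- The cross term vanishes because the error is centred and independent of the curve; the squared
error contributes `σ²`, which is why the square noise is centred at `E Y(s)² + σ²`. -/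
lemma isCentered_squareNoise : IsCentered P ν U (squareNoise ν σ Y) := by
  have := h.isProbabilityMeasure_errorLaw
  intro w
  set κ := errorLaw P U
  have i1 : Integrable (fun y : S × ℝ × ℝ => Y y.1 w.1 * Y y.1 w.1) (ν.prod (κ.prod κ)) :=
    (hY.integrable_mul w.1 w.1).comp_fst _
  have i2 : Integrable (fun y : S × ℝ × ℝ => Y y.1 w.1 * y.2.1) (ν.prod (κ.prod κ)) :=
    (hY.integrable_section w.1).mul_prod (((integrable_error h).comp_fst κ))
  have i3 : Integrable (fun y : S × ℝ × ℝ => y.2.1 ^ 2) (ν.prod (κ.prod κ)) :=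
    ((integrable_error_sq h).comp_fst κ).comp_snd ν
  have e1 : ∫ y : S × ℝ × ℝ, Y y.1 w.1 * Y y.1 w.1 ∂(ν.prod (κ.prod κ))
      = secondMoment ν Y w.1 w.1 := by
    rw [integral_fun_fst (fun x => Y x w.1 * Y x w.1)]; simp [secondMoment]
  have e2 : ∫ y : S × ℝ × ℝ, Y y.1 w.1 * y.2.1 ∂(ν.prod (κ.prod κ)) = 0 := by
    rw [integral_prod_mul (fun x => Y x w.1) (fun y : ℝ × ℝ => y.1),
      integral_fun_fst (fun y : ℝ => y), integral_error h]; simp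
  have e3 : ∫ y : S × ℝ × ℝ, y.2.1 ^ 2 ∂(ν.prod (κ.prod κ)) = σ ^ 2 := by
    rw [integral_fun_snd (fun y : ℝ × ℝ => y.1 ^ 2), integral_fun_fst (fun y : ℝ => y ^ 2),
      integral_error_sq h]; simp
  have e : ∀ y : S × ℝ × ℝ, squareNoise ν σ Y (y, w) = Y y.1 w.1 * Y y.1 w.1 +
      2 * (Y y.1 w.1 * y.2.1) + y.2.1 ^ 2 - (secondMoment ν Y w.1 w.1 + σ ^ 2) := fun y => by
    simp only [squareNoise]; ring
  simp only [e]
  have i12 : Integrable (fun y : S × ℝ × ℝ => Y y.1 w.1 * Y y.1 w.1 + 2 * (Y y.1 w.1 * y.2.1))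
    (ν.prod (κ.prod κ)) := i1.add (i2.const_mul 2)
  have i123 : Integrable (fun y : S × ℝ × ℝ => Y y.1 w.1 * Y y.1 w.1 +
    2 * (Y y.1 w.1 * y.2.1) + y.2.1 ^ 2) (ν.prod (κ.prod κ)) := i12.add i3
  rw [integral_sub i123 (integrable_const _), integral_add i12 i3,
    integral_add i1 (i2.const_mul 2), integral_const_mul, e1, e2, e3]
  simp

/-- The two observations carry different, independent errors, so their product has mean zero and no
`σ²` appears. This is the reason for excluding `j = k` in the cross smoother, and the contrast with
the square noise is what identifies `σ²`. -/
lemma isCentered_crossNoise : IsCentered P ν U (crossNoise ν Y) := by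
  have := h.isProbabilityMeasure_errorLaw
  intro w
  set κ := errorLaw P U
  have i1 : Integrable (fun y : S × ℝ × ℝ => Y y.1 w.1 * Y y.1 w.2) (ν.prod (κ.prod κ)) :=
    (hY.integrable_mul w.1 w.2).comp_fst _
  have i2 : Integrable (fun y : S × ℝ × ℝ => Y y.1 w.1 * y.2.2) (ν.prod (κ.prod κ)) :=
    (hY.integrable_section w.1).mul_prod (((integrable_error h).comp_snd κ))
  have i3 : Integrable (fun y : S × ℝ × ℝ => Y y.1 w.2 * y.2.1) (ν.prod (κ.prod κ)) :=
    (hY.integrable_section w.2).mul_prod (((integrable_error h).comp_fst κ))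
  have i4 : Integrable (fun y : S × ℝ × ℝ => y.2.1 * y.2.2) (ν.prod (κ.prod κ)) :=
    ((integrable_error h).mul_prod (integrable_error h)).comp_snd ν
  have e1 : ∫ y : S × ℝ × ℝ, Y y.1 w.1 * Y y.1 w.2 ∂(ν.prod (κ.prod κ))
      = secondMoment ν Y w.1 w.2 := by
    rw [integral_fun_fst (fun x => Y x w.1 * Y x w.2)]; simp [secondMoment]
  have e2 : ∫ y : S × ℝ × ℝ, Y y.1 w.1 * y.2.2 ∂(ν.prod (κ.prod κ)) = 0 := by
    rw [integral_prod_mul (fun x => Y x w.1) (fun y : ℝ × ℝ => y.2),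
      integral_fun_snd (fun y : ℝ => y), integral_error h]; simp
  have e3 : ∫ y : S × ℝ × ℝ, Y y.1 w.2 * y.2.1 ∂(ν.prod (κ.prod κ)) = 0 := by
    rw [integral_prod_mul (fun x => Y x w.2) (fun y : ℝ × ℝ => y.1),
      integral_fun_fst (fun y : ℝ => y), integral_error h]; simp
  have e4 : ∫ y : S × ℝ × ℝ, y.2.1 * y.2.2 ∂(ν.prod (κ.prod κ)) = 0 := by
    rw [integral_fun_snd (fun y : ℝ × ℝ => y.1 * y.2), integral_prod_mul (fun u : ℝ => u)
      (fun u : ℝ => u), integral_error h]; simp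
  have e : ∀ y : S × ℝ × ℝ, crossNoise ν Y (y, w) = Y y.1 w.1 * Y y.1 w.2 +
      Y y.1 w.1 * y.2.2 + Y y.1 w.2 * y.2.1 + y.2.1 * y.2.2 - secondMoment ν Y w.1 w.2 :=
    fun y => by simp only [crossNoise]; ring
  simp only [e]
  have i12 : Integrable (fun y : S × ℝ × ℝ => Y y.1 w.1 * Y y.1 w.2 + Y y.1 w.1 * y.2.2)
    (ν.prod (κ.prod κ)) := i1.add i2
  have i123 : Integrable (fun y : S × ℝ × ℝ => Y y.1 w.1 * Y y.1 w.2 + Y y.1 w.1 * y.2.2 +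
    Y y.1 w.2 * y.2.1) (ν.prod (κ.prod κ)) := i12.add i3
  have i1234 : Integrable (fun y : S × ℝ × ℝ => Y y.1 w.1 * Y y.1 w.2 + Y y.1 w.1 * y.2.2 +
    Y y.1 w.2 * y.2.1 + y.2.1 * y.2.2) (ν.prod (κ.prod κ)) := i123.add i4
  rw [integral_sub i1234 (integrable_const _), integral_add i123 i4, integral_add i12 i3,
    integral_add i1 i2, e1, e2, e3, e4]
  simp

end Centered

end Noise

/-! ## The law of large numbers with rates for finite families: sparse data -/

section FamilyLaw

variable {Ω S : Type*} [MeasurableSpace Ω] [MeasurableSpace S]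
  {P : Measure Ω} [IsProbabilityMeasure P] {ν : Measure S} [IsProbabilityMeasure ν]
  {a b σ : ℝ} {f : ℝ → ℝ} {X : S → ℝ → ℝ} {ξ : ℕ → Ω → S} {T U : ℕ → ℕ → Ω → ℝ}

/-- Almost surely, averages over curves and pairs deviate from their means by `O(ρ n)`, uniformly
over polynomially many pair functions that are dominated by the envelope `env` times functions in
the classes `𝒢 c n`. -/
def FamilyLaw (P : Measure Ω) (ν : Measure S) (ξ : ℕ → Ω → S) (T U : ℕ → ℕ → Ω → ℝ)
    (m : ℕ → ℕ → ℕ) (𝒢 : ℝ → ℕ → Set (ℝ × ℝ → ℝ)) (env : S × ℝ × ℝ → ℝ) (ρ : ℕ → ℝ) : Prop :=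
  ∀ (Λ : ℕ → Finset (ℕ × ℕ)) (p : ℕ), (∀ᶠ n in atTop, ((Λ n).card : ℝ) ≤ (n : ℝ) ^ p) →
  ∀ (F : ℕ → ℕ × ℕ → (S × ℝ × ℝ) × ℝ × ℝ → ℝ) (g : ℕ → ℕ × ℕ → ℝ × ℝ → ℝ) (c : ℝ),
    (∀ n l, Measurable (F n l)) →
    (∀ᶠ n in atTop, ∀ l ∈ Λ n, g n l ∈ 𝒢 c n ∧ ∀ z, |F n l z| ≤ env z.1 * g n l z.2) →
    ∀ᵐ ω ∂P, ∃ C : ℝ, ∀ᶠ n in atTop, ∀ l ∈ Λ n,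
      |curveAvg n (m n) (fun i j k => F n l (pairData ξ T U ω i j k)) -
        ∫ z, F n l z ∂(pairLaw P ν T U)| ≤ C * ρ n

/-- Functions of a pair of times bounded by `c v` with mean at most `c`. -/
def BoundedClass (τ : Measure ℝ) (v : ℕ → ℝ) (c : ℝ) (n : ℕ) : Set (ℝ × ℝ → ℝ) :=
  {g | Measurable g ∧ (∀ w, 0 ≤ g w) ∧ (∀ w, g w ≤ c * v n) ∧ ∫ w, g w ∂(τ.prod τ) ≤ c}

/-- Where the cutoff acts, `|w| > Q`, and `|w| ^ (1 - p) ≤ Q ^ (1 - p)` because the exponent is not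
positive. -/
lemma abs_sub_cutoff_le {Q p : ℝ} (hQ : 0 < Q) (hp : 1 ≤ p) (w : ℝ) :
    |w - cutoff Q w| ≤ |w| ^ p * Q ^ (1 - p) := by
  unfold cutoff
  split_ifs with h
  · simp; positivity
  · push Not at h
    have hw : 0 < |w| := hQ.trans h
    rw [sub_zero]
    calc |w| = |w| ^ p * |w| ^ (1 - p) := by rw [← Real.rpow_add hw]; simp
      _ ≤ |w| ^ p * Q ^ (1 - p) := by
          refine mul_le_mul_of_nonneg_left ?_ (by positivity)
          exact Real.rpow_le_rpow_of_nonpos hQ h.le (by linarith)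

/-- At the level `Q = √(v/r)` the tail bound `v ^ p * Q ^ (1 - p)` equals `v ^ ((p+1)/2) * r ^
((p-1)/2)`, that is, `(v * r ^ (1 - 2/p)) ^ (p/2)` times the rate `√(v r)`. Boundedness of the first
factor is the bandwidth condition. -/
lemma truncation_rate {v r p C : ℝ} (hv : 0 < v) (hr : 0 < r) (hp : 0 < p)
    (h : v * r ^ (1 - 2 / p) ≤ C) :
    v ^ p * √(v / r) ^ (1 - p) ≤ C ^ (p / 2) * √(v * r) := by
  have hl : 0 < v * r ^ (1 - 2 / p) := by positivity
  have e : v ^ p * √(v / r) ^ (1 - p) = (v * r ^ (1 - 2 / p)) ^ (p / 2) * √(v * r) := by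
    -- In logarithmic coordinates the identity of monomials becomes a linear identity of exponents.
    obtain ⟨x, rfl⟩ : ∃ x, v = Real.exp x := ⟨_, (Real.exp_log hv).symm⟩
    obtain ⟨y, rfl⟩ : ∃ y, r = Real.exp y := ⟨_, (Real.exp_log hr).symm⟩
    rw [Real.sqrt_eq_rpow, Real.sqrt_eq_rpow]
    simp only [← Real.exp_mul, ← Real.exp_add, ← Real.exp_sub]
    congr 1
    field_simp
    ring
  rw [e]
  gcongr

lemma integrable_env_mul {env : S × ℝ × ℝ → ℝ} {μ : Measure (S × ℝ × ℝ)} {τ : Measure (ℝ × ℝ)}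
    [IsFiniteMeasure μ] [IsFiniteMeasure τ]
    (hi : Integrable env μ) {g : ℝ × ℝ → ℝ} (hg : Integrable g τ)
    {F : (S × ℝ × ℝ) × ℝ × ℝ → ℝ} (hF : Measurable F)
    (hFg : ∀ z, |F z| ≤ env z.1 * g z.2) : Integrable F (μ.prod τ) :=
  (hi.mul_prod hg).mono' hF.aestronglyMeasurable (ae_of_all _ hFg)

lemma FunctionalData.ObservationModel.curveAvg_sub_integral
    (h : ObservationModel P ν a b σ f X ξ T U) {m : ℕ → ℕ} {n : ℕ} (hn : 0 < n)
    (hm : ∀ i < n, 2 ≤ m i) {F : (S × ℝ × ℝ) × ℝ × ℝ → ℝ} (hF : Measurable F)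
    (hi : Integrable F (pairLaw P ν T U)) (ω : Ω) :
    curveAvg n m (fun i j k => F (pairData ξ T U ω i j k)) - ∫ z, F z ∂(pairLaw P ν T U) =
    (n : ℝ)⁻¹ * ∑ i ∈ Finset.range n, (pairAvg (m i) (fun j k => F (pairData ξ T U ω i j k)) -
      ∫ ω', pairAvg (m i) (fun j k => F (pairData ξ T U ω' i j k)) ∂P) := by
  rw [Finset.sum_congr rfl fun i hi' => by
    rw [h.integral_pairAvg hF hi (hm i (Finset.mem_range.1 hi')) i]]
  rw [Finset.sum_sub_distrib, mul_sub, curveAvg]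
  have : (n : ℝ) ≠ 0 := by positivity
  simp [this]

/-- For fixed indices `j ≠ k` the curves together with their `j`-th and `k`-th errors are
independent and identically distributed over `i`, so the strong law applies even though the numbers
of observations vary with `n`. -/
lemma FunctionalData.ObservationModel.ae_avg_le
    (h : ObservationModel P ν a b σ f X ξ T U) {e : S × ℝ × ℝ → ℝ} (he : Measurable e)
    (hi : Integrable e (ν.prod ((errorLaw P U).prod (errorLaw P U)))) {j k : ℕ} (hjk : j ≠ k) :
    ∀ᵐ ω ∂P, ∃ C : ℝ, ∀ᶠ n : ℕ in atTop,
      (n : ℝ)⁻¹ * ∑ i ∈ Finset.range n, e (ξ i ω, U i j ω, U i k ω) ≤ C := by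
  have hmeas : ∀ i, Measurable fun ω => (ξ i ω, U i j ω, U i k ω) := fun i =>
    (h.measurable_curve i).prodMk ((h.measurable_error i j).prodMk (h.measurable_error i k))
  have hind : iIndepFun (fun i ω => e (ξ i ω, U i j ω, U i k ω)) P := by
    refine h.iIndepFun_of_blocks pairwise_disjoint_curveBlock fun i => ?_
    exact (he.comp measurable_fst).comp (measurable_pairData_curveBlock i j k)
  have hid : ∀ i, IdentDistrib (fun ω => e (ξ i ω, U i j ω, U i k ω))
      (fun ω => e (ξ 0 ω, U 0 j ω, U 0 k ω)) P P := fun i => by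
    have : IdentDistrib (fun ω => (ξ i ω, U i j ω, U i k ω))
        (fun ω => (ξ 0 ω, U 0 j ω, U 0 k ω)) P P :=
      ⟨(hmeas i).aemeasurable, (hmeas 0).aemeasurable, by
        rw [h.map_curve_errors i hjk, h.map_curve_errors 0 hjk]⟩
    exact this.comp he
  have hint : Integrable (fun ω => e (ξ 0 ω, U 0 j ω, U 0 k ω)) P := by
    rw [← h.map_curve_errors 0 hjk] at hi
    exact hi.comp_measurable (hmeas 0)
  filter_upwards [strong_law_ae_real (fun i ω => e (ξ i ω, U i j ω, U i k ω)) hint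
    (fun i i' hii => hind.indepFun hii) hid] with ω hω
  refine ⟨(∫ ω, e (ξ 0 ω, U 0 j ω, U 0 k ω) ∂P) + 1, ?_⟩
  filter_upwards [hω.eventually_le_const (lt_add_one _)] with n hn
  rwa [← div_eq_inv_mul]

/-- Boundedly many observations per curve. -/
theorem familyLaw_sparse (h : ObservationModel P ν a b σ f X ξ T U) {m : ℕ → ℕ → ℕ}
    (hm : ∀ n, ∀ i < n, 2 ≤ m n i) {M : ℕ} (hM : ∀ n, ∀ i < n, m n i ≤ M) {lam : ℝ}
    (hlam : 2 < lam) {env : S × ℝ × ℝ → ℝ} (henv : Measurable env) (h0 : ∀ y, 0 ≤ env y)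
    (hmom : Integrable (fun y => env y ^ lam) (ν.prod ((errorLaw P U).prod (errorLaw P U))))
    {v : ℕ → ℝ} (hv : ∀ n, 0 < v n) {C₀ : ℝ}
    (hrate : ∀ᶠ n in atTop, v n * logRatio n ^ (1 - 2 / lam) ≤ C₀) :
    FamilyLaw P ν ξ T U m (BoundedClass (timeLaw P T) v) env fun n => √(v n * logRatio n) := by
  intro Λ p hΛ F g c hF hFg
  have := h.isProbabilityMeasure_errorLaw
  have := h.isProbabilityMeasure_timeLaw
  set μ := ν.prod ((errorLaw P U).prod (errorLaw P U)) with hμ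
  set τ := (timeLaw P T).prod (timeLaw P T) with hτ
  have hp1 : (1 : ℝ) ≤ lam := by linarith
  have henv1 : Integrable env μ := by
    simpa using integrable_rpow_of_le henv h0 zero_le_one hp1 hmom
  have henv2 : Integrable (fun y => env y ^ 2) μ := by
    simpa using integrable_rpow_of_le henv h0 (q := 2) (by norm_num) hlam.le hmom
  have hc : ∀ᶠ n in atTop, ∀ l ∈ Λ n, 0 ≤ c := by
    filter_upwards [hFg] with n hn l hl
    exact (integral_nonneg (hn l hl).1.2.1).trans (hn l hl).1.2.2.2
  have hg1 : ∀ᶠ n in atTop, ∀ l ∈ Λ n, Integrable (g n l) τ := by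
    filter_upwards [hFg] with n hn l hl
    exact Integrable.of_bound (hn l hl).1.1.aestronglyMeasurable (c * v n)
      (ae_of_all _ fun w => by
        rw [Real.norm_of_nonneg ((hn l hl).1.2.1 w)]; exact (hn l hl).1.2.2.1 w)
  have hFi : ∀ᶠ n in atTop, ∀ l ∈ Λ n, Integrable (F n l) (pairLaw P ν T U) := by
    filter_upwards [hFg, hg1] with n hn hg l hl
    exact integrable_env_mul henv1 (hg l hl) (hF n l) (hn l hl).2
  -- One factor of `g²` is replaced by its bound `c v`, the other is integrated and contributes `c`.
  have hsq : ∀ᶠ n in atTop, ∀ l ∈ Λ n, Integrable (fun z => F n l z ^ 2) (pairLaw P ν T U) ∧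
      ∫ z, F n l z ^ 2 ∂(pairLaw P ν T U) ≤ ((∫ y, env y ^ 2 ∂μ) * (c * c)) * v n := by
    filter_upwards [hFg, hg1, hc] with n hn hg hc l hl
    obtain ⟨⟨gm, g0, gb, gi⟩, hle⟩ := hn l hl
    have hg2 : Integrable (fun w => g n l w ^ 2) τ := by
      refine ((hg l hl).const_mul (c * v n)).mono' (gm.pow_const 2).aestronglyMeasurable
        (ae_of_all _ fun w => ?_)
      rw [Real.norm_of_nonneg (sq_nonneg _), sq]
      exact mul_le_mul_of_nonneg_right (gb w) (g0 w)
    have hFle : ∀ z, F n l z ^ 2 ≤ env z.1 ^ 2 * g n l z.2 ^ 2 := fun z => by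
      rw [← mul_pow, ← sq_abs]; exact pow_le_pow_left₀ (abs_nonneg _) (hle z) 2
    have hi2 : Integrable (fun z => F n l z ^ 2) (pairLaw P ν T U) :=
      (henv2.mul_prod hg2).mono' ((hF n l).pow_const 2).aestronglyMeasurable
        (ae_of_all _ fun z => by rw [Real.norm_of_nonneg (sq_nonneg _)]; exact hFle z)
    refine ⟨hi2, (integral_mono hi2 (henv2.mul_prod hg2) hFle).trans ?_⟩
    rw [pairLaw, ← hμ, ← hτ, integral_prod_mul (fun y => env y ^ 2) (fun w => g n l w ^ 2), mul_assoc]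
    refine mul_le_mul_of_nonneg_left ?_ (integral_nonneg fun y => sq_nonneg _)
    calc ∫ w, g n l w ^ 2 ∂τ ≤ ∫ w, (c * v n) * g n l w ∂τ :=
          integral_mono hg2 ((hg l hl).const_mul _) fun w => by
            rw [sq]; exact mul_le_mul_of_nonneg_right (gb w) (g0 w)
      _ = (c * v n) * ∫ w, g n l w ∂τ := integral_const_mul _ _
      _ ≤ (c * v n) * c := mul_le_mul_of_nonneg_left gi (mul_nonneg (hc l hl) (hv n).le)
      _ = c * c * v n := by ring
  -- With at most `M` observations per curve only finitely many index pairs occur, so the strong law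
  -- can be applied to each of them and the pair averages bounded by the sum over all.
  have hLLN : ∀ᵐ ω ∂P, ∀ q ∈ (Finset.range M).offDiag, ∃ C : ℝ, ∀ᶠ n : ℕ in atTop,
      (n : ℝ)⁻¹ * ∑ i ∈ Finset.range n, env (ξ i ω, U i q.1 ω, U i q.2 ω) ^ lam ≤ C := by
    refine (ae_ball_iff (Finset.countable_toSet _)).2 fun q hq => ?_
    exact h.ae_avg_le (henv.pow_const lam) hmom (Finset.mem_offDiag.1 hq).2.2
  have key := ae_uniform_deviation (P := P) Λ p hΛ
    (fun n l i ω => pairAvg (m n i) fun j k => F n l (pairData ξ T U ω i j k))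
    (fun n l i => h.measurable_pairAvg (hF n l) _ i)
    (fun n l => h.iIndepFun_pairAvg (hF n l) _) (c := (∫ y, env y ^ 2 ∂μ) * (c * c)) hv ?_ ?_
  · filter_upwards [key] with ω ⟨C, hω⟩
    refine ⟨C, ?_⟩
    filter_upwards [hω, hFi, eventually_gt_atTop 0] with n hn hi hn0 l hl
    rw [h.curveAvg_sub_integral hn0 (hm n) (hF n l) (hi l hl)]
    exact hn l hl
  · filter_upwards [hsq] with n hn l hl i hi
    have h1 := h.integral_pairAvg_sq_le (hF n l) (hn l hl).1 (hm n i hi) i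
    exact ⟨h1.1, h1.2.trans (hn l hl).2⟩
  · filter_upwards [hLLN] with ω hω
    choose! C hC using hω
    refine ⟨c ^ lam * C₀ ^ (lam / 2) * ∑ q ∈ (Finset.range M).offDiag, C q, ?_⟩
    filter_upwards [hFg, hc, (Finset.range M).offDiag.eventually_all.2 hC, hrate,
      eventually_ge_atTop 2] with n hn hc hC hrate hn2 l hl
    obtain ⟨⟨gm, g0, gb, gi⟩, hle⟩ := hn l hl
    have hlr := logRatio_pos hn2
    set Q := √(v n / logRatio n) with hQ
    have hQ0 : 0 < Q := Real.sqrt_pos.2 (div_pos (hv n) hlr)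
    have hcv : 0 ≤ c * v n := mul_nonneg (hc l hl) (hv n).le
    -- The part cut off from one curve is at most its `lam`-th power times `Q ^ (1 - lam)`. Jensen's
    -- inequality passes to the pairs, where the weight is at most `c v` and only the envelope stays
    -- random.
    have hbound : ∀ i ∈ Finset.range n,
        |pairAvg (m n i) (fun j k => F n l (pairData ξ T U ω i j k)) -
          cutoff Q (pairAvg (m n i) fun j k => F n l (pairData ξ T U ω i j k))| ≤
        ((c * v n) ^ lam * Q ^ (1 - lam)) *
          ∑ q ∈ (Finset.range M).offDiag, env (ξ i ω, U i q.1 ω, U i q.2 ω) ^ lam := by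
      intro i hi
      have hi' := Finset.mem_range.1 hi
      refine (abs_sub_cutoff_le hQ0 hp1 _).trans ?_
      rw [mul_right_comm]
      refine mul_le_mul_of_nonneg_right ?_ (by positivity)
      refine (abs_pairAvg_rpow_le (hm n i hi') _ hp1).trans ?_
      refine (pairAvg_mono (ψ := fun j k => (c * v n) ^ lam *
        env (ξ i ω, U i j ω, U i k ω) ^ lam) fun j k => ?_).trans ?_
      · rw [← Real.mul_rpow hcv (h0 _)]
        refine Real.rpow_le_rpow (abs_nonneg _) ((hle _).trans ?_) (by linarith)
        rw [mul_comm]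
        exact mul_le_mul_of_nonneg_right (gb _) (h0 _)
      · rw [pairAvg_const_mul]
        exact mul_le_mul_of_nonneg_left (pairAvg_le_sum (hm n i hi') (hM n i hi')
          fun j k => Real.rpow_nonneg (h0 _) _) (by positivity)
    calc (n : ℝ)⁻¹ * ∑ i ∈ Finset.range n,
        |pairAvg (m n i) (fun j k => F n l (pairData ξ T U ω i j k)) -
          cutoff Q (pairAvg (m n i) fun j k => F n l (pairData ξ T U ω i j k))|
        ≤ (n : ℝ)⁻¹ * ∑ i ∈ Finset.range n, ((c * v n) ^ lam * Q ^ (1 - lam)) *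
          ∑ q ∈ (Finset.range M).offDiag, env (ξ i ω, U i q.1 ω, U i q.2 ω) ^ lam := by
          gcongr with i hi; exact hbound i hi
      _ = ((c * v n) ^ lam * Q ^ (1 - lam)) * ∑ q ∈ (Finset.range M).offDiag,
          ((n : ℝ)⁻¹ * ∑ i ∈ Finset.range n, env (ξ i ω, U i q.1 ω, U i q.2 ω) ^ lam) := by
          rw [← Finset.mul_sum, ← Finset.mul_sum, Finset.sum_comm]; ring
      _ ≤ ((c * v n) ^ lam * Q ^ (1 - lam)) * ∑ q ∈ (Finset.range M).offDiag, C q := by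
          gcongr with q hq; exact hC q hq
      _ = c ^ lam * (v n ^ lam * Q ^ (1 - lam)) * ∑ q ∈ (Finset.range M).offDiag, C q := by
          rw [Real.mul_rpow (hc l hl) (hv n).le]; ring
      _ ≤ c ^ lam * (C₀ ^ (lam / 2) * √(v n * logRatio n)) *
          ∑ q ∈ (Finset.range M).offDiag, C q := by
          have h1 := truncation_rate (hv n) hlr (by linarith) hrate
          have h2 : 0 ≤ ∑ q ∈ (Finset.range M).offDiag, C q := by
            refine Finset.sum_nonneg fun q hq => le_trans ?_ (hC q hq)
            exact mul_nonneg (by positivity) (Finset.sum_nonneg fun i _ =>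
              Real.rpow_nonneg (h0 _) _)
          have h3 : 0 ≤ c ^ lam := Real.rpow_nonneg (hc l hl) _
          gcongr
      _ = _ := by ring

end FamilyLaw

/-! ## Moments and tails of sums of independent nonnegative variables -/

section Sums

variable {Ω : Type*} [MeasurableSpace Ω] {P : Measure Ω} [IsProbabilityMeasure P]

lemma ENNReal.add_pow_le_two_pow_mul (x y : ENNReal) (q : ℕ) :
    (x + y) ^ q ≤ 2 ^ q * (x ^ q + y ^ q) := by
  rcases le_total x y with h | h
  · calc (x + y) ^ q ≤ (2 * y) ^ q := by gcongr; rw [two_mul]; gcongr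
      _ = 2 ^ q * y ^ q := mul_pow _ _ _
      _ ≤ _ := by gcongr; exact le_add_self
  · calc (x + y) ^ q ≤ (2 * x) ^ q := by gcongr; rw [two_mul]; gcongr
      _ = 2 ^ q * x ^ q := mul_pow _ _ _
      _ ≤ _ := by gcongr; exact le_self_add

/-- Moments of a sum of independent nonnegative variables are controlled by the sums of the
moments. -/
lemma exists_lintegral_sum_pow_le (q : ℕ) (D : NNReal) : ∃ D' : NNReal, ∀ (M : ℕ)
    (Z : ℕ → Ω → ENNReal), (∀ j, Measurable (Z j)) → iIndepFun Z P →
    (∀ k, 1 ≤ k → k ≤ q → ∑ j ∈ Finset.range M, ∫⁻ ω, Z j ω ^ k ∂P ≤ D) →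
    ∫⁻ ω, (∑ j ∈ Finset.range M, Z j ω) ^ q ∂P ≤ D' := by
  induction q with
  | zero => exact ⟨1, fun M Z _ _ _ => by simp⟩
  | succ q ih =>
    obtain ⟨D', hD'⟩ := ih
    refine ⟨2 ^ q * (D + D * D'), fun M Z hZ hind hk => ?_⟩
    have hq := hD' M Z hZ hind fun k h1 h2 => hk k h1 (h2.trans q.le_succ)
    set S : Ω → ENNReal := fun ω => ∑ j ∈ Finset.range M, Z j ω with hS
    set R : ℕ → Ω → ENNReal := fun j => ∑ k ∈ (Finset.range M).erase j, Z k with hR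
    have hRm : ∀ j, Measurable (R j) := fun j => by
      simp only [hR]; fun_prop
    have hSR : ∀ j ∈ Finset.range M, ∀ ω, S ω = Z j ω + R j ω := fun j hj ω => by
      simp only [hS, hR, Finset.sum_apply]
      rw [Finset.add_sum_erase _ (fun k => Z k ω) hj]
    have hRS : ∀ j ω, R j ω ≤ S ω := fun j ω => by
      simp only [hS, hR, Finset.sum_apply]
      exact Finset.sum_le_sum_of_subset (Finset.erase_subset _ _)
    -- Induction on the exponent through `S ^ (q+1) = ∑ Z_j S ^ q` and `S = Z_j + R_j`. The sum
    -- `R_j` of the other variables is independent of `Z_j` and at most `S`, so its `q`-th moment is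
    -- covered by the induction hypothesis.
    have hterm : ∀ j ∈ Finset.range M, ∫⁻ ω, Z j ω * S ω ^ q ∂P ≤
        2 ^ q * (∫⁻ ω, Z j ω ^ (q + 1) ∂P + (∫⁻ ω, Z j ω ^ 1 ∂P) * D') := by
      intro j hj
      have hi : IndepFun (Z j) (R j) P :=
        (hind.indepFun_finsetSum_of_notMem hZ (Finset.notMem_erase j _)).symm
      have hi' : IndepFun (Z j) (fun ω => R j ω ^ q) P :=
        hi.comp measurable_id (measurable_id.pow_const q)
      calc ∫⁻ ω, Z j ω * S ω ^ q ∂P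
          ≤ ∫⁻ ω, 2 ^ q * (Z j ω ^ (q + 1) + Z j ω * R j ω ^ q) ∂P := by
            refine lintegral_mono fun ω => ?_
            rw [hSR j hj ω]
            calc Z j ω * (Z j ω + R j ω) ^ q
                ≤ Z j ω * (2 ^ q * (Z j ω ^ q + R j ω ^ q)) := by
                  gcongr; exact ENNReal.add_pow_le_two_pow_mul _ _ _
              _ = _ := by ring
        _ = 2 ^ q * (∫⁻ ω, Z j ω ^ (q + 1) ∂P + ∫⁻ ω, Z j ω * R j ω ^ q ∂P) := by
            have m1 : Measurable fun ω => Z j ω ^ (q + 1) := (hZ j).pow_const _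
            have m2 : Measurable fun ω => Z j ω ^ (q + 1) + Z j ω * R j ω ^ q :=
              m1.add ((hZ j).mul ((hRm j).pow_const q))
            rw [lintegral_const_mul _ m2, lintegral_add_left m1]
        _ = 2 ^ q * (∫⁻ ω, Z j ω ^ (q + 1) ∂P +
              (∫⁻ ω, Z j ω ∂P) * ∫⁻ ω, R j ω ^ q ∂P) := by
            have := lintegral_mul_eq_lintegral_mul_lintegral_of_indepFun (hZ j)
              ((hRm j).pow_const q) hi'
            simp only [Pi.mul_apply] at this
            rw [this]
        _ ≤ _ := by
            simp only [pow_one]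
            gcongr
            exact (lintegral_mono fun ω => by gcongr; exact hRS j ω).trans hq
    calc ∫⁻ ω, S ω ^ (q + 1) ∂P = ∫⁻ ω, ∑ j ∈ Finset.range M, Z j ω * S ω ^ q ∂P := by
          refine lintegral_congr fun ω => ?_
          rw [← Finset.sum_mul, pow_succ']
      _ = ∑ j ∈ Finset.range M, ∫⁻ ω, Z j ω * S ω ^ q ∂P :=
          lintegral_finsetSum _ fun j _ => (hZ j).mul
            ((Finset.measurable_fun_sum _ fun k _ => hZ k).pow_const q)
      _ ≤ ∑ j ∈ Finset.range M,
          2 ^ q * (∫⁻ ω, Z j ω ^ (q + 1) ∂P + (∫⁻ ω, Z j ω ^ 1 ∂P) * D') :=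
          Finset.sum_le_sum hterm
      _ = 2 ^ q * (∑ j ∈ Finset.range M, ∫⁻ ω, Z j ω ^ (q + 1) ∂P +
          (∑ j ∈ Finset.range M, ∫⁻ ω, Z j ω ^ 1 ∂P) * D') := by
          rw [← Finset.mul_sum, Finset.sum_add_distrib, Finset.sum_mul]
      _ ≤ 2 ^ q * (D + D * D') := by
          gcongr
          · exact hk (q + 1) (by omega) le_rfl
          · exact hk 1 le_rfl (by omega)
      _ = _ := by push_cast; rfl

/-- Exponential tail bound for a sum of independent bounded nonnegative variables. -/
lemma measure_sum_nonneg_ge_le {Z : ℕ → Ω → ℝ} (hZ : ∀ j, Measurable (Z j)) (hind : iIndepFun Z P)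
    {M : ℕ} {Q θ D : ℝ} (h0 : ∀ j ω, 0 ≤ Z j ω) (hQ : ∀ j ω, Z j ω ≤ Q) (hθ : 0 ≤ θ)
    (hθQ : θ * Q ≤ 1) (hD : ∑ j ∈ Finset.range M, ∫ ω, Z j ω ∂P ≤ D) (x : ℝ) :
    P.real {ω | x ≤ ∑ j ∈ Finset.range M, Z j ω} ≤ Real.exp (2 * θ * D - θ * x) := by
  have hb : ∀ j ω, |Z j ω| ≤ Q := fun j ω => by rw [abs_of_nonneg (h0 j ω)]; exact hQ j ω
  have hmgf : ∀ j, mgf (Z j) P θ ≤ Real.exp (2 * θ * ∫ ω, Z j ω ∂P) := by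
    intro j
    have hi : Integrable (Z j) P := integrable_of_abs_le (hZ j) (hb j)
    have hle : ∀ ω, θ * Z j ω ≤ 1 := fun ω =>
      (mul_le_mul_of_nonneg_left (hQ j ω) hθ).trans hθQ
    calc mgf (Z j) P θ ≤ ∫ ω, (1 + 2 * θ * Z j ω) ∂P := by
          refine integral_mono (integrable_of_abs_le (by have := hZ j; fun_prop)
            (C := Real.exp 1) fun ω => ?_) ((integrable_const 1).add (hi.const_mul _)) fun ω => ?_
          · rw [abs_of_pos (Real.exp_pos _)]
            exact Real.exp_le_exp.2 (hle ω)
          -- For `0 ≤ y ≤ 1` the bound `1 + y + y²` is at most `1 + 2y`, so for nonnegative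
          -- variables the mean alone controls the exponential moment.
          · have h1 : 0 ≤ θ * Z j ω := mul_nonneg hθ (h0 j ω)
            have := exp_le_one_add_add_sq (abs_le.2 ⟨by linarith, hle ω⟩)
            have := hle ω
            change Real.exp (θ * Z j ω) ≤ 1 + 2 * θ * Z j ω
            nlinarith
      _ = 1 + 2 * θ * ∫ ω, Z j ω ∂P := by
          rw [integral_add (integrable_const 1) (hi.const_mul _), integral_const_mul]; simp
      _ ≤ _ := by linarith [Real.add_one_le_exp (2 * θ * ∫ ω, Z j ω ∂P)]
  have hint : Integrable (fun ω => Real.exp (θ * (∑ j ∈ Finset.range M, Z j) ω)) P := by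
    have : Measurable (∑ j ∈ Finset.range M, Z j) := by fun_prop
    refine integrable_of_abs_le (by fun_prop) (C := Real.exp (θ * (M * Q))) fun ω => ?_
    rw [abs_of_pos (Real.exp_pos _)]
    refine Real.exp_le_exp.2 (mul_le_mul_of_nonneg_left ?_ hθ)
    rw [Finset.sum_apply]
    exact (Finset.sum_le_sum fun j _ => hQ j ω).trans (by simp)
  have hset : {ω | x ≤ ∑ j ∈ Finset.range M, Z j ω}
      = {ω | x ≤ (∑ j ∈ Finset.range M, Z j) ω} := by ext ω; simp
  rw [hset]
  refine (measure_ge_le_exp_mul_mgf x hθ hint).trans ?_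
  rw [hind.mgf_sum hZ]
  calc Real.exp (-θ * x) * ∏ j ∈ Finset.range M, mgf (Z j) P θ
      ≤ Real.exp (-θ * x) * ∏ j ∈ Finset.range M, Real.exp (2 * θ * ∫ ω, Z j ω ∂P) := by
        refine mul_le_mul_of_nonneg_left (Finset.prod_le_prod (fun j _ => mgf_nonneg)
          fun j _ => hmgf j) (Real.exp_pos _).le
    _ = Real.exp (-θ * x + 2 * θ * ∑ j ∈ Finset.range M, ∫ ω, Z j ω ∂P) := by
        rw [← Real.exp_sum, ← Real.exp_add, ← Finset.mul_sum]
    _ ≤ _ := by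
        refine Real.exp_le_exp.2 ?_
        have := mul_le_mul_of_nonneg_left hD (by linarith : 0 ≤ 2 * θ)
        linarith

/-- Variables with bounded `p`-th moments exceed the thresholds `w ^ α` only finitely often. -/
lemma ae_finite_exceedance {ι : Type*} [Countable ι] {Z : ι → Ω → ℝ} {w : ι → ℝ} {α p D : ℝ}
    (hw : ∀ i, 0 < w i) (hp : 0 < p) (h0 : ∀ i ω, 0 ≤ Z i ω)
    (hint : ∀ i, Integrable (fun ω => Z i ω ^ p) P) (hD : ∀ i, ∫ ω, Z i ω ^ p ∂P ≤ D)
    (hs : Summable fun i => w i ^ (-(α * p))) :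
    ∀ᵐ ω ∂P, {i | w i ^ α < Z i ω}.Finite := by
  -- Markov's inequality for the `p`-th power; the summable bound then feeds Borel–Cantelli over the
  -- whole index set.
  have hle : ∀ i, P {ω | w i ^ α < Z i ω} ≤ ENNReal.ofReal (D * w i ^ (-(α * p))) := by
    intro i
    have hwp : 0 < w i ^ (α * p) := Real.rpow_pos_of_pos (hw i) _
    have hsub : {ω | w i ^ α < Z i ω} ⊆ {ω | w i ^ (α * p) ≤ Z i ω ^ p} := by
      intro ω hω
      have : w i ^ α ≤ Z i ω := le_of_lt hω
      rw [mem_ofPred_eq, Real.rpow_mul (hw i).le]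
      exact Real.rpow_le_rpow (Real.rpow_nonneg (hw i).le _) this hp.le
    have hM := mul_meas_ge_le_integral_of_nonneg
      (ae_of_all P fun ω => Real.rpow_nonneg (h0 i ω) p) (hint i) (w i ^ (α * p))
    rw [← ofReal_measureReal]
    refine ENNReal.ofReal_le_ofReal ((measureReal_mono hsub).trans ?_)
    rw [Real.rpow_neg (hw i).le, ← div_eq_mul_inv, le_div_iff₀ hwp, mul_comm]
    exact hM.trans (hD i)
  have := ae_finite_setOfPred_mem (μ := P) (s := fun i => {ω | w i ^ α < Z i ω}) <|
    ((ENNReal.tsum_le_tsum hle).trans_lt (lt_top_iff_ne_top.2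
      (hs.mul_left D).tsum_ofReal_ne_top)).ne
  exact this

end Sums

/-! ## Local averages on one curve -/

/-- Nonnegative functions bounded by `c / h` with mean at most `c`. -/
def Window (τ : Measure ℝ) (c h : ℝ) : Set (ℝ → ℝ) :=
  {φ | Measurable φ ∧ (∀ x, 0 ≤ φ x) ∧ (∀ x, φ x ≤ c / h) ∧ ∫ x, φ x ∂τ ≤ c}

section Window

variable {τ : Measure ℝ} [IsFiniteMeasure τ] {c h : ℝ} {φ : ℝ → ℝ}

lemma Window.integrable (hφ : φ ∈ Window τ c h) : Integrable φ τ :=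
  Integrable.of_bound hφ.1.aestronglyMeasurable (c / h)
    (ae_of_all _ fun x => by rw [Real.norm_of_nonneg (hφ.2.1 x)]; exact hφ.2.2.1 x)

lemma Window.nonneg_const (hφ : φ ∈ Window τ c h) : 0 ≤ c :=
  (integral_nonneg hφ.2.1).trans hφ.2.2.2

/-- Each power beyond the first costs a factor `c / h`. Against the factor `1 / M` of an average
over `M` observations this is `c / (M h)`, which stays bounded when `M h` is bounded below. -/
lemma Window.integral_pow_succ_le (hφ : φ ∈ Window τ c h) (k : ℕ) :
    Integrable (fun x => φ x ^ (k + 1)) τ ∧ ∫ x, φ x ^ (k + 1) ∂τ ≤ (c / h) ^ k * c := by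
  have hle : ∀ x, φ x ^ (k + 1) ≤ (c / h) ^ k * φ x := fun x => by
    rw [pow_succ]
    exact mul_le_mul_of_nonneg_right (pow_le_pow_left₀ (hφ.2.1 x) (hφ.2.2.1 x) k) (hφ.2.1 x)
  have hi : Integrable (fun x => φ x ^ (k + 1)) τ :=
    ((Window.integrable hφ).const_mul ((c / h) ^ k)).mono'
      (hφ.1.pow_const _).aestronglyMeasurable (ae_of_all _ fun x => by
        rw [Real.norm_of_nonneg (pow_nonneg (hφ.2.1 x) _)]; exact hle x)
  refine ⟨hi, (integral_mono hi ((Window.integrable hφ).const_mul _) hle).trans ?_⟩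
  rw [integral_const_mul]
  refine mul_le_mul_of_nonneg_left hφ.2.2.2 (pow_nonneg ?_ k)
  exact (hφ.2.1 0).trans (hφ.2.2.1 0)

end Window

section LocalAvg

variable {Ω S : Type*} [MeasurableSpace Ω] [MeasurableSpace S]
  {P : Measure Ω} [IsProbabilityMeasure P] {ν : Measure S} [IsProbabilityMeasure ν]
  {a b σ : ℝ} {f : ℝ → ℝ} {X : S → ℝ → ℝ} {ξ : ℕ → Ω → S} {T U : ℕ → ℕ → Ω → ℝ}

/-- The average over one curve of a function of the error times a function of the time. -/
noncomputable def localAvg (T U : ℕ → ℕ → Ω → ℝ) (V φ : ℝ → ℝ) (M i : ℕ) (ω : Ω) : ℝ :=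
  (M : ℝ)⁻¹ * ∑ j ∈ Finset.range M, V (U i j ω) * φ (T i j ω)

lemma localAvg_nonneg {V φ : ℝ → ℝ} (hV : ∀ u, 0 ≤ V u) (hφ : ∀ x, 0 ≤ φ x) (M i : ℕ) (ω : Ω) :
    0 ≤ localAvg T U V φ M i ω :=
  mul_nonneg (by positivity) (Finset.sum_nonneg fun _ _ => mul_nonneg (hV _) (hφ _))

variable (h : ObservationModel P ν a b σ f X ξ T U)
include h

namespace FunctionalData.ObservationModel

lemma measurable_localAvg {V φ : ℝ → ℝ} (hV : Measurable V) (hφ : Measurable φ) (M i : ℕ) :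
    Measurable (localAvg T U V φ M i) :=
  Measurable.const_mul (Finset.measurable_fun_sum _ fun j _ =>
    (hV.comp (h.measurable_error i j)).mul (hφ.comp (h.measurable_time i j))) _

lemma indepFun_error_time (i j : ℕ) : IndepFun (U i j) (T i j) P :=
  h.indepFun_of_blocks (A := {Sum.inr (Sum.inr (i, j))}) (B := {Sum.inr (Sum.inl (i, j))})
    (by simp) (measurable_error_of_mem rfl) (measurable_time_of_mem rfl)

lemma iIndepFun_error_time (i : ℕ) : iIndepFun (fun j ω => (U i j ω, T i j ω)) P := by
  refine h.iIndepFun_of_blocks (B := fun j => {Sum.inr (Sum.inr (i, j)), Sum.inr (Sum.inl (i, j))})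
    ?_ fun j => ?_
  · intro j j' hjj
    simp [Function.onFun, hjj.symm]
  · exact Measurable.prodMk (measurable_error_of_mem (by simp)) (measurable_time_of_mem (by simp))

lemma integral_error_mul_time {V φ : ℝ → ℝ} (hV : Measurable V) (hφ : Measurable φ) (i j : ℕ) :
    ∫ ω, V (U i j ω) * φ (T i j ω) ∂P =
      (∫ u, V u ∂(errorLaw P U)) * ∫ x, φ x ∂(timeLaw P T) := by
  have := h.isProbabilityMeasure_errorLaw
  have := h.isProbabilityMeasure_timeLaw
  have e := (indepFun_iff_map_prod_eq_prod_map_map (h.measurable_error i j).aemeasurable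
    (h.measurable_time i j).aemeasurable).1 (h.indepFun_error_time i j)
  rw [h.map_error, h.map_time] at e
  have hm : Measurable fun p : ℝ × ℝ => V p.1 * φ p.2 :=
    (hV.comp measurable_fst).mul (hφ.comp measurable_snd)
  rw [← integral_prod_mul V φ, ← e, integral_map
    ((h.measurable_error i j).prodMk (h.measurable_time i j)).aemeasurable
    hm.aestronglyMeasurable]

lemma integrable_error_mul_time {V φ : ℝ → ℝ} (hV : Integrable V (errorLaw P U))
    (hφ : Integrable φ (timeLaw P T)) (i j : ℕ) :
    Integrable (fun ω => V (U i j ω) * φ (T i j ω)) P := by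
  have := h.isProbabilityMeasure_errorLaw
  have := h.isProbabilityMeasure_timeLaw
  have e := (indepFun_iff_map_prod_eq_prod_map_map (h.measurable_error i j).aemeasurable
    (h.measurable_time i j).aemeasurable).1 (h.indepFun_error_time i j)
  rw [h.map_error, h.map_time] at e
  have := hV.mul_prod hφ
  rw [← e] at this
  exact this.comp_measurable ((h.measurable_error i j).prodMk (h.measurable_time i j))

/-- Moments of local averages. -/
lemma exists_lintegral_localAvg_pow_le {q : ℕ} {V : ℝ → ℝ} (hV : Measurable V)
    (hV0 : ∀ u, 0 ≤ V u) (hVq : Integrable (fun u => V u ^ q) (errorLaw P U)) (c : ℝ) {c₀ : ℝ}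
    (hc₀ : 0 < c₀) : ∃ D : NNReal, ∀ (bw : ℝ) (φ : ℝ → ℝ) (M i : ℕ), 0 < bw →
      φ ∈ Window (timeLaw P T) c bw → c₀ ≤ M * bw →
      ∫⁻ ω, ENNReal.ofReal (localAvg T U V φ M i ω) ^ q ∂P ≤ D := by
  have := h.isProbabilityMeasure_errorLaw
  have := h.isProbabilityMeasure_timeLaw
  set DV : ℝ := 1 + ∫ u, V u ^ q ∂(errorLaw P U) with hDV
  have hVk : ∀ k ≤ q, Integrable (fun u => V u ^ k) (errorLaw P U) ∧
      ∫ u, V u ^ k ∂(errorLaw P U) ≤ DV := by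
    intro k hk
    have hle : ∀ u, V u ^ k ≤ 1 + V u ^ q := fun u => by
      rcases le_total (V u) 1 with h1 | h1
      · have := pow_le_one₀ (n := k) (hV0 u) h1
        have := pow_nonneg (hV0 u) q
        linarith
      · have := pow_le_pow_right₀ h1 hk
        linarith
    have hi : Integrable (fun u => V u ^ k) (errorLaw P U) :=
      ((integrable_const (1 : ℝ)).add hVq).mono' (hV.pow_const k).aestronglyMeasurable
        (ae_of_all _ fun u => by
          rw [Real.norm_of_nonneg (pow_nonneg (hV0 u) k)]; exact hle u)
    refine ⟨hi, (integral_mono hi ((integrable_const (1 : ℝ)).add hVq) hle).trans ?_⟩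
    simp only [Pi.add_apply]
    rw [integral_add (integrable_const _) hVq]; simp [hDV]
  -- The moments of order `k + 1` of the `M` summands add up to at most `DV * c * (c / (M bw)) ^ k`.
  -- Since `M bw ≥ c₀`, the ratio is at most `c / c₀`; the summand `1` makes the base at least one,
  -- so the power `q` covers all smaller ones.
  obtain ⟨D', hD'⟩ := exists_lintegral_sum_pow_le (P := P) q
    (DV * (c * (1 + c / c₀) ^ q)).toNNReal
  refine ⟨D', fun bw φ M i hbw hφ hM => ?_⟩
  have hc := Window.nonneg_const hφ
  have hM0 : (0 : ℝ) < M := by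
    rcases (Nat.cast_nonneg M : (0 : ℝ) ≤ M).eq_or_lt with h0 | h0
    · rw [← h0, zero_mul] at hM; linarith
    · exact h0
  set Z : ℕ → Ω → ENNReal := fun j ω =>
    ENNReal.ofReal ((M : ℝ)⁻¹ * (V (U i j ω) * φ (T i j ω))) with hZ
  have hsum : ∀ ω, ENNReal.ofReal (localAvg T U V φ M i ω) = ∑ j ∈ Finset.range M, Z j ω := by
    intro ω
    rw [localAvg, Finset.mul_sum, ENNReal.ofReal_sum_of_nonneg]
    exact fun j _ => mul_nonneg (by positivity) (mul_nonneg (hV0 _) (hφ.2.1 _))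
  have hg : Measurable fun p : ℝ × ℝ => ENNReal.ofReal ((M : ℝ)⁻¹ * (V p.1 * φ p.2)) :=
    (((hV.comp measurable_fst).mul (hφ.1.comp measurable_snd)).const_mul _).ennreal_ofReal
  simp only [hsum]
  refine hD' M Z (fun j => hg.comp ((h.measurable_error i j).prodMk (h.measurable_time i j)))
    ((h.iIndepFun_error_time i).comp (fun _ p =>
      ENNReal.ofReal ((M : ℝ)⁻¹ * (V p.1 * φ p.2))) fun _ => hg) fun k hk1 hkq => ?_
  obtain ⟨k, rfl⟩ : ∃ k', k = k' + 1 := ⟨k - 1, by omega⟩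
  obtain ⟨hVi, hVle⟩ := hVk _ hkq
  obtain ⟨hφi, hφle⟩ := Window.integral_pow_succ_le hφ k
  have hone : ∀ j, ∫⁻ ω, Z j ω ^ (k + 1) ∂P ≤
      ENNReal.ofReal (((M : ℝ) ^ (k + 1))⁻¹ * (DV * ((c / bw) ^ k * c))) := by
    intro j
    have e : ∀ ω, Z j ω ^ (k + 1) = ENNReal.ofReal (((M : ℝ) ^ (k + 1))⁻¹ *
        (V (U i j ω) ^ (k + 1) * φ (T i j ω) ^ (k + 1))) := fun ω => by
      simp only [hZ]
      rw [← ENNReal.ofReal_pow (mul_nonneg (by positivity) (mul_nonneg (hV0 _) (hφ.2.1 _))),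
        mul_pow, mul_pow, inv_pow]
    simp only [e]
    rw [← ofReal_integral_eq_lintegral_ofReal
      ((h.integrable_error_mul_time hVi hφi i j).const_mul _) (ae_of_all _ fun ω =>
        mul_nonneg (by positivity) (mul_nonneg (pow_nonneg (hV0 _) _) (pow_nonneg (hφ.2.1 _) _)))]
    refine ENNReal.ofReal_le_ofReal ?_
    rw [integral_const_mul, h.integral_error_mul_time (hV.pow_const _) (hφ.1.pow_const _)]
    have h1 : 0 ≤ ∫ x, φ x ^ (k + 1) ∂(timeLaw P T) :=
      integral_nonneg fun x => pow_nonneg (hφ.2.1 x) _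
    have h2 : 0 ≤ DV := (integral_nonneg fun u => pow_nonneg (hV0 u) _).trans hVle
    gcongr
  refine (Finset.sum_le_sum fun j _ => hone j).trans ?_
  rw [Finset.sum_const, Finset.card_range, nsmul_eq_mul]
  have hDV0 : 0 ≤ DV := (integral_nonneg fun u => pow_nonneg (hV0 u) _).trans hVle
  have hnat : (M : ENNReal) = ENNReal.ofReal M := by simp
  rw [hnat, ← ENNReal.ofReal_mul hM0.le]
  refine ENNReal.ofReal_le_ofReal ?_
  calc (M : ℝ) * (((M : ℝ) ^ (k + 1))⁻¹ * (DV * ((c / bw) ^ k * c)))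
      = DV * (c * (c / (M * bw)) ^ k) := by
        rw [div_pow, div_pow, mul_pow, pow_succ]; field_simp
    _ ≤ DV * (c * (1 + c / c₀) ^ q) := by
        have h1 : c / (M * bw) ≤ 1 + c / c₀ := by
          have : c / (M * bw) ≤ c / c₀ := div_le_div_of_nonneg_left hc hc₀ hM
          linarith
        have h2 : 1 ≤ 1 + c / c₀ := by have := div_nonneg hc hc₀.le; linarith
        have h3 : (c / (M * bw)) ^ k ≤ (1 + c / c₀) ^ q :=
          (pow_le_pow_left₀ (by positivity) h1 k).trans (pow_le_pow_right₀ h2 (by omega))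
        gcongr

/-- Exponential tails of local averages of truncated errors. -/
lemma measure_localAvg_ge_le {V : ℝ → ℝ} (hV : Measurable V) (hV0 : ∀ u, 0 ≤ V u)
    (hVi : Integrable V (errorLaw P U)) {c bw y θ : ℝ} {φ : ℝ → ℝ} (hbw : 0 < bw)
    (hφ : φ ∈ Window (timeLaw P T) c bw) {M : ℕ} (hM : 0 < M) (hy : 0 ≤ y) (hθ : 0 ≤ θ)
    (hθy : θ * (y * c / (M * bw)) ≤ 1) (i : ℕ) (x : ℝ) :
    P.real {ω | x ≤ localAvg T U (fun u => min (V u) y) φ M i ω} ≤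
      Real.exp (2 * θ * ((∫ u, V u ∂(errorLaw P U)) * c) - θ * x) := by
  have := h.isProbabilityMeasure_errorLaw
  have := h.isProbabilityMeasure_timeLaw
  have hM0 : (0 : ℝ) < M := by exact_mod_cast hM
  have hm0 : ∀ u, 0 ≤ min (V u) y := fun u => le_min (hV0 u) hy
  have hmm : Measurable fun u => min (V u) y := hV.min measurable_const
  have hmi : Integrable (fun u => min (V u) y) (errorLaw P U) :=
    hVi.mono' hmm.aestronglyMeasurable (ae_of_all _ fun u => by
      rw [Real.norm_of_nonneg (hm0 u)]; exact min_le_left _ _)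
  have hg : Measurable fun p : ℝ × ℝ => (M : ℝ)⁻¹ * (min (V p.1) y * φ p.2) :=
    ((hmm.comp measurable_fst).mul (hφ.1.comp measurable_snd)).const_mul _
  have key := measure_sum_nonneg_ge_le (P := P)
    (Z := fun j ω => (M : ℝ)⁻¹ * (min (V (U i j ω)) y * φ (T i j ω)))
    (fun j => hg.comp ((h.measurable_error i j).prodMk (h.measurable_time i j)))
    ((h.iIndepFun_error_time i).comp (fun _ p => (M : ℝ)⁻¹ * (min (V p.1) y * φ p.2))
      fun _ => hg) (M := M) (Q := y * c / (M * bw)) (θ := θ)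
    (D := (∫ u, V u ∂(errorLaw P U)) * c)
    (fun j ω => mul_nonneg (by positivity) (mul_nonneg (hm0 _) (hφ.2.1 _))) ?_ hθ hθy ?_ x
  · simpa only [localAvg, Finset.mul_sum] using key
  · intro j ω
    calc (M : ℝ)⁻¹ * (min (V (U i j ω)) y * φ (T i j ω)) ≤ (M : ℝ)⁻¹ * (y * (c / bw)) := by
          have h1 := hφ.2.2.1 (T i j ω)
          have h2 := hφ.2.1 (T i j ω)
          have h3 := min_le_right (V (U i j ω)) y
          gcongr
      _ = y * c / (M * bw) := by field_simp
  · have hone : ∀ j ∈ Finset.range M,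
        ∫ ω, (M : ℝ)⁻¹ * (min (V (U i j ω)) y * φ (T i j ω)) ∂P ≤
        (M : ℝ)⁻¹ * ((∫ u, V u ∂(errorLaw P U)) * c) := by
      intro j _
      rw [integral_const_mul, h.integral_error_mul_time hmm hφ.1]
      have h1 : ∫ u, min (V u) y ∂(errorLaw P U) ≤ ∫ u, V u ∂(errorLaw P U) :=
        integral_mono hmi hVi fun u => min_le_left _ _
      have h2 : 0 ≤ ∫ x, φ x ∂(timeLaw P T) := integral_nonneg hφ.2.1
      have h3 : 0 ≤ ∫ u, V u ∂(errorLaw P U) := integral_nonneg hV0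
      have h4 := hφ.2.2.2
      gcongr
    refine (Finset.sum_le_sum hone).trans (le_of_eq ?_)
    rw [Finset.sum_const, Finset.card_range, nsmul_eq_mul]
    field_simp

/-- Almost surely, the errors are eventually below polynomial thresholds. -/
lemma ae_eventually_error_le {V : ℝ → ℝ} (hV : Measurable V) (hV0 : ∀ u, 0 ≤ V u) {α p : ℝ}
    (hα : 0 < α) (hp : 0 < p) (hαp : 1 < α * p)
    (hVp : Integrable (fun u => V u ^ p) (errorLaw P U)) (m : ℕ → ℕ → ℕ) :
    ∀ᵐ ω ∂P, ∀ᶠ n : ℕ in atTop, ∀ i < n, ∀ j < m n i,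
      V (U i j ω) ≤ ((n : ℝ) * m n i) ^ α := by
  have hs1 : Summable fun i : ℕ => ((i + 1 : ℕ) : ℝ) ^ (-(α * p)) :=
    (summable_nat_add_iff 1).2 (Real.summable_nat_rpow.2 (by linarith))
  have hs : Summable fun q : ℕ × ℕ =>
      (((q.1 + 1 : ℕ) : ℝ) * ((q.2 + 1 : ℕ) : ℝ)) ^ (-(α * p)) := by
    refine (hs1.mul_of_nonneg hs1 (fun i => by positivity) fun i => by positivity).congr
      fun q => ?_
    rw [Real.mul_rpow (by positivity) (by positivity)]
  -- The thresholds `((i+1)(j+1)) ^ α` do not depend on `n`, so one Borel–Cantelli argument covers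
  -- the whole array of errors. The finitely many exceptions are bounded by a constant that `n ^ α`
  -- eventually exceeds; the shifts by one keep the thresholds positive.
  have hfin := ae_finite_exceedance (P := P) (Z := fun (q : ℕ × ℕ) ω => V (U q.1 q.2 ω))
    (w := fun q : ℕ × ℕ => ((q.1 + 1 : ℕ) : ℝ) * ((q.2 + 1 : ℕ) : ℝ)) (α := α) (p := p)
    (D := ∫ u, V u ^ p ∂(errorLaw P U)) (fun q => by positivity) hp (fun q ω => hV0 _)
    (fun q => by
      rw [← h.map_error q.1 q.2] at hVp
      exact hVp.comp_measurable (h.measurable_error q.1 q.2))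
    (fun q => by
      rw [← h.map_error q.1 q.2, integral_map (h.measurable_error q.1 q.2).aemeasurable
        (hV.pow_const p).aestronglyMeasurable]) hs
  filter_upwards [hfin] with ω hω
  obtain ⟨K, hK⟩ := (hω.image fun q : ℕ × ℕ => V (U q.1 q.2 ω)).bddAbove
  have hlim : Tendsto (fun n : ℕ => (n : ℝ) ^ α) atTop atTop :=
    (tendsto_rpow_atTop hα).comp tendsto_natCast_atTop_atTop
  filter_upwards [hlim.eventually_ge_atTop K] with n hn i hi j hj
  have hin : ((i + 1 : ℕ) : ℝ) ≤ n := by exact_mod_cast hi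
  have hjm : ((j + 1 : ℕ) : ℝ) ≤ m n i := by exact_mod_cast hj
  by_cases hq : (((i + 1 : ℕ) : ℝ) * ((j + 1 : ℕ) : ℝ)) ^ α < V (U i j ω)
  · have h1 : V (U i j ω) ≤ K := hK ⟨(i, j), hq, rfl⟩
    refine (h1.trans hn).trans (Real.rpow_le_rpow (by positivity) ?_ hα.le)
    refine le_mul_of_one_le_right (by positivity) (le_trans ?_ hjm)
    push_cast; linarith [(Nat.cast_nonneg j : (0 : ℝ) ≤ j)]
  · refine (not_lt.1 hq).trans (Real.rpow_le_rpow (by positivity) ?_ hα.le)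
    gcongr

lemma ae_eventually_curve_le {V : S → ℝ} (hV : Measurable V) (hV0 : ∀ x, 0 ≤ V x) {α p : ℝ}
    (hα : 0 < α) (hp : 0 < p) (hαp : 1 < α * p) (hVp : Integrable (fun x => V x ^ p) ν) :
    ∀ᵐ ω ∂P, ∀ᶠ n : ℕ in atTop, ∀ i < n, V (ξ i ω) ≤ (n : ℝ) ^ α := by
  have hs1 : Summable fun i : ℕ => ((i + 1 : ℕ) : ℝ) ^ (-(α * p)) :=
    (summable_nat_add_iff 1).2 (Real.summable_nat_rpow.2 (by linarith))
  have hfin := ae_finite_exceedance (P := P) (Z := fun i ω => V (ξ i ω))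
    (w := fun i : ℕ => ((i + 1 : ℕ) : ℝ)) (α := α) (p := p)
    (D := ∫ x, V x ^ p ∂ν) (fun q => by positivity) hp (fun q ω => hV0 _)
    (fun i => by
      rw [← h.law_curve i] at hVp
      exact hVp.comp_measurable (h.measurable_curve i))
    (fun i => by
      rw [← h.law_curve i, integral_map (h.measurable_curve i).aemeasurable
        (hV.pow_const p).aestronglyMeasurable]) hs1
  filter_upwards [hfin] with ω hω
  obtain ⟨K, hK⟩ := (hω.image fun i : ℕ => V (ξ i ω)).bddAbove
  have hlim : Tendsto (fun n : ℕ => (n : ℝ) ^ α) atTop atTop :=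
    (tendsto_rpow_atTop hα).comp tendsto_natCast_atTop_atTop
  filter_upwards [hlim.eventually_ge_atTop K] with n hn i hi
  have hin : ((i + 1 : ℕ) : ℝ) ≤ n := by exact_mod_cast hi
  by_cases hq : ((i + 1 : ℕ) : ℝ) ^ α < V (ξ i ω)
  · have h1 : V (ξ i ω) ≤ K := hK ⟨i, hq, rfl⟩
    exact h1.trans hn
  · exact (not_lt.1 hq).trans (Real.rpow_le_rpow (by positivity) hin hα.le)

/-- Uniform almost sure bound of local averages. -/
lemma ae_localAvg_le {m : ℕ → ℕ → ℕ} {V : ℝ → ℝ} (hV : Measurable V) (hV0 : ∀ u, 0 ≤ V u)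
    (hVi : Integrable V (errorLaw P U)) {α : ℝ} (hα : 0 ≤ α) (hα1 : α ≤ 1)
    (hVα : ∀ᵐ ω ∂P, ∀ᶠ n : ℕ in atTop, ∀ i < n, ∀ j < m n i,
      V (U i j ω) ≤ ((n : ℝ) * m n i) ^ α)
    {bw : ℕ → ℝ} (hbw : ∀ n, 0 < bw n) {c₀ c₁ : ℝ} (hc₀ : 0 < c₀) (hc₁ : 0 < c₁)
    (hmh : ∀ᶠ n in atTop, ∀ i < n, c₀ ≤ m n i * bw n)
    (hh : ∀ᶠ n : ℕ in atTop, c₁ * (n : ℝ) ^ (-(1 / 2) : ℝ) ≤ bw n)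
    {Λ : ℕ → Finset (ℕ × ℕ)} {p : ℕ} (hΛ : ∀ᶠ n in atTop, ((Λ n).card : ℝ) ≤ (n : ℝ) ^ p)
    {φ : ℕ → ℕ × ℕ → ℝ → ℝ} {c : ℝ} (hc : 0 < c)
    (hφ : ∀ᶠ n in atTop, ∀ l ∈ Λ n, φ n l ∈ Window (timeLaw P T) c (bw n)) :
    ∃ C : ℝ, 0 ≤ C ∧ ∀ᵐ ω ∂P, ∀ᶠ n : ℕ in atTop, ∀ l ∈ Λ n, ∀ i < n,
      localAvg T U V (φ n l) (m n i) i ω ≤ C * ((n : ℝ) ^ (3 * α / 2) * Real.log n) := by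
  -- The largest possible summand of a local average of errors truncated at `(n m) ^ α` is `(n m) ^
  -- α c / (m bw) = c n ^ α (m bw) ^ (α-1) bw ^ (-α)`. With `m bw ≥ c₀` and `bw ≥ c₁ n ^ (-1/2)` it
  -- is at most `C₂ n ^ (3α/2)`.
  set C₂ : ℝ := c * (c₀ ^ (α - 1) * c₁ ^ (-α)) with hC₂
  have hC₂0 : 0 < C₂ := by positivity
  set E : ℝ := (∫ u, V u ∂(errorLaw P U)) * c with hE
  have hE0 : 0 ≤ E := mul_nonneg (integral_nonneg hV0) hc.le
  -- `θ` is the inverse of the bound on a summand, and `x` is chosen such that `θ x = (p + 3) log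
  -- n`: `p` for the family, one for the `n` curves, two for summability.
  set θ : ℕ → ℝ := fun n => (C₂ * (n : ℝ) ^ (3 * α / 2))⁻¹ with hθ
  set x : ℕ → ℝ := fun n => C₂ * (p + 3) * ((n : ℝ) ^ (3 * α / 2) * Real.log n) with hx
  refine ⟨C₂ * (p + 3), by positivity, ?_⟩
  have key : ∀ᵐ ω ∂P, ∀ᶠ n : ℕ in atTop, ω ∉ ⋃ l ∈ Λ n, ⋃ i ∈ Finset.range n,
      {ω | x n ≤ localAvg T U (fun u => min (V u) (((n : ℝ) * m n i) ^ α)) (φ n l) (m n i) i ω} := by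
    refine ae_eventually_of_measureReal_le
      (u := fun n : ℕ => Real.exp (2 * C₂⁻¹ * E) * ((n : ℝ) ^ 2)⁻¹)
      ((Real.summable_nat_pow_inv.2 one_lt_two).mul_left _) ?_
    filter_upwards [hΛ, hφ, hmh, hh, eventually_ge_atTop 1] with n hn hφ hmh hh hn1
    have hn0 : (0 : ℝ) < n := by positivity
    have hn1' : (1 : ℝ) ≤ n := by exact_mod_cast hn1
    have hb : ∀ l ∈ Λ n, ∀ i ∈ Finset.range n, P.real {ω | x n ≤
        localAvg T U (fun u => min (V u) (((n : ℝ) * m n i) ^ α)) (φ n l) (m n i) i ω} ≤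
        Real.exp (2 * C₂⁻¹ * E) * ((n : ℝ) ^ (p + 3))⁻¹ := by
      intro l hl i hi
      have hmh' := hmh i (Finset.mem_range.1 hi)
      have hm0 : (0 : ℝ) < m n i := by
        rcases (Nat.cast_nonneg (m n i) : (0 : ℝ) ≤ m n i).eq_or_lt with h0 | h0
        · rw [← h0, zero_mul] at hmh'; linarith
        · exact h0
      have hthr : ((n : ℝ) * m n i) ^ α * c / (m n i * bw n) ≤ C₂ * (n : ℝ) ^ (3 * α / 2) := by
        have h1 : (m n i : ℝ) ^ α / (m n i * bw n) =
            (m n i * bw n) ^ (α - 1) * (bw n) ^ (-α) := by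
          have := (hbw n)
          rw [Real.rpow_sub_one (by positivity), Real.mul_rpow hm0.le this.le,
            Real.rpow_neg this.le]
          have : bw n ^ α ≠ 0 := by positivity
          field_simp
        have h2 : (m n i * bw n) ^ (α - 1) ≤ c₀ ^ (α - 1) :=
          Real.rpow_le_rpow_of_nonpos hc₀ hmh' (by linarith)
        have h3 : (bw n) ^ (-α) ≤ c₁ ^ (-α) * (n : ℝ) ^ (α / 2) := by
          refine (Real.rpow_le_rpow_of_nonpos (by positivity) hh (by linarith)).trans
            (le_of_eq ?_)
          rw [Real.mul_rpow hc₁.le (by positivity), ← Real.rpow_mul hn0.le]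
          congr 2; ring
        calc ((n : ℝ) * m n i) ^ α * c / (m n i * bw n)
            = c * (n : ℝ) ^ α * ((m n i : ℝ) ^ α / (m n i * bw n)) := by
              rw [Real.mul_rpow hn0.le hm0.le]; ring
          _ ≤ c * (n : ℝ) ^ α * (c₀ ^ (α - 1) * (c₁ ^ (-α) * (n : ℝ) ^ (α / 2))) := by
              rw [h1]; have := hbw n; gcongr
          _ = C₂ * ((n : ℝ) ^ α * (n : ℝ) ^ (α / 2)) := by rw [hC₂]; ring
          _ = C₂ * (n : ℝ) ^ (3 * α / 2) := by
              rw [← Real.rpow_add hn0]; congr 2; ring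
      have hnp : 0 < (n : ℝ) ^ (3 * α / 2) := by positivity
      have hθ0 : 0 < θ n := by simp only [hθ]; positivity
      refine (h.measure_localAvg_ge_le hV hV0 hVi (hbw n) (hφ l hl) (M := m n i)
        (by exact_mod_cast hm0) (y := ((n : ℝ) * m n i) ^ α) (by positivity) hθ0.le ?_ i
        (x n)).trans ?_
      · refine (mul_le_mul_of_nonneg_left hthr hθ0.le).trans (le_of_eq ?_)
        exact inv_mul_cancel₀ (by positivity)
      · have e1 : θ n * x n = ((p + 3 : ℕ) : ℝ) * Real.log n := by
          simp only [hθ, hx]; push_cast; field_simp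
        have e2 : θ n ≤ C₂⁻¹ := by
          simp only [hθ]
          refine inv_anti₀ hC₂0 (le_mul_of_one_le_right hC₂0.le ?_)
          exact Real.one_le_rpow hn1' (by positivity)
        rw [Real.exp_sub, e1, ← Real.log_pow, Real.exp_log (by positivity), div_eq_mul_inv]
        refine mul_le_mul_of_nonneg_right (Real.exp_le_exp.2 ?_) (by positivity)
        gcongr
    calc P.real (⋃ l ∈ Λ n, ⋃ i ∈ Finset.range n, {ω | x n ≤
        localAvg T U (fun u => min (V u) (((n : ℝ) * m n i) ^ α)) (φ n l) (m n i) i ω})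
        ≤ ∑ l ∈ Λ n, ∑ i ∈ Finset.range n, Real.exp (2 * C₂⁻¹ * E) * ((n : ℝ) ^ (p + 3))⁻¹ :=
          (measureReal_biUnion_finset_le _ _).trans (Finset.sum_le_sum fun l hl =>
            (measureReal_biUnion_finset_le _ _).trans (Finset.sum_le_sum fun i hi => hb l hl i hi))
      _ = (Λ n).card * (n * (Real.exp (2 * C₂⁻¹ * E) * ((n : ℝ) ^ (p + 3))⁻¹)) := by simp
      _ ≤ (n : ℝ) ^ p * (n * (Real.exp (2 * C₂⁻¹ * E) * ((n : ℝ) ^ (p + 3))⁻¹)) := by gcongr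
      _ = Real.exp (2 * C₂⁻¹ * E) * ((n : ℝ) ^ 2)⁻¹ := by
          rw [pow_add, show (3 : ℕ) = 1 + 2 from rfl, pow_add]; field_simp
  filter_upwards [key, hVα] with ω hω hVω
  filter_upwards [hω, hVω, hφ] with n hn hVn hφ l hl i hi
  by_contra hcon
  push Not at hcon
  refine hn (mem_biUnion (Finset.mem_coe.2 hl) (mem_biUnion
    (Finset.mem_coe.2 (Finset.mem_range.2 hi)) ?_))
  refine le_of_lt (hcon.trans_le (le_of_eq ?_))
  unfold localAvg
  -- Eventually no error exceeds its threshold, so truncating the errors leaves the local average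
  -- unchanged.
  congr 1
  refine Finset.sum_congr rfl fun j hj => ?_
  simp only [min_eq_left (hVn i hi j (Finset.mem_range.1 hj))]

end FunctionalData.ObservationModel

end LocalAvg

/-! ## The law of large numbers with rates for finite families: dense data -/

/-- Functions of the first time that are windows of width `h`. -/
def SingleClass (τ : Measure ℝ) (h : ℕ → ℝ) (c : ℝ) (n : ℕ) : Set (ℝ × ℝ → ℝ) :=
  {g | ∃ φ ∈ Window τ c (h n), ∀ w, g w = φ w.1}

/-- Products of windows of width `h` in the two times. -/
def PairClass (τ : Measure ℝ) (h : ℕ → ℝ) (c : ℝ) (n : ℕ) : Set (ℝ × ℝ → ℝ) :=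
  {g | ∃ φ ∈ Window τ c (h n), ∃ ψ ∈ Window τ c (h n), ∀ w, g w = φ w.1 * ψ w.2}

/-- The right side is `√(n / log n)`, the truncation level for `v = 1`, and `3/8 < 1/2` leaves room
for the constant and the logarithms. The exponents are bookkept by `3/8 + 1/16 + 2/40 = 39/80` and
`2 * 39/80 + 1/40 = 1`. -/
lemma eventually_polynomial_le_sqrt (C : ℝ) : ∀ᶠ n : ℕ in atTop,
    C * ((n : ℝ) ^ (3 / 8 : ℝ) * Real.log n ^ 2) ≤ √(1 / logRatio n) := by
  have h1 : ∀ᶠ n : ℕ in atTop, Real.log n ≤ (n : ℝ) ^ (1 / 40 : ℝ) := by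
    have := (isLittleO_log_rpow_atTop (show (0 : ℝ) < 1 / 40 by norm_num)).bound one_pos
    filter_upwards [tendsto_natCast_atTop_atTop.eventually this] with n hn
    rw [one_mul, Real.norm_of_nonneg (Real.rpow_nonneg (Nat.cast_nonneg n) _)] at hn
    exact (le_abs_self _).trans hn
  have h2 : ∀ᶠ n : ℕ in atTop, |C| ≤ (n : ℝ) ^ (1 / 16 : ℝ) :=
    ((tendsto_rpow_atTop (by norm_num)).comp tendsto_natCast_atTop_atTop).eventually_ge_atTop _
  filter_upwards [h1, h2, eventually_ge_atTop 2] with n h1 h2 hn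
  have hn0 : (0 : ℝ) < n := by positivity
  have hlog : 0 < Real.log n := Real.log_pos (by exact_mod_cast hn)
  have e1 : (n : ℝ) ^ (39 / 80 : ℝ) ≤ √(1 / logRatio n) := by
    refine Real.le_sqrt_of_sq_le ?_
    rw [logRatio, one_div_div, ← Real.rpow_natCast, ← Real.rpow_mul hn0.le, le_div_iff₀ hlog]
    calc (n : ℝ) ^ ((39 / 80 : ℝ) * (2 : ℕ)) * Real.log n
        ≤ (n : ℝ) ^ ((39 / 80 : ℝ) * (2 : ℕ)) * (n : ℝ) ^ (1 / 40 : ℝ) := by gcongr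
      _ = n := by rw [← Real.rpow_add hn0]; norm_num
  calc C * ((n : ℝ) ^ (3 / 8 : ℝ) * Real.log n ^ 2)
      ≤ |C| * ((n : ℝ) ^ (3 / 8 : ℝ) * Real.log n ^ 2) :=
        mul_le_mul_of_nonneg_right (le_abs_self C) (by positivity)
    _ ≤ (n : ℝ) ^ (1 / 16 : ℝ) * ((n : ℝ) ^ (3 / 8 : ℝ) * ((n : ℝ) ^ (1 / 40 : ℝ)) ^ 2) := by
        gcongr
    _ = (n : ℝ) ^ (39 / 80 : ℝ) := by
        rw [← Real.rpow_natCast, ← Real.rpow_mul hn0.le, ← Real.rpow_add hn0,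
          ← Real.rpow_add hn0]
        norm_num
    _ ≤ _ := e1

section Dense

variable {Ω S : Type*} [MeasurableSpace Ω] [MeasurableSpace S]
  {P : Measure Ω} [IsProbabilityMeasure P] {ν : Measure S} [IsProbabilityMeasure ν]
  {a b σ : ℝ} {f : ℝ → ℝ} {X : S → ℝ → ℝ} {ξ : ℕ → Ω → S} {T U : ℕ → ℕ → Ω → ℝ}

/-- The average over one curve of the envelope `s(x) + V(u)` times a function of the time. -/
noncomputable def envelopeAvg (ξ : ℕ → Ω → S) (T U : ℕ → ℕ → Ω → ℝ) (s : S → ℝ) (V φ : ℝ → ℝ)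
    (M i : ℕ) (ω : Ω) : ℝ :=
  s (ξ i ω) * localAvg T U (fun _ => 1) φ M i ω + localAvg T U V φ M i ω

lemma envelopeAvg_eq (s : S → ℝ) (V φ : ℝ → ℝ) (M i : ℕ) (ω : Ω) :
    envelopeAvg ξ T U s V φ M i ω =
      (M : ℝ)⁻¹ * ∑ j ∈ Finset.range M, (s (ξ i ω) + V (U i j ω)) * φ (T i j ω) := by
  simp only [envelopeAvg, localAvg, add_mul, Finset.sum_add_distrib, one_mul, ← Finset.mul_sum]
  ring

lemma envelopeAvg_nonneg {s : S → ℝ} {V φ : ℝ → ℝ} (hs : ∀ x, 0 ≤ s x) (hV : ∀ u, 0 ≤ V u)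
    (hφ : ∀ x, 0 ≤ φ x) (M i : ℕ) (ω : Ω) : 0 ≤ envelopeAvg ξ T U s V φ M i ω :=
  add_nonneg (mul_nonneg (hs _) (localAvg_nonneg (fun _ => zero_le_one) hφ M i ω))
    (localAvg_nonneg hV hφ M i ω)

namespace FunctionalData.ObservationModel

variable (h : ObservationModel P ν a b σ f X ξ T U)
include h

lemma indepFun_curve_localAvg {φ : ℝ → ℝ} (hφ : Measurable φ) (M i : ℕ) :
    IndepFun (ξ i) (localAvg T U (fun _ => 1) φ M i) P := by
  refine h.indepFun_of_blocks (A := {Sum.inl i})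
    (B := range fun j => Sum.inr (Sum.inl (i, j))) (by simp) (measurable_curve_of_mem rfl) ?_
  let _ : MeasurableSpace Ω :=
    ⨆ α ∈ range fun j => (Sum.inr (Sum.inl (i, j)) : ℕ ⊕ (ℕ × ℕ ⊕ ℕ × ℕ)), sourceAlgebra ξ T U α
  have hT : ∀ j, Measurable (T i j) := fun j => measurable_time_of_mem ⟨j, rfl⟩
  exact Measurable.const_mul (Finset.measurable_fun_sum _ fun j _ =>
    measurable_const.mul (hφ.comp (hT j))) _

lemma measurable_envelopeAvg {s : S → ℝ} {V φ : ℝ → ℝ} (hs : Measurable s) (hV : Measurable V)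
    (hφ : Measurable φ) (M i : ℕ) : Measurable (envelopeAvg ξ T U s V φ M i) :=
  ((hs.comp (h.measurable_curve i)).mul (h.measurable_localAvg measurable_const hφ M i)).add
    (h.measurable_localAvg hV hφ M i)

/-- The curve factor is common to all observations on the curve and cannot be averaged out. It is
independent of the times, so the moment of its product with the average of the time weights
factorizes. -/
lemma exists_lintegral_envelopeAvg_pow_le {q : ℕ} {s : S → ℝ} (hs : Measurable s)
    (hs0 : ∀ x, 0 ≤ s x) (hsq : Integrable (fun x => s x ^ q) ν) {V : ℝ → ℝ} (hV : Measurable V)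
    (hV0 : ∀ u, 0 ≤ V u) (hVq : Integrable (fun u => V u ^ q) (errorLaw P U)) (c : ℝ) {c₀ : ℝ}
    (hc₀ : 0 < c₀) : ∃ D : NNReal, ∀ (bw : ℝ) (φ : ℝ → ℝ) (M i : ℕ), 0 < bw →
      φ ∈ Window (timeLaw P T) c bw → c₀ ≤ M * bw →
      ∫⁻ ω, ENNReal.ofReal (envelopeAvg ξ T U s V φ M i ω) ^ q ∂P ≤ D := by
  have := h.isProbabilityMeasure_errorLaw
  obtain ⟨D₁, hD₁⟩ := h.exists_lintegral_localAvg_pow_le (q := q) (V := fun _ => 1)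
    measurable_const (fun _ => zero_le_one) (integrable_const _) c hc₀
  obtain ⟨D₂, hD₂⟩ := h.exists_lintegral_localAvg_pow_le hV hV0 hVq c hc₀
  have hsfin : ∫⁻ x, ENNReal.ofReal (s x) ^ q ∂ν ≠ ⊤ := by
    have e : ∀ x, ENNReal.ofReal (s x) ^ q = ENNReal.ofReal (s x ^ q) := fun x =>
      (ENNReal.ofReal_pow (hs0 x) q).symm
    simp only [e]
    exact hsq.lintegral_lt_top.ne
  refine ⟨2 ^ q * ((∫⁻ x, ENNReal.ofReal (s x) ^ q ∂ν).toNNReal * D₁ + D₂),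
    fun bw φ M i hbw hφ hM => ?_⟩
  have m1 : Measurable fun ω => ENNReal.ofReal (s (ξ i ω)) ^ q :=
    (hs.comp (h.measurable_curve i)).ennreal_ofReal.pow_const q
  have m2 : Measurable fun ω => ENNReal.ofReal (localAvg T U (fun _ => 1) φ M i ω) ^ q :=
    (h.measurable_localAvg measurable_const hφ.1 M i).ennreal_ofReal.pow_const q
  have hind : IndepFun (fun ω => ENNReal.ofReal (s (ξ i ω)) ^ q)
      (fun ω => ENNReal.ofReal (localAvg T U (fun _ => 1) φ M i ω) ^ q) P :=
    (h.indepFun_curve_localAvg hφ.1 M i).comp (φ := fun x => ENNReal.ofReal (s x) ^ q)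
      (ψ := fun y => ENNReal.ofReal y ^ q) (hs.ennreal_ofReal.pow_const q) (by fun_prop)
  have hprod := lintegral_mul_eq_lintegral_mul_lintegral_of_indepFun m1 m2 hind
  simp only [Pi.mul_apply] at hprod
  have hmap : ∫⁻ ω, ENNReal.ofReal (s (ξ i ω)) ^ q ∂P = ∫⁻ x, ENNReal.ofReal (s x) ^ q ∂ν := by
    rw [← h.law_curve i, lintegral_map (hs.ennreal_ofReal.pow_const q) (h.measurable_curve i)]
  calc ∫⁻ ω, ENNReal.ofReal (envelopeAvg ξ T U s V φ M i ω) ^ q ∂P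
      ≤ ∫⁻ ω, 2 ^ q * (ENNReal.ofReal (s (ξ i ω)) ^ q *
          ENNReal.ofReal (localAvg T U (fun _ => 1) φ M i ω) ^ q +
          ENNReal.ofReal (localAvg T U V φ M i ω) ^ q) ∂P := by
        refine lintegral_mono fun ω => ?_
        rw [envelopeAvg, ENNReal.ofReal_add (mul_nonneg (hs0 _) (localAvg_nonneg
          (fun _ => zero_le_one) hφ.2.1 M i ω)) (localAvg_nonneg hV0 hφ.2.1 M i ω),
          ENNReal.ofReal_mul (hs0 _), ← mul_pow]
        exact ENNReal.add_pow_le_two_pow_mul _ _ _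
    _ = 2 ^ q * ((∫⁻ x, ENNReal.ofReal (s x) ^ q ∂ν) *
          (∫⁻ ω, ENNReal.ofReal (localAvg T U (fun _ => 1) φ M i ω) ^ q ∂P) +
          ∫⁻ ω, ENNReal.ofReal (localAvg T U V φ M i ω) ^ q ∂P) := by
        have m3 : Measurable fun ω => ENNReal.ofReal (localAvg T U V φ M i ω) ^ q :=
          (h.measurable_localAvg hV hφ.1 M i).ennreal_ofReal.pow_const q
        have m12 : Measurable fun ω => ENNReal.ofReal (s (ξ i ω)) ^ q *
          ENNReal.ofReal (localAvg T U (fun _ => 1) φ M i ω) ^ q := m1.mul m2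
        have m123 : Measurable fun ω => ENNReal.ofReal (s (ξ i ω)) ^ q *
          ENNReal.ofReal (localAvg T U (fun _ => 1) φ M i ω) ^ q +
          ENNReal.ofReal (localAvg T U V φ M i ω) ^ q := m12.add m3
        rw [lintegral_const_mul _ m123, lintegral_add_left m12, hprod, hmap]
    _ ≤ 2 ^ q * ((∫⁻ x, ENNReal.ofReal (s x) ^ q ∂ν) * D₁ + D₂) := by
        gcongr
        · exact hD₁ bw φ M i hbw hφ hM
        · exact hD₂ bw φ M i hbw hφ hM
    _ = _ := by
        push_cast [ENNReal.coe_toNNReal hsfin]; rfl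

/-- Uniform almost sure bound of the envelope averages. -/
lemma ae_envelopeAvg_le {m : ℕ → ℕ → ℕ} {s : S → ℝ} (hs : Measurable s) (hs0 : ∀ x, 0 ≤ s x)
    {V : ℝ → ℝ} (hV : Measurable V) (hV0 : ∀ u, 0 ≤ V u) {α p : ℝ} (hα : 0 < α) (hα1 : α ≤ 1)
    (hp : 1 ≤ p) (hαp : 1 < α * p) (hsp : Integrable (fun x => s x ^ p) ν)
    (hVp : Integrable (fun u => V u ^ p) (errorLaw P U))
    {bw : ℕ → ℝ} (hbw : ∀ n, 0 < bw n) {c₀ c₁ : ℝ} (hc₀ : 0 < c₀) (hc₁ : 0 < c₁)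
    (hmh : ∀ᶠ n in atTop, ∀ i < n, c₀ ≤ m n i * bw n)
    (hh : ∀ᶠ n : ℕ in atTop, c₁ * (n : ℝ) ^ (-(1 / 2) : ℝ) ≤ bw n)
    {Λ : ℕ → Finset (ℕ × ℕ)} {r : ℕ} (hΛ : ∀ᶠ n in atTop, ((Λ n).card : ℝ) ≤ (n : ℝ) ^ r)
    {φ : ℕ → ℕ × ℕ → ℝ → ℝ} {c : ℝ} (hc : 0 < c)
    (hφ : ∀ᶠ n in atTop, ∀ l ∈ Λ n, φ n l ∈ Window (timeLaw P T) c (bw n)) :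
    ∃ C : ℝ, 0 ≤ C ∧ ∀ᵐ ω ∂P, ∀ᶠ n : ℕ in atTop, ∀ l ∈ Λ n, ∀ i < n,
      envelopeAvg ξ T U s V (φ n l) (m n i) i ω ≤ C * ((n : ℝ) ^ (3 * α / 2) * Real.log n) := by
  have := h.isProbabilityMeasure_errorLaw
  have hVi : Integrable V (errorLaw P U) := by
    simpa using integrable_rpow_of_le hV hV0 zero_le_one hp hVp
  -- With `V = 1` the exponent `α = 0` is admissible, so the averages of the time weights alone are
  -- `O(log n)`. This leaves room for the curve factor `n ^ α`.
  obtain ⟨C₁, hC₁, h₁⟩ := h.ae_localAvg_le (m := m) (V := fun _ => 1) measurable_const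
    (fun _ => zero_le_one) (integrable_const _) le_rfl zero_le_one
    (ae_of_all _ fun ω => Eventually.of_forall fun n i _ j _ => by simp) hbw hc₀ hc₁ hmh hh hΛ
    hc hφ
  obtain ⟨C₂, hC₂, h₂⟩ := h.ae_localAvg_le hV hV0 hVi hα.le hα1
    (h.ae_eventually_error_le hV hV0 hα (by linarith) hαp hVp m) hbw hc₀ hc₁ hmh hh hΛ hc hφ
  refine ⟨C₁ + C₂, by positivity, ?_⟩
  filter_upwards [h₁, h₂, h.ae_eventually_curve_le hs hs0 hα (by linarith) hαp hsp]
    with ω h₁ h₂ h₃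
  filter_upwards [h₁, h₂, h₃, hφ, eventually_ge_atTop 1] with n h₁ h₂ h₃ hφ hn l hl i hi
  have hn1 : (1 : ℝ) ≤ n := by exact_mod_cast hn
  have e1 := h₁ l hl i hi
  have e2 := h₂ l hl i hi
  have e3 := h₃ i hi
  have e0 := localAvg_nonneg (T := T) (U := U) (fun _ => zero_le_one) (hφ l hl).2.1 (m n i) i ω
    (V := fun _ => 1)
  simp only [mul_zero, zero_div, Real.rpow_zero, one_mul] at e1
  have hlog : 0 ≤ Real.log n := Real.log_nonneg hn1
  have e4 : (n : ℝ) ^ α ≤ (n : ℝ) ^ (3 * α / 2) :=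
    Real.rpow_le_rpow_of_exponent_le hn1 (by linarith)
  have e5 : s (ξ i ω) * localAvg T U (fun _ => 1) (φ n l) (m n i) i ω ≤
      (n : ℝ) ^ (3 * α / 2) * (C₁ * Real.log n) :=
    mul_le_mul (e3.trans e4) e1 e0 (by positivity)
  unfold envelopeAvg
  linarith

end FunctionalData.ObservationModel

/-- A family law when the curve averages have bounded second moments and are eventually below the
truncation level. -/
lemma ae_family_deviation_dense (h : ObservationModel P ν a b σ f X ξ T U) {m : ℕ → ℕ → ℕ}
    (hm : ∀ n, ∀ i < n, 2 ≤ m n i) (Λ : ℕ → Finset (ℕ × ℕ)) (p : ℕ)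
    (hΛ : ∀ᶠ n in atTop, ((Λ n).card : ℝ) ≤ (n : ℝ) ^ p)
    (F : ℕ → ℕ × ℕ → (S × ℝ × ℝ) × ℝ × ℝ → ℝ) (hF : ∀ n l, Measurable (F n l))
    (hFi : ∀ᶠ n in atTop, ∀ l ∈ Λ n, Integrable (F n l) (pairLaw P ν T U))
    (D : NNReal) (G : ℕ → ℕ × ℕ → ℕ → Ω → ℝ)
    (hFG : ∀ᶠ n in atTop, ∀ l ∈ Λ n, ∀ i < n, ∀ ω,
      |pairAvg (m n i) fun j k => F n l (pairData ξ T U ω i j k)| ≤ G n l i ω)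
    (hD : ∀ᶠ n in atTop, ∀ l ∈ Λ n, ∀ i < n, ∫⁻ ω, ENNReal.ofReal (G n l i ω) ^ 2 ∂P ≤ D)
    (hG : ∀ᵐ ω ∂P, ∀ᶠ n in atTop, ∀ l ∈ Λ n, ∀ i < n, G n l i ω ≤ √(1 / logRatio n)) :
    ∀ᵐ ω ∂P, ∃ C : ℝ, ∀ᶠ n in atTop, ∀ l ∈ Λ n,
      |curveAvg n (m n) (fun i j k => F n l (pairData ξ T U ω i j k)) -
        ∫ z, F n l z ∂(pairLaw P ν T U)| ≤ C * √(logRatio n) := by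
  have key := ae_uniform_deviation (P := P) Λ p hΛ
    (fun n l i ω => pairAvg (m n i) fun j k => F n l (pairData ξ T U ω i j k))
    (fun n l i => h.measurable_pairAvg (hF n l) _ i)
    (fun n l => h.iIndepFun_pairAvg (hF n l) _) (c := D) (v := fun _ => 1) (fun _ => one_pos) ?_ ?_
  · filter_upwards [key] with ω ⟨C, hω⟩
    refine ⟨C, ?_⟩
    filter_upwards [hω, hFi, eventually_gt_atTop 0] with n hn hi hn0 l hl
    rw [h.curveAvg_sub_integral hn0 (hm n) (hF n l) (hi l hl)]
    simpa using hn l hl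
  · filter_upwards [hFG, hD] with n hFG hD l hl i hi
    set W : Ω → ℝ := fun ω => pairAvg (m n i) fun j k => F n l (pairData ξ T U ω i j k) with hW
    have hWm : Measurable W := h.measurable_pairAvg (hF n l) _ i
    have hle : ∫⁻ ω, ENNReal.ofReal (W ω ^ 2) ∂P ≤ D := by
      refine (lintegral_mono fun ω => ?_).trans (hD l hl i hi)
      have hG0 : 0 ≤ G n l i ω := (abs_nonneg _).trans (hFG l hl i hi ω)
      rw [← ENNReal.ofReal_pow hG0, ← sq_abs]
      exact ENNReal.ofReal_le_ofReal (pow_le_pow_left₀ (abs_nonneg _) (hFG l hl i hi ω) 2)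
    have hint : Integrable (fun ω => W ω ^ 2) P := by
      refine ⟨(hWm.pow_const 2).aestronglyMeasurable, ?_⟩
      rw [hasFiniteIntegral_iff_ofReal (ae_of_all _ fun ω => sq_nonneg _)]
      exact hle.trans_lt ENNReal.coe_lt_top
    refine ⟨hint, ?_⟩
    rw [integral_eq_lintegral_of_nonneg_ae (ae_of_all _ fun ω => sq_nonneg _)
      (hWm.pow_const 2).aestronglyMeasurable, mul_one]
    exact ENNReal.toReal_mono ENNReal.coe_ne_top hle
  · filter_upwards [hG] with ω hω
    -- The averages stay below the truncation level eventually, so the cutoff removes nothing and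
    -- the tail is exactly zero.
    refine ⟨0, ?_⟩
    filter_upwards [hω, hFG] with n hn hFG l hl
    rw [zero_mul, Finset.sum_eq_zero fun i hi => ?_, mul_zero]
    have hi' := Finset.mem_range.1 hi
    rw [cutoff, if_pos ((hFG l hl i hi' ω).trans (hn l hl i hi')), sub_self, abs_zero]

/-- Many observations per curve, statistics of single observations. -/
theorem familyLaw_dense_single (h : ObservationModel P ν a b σ f X ξ T U) {m : ℕ → ℕ → ℕ}
    (hm : ∀ n, ∀ i < n, 2 ≤ m n i) {s : S → ℝ} (hs : Measurable s) (hs0 : ∀ x, 0 ≤ s x)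
    {V : ℝ → ℝ} (hV : Measurable V) (hV0 : ∀ u, 0 ≤ V u) {p : ℝ} (hp : 4 < p)
    (hsp : Integrable (fun x => s x ^ p) ν) (hVp : Integrable (fun u => V u ^ p) (errorLaw P U))
    {bw : ℕ → ℝ} (hbw : ∀ n, 0 < bw n) {c₀ c₁ : ℝ} (hc₀ : 0 < c₀) (hc₁ : 0 < c₁)
    (hmh : ∀ᶠ n in atTop, ∀ i < n, c₀ ≤ m n i * bw n)
    (hh : ∀ᶠ n : ℕ in atTop, c₁ * (n : ℝ) ^ (-(1 / 2) : ℝ) ≤ bw n) :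
    FamilyLaw P ν ξ T U m (SingleClass (timeLaw P T) bw) (fun y => s y.1 + V y.2.1)
      fun n => √(logRatio n) := by
  intro Λ r hΛ F g c hF hFg
  have := h.isProbabilityMeasure_errorLaw
  have := h.isProbabilityMeasure_timeLaw
  have hp1 : (1 : ℝ) ≤ p := by linarith
  have hs1 : Integrable s ν := by simpa using integrable_rpow_of_le hs hs0 zero_le_one hp1 hsp
  have hV1 : Integrable V (errorLaw P U) := by
    simpa using integrable_rpow_of_le hV hV0 zero_le_one hp1 hVp
  have hs2 : Integrable (fun x => s x ^ 2) ν := by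
    simpa using integrable_rpow_of_le hs hs0 (q := 2) (by norm_num) (by linarith) hsp
  have hV2 : Integrable (fun u => V u ^ 2) (errorLaw P U) := by
    simpa using integrable_rpow_of_le hV hV0 (q := 2) (by norm_num) (by linarith) hVp
  -- A window is selected for every index, with a default where `g n l` lies outside the class; only
  -- finitely many rows are affected.
  have hex : ∀ n l, ∃ φ : ℝ → ℝ, g n l ∈ SingleClass (timeLaw P T) bw c n →
      φ ∈ Window (timeLaw P T) c (bw n) ∧ ∀ w, g n l w = φ w.1 := fun n l => by
    by_cases hg : g n l ∈ SingleClass (timeLaw P T) bw c n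
    · obtain ⟨φ, h1, h2⟩ := hg
      exact ⟨φ, fun _ => ⟨h1, h2⟩⟩
    · exact ⟨0, fun hg' => absurd hg' hg⟩
  choose φ hφ using hex
  have hφw : ∀ᶠ n in atTop, ∀ l ∈ Λ n, φ n l ∈ Window (timeLaw P T) (max c 1) (bw n) := by
    filter_upwards [hFg] with n hn l hl
    obtain ⟨h1, h2, h3, h4⟩ := (hφ n l (hn l hl).1).1
    refine ⟨h1, h2, fun x => (h3 x).trans ?_, h4.trans (le_max_left _ _)⟩
    have := hbw n
    gcongr
    exact le_max_left _ _
  obtain ⟨D, hD⟩ := h.exists_lintegral_envelopeAvg_pow_le hs hs0 hs2 hV hV0 hV2 (max c 1) hc₀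
  -- The choice `α = 1/4` satisfies `α p > 1` because `p > 4`, and yields averages of order `n ^
  -- (3/8) log n`, below the truncation level.
  obtain ⟨C, hC, hCb⟩ := h.ae_envelopeAvg_le (m := m) hs hs0 hV hV0 (α := 1 / 4) (p := p)
    (by norm_num) (by norm_num) hp1 (by linarith) hsp hVp hbw hc₀ hc₁ hmh hh hΛ
    (lt_max_of_lt_right one_pos) hφw
  refine ae_family_deviation_dense h hm Λ r hΛ F hF ?_ D
    (fun n l i ω => envelopeAvg ξ T U s V (φ n l) (m n i) i ω) ?_ ?_ ?_
  · filter_upwards [hFg, hφw] with n hn hw l hl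
    have hg : Integrable (g n l) ((timeLaw P T).prod (timeLaw P T)) := by
      have := (Window.integrable (hw l hl)).comp_fst (timeLaw P T)
      exact this.congr (ae_of_all _ fun w => ((hφ n l (hn l hl).1).2 w).symm)
    refine integrable_env_mul (env := fun y => s y.1 + V y.2.1) ?_ hg (hF n l) (hn l hl).2
    exact (hs1.comp_fst _).add ((hV1.comp_fst (errorLaw P U)).comp_snd ν)
  · filter_upwards [hFg] with n hn l hl i hi ω
    refine (abs_pairAvg_le _ _).trans ?_
    rw [envelopeAvg_eq, ← pairAvg_fst (hm n i hi)]
    refine pairAvg_mono fun j k => ((hn l hl).2 _).trans (le_of_eq ?_)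
    rw [(hφ n l (hn l hl).1).2]; rfl
  · filter_upwards [hφw, hmh] with n hw hmh l hl i hi
    exact hD (bw n) _ _ _ (hbw n) (hw l hl) (hmh i hi)
  · filter_upwards [hCb] with ω hω
    filter_upwards [hω, eventually_polynomial_le_sqrt C, eventually_ge_atTop 3]
      with n hn hev hn3 l hl i hi
    refine (hn l hl i hi).trans (le_trans ?_ hev)
    have hlog : 1 ≤ Real.log n := by
      rw [Real.le_log_iff_exp_le (by positivity)]
      refine Real.exp_one_lt_d9.le.trans ?_
      have : (3 : ℝ) ≤ n := by exact_mod_cast hn3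
      linarith
    rw [show (3 * (1 / 4) / 2 : ℝ) = 3 / 8 by norm_num]
    gcongr
    nlinarith

/-- Many observations per curve, statistics of pairs of observations. -/
theorem familyLaw_dense_pair (h : ObservationModel P ν a b σ f X ξ T U) {m : ℕ → ℕ → ℕ}
    (hm : ∀ n, ∀ i < n, 2 ≤ m n i) {s : S → ℝ} (hs : Measurable s) (hs0 : ∀ x, 0 ≤ s x)
    {V : ℝ → ℝ} (hV : Measurable V) (hV0 : ∀ u, 0 ≤ V u) {p : ℝ} (hp : 8 < p)
    (hsp : Integrable (fun x => s x ^ p) ν) (hVp : Integrable (fun u => V u ^ p) (errorLaw P U))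
    {bw : ℕ → ℝ} (hbw : ∀ n, 0 < bw n) {c₀ c₁ : ℝ} (hc₀ : 0 < c₀) (hc₁ : 0 < c₁)
    (hmh : ∀ᶠ n in atTop, ∀ i < n, c₀ ≤ m n i * bw n)
    (hh : ∀ᶠ n : ℕ in atTop, c₁ * (n : ℝ) ^ (-(1 / 2) : ℝ) ≤ bw n) :
    FamilyLaw P ν ξ T U m (PairClass (timeLaw P T) bw)
      (fun y => (s y.1 + V y.2.1) * (s y.1 + V y.2.2)) fun n => √(logRatio n) := by
  intro Λ r hΛ F g c hF hFg
  have := h.isProbabilityMeasure_errorLaw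
  have := h.isProbabilityMeasure_timeLaw
  have hp1 : (1 : ℝ) ≤ p := by linarith
  have hs1 : Integrable s ν := by simpa using integrable_rpow_of_le hs hs0 zero_le_one hp1 hsp
  have hV1 : Integrable V (errorLaw P U) := by
    simpa using integrable_rpow_of_le hV hV0 zero_le_one hp1 hVp
  have hs2 : Integrable (fun x => s x ^ 2) ν := by
    simpa using integrable_rpow_of_le hs hs0 (q := 2) (by norm_num) (by linarith) hsp
  have hs4 : Integrable (fun x => s x ^ 4) ν := by
    have := integrable_rpow_of_le hs hs0 (q := (4 : ℕ)) (by norm_num) (by push_cast; linarith) hsp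
    simpa only [Real.rpow_natCast] using this
  have hV4 : Integrable (fun u => V u ^ 4) (errorLaw P U) := by
    have := integrable_rpow_of_le hV hV0 (q := (4 : ℕ)) (by norm_num) (by push_cast; linarith) hVp
    simpa only [Real.rpow_natCast] using this
  have hex : ∀ n l, ∃ φ ψ : ℝ → ℝ, g n l ∈ PairClass (timeLaw P T) bw c n →
      φ ∈ Window (timeLaw P T) c (bw n) ∧ ψ ∈ Window (timeLaw P T) c (bw n) ∧
        ∀ w, g n l w = φ w.1 * ψ w.2 := fun n l => by
    by_cases hg : g n l ∈ PairClass (timeLaw P T) bw c n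
    · obtain ⟨φ, h1, ψ, h2, h3⟩ := hg
      exact ⟨φ, ψ, fun _ => ⟨h1, h2, h3⟩⟩
    · exact ⟨0, 0, fun hg' => absurd hg' hg⟩
  choose φ ψ hφψ using hex
  have hmono : ∀ {n} {φ : ℝ → ℝ}, φ ∈ Window (timeLaw P T) c (bw n) →
      φ ∈ Window (timeLaw P T) (max c 1) (bw n) := by
    rintro n φ ⟨h1, h2, h3, h4⟩
    refine ⟨h1, h2, fun x => (h3 x).trans ?_, h4.trans (le_max_left _ _)⟩
    have := hbw n
    gcongr
    exact le_max_left _ _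
  have hφw : ∀ᶠ n in atTop, ∀ l ∈ Λ n, φ n l ∈ Window (timeLaw P T) (max c 1) (bw n) := by
    filter_upwards [hFg] with n hn l hl
    exact hmono (hφψ n l (hn l hl).1).1
  have hψw : ∀ᶠ n in atTop, ∀ l ∈ Λ n, ψ n l ∈ Window (timeLaw P T) (max c 1) (bw n) := by
    filter_upwards [hFg] with n hn l hl
    exact hmono (hφψ n l (hn l hl).1).2.1
  obtain ⟨D, hD⟩ := h.exists_lintegral_envelopeAvg_pow_le hs hs0 hs4 hV hV0 hV4 (max c 1) hc₀
  -- A product of two averages is to be kept below the same level, so each may be of order `n ^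
  -- (3/16) log n` only; `α = 1/8` requires `p > 8`.
  obtain ⟨C, hC, hCb⟩ := h.ae_envelopeAvg_le (m := m) hs hs0 hV hV0 (α := 1 / 8) (p := p)
    (by norm_num) (by norm_num) hp1 (by linarith) hsp hVp hbw hc₀ hc₁ hmh hh hΛ
    (lt_max_of_lt_right one_pos) hφw
  obtain ⟨C', hC', hCb'⟩ := h.ae_envelopeAvg_le (m := m) hs hs0 hV hV0 (α := 1 / 8) (p := p)
    (by norm_num) (by norm_num) hp1 (by linarith) hsp hVp hbw hc₀ hc₁ hmh hh hΛ
    (lt_max_of_lt_right one_pos) hψw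
  refine ae_family_deviation_dense h hm Λ r hΛ F hF ?_ (4 * (D + D))
    (fun n l i ω => 2 * (envelopeAvg ξ T U s V (φ n l) (m n i) i ω *
      envelopeAvg ξ T U s V (ψ n l) (m n i) i ω)) ?_ ?_ ?_
  · filter_upwards [hFg, hφw, hψw] with n hn hw hw' l hl
    have hg : Integrable (g n l) ((timeLaw P T).prod (timeLaw P T)) := by
      have := (Window.integrable (hw l hl)).mul_prod (Window.integrable (hw' l hl))
      exact this.congr (ae_of_all _ fun w => ((hφψ n l (hn l hl).1).2.2 w).symm)
    refine integrable_env_mul (env := fun y => (s y.1 + V y.2.1) * (s y.1 + V y.2.2)) ?_ hg (hF n l)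
      (hn l hl).2
    have i1 : Integrable (fun y : S × ℝ × ℝ => s y.1 ^ 2)
      (ν.prod ((errorLaw P U).prod (errorLaw P U))) := hs2.comp_fst _
    have i2 : Integrable (fun y : S × ℝ × ℝ => s y.1 * V y.2.2)
      (ν.prod ((errorLaw P U).prod (errorLaw P U))) := hs1.mul_prod (hV1.comp_snd (errorLaw P U))
    have i3 : Integrable (fun y : S × ℝ × ℝ => s y.1 * V y.2.1)
      (ν.prod ((errorLaw P U).prod (errorLaw P U))) := hs1.mul_prod (hV1.comp_fst (errorLaw P U))
    have i4 : Integrable (fun y : S × ℝ × ℝ => V y.2.1 * V y.2.2)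
      (ν.prod ((errorLaw P U).prod (errorLaw P U))) := (hV1.mul_prod hV1).comp_snd ν
    refine (((i1.add i2).add i3).add i4).congr (ae_of_all _ fun y => ?_)
    simp only [Pi.add_apply]; ring
  · filter_upwards [hFg] with n hn l hl i hi ω
    refine (abs_pairAvg_le _ _).trans ?_
    have h2 : (2 : ℝ) ≤ m n i := by exact_mod_cast hm n i hi
    set A : ℕ → ℝ := fun j => (s (ξ i ω) + V (U i j ω)) * φ n l (T i j ω) with hA
    set B : ℕ → ℝ := fun j => (s (ξ i ω) + V (U i j ω)) * ψ n l (T i j ω) with hB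
    have hgw := hφψ n l (hn l hl).1
    have hA0 : ∀ j, 0 ≤ A j := fun j => mul_nonneg (add_nonneg (hs0 _) (hV0 _)) (hgw.1.2.1 _)
    have hB0 : ∀ j, 0 ≤ B j := fun j => mul_nonneg (add_nonneg (hs0 _) (hV0 _)) (hgw.2.1.2.1 _)
    -- Adding the diagonal terms, which are nonnegative, factorizes the double sum. The price is the
    -- factor `2`, since `m (m - 1) ≥ m² / 2` for `m ≥ 2`.
    calc pairAvg (m n i) (fun j k => |F n l (pairData ξ T U ω i j k)|)
        ≤ pairAvg (m n i) (fun j k => A j * B k) := by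
          refine pairAvg_mono fun j k => ((hn l hl).2 _).trans (le_of_eq ?_)
          rw [hgw.2.2]; simp only [hA, hB, pairData]; ring
      _ ≤ ((m n i : ℝ) * ((m n i : ℝ) - 1))⁻¹ *
          ((∑ j ∈ Finset.range (m n i), A j) * ∑ k ∈ Finset.range (m n i), B k) := by
          rw [pairAvg, Finset.sum_mul]
          refine mul_le_mul_of_nonneg_left (Finset.sum_le_sum fun j _ => ?_)
            (pair_weight_nonneg _)
          rw [← Finset.mul_sum]
          exact mul_le_mul_of_nonneg_left (Finset.sum_le_sum_of_subset_of_nonneg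
            (Finset.erase_subset _ _) fun k _ _ => hB0 k) (hA0 j)
      _ ≤ (2 * ((m n i : ℝ)⁻¹ * (m n i : ℝ)⁻¹)) *
          ((∑ j ∈ Finset.range (m n i), A j) * ∑ k ∈ Finset.range (m n i), B k) := by
          refine mul_le_mul_of_nonneg_right ?_ (mul_nonneg (Finset.sum_nonneg fun j _ => hA0 j)
            (Finset.sum_nonneg fun j _ => hB0 j))
          rw [inv_le_iff_one_le_mul₀ (by nlinarith)]
          field_simp
          linarith
      _ = _ := by rw [envelopeAvg_eq, envelopeAvg_eq]; ring
  -- The two averages share the curve and are not independent; `(2xy)² ≤ 4 (x⁴ + y⁴)` reduces the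
  -- second moment of their product to fourth moments.
  · filter_upwards [hφw, hψw, hmh] with n hw hw' hmh l hl i hi
    have hm1 : Measurable fun ω =>
        ENNReal.ofReal (envelopeAvg ξ T U s V (φ n l) (m n i) i ω) ^ 4 :=
      (h.measurable_envelopeAvg hs hV (hw l hl).1 _ i).ennreal_ofReal.pow_const 4
    have hm2 : Measurable fun ω =>
        ENNReal.ofReal (envelopeAvg ξ T U s V (ψ n l) (m n i) i ω) ^ 4 :=
      (h.measurable_envelopeAvg hs hV (hw' l hl).1 _ i).ennreal_ofReal.pow_const 4
    calc ∫⁻ ω, ENNReal.ofReal (2 * (envelopeAvg ξ T U s V (φ n l) (m n i) i ω *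
          envelopeAvg ξ T U s V (ψ n l) (m n i) i ω)) ^ 2 ∂P
        ≤ ∫⁻ ω, 4 * (ENNReal.ofReal (envelopeAvg ξ T U s V (φ n l) (m n i) i ω) ^ 4 +
            ENNReal.ofReal (envelopeAvg ξ T U s V (ψ n l) (m n i) i ω) ^ 4) ∂P := by
          refine lintegral_mono fun ω => ?_
          have p1 := envelopeAvg_nonneg (ξ := ξ) (T := T) (U := U) hs0 hV0 (hw l hl).2.1 (m n i) i ω
          have p2 := envelopeAvg_nonneg (ξ := ξ) (T := T) (U := U) hs0 hV0 (hw' l hl).2.1 (m n i) i ω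
          set x := envelopeAvg ξ T U s V (φ n l) (m n i) i ω
          set y := envelopeAvg ξ T U s V (ψ n l) (m n i) i ω
          rw [← ENNReal.ofReal_pow p1, ← ENNReal.ofReal_pow p2, ← ENNReal.ofReal_add (by positivity)
            (by positivity), ← ENNReal.ofReal_pow (by positivity),
            show (4 : ENNReal) = ENNReal.ofReal 4 by simp, ← ENNReal.ofReal_mul (by norm_num)]
          refine ENNReal.ofReal_le_ofReal ?_
          nlinarith [sq_nonneg (x ^ 2 - y ^ 2), sq_nonneg (x ^ 2), sq_nonneg (y ^ 2)]
      _ = 4 * (∫⁻ ω, ENNReal.ofReal (envelopeAvg ξ T U s V (φ n l) (m n i) i ω) ^ 4 ∂P +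
            ∫⁻ ω, ENNReal.ofReal (envelopeAvg ξ T U s V (ψ n l) (m n i) i ω) ^ 4 ∂P) := by
          have hm12 : Measurable fun ω =>
              ENNReal.ofReal (envelopeAvg ξ T U s V (φ n l) (m n i) i ω) ^ 4 +
              ENNReal.ofReal (envelopeAvg ξ T U s V (ψ n l) (m n i) i ω) ^ 4 := hm1.add hm2
          rw [lintegral_const_mul _ hm12, lintegral_add_left hm1]
      _ ≤ 4 * (D + D) := by
          gcongr
          · exact hD (bw n) _ _ _ (hbw n) (hw l hl) (hmh i hi)
          · exact hD (bw n) _ _ _ (hbw n) (hw' l hl) (hmh i hi)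
      _ = _ := by push_cast; rfl
  · filter_upwards [hCb, hCb'] with ω hω hω'
    filter_upwards [hω, hω', eventually_polynomial_le_sqrt (2 * (C * C')), hφw, hψw]
      with n hn hn' hev hw hw' l hl i hi
    refine le_trans ?_ hev
    have p1 := envelopeAvg_nonneg (ξ := ξ) (T := T) (U := U) hs0 hV0 (hw l hl).2.1 (m n i) i ω
    have p2 := envelopeAvg_nonneg (ξ := ξ) (T := T) (U := U) hs0 hV0 (hw' l hl).2.1 (m n i) i ω
    have e := mul_le_mul (hn l hl i hi) (hn' l hl i hi) p2 (p1.trans (hn l hl i hi))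
    refine (mul_le_mul_of_nonneg_left e zero_le_two).trans (le_of_eq ?_)
    have hpow : (n : ℝ) ^ (3 * (1 / 8) / 2 : ℝ) * (n : ℝ) ^ (3 * (1 / 8) / 2 : ℝ) =
        (n : ℝ) ^ (3 / 8 : ℝ) := by
      rw [← Real.rpow_add_of_nonneg (Nat.cast_nonneg n) (by norm_num) (by norm_num)]
      norm_num
    rw [← hpow]; ring

end Dense

/-! ## The kernel -/

section Kernel

/-- `f` has increments dominated by those of the monotone function `G`, with `0 ≤ G ≤ V`. -/
structure MonotoneControl (f G : ℝ → ℝ) (V : ℝ) : Prop where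
  nonneg : ∀ x, 0 ≤ G x
  le : ∀ x, G x ≤ V
  abs_sub_le : ∀ x y, x ≤ y → |f y - f x| ≤ G y - G x

namespace MonotoneControl

variable {f G : ℝ → ℝ} {V : ℝ} (h : MonotoneControl f G V)
include h

lemma monotone : Monotone G := fun x y hxy => by
  linarith [abs_nonneg (f y - f x), h.abs_sub_le x y hxy]

lemma bound_nonneg : 0 ≤ V := (h.nonneg 0).trans (h.le 0)

/-- Both `G` and `G - f` are monotone, so `f` is a difference of monotone functions. -/
lemma measurable : Measurable f := by
  have h1 : Monotone fun x => G x - f x := fun x y hxy => by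
    have := (abs_le.1 (h.abs_sub_le x y hxy)).2
    dsimp only
    linarith
  have : f = fun x => G x - (G x - f x) := by ext x; ring
  rw [this]
  exact h.monotone.measurable.sub h1.measurable

lemma scale {bw : ℝ} (hbw : 0 < bw) : MonotoneControl (fun x => f (x / bw)) (fun x => G (x / bw)) V :=
  ⟨fun x => h.nonneg _, fun x => h.le _, fun x y hxy => h.abs_sub_le _ _ (by gcongr)⟩

lemma intervalIntegrable_comp_sub (c x y : ℝ) :
    IntervalIntegrable (fun u => G (u - c)) volume x y :=
  (h.monotone.comp (fun _ _ huv => sub_le_sub_right huv c)).intervalIntegrable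

/-- The mean increment of the control over a shift `η` is at most `η V`. -/
lemma integral_shift_le {a b : ℝ} (hab : a ≤ b) {s t : ℝ} (hst : s ≤ t) :
    ∫ x in Icc a b, (G (x - s) - G (x - t)) ≤ (t - s) * V := by
  rw [integral_Icc_eq_integral_Ioc, ← intervalIntegral.integral_of_le hab,
    intervalIntegral.integral_sub (h.intervalIntegrable_comp_sub s a b)
      (h.intervalIntegrable_comp_sub t a b),
    intervalIntegral.integral_comp_sub_right G, intervalIntegral.integral_comp_sub_right G]
  have hi : ∀ x y, IntervalIntegrable G volume x y := fun x y => h.monotone.intervalIntegrable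
  -- The two translated intervals overlap; after cancellation only end pieces of length `t - s` are
  -- left, and the one entering with a minus sign is nonnegative.
  rw [intervalIntegral.integral_interval_sub_interval_comm' (hi _ _) (hi _ _) (hi _ _)]
  have h1 : ∫ x in (b - t)..(b - s), G x ≤ (t - s) * V := by
    refine (intervalIntegral.integral_mono_on (g := fun _ => V) (by linarith) (hi _ _)
      intervalIntegrable_const fun x _ => h.le x).trans (le_of_eq ?_)
    rw [intervalIntegral.integral_const, smul_eq_mul]; ring
  have h2 : 0 ≤ ∫ x in (a - t)..(a - s), G x :=
    intervalIntegral.integral_nonneg (by linarith) fun x _ => h.nonneg x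
  linarith

end MonotoneControl

variable {K : ℝ → ℝ}

lemma kernel_bounded (hK : KernelCond K) : ∃ B : ℝ, 0 < B ∧ ∀ u, K u ≤ B := by
  refine ⟨K 0 + (eVariationOn K (Icc (-1) 1)).toReal + 1, ?_, fun u => ?_⟩
  · have := hK.nonneg 0
    have : 0 ≤ (eVariationOn K (Icc (-1) 1)).toReal := ENNReal.toReal_nonneg
    linarith
  · have h0 := hK.nonneg 0
    have h1 : 0 ≤ (eVariationOn K (Icc (-1) 1)).toReal := ENNReal.toReal_nonneg
    by_cases hu : u ∈ Icc (-1 : ℝ) 1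
    · have := hK.boundedVariation.sub_le hu (show (0 : ℝ) ∈ Icc (-1 : ℝ) 1 by constructor <;> norm_num)
      linarith
    · rw [hK.support u hu]; linarith

/-- The functions `K(u) u ^ p` have increments dominated by those of a bounded monotone function. -/
lemma exists_monotoneControl (hK : KernelCond K) (p : ℕ) :
    ∃ G V, MonotoneControl (fun u => K u * u ^ p) G V := by
  obtain ⟨B, hB, hKB⟩ := kernel_bounded hK
  set I : Set ℝ := Icc (-1) 1 with hI
  have hm1 : (-1 : ℝ) ∈ I := by constructor <;> norm_num
  set v : ℝ → ℝ := variationOnFromTo K I (-1) with hv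
  have hloc := hK.boundedVariation.locallyBoundedVariationOn
  have hinc : ∀ x ∈ I, ∀ y ∈ I, x ≤ y → |K y - K x| ≤ v y - v x := fun x hx y hy hxy =>
    variationOnFromTo.abs_sub_le_sub_of_le hloc hm1 hx hy hxy
  set E := (eVariationOn K I).toReal with hE
  set c : ℝ → ℝ := fun x => max (-1) (min x 1) with hc
  have hcI : ∀ x, c x ∈ I := fun x => ⟨le_max_left _ _, max_le (by norm_num) (min_le_right _ _)⟩
  have hcm : Monotone c := fun x y hxy => max_le_max le_rfl (min_le_min hxy le_rfl)
  have hcid : ∀ x ∈ I, c x = x := fun x hx => by simp [hc, hx.1, hx.2]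
  -- Inside `[-1,1]` the increment of `K(u) u ^ p` has two sources: the variation of `K`, and `B`
  -- times the increment of `u ^ p`, which is at most `p` times the distance. Clamping the argument
  -- makes `w` constant off the interval.
  set w : ℝ → ℝ := fun x => v (c x) + B * p * (c x + 1) with hw
  have hv0 : ∀ x ∈ I, 0 ≤ v x := fun x hx => variationOnFromTo.nonneg_of_le K I hx.1
  have hvE : ∀ x, v x ≤ E := fun x =>
    (le_abs_self _).trans (variationOnFromTo.abs_le_eVariationOn hK.boundedVariation)
  have hwm : ∀ x y, x ≤ y → w x ≤ w y := fun x y hxy => by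
    have h1 := hinc (c x) (hcI x) (c y) (hcI y) (hcm hxy)
    have h2 : B * p * (c x + 1) ≤ B * p * (c y + 1) := by gcongr; exact hcm hxy
    have := abs_nonneg (K (c y) - K (c x))
    simp only [hw]; linarith
  have hκ : ∀ x, |K x * x ^ p| ≤ B := fun x => by
    by_cases hx : x ∈ I
    · rw [abs_mul, abs_of_nonneg (hK.nonneg x), abs_pow]
      have h1 : |x| ^ p ≤ 1 := pow_le_one₀ (abs_nonneg x) (abs_le.2 hx)
      calc K x * |x| ^ p ≤ B * 1 := by gcongr; exact hKB x
        _ = B := mul_one B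
    · rw [hK.support x hx]; simpa using hB.le
  -- The kernel may jump at the ends of its support, so `J` adds the bound `B` on entering and on
  -- leaving. The left inequality is weak and the right one strict because both end points belong to
  -- the support interval.
  set J : ℝ → ℝ := fun x => (if -1 ≤ x then B else 0) + (if 1 < x then B else 0) with hJ
  refine ⟨fun x => w x + J x, E + B * p * 2 + 2 * B, ⟨fun x => ?_, fun x => ?_, ?_⟩⟩
  · have h1 : 0 ≤ w x := add_nonneg (hv0 _ (hcI x))
      (mul_nonneg (by positivity) (by linarith [(hcI x).1]))
    have h2 : 0 ≤ J x := by simp only [hJ]; split_ifs <;> simp <;> positivity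
    exact add_nonneg h1 h2
  · have h1 : w x ≤ E + B * p * 2 := by
      refine add_le_add (hvE _) ?_
      gcongr
      linarith [(hcI x).2]
    have h2 : J x ≤ 2 * B := by simp only [hJ]; split_ifs <;> linarith
    linarith
  · intro x y hxy
    have h1 := hwm x y hxy
    by_cases hx : x ∈ I
    · by_cases hy : y ∈ I
      · have e : J y = J x := by simp only [hJ, hx.1, hy.1, not_lt.2 hx.2, not_lt.2 hy.2]
        have h2 := hinc x hx y hy hxy
        have h3 : |y ^ p - x ^ p| ≤ p * (y - x) := by
          refine (abs_pow_sub_pow_le y x p).trans ?_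
          rw [abs_of_nonneg (sub_nonneg.2 hxy), mul_comm (y - x)]
          refine mul_le_of_le_one_right (mul_nonneg (Nat.cast_nonneg p) (sub_nonneg.2 hxy)) ?_
          exact pow_le_one₀ (le_max_of_le_left (abs_nonneg y)) (max_le (abs_le.2 hy) (abs_le.2 hx))
        have h4 : K y * y ^ p - K x * x ^ p = (K y - K x) * y ^ p + K x * (y ^ p - x ^ p) := by ring
        have h5 : |(K y - K x) * y ^ p| ≤ v y - v x := by
          rw [abs_mul, abs_pow]
          exact (mul_le_of_le_one_right (abs_nonneg _)
            (pow_le_one₀ (abs_nonneg y) (abs_le.2 hy))).trans h2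
        have h6 : |K x * (y ^ p - x ^ p)| ≤ B * (p * (y - x)) := by
          rw [abs_mul, abs_of_nonneg (hK.nonneg x)]
          gcongr
          exact hKB x
        rw [h4]
        refine (abs_add_le _ _).trans ?_
        simp only [hw, hcid x hx, hcid y hy, e]
        linarith
      · have hy1 : 1 < y := by
          by_contra hcon
          exact hy ⟨hx.1.trans hxy, not_lt.1 hcon⟩
        have e : J y - J x = B := by
          simp [hJ, hx.1, hx.1.trans hxy, not_lt.2 hx.2, hy1]
        rw [hK.support y hy, zero_mul, zero_sub, abs_neg]
        have := hκ x
        linarith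
    · rcases lt_or_ge x (-1) with hx1 | hx1
      · rw [hK.support x hx, zero_mul, sub_zero]
        have e0 : J x = 0 := by simp [hJ, not_le.2 hx1, not_lt.2 (show x ≤ 1 by linarith)]
        rcases lt_or_ge y (-1) with hy1 | hy1
        · rw [hK.support y (fun hy => absurd hy.1 (not_le.2 hy1))]
          have e1 : J y = 0 := by simp [hJ, not_le.2 hy1, not_lt.2 (show y ≤ 1 by linarith)]
          simp only [zero_mul, abs_zero]; linarith
        · have e1 : B ≤ J y := by
            simp only [hJ, hy1, if_true]; split_ifs <;> linarith
          have := hκ y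
          linarith
      · have hx2 : 1 < x := by
          by_contra hcon
          exact hx ⟨hx1, not_lt.1 hcon⟩
        have hy2 : 1 < y := hx2.trans_le hxy
        rw [hK.support x hx, hK.support y (fun hy => absurd hy.2 (not_le.2 hy2))]
        have e : J y = J x := by
          simp [hJ, hx1, hx1.trans hxy, hx2, hy2]
        simp only [zero_mul, sub_zero, abs_zero, e]; linarith

lemma measurable_kernel (hK : KernelCond K) : Measurable K := by
  obtain ⟨G, V, hG⟩ := exists_monotoneControl hK 0
  simpa using hG.measurable

/-- `K_h(u) (u / h) ^ p`. -/
noncomputable def scaledMoment (K : ℝ → ℝ) (h : ℝ) (p : ℕ) (u : ℝ) : ℝ :=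
  scaledKernel K h u * (u / h) ^ p

lemma measurable_scaledKernel (hK : KernelCond K) (h : ℝ) : Measurable (scaledKernel K h) :=
  ((measurable_kernel hK).comp (measurable_id.div_const h)).const_mul _

lemma measurable_scaledMoment (hK : KernelCond K) (h : ℝ) (p : ℕ) :
    Measurable (scaledMoment K h p) :=
  (measurable_scaledKernel hK h).mul ((measurable_id.div_const h).pow_const p)

lemma scaledKernel_nonneg (hK : KernelCond K) {h : ℝ} (hh : 0 < h) (u : ℝ) :
    0 ≤ scaledKernel K h u := mul_nonneg (inv_nonneg.2 hh.le) (hK.nonneg _)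

lemma scaledKernel_eq_zero (hK : KernelCond K) {h : ℝ} (hh : 0 < h) {u : ℝ} (hu : h < |u|) :
    scaledKernel K h u = 0 := by
  rw [scaledKernel, hK.support, mul_zero]
  intro hmem
  have := abs_le.2 hmem
  rw [abs_div, abs_of_pos hh, div_le_one hh] at this
  linarith

lemma abs_scaledMoment_le (hK : KernelCond K) {h : ℝ} (hh : 0 < h) (p : ℕ) (u : ℝ) :
    |scaledMoment K h p u| ≤ scaledKernel K h u := by
  have h0 := scaledKernel_nonneg hK hh u
  rw [scaledMoment, abs_mul, abs_of_nonneg h0, abs_pow]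
  rcases le_or_gt |u| h with hu | hu
  · refine mul_le_of_le_one_right h0 (pow_le_one₀ (abs_nonneg _) ?_)
    rw [abs_div, abs_of_pos hh]
    exact div_le_one_of_le₀ hu hh.le
  · rw [scaledKernel_eq_zero hK hh hu, zero_mul]

/-- A nonintegrable function has integral `0` by convention, which contradicts the normalization to
one. -/
lemma integrable_kernel (hK : KernelCond K) : Integrable K := by
  by_contra hcon
  have := hK.integral_eq_one
  rw [integral_undef hcon] at this
  exact zero_ne_one this

lemma integrable_scaledKernel_comp_sub (hK : KernelCond K) {h : ℝ} (hh : 0 < h) (t : ℝ) :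
    Integrable fun x => scaledKernel K h (x - t) :=
  (((integrable_kernel hK).comp_div hh.ne').const_mul h⁻¹).comp_sub_right t

lemma integral_scaledKernel_comp_sub (hK : KernelCond K) {h : ℝ} (hh : 0 < h) (t : ℝ) :
    ∫ x, scaledKernel K h (x - t) = 1 := by
  rw [integral_sub_right_eq_self (fun x => scaledKernel K h x) t]
  simp only [scaledKernel]
  rw [integral_const_mul, Measure.integral_comp_div, hK.integral_eq_one, smul_eq_mul, mul_one,
    abs_of_pos hh, inv_mul_cancel₀ hh.ne']

variable {a b mT MT : ℝ} {τ : Measure ℝ}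

lemma DesignLaw.integral_scaledKernel_le (hτ : DesignLaw a b mT MT τ) (hK : KernelCond K) {h : ℝ}
    (hh : 0 < h) (t : ℝ) : ∫ x, scaledKernel K h (x - t) ∂τ ≤ MT := by
  have h0 : ∀ x, 0 ≤ scaledKernel K h (x - t) := fun x => scaledKernel_nonneg hK hh _
  have hi := integrable_scaledKernel_comp_sub hK hh t
  refine (hτ.integral_le h0 hi.integrableOn).trans (mul_le_of_le_one_right hτ.MT_pos.le ?_)
  refine (setIntegral_le_integral hi (ae_of_all _ h0)).trans ?_
  rw [integral_scaledKernel_comp_sub hK hh]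

/-- Bracketing of the scaled kernel moments by polynomially many windows. -/
lemma exists_kernel_bracket (hab : a < b) (hK : KernelCond K) [IsProbabilityMeasure τ]
    (hτ : DesignLaw a b mT MT τ) (p : ℕ) :
    ∃ c : ℝ, 0 < c ∧ ∀ (h : ℝ) (n : ℕ), 0 < h → 1 ≤ n * h → ∃ ψ D W : ℕ → ℝ → ℝ,
      (∀ l < n ^ 2, Measurable (ψ l) ∧ W l ∈ Window τ c h ∧ D l ∈ Window τ c h ∧
        ∫ x, D l x ∂τ ≤ c / n ∧ ∀ x, |ψ l x| ≤ W l x ∧ D l x ≤ W l x) ∧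
      ∀ t ∈ Icc a b, ∃ l < n ^ 2, ∀ x, |scaledMoment K h p (x - t) - ψ l x| ≤ D l x ∧
        |scaledMoment K h p (x - t)| ≤ W l x := by
  obtain ⟨B, hB, hKB⟩ := kernel_bounded hK
  obtain ⟨G, V, hG⟩ := exists_monotoneControl hK p
  have hV := hG.bound_nonneg
  have hMT := hτ.MT_pos
  have hba : 0 < b - a := sub_pos.2 hab
  refine ⟨B + V + MT + MT * V * (b - a), by positivity, fun h n hh hnh => ?_⟩
  set c := B + V + MT + MT * V * (b - a) with hc
  have hn : 0 < n := by
    rcases Nat.eq_zero_or_pos n with rfl | hn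
    · simp at hnh; linarith
    · exact hn
  have hn0 : (0 : ℝ) < n := by exact_mod_cast hn
  have hn1 : (1 : ℝ) ≤ n := by exact_mod_cast hn
  -- With `n²` cells the mean increment over one cell is at most `MT h⁻¹ η V = (MT V (b - a) / n) /
  -- (n h)`, hence `O(1/n)` as soon as `n h ≥ 1`.
  set η : ℝ := (b - a) / (n : ℝ) ^ 2 with hη
  have hη0 : 0 < η := by positivity
  set e : ℕ → ℝ := fun l => a + l * η with he
  have hGs := hG.scale hh
  have hGm : Measurable fun x => G (x / h) := hGs.monotone.measurable
  set ψ : ℕ → ℝ → ℝ := fun l x => scaledMoment K h p (x - e l) with hψ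
  -- For `t` in the cell `[e l, e (l+1)]` the argument `x - t` lies between `x - e (l+1)` and `x - e
  -- l`, so the increment of the monotone control over the cell bounds the change of the kernel
  -- moment.
  set D : ℕ → ℝ → ℝ := fun l x => h⁻¹ * (G ((x - e l) / h) - G ((x - e (l + 1)) / h)) with hD
  have hel : ∀ l, e l ≤ e (l + 1) := fun l => by simp only [he]; push_cast; nlinarith
  have hD0 : ∀ l x, 0 ≤ D l x := fun l x => mul_nonneg (inv_nonneg.2 hh.le)
    (sub_nonneg.2 (hGs.monotone (sub_le_sub_left (hel l) x)))
  have hDm : ∀ l, Measurable (D l) := fun l =>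
    ((hGm.comp (measurable_id.sub_const _)).sub (hGm.comp (measurable_id.sub_const _))).const_mul _
  have hDV : ∀ l x, D l x ≤ V / h := fun l x => by
    rw [div_eq_inv_mul]
    refine mul_le_mul_of_nonneg_left ?_ (inv_nonneg.2 hh.le)
    linarith [hG.le ((x - e l) / h), hG.nonneg ((x - e (l + 1)) / h)]
  have hDi : ∀ l, Integrable (D l) τ := fun l => Integrable.of_bound (hDm l).aestronglyMeasurable
    (V / h) (ae_of_all _ fun x => by rw [Real.norm_of_nonneg (hD0 l x)]; exact hDV l x)
  have hDint : ∀ l, ∫ x, D l x ∂τ ≤ MT * V * (b - a) / n := fun l => by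
    have hIo : IntegrableOn (D l) (Icc a b) := Measure.integrableOn_of_bounded
      (by simp) (hDm l).aestronglyMeasurable (M := V / h)
      (ae_of_all _ fun x => by rw [Real.norm_of_nonneg (hD0 l x)]; exact hDV l x)
    have h1 : ∫ x in Icc a b, D l x ≤ h⁻¹ * (η * V) := by
      simp only [hD]
      rw [integral_const_mul]
      refine mul_le_mul_of_nonneg_left ?_ (inv_nonneg.2 hh.le)
      refine (hGs.integral_shift_le hab.le (hel l)).trans (le_of_eq ?_)
      simp only [he]; push_cast; ring
    refine (hτ.integral_le (hD0 l) hIo).trans ?_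
    refine (mul_le_mul_of_nonneg_left h1 hMT.le).trans ?_
    have e1 : MT * (h⁻¹ * (η * V)) = MT * V * (b - a) / n / (n * h) := by
      rw [hη]; field_simp
    rw [e1]
    exact div_le_self (by positivity) hnh
  have hψW : ∀ t x, |scaledMoment K h p (x - t)| ≤ scaledKernel K h (x - t) := fun t x =>
    abs_scaledMoment_le hK hh p _
  have hψm : ∀ l, Measurable (ψ l) := fun l =>
    (measurable_scaledMoment hK h p).comp (measurable_id.sub_const _)
  have hKb : ∀ u, scaledKernel K h u ≤ B / h := fun u => by
    rw [div_eq_inv_mul]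
    exact mul_le_mul_of_nonneg_left (hKB _) (inv_nonneg.2 hh.le)
  have hψB : ∀ l x, |ψ l x| ≤ B / h := fun l x => (hψW _ x).trans (hKb _)
  have hψi : ∀ l, Integrable (fun x => |ψ l x|) τ := fun l => Integrable.of_bound
    (hψm l).abs.aestronglyMeasurable (B / h) (ae_of_all _ fun x => by
      rw [Real.norm_of_nonneg (abs_nonneg _)]; exact hψB l x)
  have hψint : ∀ l, ∫ x, |ψ l x| ∂τ ≤ MT := fun l => by
    refine le_trans (integral_mono (hψi l) ?_ fun x => hψW (e l) x)
      (hτ.integral_scaledKernel_le hK hh (e l))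
    exact Integrable.of_bound ((measurable_scaledKernel hK h).comp
      (measurable_id.sub_const _)).aestronglyMeasurable (B / h) (ae_of_all _ fun x => by
        rw [Real.norm_of_nonneg (scaledKernel_nonneg hK hh _)]; exact hKb _)
  have hq : MT * V * (b - a) / n ≤ MT * V * (b - a) := div_le_self (by positivity) hn1
  refine ⟨ψ, D, fun l x => |ψ l x| + D l x, fun l _ => ⟨hψm l, ?_, ?_, ?_, ?_⟩, ?_⟩
  · refine ⟨(hψm l).abs.add (hDm l), fun x => add_nonneg (abs_nonneg _) (hD0 l x), fun x => ?_, ?_⟩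
    · refine (add_le_add (hψB l x) (hDV l x)).trans ?_
      rw [← add_div]
      gcongr
      have : 0 ≤ MT * V * (b - a) := by positivity
      linarith
    · rw [integral_add (hψi l) (hDi l)]
      linarith [hψint l, hDint l]
  · refine ⟨hDm l, hD0 l, fun x => (hDV l x).trans ?_, (hDint l).trans ?_⟩
    · gcongr
      have : 0 ≤ MT * V * (b - a) := by positivity
      linarith
    · linarith
  · refine (hDint l).trans ?_
    gcongr
    linarith
  · exact fun x => ⟨le_add_of_nonneg_right (hD0 l x), le_add_of_nonneg_left (abs_nonneg _)⟩
  · intro t ht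
    have hcell : ∃ l < n ^ 2, e l ≤ t ∧ t ≤ e (l + 1) := by
      rcases eq_or_lt_of_le ht.2 with rfl | htb
      -- The right end point is assigned to the last cell; the floor used below would give the
      -- nonexistent cell `n²`.
      · refine ⟨n ^ 2 - 1, Nat.sub_lt (by positivity) one_pos, ?_⟩
        have h1 : ((n ^ 2 - 1 : ℕ) : ℝ) = (n : ℝ) ^ 2 - 1 := by
          rw [Nat.cast_sub (Nat.one_le_pow _ _ hn)]; push_cast; ring
        have h2 : (n : ℝ) ^ 2 * η = t - a := by rw [hη]; field_simp
        simp only [he, Nat.cast_add, h1, Nat.cast_one]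
        constructor <;> nlinarith
      · have h0 : 0 ≤ (t - a) / η := div_nonneg (by linarith [ht.1]) hη0.le
        refine ⟨⌊(t - a) / η⌋₊, ?_, ?_, ?_⟩
        · rw [Nat.floor_lt h0, div_lt_iff₀ hη0]
          have h2 : (n : ℝ) ^ 2 * η = b - a := by rw [hη]; field_simp
          push_cast
          linarith
        · have := Nat.floor_le h0
          rw [le_div_iff₀ hη0] at this
          simp only [he]; linarith
        · have := (Nat.lt_floor_add_one ((t - a) / η)).le
          rw [div_le_iff₀ hη0] at this
          simp only [he]; push_cast; linarith
    obtain ⟨l, hl, h1, h2⟩ := hcell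
    have key : ∀ x, |scaledMoment K h p (x - t) - ψ l x| ≤ D l x := fun x => by
      have e1 : scaledMoment K h p (x - t) - ψ l x =
          h⁻¹ * (K ((x - t) / h) * ((x - t) / h) ^ p -
            K ((x - e l) / h) * ((x - e l) / h) ^ p) := by
        simp only [hψ, scaledMoment, scaledKernel]; ring
      rw [e1, abs_mul, abs_of_pos (inv_pos.2 hh), abs_sub_comm]
      refine mul_le_mul_of_nonneg_left ?_ (inv_nonneg.2 hh.le)
      refine (hGs.abs_sub_le (x - t) (x - e l) (by linarith)).trans ?_
      have := hGs.monotone (show x - e (l + 1) ≤ x - t by linarith)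
      linarith
    refine ⟨l, hl, fun x => ⟨key x, ?_⟩⟩
    have := abs_sub_abs_le_abs_sub (scaledMoment K h p (x - t)) (ψ l x)
    linarith [key x]

end Kernel

/-! ## Averages over curves -/

section CurveAvg

variable {n : ℕ} {m : ℕ → ℕ} {φ ψ : ℕ → ℕ → ℕ → ℝ}

lemma curveAvg_add (φ ψ : ℕ → ℕ → ℕ → ℝ) : curveAvg n m (fun i j k => φ i j k + ψ i j k) =
    curveAvg n m φ + curveAvg n m ψ := by
  simp only [curveAvg]
  rw [← mul_add, ← Finset.sum_add_distrib]
  exact congrArg _ (Finset.sum_congr rfl fun i _ => pairAvg_add _ _ _)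

lemma curveAvg_const_mul (c : ℝ) (φ : ℕ → ℕ → ℕ → ℝ) :
    curveAvg n m (fun i j k => c * φ i j k) = c * curveAvg n m φ := by
  simp only [curveAvg, pairAvg_const_mul, ← Finset.mul_sum]; ring

lemma curveAvg_sub (φ ψ : ℕ → ℕ → ℕ → ℝ) : curveAvg n m (fun i j k => φ i j k - ψ i j k) =
    curveAvg n m φ - curveAvg n m ψ := by
  have := curveAvg_add (n := n) (m := m) φ fun i j k => (-1) * ψ i j k
  rw [curveAvg_const_mul] at this
  rw [sub_eq_add_neg, ← neg_one_mul (curveAvg n m ψ), ← this]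
  congr 1; ext i j k; ring

lemma curveAvg_mono (h : ∀ i j k, φ i j k ≤ ψ i j k) : curveAvg n m φ ≤ curveAvg n m ψ :=
  mul_le_mul_of_nonneg_left (Finset.sum_le_sum fun i _ => pairAvg_mono (h i))
    (inv_nonneg.2 (Nat.cast_nonneg n))

lemma abs_curveAvg_le (h : ∀ i j k, |φ i j k| ≤ ψ i j k) : |curveAvg n m φ| ≤ curveAvg n m ψ := by
  refine abs_le.2 ⟨?_, curveAvg_mono fun i j k => (le_abs_self _).trans (h i j k)⟩
  have : curveAvg n m (fun i j k => (-1) * ψ i j k) ≤ curveAvg n m φ :=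
    curveAvg_mono fun i j k => by linarith [neg_abs_le (φ i j k), h i j k]
  rw [curveAvg_const_mul] at this
  linarith

lemma curveAvg_finsetSum {ι : Type*} (s : Finset ι) (φ : ι → ℕ → ℕ → ℕ → ℝ) :
    curveAvg n m (fun i j k => ∑ p ∈ s, φ p i j k) = ∑ p ∈ s, curveAvg n m (φ p) := by
  classical
  induction s using Finset.induction_on with
  | empty => simp [curveAvg, pairAvg]
  | insert a s ha ih => simp only [Finset.sum_insert ha, curveAvg_add, ih]

end CurveAvg

/-! ## Laws of large numbers with rates, uniformly over bracketed families -/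

section Uniform

variable {Ω S : Type*} [MeasurableSpace Ω] [MeasurableSpace S]
  {P : Measure Ω} [IsProbabilityMeasure P] {ν : Measure S} [IsProbabilityMeasure ν]
  {a b σ : ℝ} {f : ℝ → ℝ} {X : S → ℝ → ℝ} {ξ : ℕ → Ω → S} {T U : ℕ → ℕ → Ω → ℝ}
  {m : ℕ → ℕ → ℕ} {𝒢 𝒢' : ℝ → ℕ → Set (ℝ × ℝ → ℝ)} {env env' : S × ℝ × ℝ → ℝ} {ρ : ℕ → ℝ}

lemma FamilyLaw.mono_class (hlaw : FamilyLaw P ν ξ T U m 𝒢 env ρ)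
    (h : ∀ c, ∃ c', ∀ n, 𝒢' c n ⊆ 𝒢 c' n) : FamilyLaw P ν ξ T U m 𝒢' env ρ := by
  intro Λ p hΛ F g c hF hFg
  obtain ⟨c', hc'⟩ := h c
  refine hlaw Λ p hΛ F g c' hF ?_
  filter_upwards [hFg] with n hn l hl
  exact ⟨hc' n (hn l hl).1, (hn l hl).2⟩

lemma FamilyLaw.mono_env (hlaw : FamilyLaw P ν ξ T U m 𝒢 env ρ) (h : ∀ y, env' y ≤ env y)
    (h0 : ∀ c n, ∀ g ∈ 𝒢 c n, ∀ w, 0 ≤ g w) : FamilyLaw P ν ξ T U m 𝒢 env' ρ := by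
  intro Λ p hΛ F g c hF hFg
  refine hlaw Λ p hΛ F g c hF ?_
  filter_upwards [hFg] with n hn l hl
  exact ⟨(hn l hl).1, fun z => ((hn l hl).2 z).trans
    (mul_le_mul_of_nonneg_right (h _) (h0 c n _ (hn l hl).1 _))⟩

lemma singleClass_subset_boundedClass {τ : Measure ℝ} [IsProbabilityMeasure τ] (bw : ℕ → ℝ)
    (c : ℝ) (n : ℕ) : SingleClass τ bw c n ⊆ BoundedClass τ (fun n => 1 / bw n) c n := by
  rintro g ⟨φ, hφ, hg⟩
  obtain rfl : g = fun w => φ w.1 := funext hg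
  refine ⟨hφ.1.comp measurable_fst, fun w => hφ.2.1 _, fun w => ?_, ?_⟩
  · rw [mul_one_div]; exact hφ.2.2.1 _
  · rw [integral_fun_fst]
    simpa using hφ.2.2.2

lemma pairClass_subset_boundedClass {τ : Measure ℝ} [IsProbabilityMeasure τ] (bw : ℕ → ℝ)
    (c : ℝ) (n : ℕ) :
    PairClass τ bw c n ⊆ BoundedClass τ (fun n => 1 / bw n ^ 2) (c ^ 2) n := by
  rintro g ⟨φ, hφ, ψ, hψ, hg⟩
  obtain rfl : g = fun w => φ w.1 * ψ w.2 := funext hg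
  have hc := Window.nonneg_const hφ
  refine ⟨(hφ.1.comp measurable_fst).mul (hψ.1.comp measurable_snd),
    fun w => mul_nonneg (hφ.2.1 _) (hψ.2.1 _), fun w => ?_, ?_⟩
  · have : c ^ 2 * (1 / bw n ^ 2) = c / bw n * (c / bw n) := by ring
    rw [this]
    exact mul_le_mul (hφ.2.2.1 _) (hψ.2.2.1 _) (hψ.2.1 _) ((hφ.2.1 w.1).trans (hφ.2.2.1 _))
  · rw [integral_prod_mul, sq]
    exact mul_le_mul hφ.2.2.2 hψ.2.2.2 (integral_nonneg hψ.2.1) hc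

lemma integral_env_mul (h : ObservationModel P ν a b σ f X ξ T U) (env : S × ℝ × ℝ → ℝ)
    (g : ℝ × ℝ → ℝ) : ∫ z, env z.1 * g z.2 ∂(pairLaw P ν T U) =
    (∫ y, env y ∂(ν.prod ((errorLaw P U).prod (errorLaw P U)))) *
      ∫ w, g w ∂((timeLaw P T).prod (timeLaw P T)) := by
  have := h.isProbabilityMeasure_errorLaw
  have := h.isProbabilityMeasure_timeLaw
  rw [pairLaw, integral_prod_mul]

/-- The averages of small brackets are `O(ρ n)`. -/
lemma FamilyLaw.ae_bracket_le (h : ObservationModel P ν a b σ f X ξ T U)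
    (hlaw : FamilyLaw P ν ξ T U m 𝒢 env ρ) (henv : Measurable env) (henv0 : ∀ y, 0 ≤ env y)
    {Λ : ℕ → Finset (ℕ × ℕ)} {p : ℕ} (hΛ : ∀ᶠ n in atTop, ((Λ n).card : ℝ) ≤ (n : ℝ) ^ p)
    {Δ : ℕ → ℕ × ℕ → ℝ × ℝ → ℝ} {c : ℝ}
    (hΔ : ∀ᶠ n in atTop, ∀ l ∈ Λ n, Measurable (Δ n l) ∧ (∀ w, 0 ≤ Δ n l w) ∧ Δ n l ∈ 𝒢 c n ∧
      ∫ w, Δ n l w ∂((timeLaw P T).prod (timeLaw P T)) ≤ c * ρ n) :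
    ∀ᵐ ω ∂P, ∃ C : ℝ, ∀ᶠ n in atTop, ∀ l ∈ Λ n,
      curveAvg n (m n) (fun i j k => env (pairData ξ T U ω i j k).1 *
        Δ n l (pairData ξ T U ω i j k).2) ≤ C * ρ n := by
  classical
  -- The family law asks for measurability at every index, whereas it is known only on `Λ n` for
  -- large `n`; elsewhere the function is replaced by zero.
  set Δ' : ℕ → ℕ × ℕ → ℝ × ℝ → ℝ := fun n l => if Measurable (Δ n l) then Δ n l else 0 with hΔ'
  have hmeas : ∀ n l, Measurable (Δ' n l) := fun n l => by
    simp only [hΔ']; split_ifs with h'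
    · exact h'
    · exact measurable_const
  have hmain := hlaw Λ p hΛ (fun n l z => env z.1 * Δ' n l z.2) Δ c
    (fun n l => (henv.comp measurable_fst).mul ((hmeas n l).comp measurable_snd)) (by
      filter_upwards [hΔ] with n hn l hl
      obtain ⟨h1, h2, h3, h4⟩ := hn l hl
      refine ⟨h3, fun z => ?_⟩
      simp only [hΔ', if_pos h1]
      rw [abs_of_nonneg (mul_nonneg (henv0 _) (h2 _))])
  filter_upwards [hmain] with ω ⟨C, hC⟩
  refine ⟨C + (∫ y, env y ∂(ν.prod ((errorLaw P U).prod (errorLaw P U)))) * c, ?_⟩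
  filter_upwards [hC, hΔ] with n hn hΔ l hl
  obtain ⟨h1, h2, h3, h4⟩ := hΔ l hl
  have e := hn l hl
  simp only [hΔ', if_pos h1] at e
  rw [integral_env_mul h] at e
  have h5 : (∫ y, env y ∂(ν.prod ((errorLaw P U).prod (errorLaw P U)))) *
      ∫ w, Δ n l w ∂((timeLaw P T).prod (timeLaw P T)) ≤
      (∫ y, env y ∂(ν.prod ((errorLaw P U).prod (errorLaw P U)))) * (c * ρ n) :=
    mul_le_mul_of_nonneg_left h4 (integral_nonneg henv0)
  have := (abs_le.1 e).2
  linarith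

/-- The uniform law over a family of weights of the times that has polynomially many brackets. -/
theorem FamilyLaw.ae_uniform (h : ObservationModel P ν a b σ f X ξ T U)
    (hlaw : FamilyLaw P ν ξ T U m 𝒢 env ρ) (henv : Measurable env) (henv0 : ∀ y, 0 ≤ env y)
    (henvi : Integrable env (ν.prod ((errorLaw P U).prod (errorLaw P U))))
    {ζ : (S × ℝ × ℝ) × ℝ × ℝ → ℝ} (hζ : Measurable ζ) (hζe : ∀ z, |ζ z| ≤ env z.1)
    {Λ : ℕ → Finset (ℕ × ℕ)} {p : ℕ} (hΛ : ∀ᶠ n in atTop, ((Λ n).card : ℝ) ≤ (n : ℝ) ^ p)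
    {Θ : Type*} {G : ℕ → Θ → ℝ × ℝ → ℝ} (hG : ∀ n θ, Measurable (G n θ))
    {Ψ W Δ₁ Δ₂ : ℕ → ℕ × ℕ → ℝ × ℝ → ℝ} {c : ℝ}
    (hΨ : ∀ᶠ n in atTop, ∀ l ∈ Λ n, Measurable (Ψ n l) ∧ (∀ w, |Ψ n l w| ≤ W n l w) ∧
      W n l ∈ 𝒢 c n ∧ Integrable (W n l) ((timeLaw P T).prod (timeLaw P T)))
    (hΔ₁ : ∀ᶠ n in atTop, ∀ l ∈ Λ n, Measurable (Δ₁ n l) ∧ (∀ w, 0 ≤ Δ₁ n l w) ∧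
      Δ₁ n l ∈ 𝒢 c n ∧ ∫ w, Δ₁ n l w ∂((timeLaw P T).prod (timeLaw P T)) ≤ c * ρ n)
    (hΔ₁i : ∀ᶠ n in atTop, ∀ l ∈ Λ n, Integrable (Δ₁ n l) ((timeLaw P T).prod (timeLaw P T)))
    (hΔ₂ : ∀ᶠ n in atTop, ∀ l ∈ Λ n, Measurable (Δ₂ n l) ∧ (∀ w, 0 ≤ Δ₂ n l w) ∧
      Δ₂ n l ∈ 𝒢 c n ∧ ∫ w, Δ₂ n l w ∂((timeLaw P T).prod (timeLaw P T)) ≤ c * ρ n)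
    (hΔ₂i : ∀ᶠ n in atTop, ∀ l ∈ Λ n, Integrable (Δ₂ n l) ((timeLaw P T).prod (timeLaw P T)))
    (hcov : ∀ᶠ n in atTop, ∀ θ, ∃ l ∈ Λ n, ∀ w, |G n θ w - Ψ n l w| ≤ Δ₁ n l w + Δ₂ n l w) :
    ∀ᵐ ω ∂P, ∃ C : ℝ, ∀ᶠ n in atTop, ∀ θ,
      |curveAvg n (m n) (fun i j k => ζ (pairData ξ T U ω i j k) *
          G n θ (pairData ξ T U ω i j k).2) -
        ∫ z, ζ z * G n θ z.2 ∂(pairLaw P ν T U)| ≤ C * ρ n := by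
  classical
  have := h.isProbabilityMeasure_errorLaw
  have := h.isProbabilityMeasure_timeLaw
  set τ₂ := (timeLaw P T).prod (timeLaw P T) with hτ₂
  set μ := ν.prod ((errorLaw P U).prod (errorLaw P U)) with hμ
  set Ψ' : ℕ → ℕ × ℕ → ℝ × ℝ → ℝ := fun n l => if Measurable (Ψ n l) then Ψ n l else 0 with hΨ'
  have hmeas : ∀ n l, Measurable (Ψ' n l) := fun n l => by
    simp only [hΨ']; split_ifs with h'
    · exact h'
    · exact measurable_const
  have hmain := hlaw Λ p hΛ (fun n l z => ζ z * Ψ' n l z.2) W c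
    (fun n l => hζ.mul ((hmeas n l).comp measurable_snd)) (by
      filter_upwards [hΨ] with n hn l hl
      obtain ⟨h1, h2, h3, h4⟩ := hn l hl
      refine ⟨h3, fun z => ?_⟩
      simp only [hΨ', if_pos h1]
      rw [abs_mul]
      exact mul_le_mul (hζe z) (h2 _) (abs_nonneg _) (henv0 _))
  filter_upwards [hmain, hlaw.ae_bracket_le h henv henv0 hΛ hΔ₁,
    hlaw.ae_bracket_le h henv henv0 hΛ hΔ₂] with ω ⟨C, hC⟩ ⟨C₁, hC₁⟩ ⟨C₂, hC₂⟩
  set E := ∫ y, env y ∂μ with hE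
  have hE0 : 0 ≤ E := integral_nonneg henv0
  refine ⟨C + C₁ + C₂ + E * c + E * c, ?_⟩
  filter_upwards [hC, hC₁, hC₂, hΨ, hΔ₁, hΔ₂, hΔ₁i, hΔ₂i, hcov]
    with n hC hC₁ hC₂ hΨ hΔ₁ hΔ₂ hΔ₁i hΔ₂i hcov θ
  obtain ⟨l, hl, hθ⟩ := hcov θ
  obtain ⟨h1, h2, h3, h4⟩ := hΨ l hl
  obtain ⟨d1, d2, d3, d4⟩ := hΔ₁ l hl
  obtain ⟨e1, e2, e3, e4⟩ := hΔ₂ l hl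
  have c0 := hC l hl
  simp only [hΨ', if_pos h1] at c0
  have c1 := hC₁ l hl
  have c2 := hC₂ l hl
  -- The target is compared with the bracket centre `Ψ` twice, in the sample and in the population,
  -- and the two are linked by the deviation of `Ψ`. The same pointwise bound serves both
  -- comparisons.
  have hpt : ∀ z : (S × ℝ × ℝ) × ℝ × ℝ, |ζ z * G n θ z.2 - ζ z * Ψ n l z.2| ≤
      env z.1 * Δ₁ n l z.2 + env z.1 * Δ₂ n l z.2 := fun z => by
    rw [← mul_sub, ← mul_add, abs_mul]
    exact mul_le_mul (hζe z) (hθ _) (abs_nonneg _) (henv0 _)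
  have i1 : Integrable (fun z : (S × ℝ × ℝ) × ℝ × ℝ => env z.1 * Δ₁ n l z.2) (μ.prod τ₂) :=
    henvi.mul_prod (hΔ₁i l hl)
  have i2 : Integrable (fun z : (S × ℝ × ℝ) × ℝ × ℝ => env z.1 * Δ₂ n l z.2) (μ.prod τ₂) :=
    henvi.mul_prod (hΔ₂i l hl)
  have iΨ : Integrable (fun z => ζ z * Ψ n l z.2) (μ.prod τ₂) :=
    integrable_env_mul henvi h4 (hζ.mul (h1.comp measurable_snd)) fun z => by
      rw [abs_mul]
      exact mul_le_mul (hζe z) (h2 _) (abs_nonneg _) (henv0 _)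
  have i12 : Integrable (fun z : (S × ℝ × ℝ) × ℝ × ℝ =>
    env z.1 * Δ₁ n l z.2 + env z.1 * Δ₂ n l z.2) (μ.prod τ₂) := i1.add i2
  have id : Integrable (fun z => ζ z * G n θ z.2 - ζ z * Ψ n l z.2) (μ.prod τ₂) :=
    i12.mono' ((hζ.mul ((hG n θ).comp measurable_snd)).sub
      (hζ.mul (h1.comp measurable_snd))).aestronglyMeasurable (ae_of_all _ hpt)
  have iG : Integrable (fun z => ζ z * G n θ z.2) (μ.prod τ₂) :=
    (id.add iΨ).congr (ae_of_all _ fun z => by simp)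
  have b1 : |(∫ z, ζ z * G n θ z.2 ∂(pairLaw P ν T U)) -
      ∫ z, ζ z * Ψ n l z.2 ∂(pairLaw P ν T U)| ≤ E * (c * ρ n) + E * (c * ρ n) := by
    rw [pairLaw, ← integral_sub iG iΨ]
    rw [← Real.norm_eq_abs]
    refine (norm_integral_le_of_norm_le i12
      (ae_of_all _ fun z => (Real.norm_eq_abs _).le.trans (hpt z))).trans ?_
    rw [integral_add i1 i2]
    have q1 := integral_env_mul h env (Δ₁ n l)
    have q2 := integral_env_mul h env (Δ₂ n l)
    rw [pairLaw] at q1 q2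
    rw [q1, q2]
    exact add_le_add (mul_le_mul_of_nonneg_left d4 hE0) (mul_le_mul_of_nonneg_left e4 hE0)
  have b2 : |curveAvg n (m n) (fun i j k => ζ (pairData ξ T U ω i j k) *
          G n θ (pairData ξ T U ω i j k).2) -
      curveAvg n (m n) (fun i j k => ζ (pairData ξ T U ω i j k) *
          Ψ n l (pairData ξ T U ω i j k).2)| ≤ C₁ * ρ n + C₂ * ρ n := by
    rw [← curveAvg_sub]
    refine (abs_curveAvg_le fun i j k => hpt _).trans ?_
    rw [curveAvg_add]
    exact add_le_add c1 c2
  rw [abs_le] at b1 b2 c0 ⊢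
  constructor <;> linarith [b1.1, b1.2, b2.1, b2.2, c0.1, c0.2]

lemma Window.mono {τ : Measure ℝ} {c c' h : ℝ} (hh : 0 < h) (hc : c ≤ c') {φ : ℝ → ℝ}
    (hφ : φ ∈ Window τ c h) : φ ∈ Window τ c' h :=
  ⟨hφ.1, hφ.2.1, fun x => (hφ.2.2.1 x).trans (by gcongr), hφ.2.2.2.trans hc⟩

section KernelWeights

variable {K : ℝ → ℝ} {bw : ℕ → ℝ} {ζ : (S × ℝ × ℝ) × ℝ × ℝ → ℝ}

/-- The uniform law for the kernel averages of single observations. -/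
theorem FamilyLaw.ae_uniform_single (h : ObservationModel P ν a b σ f X ξ T U) (hab : a < b)
    (hK : KernelCond K) {mT MT : ℝ} (hτ : DesignLaw a b mT MT (timeLaw P T))
    (hlaw : FamilyLaw P ν ξ T U m (SingleClass (timeLaw P T) bw) env ρ) (henv : Measurable env)
    (henv0 : ∀ y, 0 ≤ env y)
    (henvi : Integrable env (ν.prod ((errorLaw P U).prod (errorLaw P U))))
    (hζ : Measurable ζ) (hζe : ∀ z, |ζ z| ≤ env z.1) (hbw : ∀ n, 0 < bw n)
    (hnh : ∀ᶠ n : ℕ in atTop, 1 ≤ n * bw n) (hρ : ∀ᶠ n : ℕ in atTop, (n : ℝ)⁻¹ ≤ ρ n) (p : ℕ) :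
    ∀ᵐ ω ∂P, ∃ C : ℝ, ∀ᶠ n in atTop, ∀ t : Icc a b,
      |curveAvg n (m n) (fun i j k => ζ (pairData ξ T U ω i j k) *
          scaledMoment K (bw n) p ((pairData ξ T U ω i j k).2.1 - t)) -
        ∫ z, ζ z * scaledMoment K (bw n) p (z.2.1 - t) ∂(pairLaw P ν T U)| ≤ C * ρ n := by
  have := h.isProbabilityMeasure_timeLaw
  obtain ⟨c, hc, hbr⟩ := exists_kernel_bracket hab hK hτ p
  have hex : ∀ n : ℕ, ∃ ψ D W : ℕ → ℝ → ℝ, 1 ≤ n * bw n →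
      (∀ l < n ^ 2, Measurable (ψ l) ∧ W l ∈ Window (timeLaw P T) c (bw n) ∧
        D l ∈ Window (timeLaw P T) c (bw n) ∧ ∫ x, D l x ∂(timeLaw P T) ≤ c / n ∧
        ∀ x, |ψ l x| ≤ W l x ∧ D l x ≤ W l x) ∧
      ∀ t ∈ Icc a b, ∃ l < n ^ 2, ∀ x, |scaledMoment K (bw n) p (x - t) - ψ l x| ≤ D l x ∧
        |scaledMoment K (bw n) p (x - t)| ≤ W l x := fun n => by
    by_cases hn : 1 ≤ n * bw n
    · obtain ⟨ψ, D, W, h1⟩ := hbr (bw n) n (hbw n) hn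
      exact ⟨ψ, D, W, fun _ => h1⟩
    · exact ⟨0, 0, 0, fun hn' => absurd hn' hn⟩
  choose ψ D W hψ using hex
  have hD : ∀ᶠ n in atTop, ∀ l ∈ (Finset.range (n ^ 2)).product (Finset.range 1),
      Measurable (fun w : ℝ × ℝ => D n l.1 w.1) ∧ (∀ w : ℝ × ℝ, 0 ≤ D n l.1 w.1) ∧
      (fun w : ℝ × ℝ => D n l.1 w.1) ∈ SingleClass (timeLaw P T) bw c n ∧
      ∫ w, D n l.1 w.1 ∂((timeLaw P T).prod (timeLaw P T)) ≤ c * ρ n := by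
    filter_upwards [hnh, hρ] with n hn hρ l hl
    have hl1 := Finset.mem_range.1 (Finset.mem_product.1 hl).1
    obtain ⟨h1, h2, h3, h4, h5⟩ := (hψ n hn).1 l.1 hl1
    refine ⟨h3.1.comp measurable_fst, fun w => h3.2.1 _, ⟨_, h3, fun w => rfl⟩, ?_⟩
    rw [integral_fun_fst]
    simp only [probReal_univ, one_smul]
    refine h4.trans ?_
    rw [div_eq_mul_inv]
    gcongr
  have hDi : ∀ᶠ n in atTop, ∀ l ∈ (Finset.range (n ^ 2)).product (Finset.range 1),
      Integrable (fun w : ℝ × ℝ => D n l.1 w.1) ((timeLaw P T).prod (timeLaw P T)) := by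
    filter_upwards [hnh] with n hn l hl
    have hl1 := Finset.mem_range.1 (Finset.mem_product.1 hl).1
    exact (Window.integrable ((hψ n hn).1 l.1 hl1).2.2.1).comp_fst _
  -- A single observation needs one bracket only: the second index runs over one element and `Δ₂`
  -- merely repeats `Δ₁`.
  refine hlaw.ae_uniform h henv henv0 henvi hζ hζe
    (Λ := fun n => (Finset.range (n ^ 2)).product (Finset.range 1)) (p := 2)
    (Eventually.of_forall fun n => by simp) (Θ := Icc a b)
    (G := fun n t w => scaledMoment K (bw n) p (w.1 - t))
    (fun n t => (measurable_scaledMoment hK _ p).comp (measurable_fst.sub_const _))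
    (Ψ := fun n l w => ψ n l.1 w.1) (W := fun n l w => W n l.1 w.1)
    (Δ₁ := fun n l w => D n l.1 w.1) (Δ₂ := fun n l w => D n l.1 w.1) (c := c)
    ?_ hD hDi hD hDi ?_
  · filter_upwards [hnh] with n hn l hl
    have hl1 := Finset.mem_range.1 (Finset.mem_product.1 hl).1
    obtain ⟨h1, h2, h3, h4, h5⟩ := (hψ n hn).1 l.1 hl1
    exact ⟨h1.comp measurable_fst, fun w => (h5 _).1, ⟨_, h2, fun w => rfl⟩,
      (Window.integrable h2).comp_fst _⟩
  · filter_upwards [hnh] with n hn t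
    obtain ⟨l, hl, hlx⟩ := (hψ n hn).2 t t.2
    refine ⟨(l, 0), Finset.mem_product.2 ⟨Finset.mem_range.2 hl, by simp⟩, fun w => ?_⟩
    have h3 := ((hψ n hn).1 l hl).2.2.1
    exact (hlx w.1).1.trans (le_add_of_nonneg_right (h3.2.1 _))

/-- The uniform law for the product kernel averages of pairs of observations. -/
theorem FamilyLaw.ae_uniform_pair (h : ObservationModel P ν a b σ f X ξ T U) (hab : a < b)
    (hK : KernelCond K) {mT MT : ℝ} (hτ : DesignLaw a b mT MT (timeLaw P T))
    (hlaw : FamilyLaw P ν ξ T U m (PairClass (timeLaw P T) bw) env ρ) (henv : Measurable env)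
    (henv0 : ∀ y, 0 ≤ env y)
    (henvi : Integrable env (ν.prod ((errorLaw P U).prod (errorLaw P U))))
    (hζ : Measurable ζ) (hζe : ∀ z, |ζ z| ≤ env z.1) (hbw : ∀ n, 0 < bw n)
    (hnh : ∀ᶠ n : ℕ in atTop, 1 ≤ n * bw n) (hρ : ∀ᶠ n : ℕ in atTop, (n : ℝ)⁻¹ ≤ ρ n) (p q : ℕ) :
    ∀ᵐ ω ∂P, ∃ C : ℝ, ∀ᶠ n in atTop, ∀ θ : Icc a b × Icc a b,
      |curveAvg n (m n) (fun i j k => ζ (pairData ξ T U ω i j k) *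
          (scaledMoment K (bw n) p ((pairData ξ T U ω i j k).2.1 - θ.1) *
            scaledMoment K (bw n) q ((pairData ξ T U ω i j k).2.2 - θ.2))) -
        ∫ z, ζ z * (scaledMoment K (bw n) p (z.2.1 - θ.1) *
          scaledMoment K (bw n) q (z.2.2 - θ.2)) ∂(pairLaw P ν T U)| ≤ C * ρ n := by
  have := h.isProbabilityMeasure_timeLaw
  have hbr : ∀ p, ∃ c : ℝ, 0 < c ∧ ∃ ψ D W : ℕ → ℕ → ℝ → ℝ, ∀ n : ℕ, 1 ≤ n * bw n →
      (∀ l < n ^ 2, Measurable (ψ n l) ∧ W n l ∈ Window (timeLaw P T) c (bw n) ∧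
        D n l ∈ Window (timeLaw P T) c (bw n) ∧ ∫ x, D n l x ∂(timeLaw P T) ≤ c / n ∧
        ∀ x, |ψ n l x| ≤ W n l x ∧ D n l x ≤ W n l x) ∧
      ∀ t ∈ Icc a b, ∃ l < n ^ 2, ∀ x, |scaledMoment K (bw n) p (x - t) - ψ n l x| ≤ D n l x ∧
        |scaledMoment K (bw n) p (x - t)| ≤ W n l x := fun p => by
    obtain ⟨c, hc, hbr⟩ := exists_kernel_bracket hab hK hτ p
    have hex : ∀ n : ℕ, ∃ ψ D W : ℕ → ℝ → ℝ, 1 ≤ n * bw n →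
        (∀ l < n ^ 2, Measurable (ψ l) ∧ W l ∈ Window (timeLaw P T) c (bw n) ∧
          D l ∈ Window (timeLaw P T) c (bw n) ∧ ∫ x, D l x ∂(timeLaw P T) ≤ c / n ∧
          ∀ x, |ψ l x| ≤ W l x ∧ D l x ≤ W l x) ∧
        ∀ t ∈ Icc a b, ∃ l < n ^ 2, ∀ x, |scaledMoment K (bw n) p (x - t) - ψ l x| ≤ D l x ∧
          |scaledMoment K (bw n) p (x - t)| ≤ W l x := fun n => by
      by_cases hn : 1 ≤ n * bw n
      · obtain ⟨ψ, D, W, h1⟩ := hbr (bw n) n (hbw n) hn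
        exact ⟨ψ, D, W, fun _ => h1⟩
      · exact ⟨0, 0, 0, fun hn' => absurd hn' hn⟩
    choose ψ D W hψ using hex
    exact ⟨c, hc, ψ, D, W, hψ⟩
  obtain ⟨c₁, hc₁, ψ, D, W, hψ⟩ := hbr p
  obtain ⟨c₂, hc₂, ψ', D', W', hψ'⟩ := hbr q
  set c := max c₁ c₂ with hc
  have hc0 : 0 < c := lt_max_of_lt_left hc₁
  -- A member of the pair class has two windows of constant at least `c`, while the mean of a
  -- bracket product is at most `c * c / n`; `κ` covers both.
  set κ := max c (c * c) with hκ
  have hκ0 : 0 < κ := lt_max_of_lt_left hc0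
  -- the products of windows
  have hprod : ∀ n : ℕ, 1 ≤ n * bw n → (n : ℝ)⁻¹ ≤ ρ n → ∀ {c₃ c₄ : ℝ} {φ φ' : ℝ → ℝ}, c₃ ≤ c →
      c₄ ≤ c → φ ∈ Window (timeLaw P T) c₃ (bw n) → φ' ∈ Window (timeLaw P T) c₄ (bw n) →
      (∫ x, φ x ∂(timeLaw P T) ≤ c₃ / n ∨ ∫ x, φ' x ∂(timeLaw P T) ≤ c₄ / n) →
      Measurable (fun w : ℝ × ℝ => φ w.1 * φ' w.2) ∧ (∀ w : ℝ × ℝ, 0 ≤ φ w.1 * φ' w.2) ∧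
      (fun w : ℝ × ℝ => φ w.1 * φ' w.2) ∈ PairClass (timeLaw P T) bw κ n ∧
      ∫ w, φ w.1 * φ' w.2 ∂((timeLaw P T).prod (timeLaw P T)) ≤ κ * ρ n := by
    intro n hn hρ c₃ c₄ φ φ' h3 h4 hφ hφ' hint
    have hn0 : (0 : ℝ) ≤ (n : ℝ)⁻¹ := inv_nonneg.2 (Nat.cast_nonneg n)
    have hφ1 := Window.mono (hbw n) h3 hφ
    have hφ'1 := Window.mono (hbw n) h4 hφ'
    refine ⟨(hφ.1.comp measurable_fst).mul (hφ'.1.comp measurable_snd),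
      fun w => mul_nonneg (hφ.2.1 _) (hφ'.2.1 _),
      ⟨_, Window.mono (hbw n) (le_max_left _ _) hφ1, _, Window.mono (hbw n) (le_max_left _ _) hφ'1,
        fun w => rfl⟩, ?_⟩
    rw [integral_prod_mul]
    have p1 : 0 ≤ ∫ x, φ x ∂(timeLaw P T) := integral_nonneg fun x => hφ.2.1 x
    have p2 : 0 ≤ ∫ x, φ' x ∂(timeLaw P T) := integral_nonneg fun x => hφ'.2.1 x
    have key : (∫ x, φ x ∂(timeLaw P T)) * ∫ x, φ' x ∂(timeLaw P T) ≤ c * c * (n : ℝ)⁻¹ := by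
      rcases hint with hi | hi
      · have : ∫ x, φ x ∂(timeLaw P T) ≤ c * (n : ℝ)⁻¹ :=
          hi.trans (by rw [div_eq_mul_inv]; gcongr)
        calc _ ≤ c * (n : ℝ)⁻¹ * c := mul_le_mul this hφ'1.2.2.2 p2 (by positivity)
          _ = _ := by ring
      · have : ∫ x, φ' x ∂(timeLaw P T) ≤ c * (n : ℝ)⁻¹ :=
          hi.trans (by rw [div_eq_mul_inv]; gcongr)
        calc _ ≤ c * (c * (n : ℝ)⁻¹) := mul_le_mul hφ1.2.2.2 this p2 (by positivity)
          _ = _ := by ring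
    refine key.trans (mul_le_mul (le_max_right _ _) hρ hn0 hκ0.le)
  have hmem : ∀ {n : ℕ} {l : ℕ × ℕ},
      l ∈ (Finset.range (n ^ 2)).product (Finset.range (n ^ 2)) → l.1 < n ^ 2 ∧ l.2 < n ^ 2 :=
    fun hl => ⟨Finset.mem_range.1 (Finset.mem_product.1 hl).1,
      Finset.mem_range.1 (Finset.mem_product.1 hl).2⟩
  refine hlaw.ae_uniform h henv henv0 henvi hζ hζe
    (Λ := fun n => (Finset.range (n ^ 2)).product (Finset.range (n ^ 2))) (p := 4)
    (Eventually.of_forall fun n => ?_) (Θ := Icc a b × Icc a b)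
    (G := fun n θ w => scaledMoment K (bw n) p (w.1 - θ.1) * scaledMoment K (bw n) q (w.2 - θ.2))
    (fun n θ => ((measurable_scaledMoment hK _ p).comp (measurable_fst.sub_const _)).mul
      ((measurable_scaledMoment hK _ q).comp (measurable_snd.sub_const _)))
    (Ψ := fun n l w => ψ n l.1 w.1 * ψ' n l.2 w.2)
    (W := fun n l w => W n l.1 w.1 * W' n l.2 w.2)
    (Δ₁ := fun n l w => D n l.1 w.1 * W' n l.2 w.2)
    (Δ₂ := fun n l w => W n l.1 w.1 * D' n l.2 w.2) (c := κ) ?_ ?_ ?_ ?_ ?_ ?_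
  · have : ((Finset.range (n ^ 2)).product (Finset.range (n ^ 2))).card = n ^ 2 * n ^ 2 := by
      rw [Finset.product_eq_sprod, Finset.card_product, Finset.card_range]
    rw [this]; push_cast; exact le_of_eq (by ring)
  · filter_upwards [hnh] with n hn l hl
    obtain ⟨h1, h2, h3, h4, h5⟩ := (hψ n hn).1 l.1 (hmem hl).1
    obtain ⟨h1', h2', h3', h4', h5'⟩ := (hψ' n hn).1 l.2 (hmem hl).2
    refine ⟨(h1.comp measurable_fst).mul (h1'.comp measurable_snd), fun w => ?_,
      ⟨_, Window.mono (hbw n) ((le_max_left _ _).trans (le_max_left _ _)) h2, _,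
        Window.mono (hbw n) ((le_max_right _ _).trans (le_max_left _ _)) h2', fun w => rfl⟩,
      (Window.integrable h2).mul_prod (Window.integrable h2')⟩
    rw [abs_mul]
    exact mul_le_mul (h5 _).1 (h5' _).1 (abs_nonneg _) (h2.2.1 _)
  · filter_upwards [hnh, hρ] with n hn hρ l hl
    obtain ⟨h1, h2, h3, h4, h5⟩ := (hψ n hn).1 l.1 (hmem hl).1
    obtain ⟨h1', h2', h3', h4', h5'⟩ := (hψ' n hn).1 l.2 (hmem hl).2
    exact hprod n hn hρ (le_max_left _ _) (le_max_right _ _) h3 h2' (Or.inl h4)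
  · filter_upwards [hnh] with n hn l hl
    exact (Window.integrable ((hψ n hn).1 l.1 (hmem hl).1).2.2.1).mul_prod
      (Window.integrable ((hψ' n hn).1 l.2 (hmem hl).2).2.1)
  · filter_upwards [hnh, hρ] with n hn hρ l hl
    obtain ⟨h1, h2, h3, h4, h5⟩ := (hψ n hn).1 l.1 (hmem hl).1
    obtain ⟨h1', h2', h3', h4', h5'⟩ := (hψ' n hn).1 l.2 (hmem hl).2
    exact hprod n hn hρ (le_max_left _ _) (le_max_right _ _) h2 h3' (Or.inr h4')
  · filter_upwards [hnh] with n hn l hl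
    exact (Window.integrable ((hψ n hn).1 l.1 (hmem hl).1).2.1).mul_prod
      (Window.integrable ((hψ' n hn).1 l.2 (hmem hl).2).2.2.1)
  · filter_upwards [hnh] with n hn θ
    obtain ⟨l, hl, hlx⟩ := (hψ n hn).2 θ.1 θ.1.2
    obtain ⟨l', hl', hlx'⟩ := (hψ' n hn).2 θ.2 θ.2.2
    refine ⟨(l, l'), Finset.mem_product.2 ⟨Finset.mem_range.2 hl, Finset.mem_range.2 hl'⟩,
      fun w => ?_⟩
    have h3 := ((hψ n hn).1 l hl).2.2.1
    have h5 := ((hψ n hn).1 l hl).2.2.2.2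
    set A := scaledMoment K (bw n) p (w.1 - θ.1)
    set A' := scaledMoment K (bw n) q (w.2 - θ.2)
    -- Telescoping the product explains the two brackets: `D W'` for replacing the first factor, `W
    -- D'` for replacing the second.
    have e : A * A' - ψ n l w.1 * ψ' n l' w.2 =
        (A - ψ n l w.1) * A' + ψ n l w.1 * (A' - ψ' n l' w.2) := by ring
    dsimp only
    rw [e]
    refine (abs_add_le _ _).trans ?_
    rw [abs_mul, abs_mul]
    exact add_le_add (mul_le_mul (hlx w.1).1 (hlx' w.2).2 (abs_nonneg _) (h3.2.1 _))
      (mul_le_mul (h5 w.1).1 (hlx' w.2).1 (abs_nonneg _) ((abs_nonneg _).trans (h5 w.1).1))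

end KernelWeights

end Uniform

/-! ## Coercive matrices -/

section Coercive

open Matrix

variable {d : ℕ} {A B : Matrix (Fin d) (Fin d) ℝ} {c : ℝ}

/-- The quadratic form of `A` is at least `c` times the squared Euclidean norm. -/
def Coercive (A : Matrix (Fin d) (Fin d) ℝ) (c : ℝ) : Prop :=
  ∀ θ : Fin d → ℝ, c * ∑ p, θ p ^ 2 ≤ ∑ p, θ p * (A *ᵥ θ) p

/-- Keeping only the largest entry `θ p₀` on the left of the coercivity inequality gives `c |θ p₀|²
≤ d |θ p₀| R`, and one factor cancels. -/
lemma Coercive.abs_entry_le (hA : Coercive A c) (hc : 0 < c) {θ : Fin d → ℝ} {R : ℝ}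
    (hR : ∀ p, |(A *ᵥ θ) p| ≤ R) (p : Fin d) : |θ p| ≤ d * R / c := by
  have : Nonempty (Fin d) := ⟨p⟩
  obtain ⟨p₀, hp₀⟩ := Finite.exists_max fun p => |θ p|
  refine (hp₀ p).trans ?_
  have hR0 : 0 ≤ R := (abs_nonneg _).trans (hR p)
  have h1 : c * |θ p₀| ^ 2 ≤ d * (|θ p₀| * R) := by
    calc c * |θ p₀| ^ 2 ≤ c * ∑ p, θ p ^ 2 := by
          rw [sq_abs]
          gcongr
          exact Finset.single_le_sum (f := fun p => θ p ^ 2) (fun _ _ => sq_nonneg _)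
            (Finset.mem_univ p₀)
      _ ≤ ∑ p, θ p * (A *ᵥ θ) p := hA θ
      _ ≤ ∑ _p : Fin d, |θ p₀| * R := by
          refine Finset.sum_le_sum fun q _ => (le_abs_self _).trans ?_
          rw [abs_mul]
          exact mul_le_mul (hp₀ q) (hR q) (abs_nonneg _) (abs_nonneg _)
      _ = d * (|θ p₀| * R) := by simp
  rw [le_div_iff₀ hc]
  rcases (abs_nonneg (θ p₀)).eq_or_lt with h0 | h0
  · rw [← h0, zero_mul]; positivity
  · nlinarith

/-- The two quadratic forms differ by at most `ε (∑ |θ p|)²`, which is at most `d ε ∑ θ p²` by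
Cauchy–Schwarz; half of the coercivity constant absorbs this. -/
lemma Coercive.perturb (hA : Coercive A c) {ε : ℝ} (hB : ∀ p q, |B p q - A p q| ≤ ε)
    (hε : d * ε ≤ c / 2) : Coercive B (c / 2) := by
  intro θ
  have h1 := hA θ
  have h2 : |∑ p, θ p * (B *ᵥ θ) p - ∑ p, θ p * (A *ᵥ θ) p| ≤ ε * (∑ p, |θ p|) ^ 2 := by
    rw [← Finset.sum_sub_distrib, sq, Finset.sum_mul_sum, Finset.mul_sum]
    refine (Finset.abs_sum_le_sum_abs _ _).trans (Finset.sum_le_sum fun p _ => ?_)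
    rw [← mul_sub, ← Pi.sub_apply, ← Matrix.sub_mulVec, abs_mul, Matrix.mulVec, dotProduct,
      Finset.mul_sum]
    refine (mul_le_mul_of_nonneg_left (Finset.abs_sum_le_sum_abs _ _) (abs_nonneg _)).trans ?_
    rw [Finset.mul_sum]
    refine Finset.sum_le_sum fun q _ => ?_
    rw [abs_mul, Matrix.sub_apply]
    have := mul_le_mul_of_nonneg_right (hB p q) (mul_nonneg (abs_nonneg (θ p)) (abs_nonneg (θ q)))
    linarith
  rcases Nat.eq_zero_or_pos d with rfl | hd
  · simp
  have hε0 : 0 ≤ ε := (abs_nonneg _).trans (hB ⟨0, hd⟩ ⟨0, hd⟩)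
  have h3 : (∑ p, |θ p|) ^ 2 ≤ d * ∑ p, θ p ^ 2 := by
    have := sq_sum_le_card_mul_sum_sq (s := Finset.univ) (f := fun p => |θ p|)
    simpa using this
  have h4 : ε * (∑ p, |θ p|) ^ 2 ≤ c / 2 * ∑ p, θ p ^ 2 :=
    calc ε * (∑ p, |θ p|) ^ 2 ≤ ε * (d * ∑ p, θ p ^ 2) := by gcongr
      _ = d * ε * ∑ p, θ p ^ 2 := by ring
      _ ≤ _ := mul_le_mul_of_nonneg_right hε (Finset.sum_nonneg fun _ _ => sq_nonneg _)
  have := (abs_le.1 h2).1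
  linarith

lemma Coercive.isUnit_det (hA : Coercive A c) (hc : 0 < c) : IsUnit A.det := by
  rw [isUnit_iff_ne_zero]
  intro hdet
  obtain ⟨v, hv, hv0⟩ := Matrix.exists_mulVec_eq_zero_iff.2 hdet
  refine hv (funext fun p => ?_)
  have := hA.abs_entry_le hc (θ := v) (R := 0) (fun p => by rw [hv0]; simp) p
  simpa using this

/-- A column of the inverse solves the linear system whose right side is a unit vector. -/
lemma Coercive.abs_inv_le (hA : Coercive A c) (hc : 0 < c) (p q : Fin d) :
    |A⁻¹ p q| ≤ d / c := by
  have hmul : A * A⁻¹ = 1 := Matrix.mul_nonsing_inv _ (hA.isUnit_det hc)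
  have h1 : A *ᵥ (fun p => A⁻¹ p q) = fun p => (1 : Matrix (Fin d) (Fin d) ℝ) p q := by
    rw [← hmul]; rfl
  have := hA.abs_entry_le hc (θ := fun p => A⁻¹ p q) (R := 1) (fun p => by
    rw [h1]
    change |(1 : Matrix (Fin d) (Fin d) ℝ) p q| ≤ 1
    rw [Matrix.one_apply]; split_ifs <;> simp) p
  simpa using this

/-- The inverse is the adjugate divided by the determinant, with value zero at singular matrices.
This formula is measurable in the entries without any assumption of nonsingularity. -/
lemma measurable_matrix_inv {α : Type*} [MeasurableSpace α] {A : α → Matrix (Fin d) (Fin d) ℝ}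
    (hA : ∀ p q, Measurable fun x => A x p q) (p q : Fin d) :
    Measurable fun x => (A x)⁻¹ p q := by
  have hdet : ∀ {B : α → Matrix (Fin d) (Fin d) ℝ}, (∀ p q, Measurable fun x => B x p q) →
      Measurable fun x => (B x).det := fun hB => by
    simp only [Matrix.det_apply']
    exact Finset.measurable_fun_sum _ fun σ _ => measurable_const.mul
      (Finset.measurable_fun_prod _ fun i _ => hB _ _)
  simp only [Matrix.inv_def, Matrix.smul_apply, Matrix.adjugate_apply, Ring.inverse_eq_inv',
    smul_eq_mul]
  refine (hdet hA).inv.mul (hdet fun r s => ?_)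
  by_cases hr : r = q
  · subst hr; simp only [Matrix.updateRow_self]; exact measurable_const
  · simp only [Matrix.updateRow_ne hr]; exact hA r s

end Coercive

/-! ## Weighted least squares -/

section LeastSquares

open Matrix

variable {d n : ℕ} {m : ℕ → ℕ} {u : Fin d → ℕ → ℕ → ℕ → ℝ} {W Z ζ : ℕ → ℕ → ℕ → ℝ}

/-- The Gram matrix of the regressors `u` with weights `W`. -/
noncomputable def gramMatrix (n : ℕ) (m : ℕ → ℕ) (u : Fin d → ℕ → ℕ → ℕ → ℝ) (W : ℕ → ℕ → ℕ → ℝ) :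
    Matrix (Fin d) (Fin d) ℝ :=
  Matrix.of fun p q => curveAvg n m fun i j k => u p i j k * u q i j k * W i j k

/-- The weighted cross moments of the responses `Z` and the regressors `u`. -/
noncomputable def crossMoment (n : ℕ) (m : ℕ → ℕ) (u : Fin d → ℕ → ℕ → ℕ → ℝ)
    (W Z : ℕ → ℕ → ℕ → ℝ) (p : Fin d) : ℝ :=
  curveAvg n m fun i j k => Z i j k * u p i j k * W i j k

/-- The normal equations. -/
lemma gram_mulVec_eq_of_minimizer {θ : Fin d → ℝ}
    (hmin : ∀ η : Fin d → ℝ,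
      curveAvg n m (fun i j k => (Z i j k - ∑ q, θ q * u q i j k) ^ 2 * W i j k) ≤
      curveAvg n m (fun i j k => (Z i j k - ∑ q, η q * u q i j k) ^ 2 * W i j k)) :
    gramMatrix n m u W *ᵥ θ = crossMoment n m u W Z := by
  funext p
  set e : ℕ → ℕ → ℕ → ℝ := fun i j k => Z i j k - ∑ q, θ q * u q i j k with he
  set A := curveAvg n m fun i j k => e i j k * u p i j k * W i j k with hA
  set B := curveAvg n m fun i j k => u p i j k ^ 2 * W i j k with hB
  -- Moving coordinate `p` by `ε` changes the criterion by a quadratic polynomial in `ε` whose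
  -- linear coefficient is `-2 A`. Minimality makes the polynomial nonnegative, which forces `A =
  -- 0`.
  have hquad : ∀ ε : ℝ, 0 ≤ -2 * ε * A + ε ^ 2 * B := fun ε => by
    have h1 := hmin fun q => θ q + if q = p then ε else 0
    have h2 : curveAvg n m (fun i j k => (Z i j k - ∑ q, (θ q + if q = p then ε else 0) *
        u q i j k) ^ 2 * W i j k) = curveAvg n m (fun i j k => e i j k ^ 2 * W i j k) +
        (-2 * ε * A + ε ^ 2 * B) := by
      rw [hA, hB, ← curveAvg_const_mul, ← curveAvg_const_mul, ← curveAvg_add, ← curveAvg_add]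
      congr 1; ext i j k
      have : ∑ q, (θ q + if q = p then ε else 0) * u q i j k =
          ∑ q, θ q * u q i j k + ε * u p i j k := by
        simp [add_mul, Finset.sum_add_distrib]
      rw [this]; simp only [he]; ring
    rw [h2] at h1
    linarith
  have hA0 : A = 0 := by
    by_contra hne
    have hpos : 0 < |B| + 1 := by positivity
    -- A step in the descent direction, scaled by `|B| + 1` so that the linear term dominates the
    -- quadratic one.
    have h1 := hquad (A / (|B| + 1))
    have h2 : -2 * (A / (|B| + 1)) * A + (A / (|B| + 1)) ^ 2 * B =
        (A ^ 2 / (|B| + 1) ^ 2) * (-2 * (|B| + 1) + B) := by field_simp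
    rw [h2] at h1
    have h3 : 0 < A ^ 2 / (|B| + 1) ^ 2 := by positivity
    have h4 : -2 * (|B| + 1) + B < 0 := by linarith [le_abs_self B, abs_nonneg B]
    nlinarith
  have : crossMoment n m u W Z p - (gramMatrix n m u W *ᵥ θ) p = A := by
    simp only [crossMoment, Matrix.mulVec, dotProduct, gramMatrix, Matrix.of_apply]
    rw [show (∑ q, curveAvg n m (fun i j k => u p i j k * u q i j k * W i j k) * θ q) =
      curveAvg n m (fun i j k => ∑ q, θ q * (u p i j k * u q i j k * W i j k)) by
        rw [curveAvg_finsetSum]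
        exact Finset.sum_congr rfl fun q _ => by rw [curveAvg_const_mul, mul_comm],
      ← curveAvg_sub, hA]
    congr 1; ext i j k
    simp only [he, sub_mul, Finset.sum_mul]
    congr 1
    exact Finset.sum_congr rfl fun q _ => by ring
  linarith

lemma gram_mulVec (β : Fin d → ℝ) :
    gramMatrix n m u W *ᵥ β = crossMoment n m u W fun i j k => ∑ q, β q * u q i j k := by
  funext p
  simp only [crossMoment, Matrix.mulVec, dotProduct, gramMatrix, Matrix.of_apply]
  rw [show (fun i j k => (∑ q, β q * u q i j k) * u p i j k * W i j k) =
    fun i j k => ∑ q, β q * (u p i j k * u q i j k * W i j k) by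
      ext i j k; rw [Finset.sum_mul, Finset.sum_mul]
      exact Finset.sum_congr rfl fun q _ => by ring, curveAvg_finsetSum]
  exact Finset.sum_congr rfl fun q _ => by rw [curveAvg_const_mul, mul_comm]

variable {u : Fin (d + 1) → ℕ → ℕ → ℕ → ℝ}

/-- Error bounds for the solution of the normal equations, and its linearization. -/
lemma least_squares_error {θ β : Fin (d + 1) → ℝ} {A : Matrix (Fin (d + 1)) (Fin (d + 1)) ℝ}
    {c δ δ' κ w : ℝ} (hθ : gramMatrix n m u W *ᵥ θ = crossMoment n m u W Z)
    (hrem : ∀ i j k, |Z i j k - ∑ q, β q * u q i j k - ζ i j k| * W i j k ≤ κ * W i j k)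
    (hu : ∀ p i j k, |u p i j k| * W i j k ≤ W i j k) (hκ : 0 ≤ κ)
    (hA : Coercive A c) (hc : 0 < c) (hδ : ∀ p q, |gramMatrix n m u W p q - A p q| ≤ δ)
    (hδc : (d + 1 : ℕ) * δ ≤ c / 2) (hζ : ∀ p, |crossMoment n m u W ζ p| ≤ δ')
    (hw : curveAvg n m W ≤ w) (hW : ∀ i j k, 0 ≤ W i j k) :
    |θ 0 - β 0| ≤ (d + 1 : ℕ) * (δ' + κ * w) / (c / 2) ∧
    |θ 0 - β 0 - ∑ q, A⁻¹ 0 q * crossMoment n m u W ζ q| ≤ (d + 1 : ℕ) * ((d + 1 : ℕ) / c *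
      (κ * w + (d + 1 : ℕ) * (δ * ((d + 1 : ℕ) * (δ' + κ * w) / (c / 2))))) := by
  set G := gramMatrix n m u W with hG
  have hGc : Coercive G (c / 2) := hA.perturb hδ hδc
  set R : Fin (d + 1) → ℝ := crossMoment n m u W fun i j k =>
    Z i j k - ∑ q, β q * u q i j k - ζ i j k with hR
  have hRb : ∀ p, |R p| ≤ κ * w := fun p => by
    calc |R p| ≤ curveAvg n m fun i j k => κ * W i j k := by
          refine abs_curveAvg_le fun i j k => ?_
          rw [abs_mul, abs_mul, abs_of_nonneg (hW i j k), mul_assoc]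
          calc _ ≤ |Z i j k - ∑ q, β q * u q i j k - ζ i j k| * W i j k := by
                gcongr; exact hu p i j k
            _ ≤ _ := hrem i j k
      _ = κ * curveAvg n m W := curveAvg_const_mul _ _
      _ ≤ κ * w := by gcongr
  -- Subtracting `G β`, the moments of the fitted polynomial, from the normal equations leaves the
  -- noise and the Taylor remainder as the right side for `θ - β`.
  have hsplit : G *ᵥ (θ - β) = fun p => crossMoment n m u W ζ p + R p := by
    rw [Matrix.mulVec_sub, hθ, hG, gram_mulVec]
    funext p
    simp only [Pi.sub_apply, hR, crossMoment]
    rw [← curveAvg_sub, ← curveAvg_add]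
    congr 1; ext i j k; ring
  have hb : ∀ p, |(θ - β) p| ≤ (d + 1 : ℕ) * (δ' + κ * w) / (c / 2) :=
    hGc.abs_entry_le (by positivity) fun p => by
      rw [hsplit]
      exact (abs_add_le _ _).trans (add_le_add (hζ p) (hRb p))
  refine ⟨hb 0, ?_⟩
  set D := (d + 1 : ℕ) * (δ' + κ * w) / (c / 2) with hD
  have hinv : A⁻¹ *ᵥ (A *ᵥ (θ - β)) = θ - β := by
    rw [Matrix.mulVec_mulVec, Matrix.nonsing_inv_mul _ (hA.isUnit_det hc), Matrix.one_mulVec]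
  -- Replacing `G` by the deterministic matrix `A` costs `(G - A)(θ - β)`, a product of two small
  -- quantities; hence the linearization error is of second order up to the bias.
  have hA' : A *ᵥ (θ - β) = fun p => crossMoment n m u W ζ p +
      (R p - ((G - A) *ᵥ (θ - β)) p) := by
    funext p
    rw [Matrix.sub_mulVec, hsplit, Pi.sub_apply]; ring
  have h0 : θ 0 - β 0 - ∑ q, A⁻¹ 0 q * crossMoment n m u W ζ q =
      ∑ q, A⁻¹ 0 q * (R q - ((G - A) *ᵥ (θ - β)) q) := by
    have := congrFun hinv 0
    rw [hA'] at this
    simp only [Matrix.mulVec, dotProduct, Pi.sub_apply, mul_add, Finset.sum_add_distrib] at this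
    rw [← this]
    simp [Matrix.mulVec, dotProduct]
  rw [h0]
  have hδ0 : 0 ≤ δ := (abs_nonneg _).trans (hδ 0 0)
  have hGA : ∀ q, |((G - A) *ᵥ (θ - β)) q| ≤ (d + 1 : ℕ) * (δ * D) := fun q => by
    rw [Matrix.mulVec, dotProduct]
    refine (Finset.abs_sum_le_sum_abs _ _).trans
      ((Finset.sum_le_sum (g := fun _ => δ * D) fun r _ => ?_).trans (le_of_eq (by simp)))
    rw [abs_mul]
    exact mul_le_mul (hδ q r) (hb r) (abs_nonneg _) hδ0
  refine (Finset.abs_sum_le_sum_abs _ _).trans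
    ((Finset.sum_le_sum (g := fun _ => (d + 1 : ℕ) / c * (κ * w + (d + 1 : ℕ) * (δ * D)))
      fun q _ => ?_).trans (le_of_eq (by simp)))
  rw [abs_mul]
  refine mul_le_mul (hA.abs_inv_le hc 0 q) ((abs_sub _ _).trans (add_le_add (hRb q) (hGA q)))
    (abs_nonneg _) (by positivity)

end LeastSquares

/-! ## The local-linear criteria -/

section Loss

variable {K : ℝ → ℝ} {h : ℝ} {n : ℕ} {m : ℕ → ℕ} {τ Z Y : ℕ → ℕ → ℝ}

/-- The regressors of the univariate smoother at `t`. -/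
noncomputable def regressor₁ (h t : ℝ) (p : Fin 2) (w : ℝ × ℝ) : ℝ := ((w.1 - t) / h) ^ (p : ℕ)

/-- The weights of the univariate smoother at `t`. -/
noncomputable def weight₁ (K : ℝ → ℝ) (h t : ℝ) (w : ℝ × ℝ) : ℝ := scaledKernel K h (w.1 - t)

/-- The regressors of the bivariate smoother at `(s,t)`. -/
noncomputable def regressor₂ (h s t : ℝ) (p : Fin 3) (w : ℝ × ℝ) : ℝ :=
  ((w.1 - s) / h) ^ (![0, 1, 0] p : ℕ) * ((w.2 - t) / h) ^ (![0, 0, 1] p : ℕ)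

/-- The weights of the bivariate smoother at `(s,t)`. -/
noncomputable def weight₂ (K : ℝ → ℝ) (h s t : ℝ) (w : ℝ × ℝ) : ℝ :=
  scaledKernel K h (w.1 - s) * scaledKernel K h (w.2 - t)

/-- Since every curve has a pair of observations, the univariate criterion is a pair average that
ignores the second index. Both smoothers thus share one least-squares theory. -/
lemma loss₁_eq_curveAvg (hm : ∀ i < n, 2 ≤ m i) (t a₀ a₁ : ℝ) :
    loss₁ K h n m τ Z t a₀ a₁ = curveAvg n m fun i j _ =>
      (Z i j - a₀ - a₁ * (τ i j - t)) ^ 2 * scaledKernel K h (τ i j - t) := by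
  rw [loss₁, curveAvg]
  congr 1
  refine Finset.sum_congr rfl fun i hi => ?_
  rw [pairAvg_fst (hm i (Finset.mem_range.1 hi))
    fun j => (Z i j - a₀ - a₁ * (τ i j - t)) ^ 2 * scaledKernel K h (τ i j - t)]

/-- Multiplying the slope by `h` turns the regressors into powers of `(x - t) / h`, which are at
most one on the support of the weight. This makes Gram bounds uniform in the bandwidth and leaves
the intercept unchanged. -/
lemma FunctionalData.IsLocalLinearFit₁.normal_equations (hh : h ≠ 0) (hm : ∀ i < n, 2 ≤ m i)
    {t a₀ : ℝ} (hfit : IsLocalLinearFit₁ K h n m τ Z t a₀) :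
    ∃ θ : Fin 2 → ℝ, θ 0 = a₀ ∧
      (gramMatrix n m (fun p i j k => regressor₁ h t p (τ i j, τ i k))
        (fun i j k => weight₁ K h t (τ i j, τ i k))).mulVec θ =
      crossMoment n m (fun p i j k => regressor₁ h t p (τ i j, τ i k))
        (fun i j k => weight₁ K h t (τ i j, τ i k)) fun i j _ => Z i j := by
  obtain ⟨a₁, hmin⟩ := hfit
  refine ⟨![a₀, h * a₁], rfl, gram_mulVec_eq_of_minimizer fun η => ?_⟩
  have e : ∀ c₀ c₁ : ℝ, loss₁ K h n m τ Z t c₀ c₁ = curveAvg n m (fun i j k =>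
      (Z i j - ∑ q, ![c₀, h * c₁] q * regressor₁ h t q (τ i j, τ i k)) ^ 2 *
        weight₁ K h t (τ i j, τ i k)) := fun c₀ c₁ => by
    rw [loss₁_eq_curveAvg hm]
    congr 1; ext i j k
    simp only [Fin.sum_univ_two, regressor₁, weight₁, Matrix.cons_val_zero, Matrix.cons_val_one,
      Fin.val_zero, Fin.val_one, pow_zero, pow_one, mul_one]
    congr 2
    field_simp
    ring
  have := hmin (η 0) (η 1 / h)
  rw [e, e] at this
  have hη : ![η 0, h * (η 1 / h)] = η := by
    ext p; fin_cases p
    · rfl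
    · simp [mul_div_cancel₀ _ hh]
  rwa [hη] at this

lemma FunctionalData.IsLocalLinearFit₂.normal_equations (hh : h ≠ 0)
    {s t a₀ : ℝ} (hfit : IsLocalLinearFit₂ K h n m τ Y s t a₀) :
    ∃ θ : Fin 3 → ℝ, θ 0 = a₀ ∧
      (gramMatrix n m (fun p i j k => regressor₂ h s t p (τ i j, τ i k))
        (fun i j k => weight₂ K h s t (τ i j, τ i k))).mulVec θ =
      crossMoment n m (fun p i j k => regressor₂ h s t p (τ i j, τ i k))
        (fun i j k => weight₂ K h s t (τ i j, τ i k)) fun i j k => Y i j * Y i k := by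
  obtain ⟨a₁, a₂, hmin⟩ := hfit
  refine ⟨![a₀, h * a₁, h * a₂], rfl, gram_mulVec_eq_of_minimizer fun η => ?_⟩
  have e : ∀ c₀ c₁ c₂ : ℝ, loss₂ K h n m τ Y s t c₀ c₁ c₂ = curveAvg n m (fun i j k =>
      (Y i j * Y i k - ∑ q, ![c₀, h * c₁, h * c₂] q * regressor₂ h s t q (τ i j, τ i k)) ^ 2 *
        weight₂ K h s t (τ i j, τ i k)) := fun c₀ c₁ c₂ => by
    rw [loss₂, curveAvg]
    simp only [pairAvg]
    congr 1
    refine Finset.sum_congr rfl fun i _ => ?_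
    congr 1
    refine Finset.sum_congr rfl fun j _ => Finset.sum_congr rfl fun k _ => ?_
    simp only [Fin.sum_univ_three, regressor₂, weight₂, Matrix.cons_val_zero, Matrix.cons_val_one,
      Matrix.cons_val, pow_zero, pow_one, mul_one, one_mul]
    congr 2
    field_simp
    ring
  have := hmin (η 0) (η 1 / h) (η 2 / h)
  rw [e, e] at this
  have hη : ![η 0, h * (η 1 / h), h * (η 2 / h)] = η := by
    ext p; fin_cases p
    · rfl
    · simp [mul_div_cancel₀ _ hh]
    · simp [mul_div_cancel₀ _ hh]
  rwa [hη] at this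

end Loss

/-! ## Coercivity of the population Gram matrices -/

section Population

/-- The population Gram matrix of the regressors `u` with weights `W`. -/
noncomputable def populationGram {d : ℕ} (μ : Measure (ℝ × ℝ)) (u : Fin d → ℝ × ℝ → ℝ)
    (W : ℝ × ℝ → ℝ) : Matrix (Fin d) (Fin d) ℝ :=
  Matrix.of fun p q => ∫ w, u p w * u q w * W w ∂μ

lemma coercive_populationGram {d : ℕ} {μ : Measure (ℝ × ℝ)} {u : Fin d → ℝ × ℝ → ℝ}
    {W : ℝ × ℝ → ℝ} {c : ℝ} (hi : ∀ p q, Integrable (fun w => u p w * u q w * W w) μ)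
    (h : ∀ θ : Fin d → ℝ, c * ∑ p, θ p ^ 2 ≤ ∫ w, (∑ p, θ p * u p w) ^ 2 * W w ∂μ) :
    Coercive (populationGram μ u W) c := by
  intro θ
  refine (h θ).trans (le_of_eq ?_)
  have e : ∀ w, (∑ p, θ p * u p w) ^ 2 * W w =
      ∑ p, ∑ q, θ p * θ q * (u p w * u q w * W w) := fun w => by
    rw [sq, Finset.sum_mul_sum, Finset.sum_mul]
    refine Finset.sum_congr rfl fun p _ => ?_
    rw [Finset.sum_mul]
    exact Finset.sum_congr rfl fun q _ => by ring
  simp only [e]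
  rw [integral_finsetSum _ fun p _ => integrable_finsetSum _ fun q _ => (hi p q).const_mul _]
  refine Finset.sum_congr rfl fun p _ => ?_
  rw [integral_finsetSum _ fun q _ => (hi p q).const_mul _, Matrix.mulVec, dotProduct,
    Finset.mul_sum]
  refine Finset.sum_congr rfl fun q _ => ?_
  rw [integral_const_mul, populationGram, Matrix.of_apply]
  ring

variable {K : ℝ → ℝ} {a b mT MT : ℝ} {τ : Measure ℝ}

lemma intervalIntegrable_mul_kernel (hK : KernelCond K) {g : ℝ → ℝ} (hg : Continuous g)
    (x y : ℝ) : IntervalIntegrable (fun u => g u * K u) volume x y :=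
  (((integrable_kernel hK).intervalIntegrable).continuousOn_mul hg.continuousOn)

lemma integral_kernel_half (hK : KernelCond K) : ∫ u in (0 : ℝ)..1, K u = 1 / 2 := by
  have hi : ∀ x y, IntervalIntegrable K volume x y := fun x y =>
    (integrable_kernel hK).intervalIntegrable
  have h1 : ∫ u in (-1 : ℝ)..1, K u = 1 := by
    rw [intervalIntegral.integral_of_le (by norm_num), ← integral_Icc_eq_integral_Ioc,
      setIntegral_eq_integral_of_forall_compl_eq_zero fun u hu => hK.support u hu,
      hK.integral_eq_one]
  have h2 : ∫ u in (-1 : ℝ)..0, K u = ∫ u in (0 : ℝ)..1, K u := by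
    have := intervalIntegral.integral_comp_neg (a := -1) (b := 0) K
    simp only [hK.symm, neg_zero, neg_neg] at this
    exact this
  have h3 := intervalIntegral.integral_add_adjacent_intervals (hi (-1) 0) (hi 0 1)
  rw [h1, h2] at h3
  linarith

/-- The kernel restricted to `[0,1]` has positive definite moments. -/
lemma exists_kernel_quadratic_le (hK : KernelCond K) : ∃ c : ℝ, 0 < c ∧ ∀ α β : ℝ,
    c * (α ^ 2 + β ^ 2) ≤ ∫ u in (0 : ℝ)..1, (α + β * u) ^ 2 * K u := by
  set k₀ := ∫ u in (0 : ℝ)..1, K u with hk₀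
  set k₁ := ∫ u in (0 : ℝ)..1, u * K u with hk₁
  set k₂ := ∫ u in (0 : ℝ)..1, u ^ 2 * K u with hk₂
  have hk : k₀ = 1 / 2 := integral_kernel_half hK
  have hi0 : IntervalIntegrable K volume 0 1 := (integrable_kernel hK).intervalIntegrable
  have hi1 : IntervalIntegrable (fun u => u * K u) volume 0 1 :=
    intervalIntegrable_mul_kernel hK continuous_id 0 1
  have hi2 : IntervalIntegrable (fun u => u ^ 2 * K u) volume 0 1 :=
    intervalIntegrable_mul_kernel hK (continuous_pow 2) 0 1
  have hexp : ∀ α β : ℝ, ∫ u in (0 : ℝ)..1, (α + β * u) ^ 2 * K u =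
      α ^ 2 * k₀ + 2 * α * β * k₁ + β ^ 2 * k₂ := fun α β => by
    have e : ∀ u, (α + β * u) ^ 2 * K u =
        α ^ 2 * K u + 2 * α * β * (u * K u) + β ^ 2 * (u ^ 2 * K u) := fun u => by ring
    simp only [e]
    have i01 : IntervalIntegrable (fun u => α ^ 2 * K u + 2 * α * β * (u * K u)) volume 0 1 :=
      (hi0.const_mul _).add (hi1.const_mul _)
    rw [intervalIntegral.integral_add i01 (hi2.const_mul _),
      intervalIntegral.integral_add (hi0.const_mul _) (hi1.const_mul _),
      intervalIntegral.integral_const_mul, intervalIntegral.integral_const_mul,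
      intervalIntegral.integral_const_mul]
  -- Completing the square writes the form as `k₀ (α + β r)² + β² V`, where `r` is the barycentre of
  -- the kernel on `[0,1]` and `V` its second moment about `r`.
  set r := k₁ / k₀ with hr
  have hk₀p : 0 < k₀ := by rw [hk]; norm_num
  set V := ∫ u in (0 : ℝ)..1, (-r + 1 * u) ^ 2 * K u with hV
  -- If `V` vanished, the kernel would be zero almost everywhere on `(0,1]`, the single point `r`
  -- being negligible; but half of its mass lies there.
  have hVpos : 0 < V := by
    have hnn : ∀ u, 0 ≤ (-r + 1 * u) ^ 2 * K u := fun u => mul_nonneg (sq_nonneg _) (hK.nonneg u)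
    have hV0 : 0 ≤ V := intervalIntegral.integral_nonneg zero_le_one fun u _ => hnn u
    refine lt_of_le_of_ne hV0 fun hzero => ?_
    rw [hV, intervalIntegral.integral_of_le zero_le_one] at hzero
    have hint : IntegrableOn (fun u => (-r + 1 * u) ^ 2 * K u) (Ioc 0 1) :=
      (intervalIntegrable_iff_integrableOn_Ioc_of_le zero_le_one).1
        (intervalIntegrable_mul_kernel hK (by fun_prop) 0 1)
    have hae := (setIntegral_eq_zero_iff_of_nonneg_ae (ae_of_all _ hnn) hint).1 hzero.symm
    have hKae : K =ᵐ[volume.restrict (Ioc 0 1)] 0 := by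
      have hne : ∀ᵐ u ∂(volume.restrict (Ioc (0 : ℝ) 1)), u ≠ r := by
        rw [ae_iff]; simp
      filter_upwards [hae, hne] with u hu hur
      rcases mul_eq_zero.1 hu with h | h
      · exact absurd (by linarith [pow_eq_zero_iff (n := 2) (by norm_num) |>.1 h]) hur
      · exact h
    have : k₀ = 0 := by
      rw [hk₀, intervalIntegral.integral_of_le zero_le_one, integral_congr_ae hKae]; simp
    linarith
  have hVeq : V = k₂ - k₁ ^ 2 / k₀ := by
    rw [hV, hexp, hr]; field_simp; ring
  -- From `α² ≤ 2 (α + β r)² + 2 β² r²` one gets `α² + β² ≤ 2 (α + β r)² + (1 + 2 r²) β²`; the two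
  -- coefficients are compared with `k₀` and `V`.
  refine ⟨(2 / k₀ + (1 + 2 * r ^ 2) / V)⁻¹, by positivity, fun α β => ?_⟩
  rw [inv_mul_le_iff₀ (by positivity), hexp]
  have e : α ^ 2 * k₀ + 2 * α * β * k₁ + β ^ 2 * k₂ = k₀ * (α + β * r) ^ 2 + β ^ 2 * V := by
    rw [hVeq, hr]; field_simp; ring
  rw [e]
  have h1 : α ^ 2 ≤ 2 * (α + β * r) ^ 2 + 2 * β ^ 2 * r ^ 2 := by
    nlinarith [sq_nonneg (α + 2 * β * r)]
  have h2 : (2 / k₀ + (1 + 2 * r ^ 2) / V) * (k₀ * (α + β * r) ^ 2 + β ^ 2 * V) =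
      2 * (α + β * r) ^ 2 + (1 + 2 * r ^ 2) * β ^ 2 + (2 / k₀) * (β ^ 2 * V) +
        (1 + 2 * r ^ 2) / V * (k₀ * (α + β * r) ^ 2) := by field_simp; ring
  rw [h2]
  have h3 : 0 ≤ (2 / k₀) * (β ^ 2 * V) := by positivity
  have h4 : 0 ≤ (1 + 2 * r ^ 2) / V * (k₀ * (α + β * r) ^ 2) := by positivity
  nlinarith

lemma scaledKernel_le {B : ℝ} (hKB : ∀ u, K u ≤ B) {h : ℝ} (hh : 0 < h) (u : ℝ) :
    scaledKernel K h u ≤ B / h := by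
  rw [div_eq_inv_mul]
  exact mul_le_mul_of_nonneg_left (hKB _) (inv_nonneg.2 hh.le)

lemma integrable_scaledMoment [IsFiniteMeasure τ] (hK : KernelCond K) {h : ℝ} (hh : 0 < h)
    (p : ℕ) (t : ℝ) : Integrable (fun x => scaledMoment K h p (x - t)) τ := by
  obtain ⟨B, hB, hKB⟩ := kernel_bounded hK
  exact Integrable.of_bound ((measurable_scaledMoment hK h p).comp
    (measurable_id.sub_const t)).aestronglyMeasurable (B / h) (ae_of_all _ fun x => by
      rw [Real.norm_eq_abs]
      exact (abs_scaledMoment_le hK hh p _).trans (scaledKernel_le hKB hh _))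

lemma integral_comp_scaled (F : ℝ → ℝ) {h : ℝ} (hh : 0 < h) (t r s : ℝ) :
    ∫ x in (t + h * r)..(t + h * s), h⁻¹ * F ((x - t) / h) = ∫ u in r..s, F u := by
  rw [intervalIntegral.integral_const_mul,
    intervalIntegral.integral_comp_sub_right (fun x => F (x / h)) t,
    intervalIntegral.integral_comp_div F hh.ne', smul_eq_mul, ← mul_assoc,
    inv_mul_cancel₀ hh.ne', one_mul]
  congr 1 <;> field_simp <;> ring

/-- The local quadratic forms of the univariate smoother are uniformly coercive. -/
lemma exists_local_quadratic_le (hK : KernelCond K) [IsProbabilityMeasure τ]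
    (hτ : DesignLaw a b mT MT τ) : ∃ c : ℝ, 0 < c ∧ ∀ h : ℝ, 0 < h → h ≤ (b - a) / 2 →
    ∀ t ∈ Icc a b, ∀ α β : ℝ, c * (α ^ 2 + β ^ 2) ≤
      ∫ x, (α + β * ((x - t) / h)) ^ 2 * scaledKernel K h (x - t) ∂τ := by
  obtain ⟨c, hc, hcK⟩ := exists_kernel_quadratic_le hK
  have hmT := hτ.mT_pos
  refine ⟨mT * c, mul_pos hmT hc, fun h hh hhab t ht α β => ?_⟩
  set q : ℝ → ℝ := fun x => (α + β * ((x - t) / h)) ^ 2 * scaledKernel K h (x - t) with hq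
  have hq0 : ∀ x, 0 ≤ q x := fun x => mul_nonneg (sq_nonneg _) (scaledKernel_nonneg hK hh _)
  have hqe : ∀ x, q x = α ^ 2 * scaledMoment K h 0 (x - t) +
      2 * α * β * scaledMoment K h 1 (x - t) + β ^ 2 * scaledMoment K h 2 (x - t) := fun x => by
    simp only [hq, scaledMoment]; ring
  have hqi : ∀ μ : Measure ℝ, IsFiniteMeasure μ → Integrable q μ := fun μ _ => by
    rw [show q = _ from funext hqe]
    exact (((integrable_scaledMoment hK hh 0 t).const_mul _).add
      ((integrable_scaledMoment hK hh 1 t).const_mul _)).add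
      ((integrable_scaledMoment hK hh 2 t).const_mul _)
  have hset : ∀ r s : ℝ, r ≤ s → a ≤ t + h * r → t + h * s ≤ b →
      ∫ u in r..s, (α + β * u) ^ 2 * K u ≤ ∫ x in Icc a b, q x := fun r s hrs hr hs => by
    rw [← integral_comp_scaled _ hh t r s, intervalIntegral.integral_of_le (by gcongr),
      show (fun x => h⁻¹ * ((α + β * ((x - t) / h)) ^ 2 * K ((x - t) / h))) = q by
        ext x; simp only [hq, scaledKernel]; ring]
    refine setIntegral_mono_set (hqi _ inferInstance) (ae_of_all _ hq0) ?_
    exact (Ioc_subset_Icc_self.trans (Icc_subset_Icc hr hs)).eventuallyLE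
  have hmain : c * (α ^ 2 + β ^ 2) ≤ ∫ x in Icc a b, q x := by
    -- As `h ≤ (b - a) / 2`, at least one of `[t, t + h]` and `[t - h, t]` is contained in `[a,b]`.
    -- Half of the kernel is enough, and symmetry carries the left half to the right one by changing
    -- the sign of the slope.
    rcases le_total (t + h) b with hb | hb
    · exact (hcK α β).trans (hset 0 1 zero_le_one (by linarith [ht.1]) (by linarith))
    · have h1 := hcK α (-β)
      have h2 : ∫ u in (0 : ℝ)..1, (α + -β * u) ^ 2 * K u =
          ∫ u in (-1 : ℝ)..0, (α + β * u) ^ 2 * K u := by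
        have := intervalIntegral.integral_comp_neg (a := 0) (b := 1)
          fun u => (α + β * u) ^ 2 * K u
        simp only [hK.symm, neg_zero, mul_neg] at this
        rw [← this]
        simp only [neg_mul]
      rw [h2, neg_sq] at h1
      exact h1.trans (hset (-1) 0 (by norm_num) (by linarith) (by linarith [ht.2]))
  calc mT * c * (α ^ 2 + β ^ 2) = mT * (c * (α ^ 2 + β ^ 2)) := by ring
    _ ≤ mT * ∫ x in Icc a b, q x := by gcongr
    _ ≤ _ := hτ.le_integral hq0 (hqi τ inferInstance)

lemma regressor₁_mul_weight (h t : ℝ) (p q : Fin 2) (w : ℝ × ℝ) :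
    regressor₁ h t p w * regressor₁ h t q w * weight₁ K h t w =
      scaledMoment K h (p + q) (w.1 - t) := by
  simp only [regressor₁, weight₁, scaledMoment, pow_add]; ring

lemma regressor₂_mul_weight (h s t : ℝ) (p q : Fin 3) (w : ℝ × ℝ) :
    regressor₂ h s t p w * regressor₂ h s t q w * weight₂ K h s t w =
      scaledMoment K h ((![0, 1, 0] p : ℕ) + (![0, 1, 0] q : ℕ)) (w.1 - s) *
        scaledMoment K h ((![0, 0, 1] p : ℕ) + (![0, 0, 1] q : ℕ)) (w.2 - t) := by
  simp only [regressor₂, weight₂, scaledMoment, pow_add]; ring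

lemma integrable_regressor₁ [IsProbabilityMeasure τ] (hK : KernelCond K) {h : ℝ} (hh : 0 < h)
    (t : ℝ) (p q : Fin 2) : Integrable (fun w => regressor₁ h t p w * regressor₁ h t q w *
      weight₁ K h t w) (τ.prod τ) := by
  simp only [regressor₁_mul_weight]
  exact (integrable_scaledMoment hK hh _ t).comp_fst τ

lemma integrable_regressor₂ [IsProbabilityMeasure τ] (hK : KernelCond K) {h : ℝ} (hh : 0 < h)
    (s t : ℝ) (p q : Fin 3) : Integrable (fun w => regressor₂ h s t p w * regressor₂ h s t q w *
      weight₂ K h s t w) (τ.prod τ) := by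
  simp only [regressor₂_mul_weight]
  exact (integrable_scaledMoment hK hh _ s).mul_prod (integrable_scaledMoment hK hh _ t)

lemma exists_coercive₁ (hK : KernelCond K) [IsProbabilityMeasure τ]
    (hτ : DesignLaw a b mT MT τ) : ∃ c : ℝ, 0 < c ∧ ∀ h : ℝ, 0 < h → h ≤ (b - a) / 2 →
    ∀ t ∈ Icc a b,
      Coercive (populationGram (τ.prod τ) (regressor₁ h t) (weight₁ K h t)) c := by
  obtain ⟨c, hc, hq⟩ := exists_local_quadratic_le hK hτ
  refine ⟨c, hc, fun h hh hhab t ht =>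
    coercive_populationGram (integrable_regressor₁ hK hh t) fun θ => ?_⟩
  have := hq h hh hhab t ht (θ 0) (θ 1)
  rw [Fin.sum_univ_two]
  refine this.trans (le_of_eq ?_)
  simp only [Fin.sum_univ_two, regressor₁, weight₁, Fin.val_zero, Fin.val_one, pow_zero, pow_one,
    mul_one]
  rw [integral_fun_fst (fun x => (θ 0 + θ 1 * ((x - t) / h)) ^ 2 * scaledKernel K h (x - t))]
  simp

/-- The univariate bound is used once per variable. For fixed `x` the form in `y` has intercept `θ 0
+ θ 1 (x - s) / h` and slope `θ 2`; its lower bound is then integrated against the kernel in `x`,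
where the univariate bound applies again. -/
lemma exists_coercive₂ (hK : KernelCond K) [IsProbabilityMeasure τ]
    (hτ : DesignLaw a b mT MT τ) : ∃ c : ℝ, 0 < c ∧ ∀ h : ℝ, 0 < h → h ≤ (b - a) / 2 →
    ∀ s ∈ Icc a b, ∀ t ∈ Icc a b,
      Coercive (populationGram (τ.prod τ) (regressor₂ h s t) (weight₂ K h s t)) c := by
  obtain ⟨c, hc, hq⟩ := exists_local_quadratic_le hK hτ
  refine ⟨c * c, mul_pos hc hc, fun h hh hhab s hs t ht =>
    coercive_populationGram (integrable_regressor₂ hK hh s t) fun θ => ?_⟩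
  have hint : Integrable (fun w => (∑ p, θ p * regressor₂ h s t p w) ^ 2 * weight₂ K h s t w)
      (τ.prod τ) := by
    have e : ∀ w, (∑ p, θ p * regressor₂ h s t p w) ^ 2 * weight₂ K h s t w =
        ∑ p, ∑ q, θ p * θ q * (regressor₂ h s t p w * regressor₂ h s t q w *
          weight₂ K h s t w) := fun w => by
      rw [sq, Finset.sum_mul_sum, Finset.sum_mul]
      refine Finset.sum_congr rfl fun p _ => ?_
      rw [Finset.sum_mul]
      exact Finset.sum_congr rfl fun q _ => by ring
    simp only [e]
    exact integrable_finsetSum _ fun p _ => integrable_finsetSum _ fun q _ =>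
      (integrable_regressor₂ hK hh s t p q).const_mul _
  have hinner : ∀ x, c * scaledKernel K h (x - s) *
      ((θ 0 + θ 1 * ((x - s) / h)) ^ 2 + θ 2 ^ 2) ≤
      ∫ y, (∑ p, θ p * regressor₂ h s t p (x, y)) ^ 2 * weight₂ K h s t (x, y) ∂τ := fun x => by
    have e : ∀ y, (∑ p, θ p * regressor₂ h s t p (x, y)) ^ 2 * weight₂ K h s t (x, y) =
        scaledKernel K h (x - s) * ((θ 0 + θ 1 * ((x - s) / h) + θ 2 * ((y - t) / h)) ^ 2 *
          scaledKernel K h (y - t)) := fun y => by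
      simp only [Fin.sum_univ_three, regressor₂, weight₂, Matrix.cons_val_zero,
        Matrix.cons_val_one, Matrix.cons_val, pow_zero, pow_one, mul_one, one_mul]
      ring
    simp only [e]
    rw [integral_const_mul, mul_comm c, mul_assoc]
    exact mul_le_mul_of_nonneg_left (hq h hh hhab t ht _ _) (scaledKernel_nonneg hK hh _)
  rw [integral_prod _ hint]
  have hi0 : Integrable (fun x => (θ 0 + θ 1 * ((x - s) / h)) ^ 2 * scaledKernel K h (x - s)) τ := by
    have e : ∀ x, (θ 0 + θ 1 * ((x - s) / h)) ^ 2 * scaledKernel K h (x - s) =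
        θ 0 ^ 2 * scaledMoment K h 0 (x - s) + 2 * θ 0 * θ 1 * scaledMoment K h 1 (x - s) +
          θ 1 ^ 2 * scaledMoment K h 2 (x - s) := fun x => by
      simp only [scaledMoment]; ring
    simp only [e]
    exact (((integrable_scaledMoment hK hh 0 s).const_mul _).add
      ((integrable_scaledMoment hK hh 1 s).const_mul _)).add
      ((integrable_scaledMoment hK hh 2 s).const_mul _)
  have hi1 : Integrable (fun x => scaledKernel K h (x - s)) τ := by
    simpa [scaledMoment] using integrable_scaledMoment (τ := τ) hK hh 0 s
  have e1 : ∀ x, c * scaledKernel K h (x - s) *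
      ((θ 0 + θ 1 * ((x - s) / h)) ^ 2 + θ 2 ^ 2) =
      c * ((θ 0 + θ 1 * ((x - s) / h)) ^ 2 * scaledKernel K h (x - s)) +
        c * θ 2 ^ 2 * scaledKernel K h (x - s) := fun x => by ring
  have hk : c ≤ ∫ x, scaledKernel K h (x - s) ∂τ := by
    have := hq h hh hhab s hs 1 0
    simpa using this
  calc c * c * ∑ p, θ p ^ 2 = c * (c * (θ 0 ^ 2 + θ 1 ^ 2)) + c * θ 2 ^ 2 * c := by
        rw [Fin.sum_univ_three]; ring
    _ ≤ c * (∫ x, (θ 0 + θ 1 * ((x - s) / h)) ^ 2 * scaledKernel K h (x - s) ∂τ) +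
        c * θ 2 ^ 2 * ∫ x, scaledKernel K h (x - s) ∂τ := by
        gcongr
        exact hq h hh hhab s hs _ _
    _ = ∫ x, c * scaledKernel K h (x - s) *
          ((θ 0 + θ 1 * ((x - s) / h)) ^ 2 + θ 2 ^ 2) ∂τ := by
        simp only [e1]
        rw [integral_add (hi0.const_mul _) (hi1.const_mul _), integral_const_mul,
          integral_const_mul]
    _ ≤ _ := by
        refine integral_mono ?_ hint.integral_prod_left hinner
        simp only [e1]
        exact (hi0.const_mul _).add (hi1.const_mul _)

end Population

/-! ## Uniform rates for the local-linear fits -/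

section LocalFit

variable {Ω S : Type*} [MeasurableSpace Ω] [MeasurableSpace S]
  {P : Measure Ω} [IsProbabilityMeasure P] {ν : Measure S} [IsProbabilityMeasure ν]
  {a b σ : ℝ} {f : ℝ → ℝ} {X : S → ℝ → ℝ} {ξ : ℕ → Ω → S} {T U : ℕ → ℕ → Ω → ℝ}
  {m : ℕ → ℕ → ℕ} {env : S × ℝ × ℝ → ℝ} {ρ : ℕ → ℝ} {K : ℝ → ℝ} {bw : ℕ → ℝ}
  {ζ : (S × ℝ × ℝ) × ℝ × ℝ → ℝ}

/-- The Gram matrix of functions of the pairs of observation times. -/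
noncomputable def sampleGram {d : ℕ} (n : ℕ) (m : ℕ → ℕ) (τ : ℕ → ℕ → ℝ)
    (u : Fin d → ℝ × ℝ → ℝ) (W : ℝ × ℝ → ℝ) : Matrix (Fin d) (Fin d) ℝ :=
  gramMatrix n m (fun p i j k => u p (τ i j, τ i k)) fun i j k => W (τ i j, τ i k)

/-- The cross moments of responses and functions of the pairs of observation times. -/
noncomputable def sampleMoment {d : ℕ} (n : ℕ) (m : ℕ → ℕ) (τ : ℕ → ℕ → ℝ)
    (u : Fin d → ℝ × ℝ → ℝ) (W : ℝ × ℝ → ℝ) (Z : ℕ → ℕ → ℕ → ℝ) : Fin d → ℝ :=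
  crossMoment n m (fun p i j k => u p (τ i j, τ i k)) (fun i j k => W (τ i j, τ i k)) Z

/-- The conclusion about a local fit `ahat` of `g`: nonsingularity of the normal equations, the
uniform rate, and the linearization in terms of the averages of the noise. -/
structure LocalFitRate {d : ℕ} {Θ : Type*} (ξ : ℕ → Ω → S) (T U : ℕ → ℕ → Ω → ℝ)
    (m : ℕ → ℕ → ℕ) (μ : Measure (ℝ × ℝ)) (u : ℕ → Θ → Fin (d + 1) → ℝ × ℝ → ℝ)
    (W : ℕ → Θ → ℝ × ℝ → ℝ) (ζ : (S × ℝ × ℝ) × ℝ × ℝ → ℝ) (g : Θ → ℝ) (bw ρ : ℕ → ℝ)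
    (ahat : ℕ → Ω → Θ → ℝ) (c C : ℝ) (n : ℕ) (ω : Ω) : Prop where
  coercive : ∀ θ, Coercive (sampleGram n (m n) (fun i j => T i j ω) (u n θ) (W n θ)) c
  rate : ∀ θ, |ahat n ω θ - g θ| ≤ C * (ρ n + bw n ^ 2)
  linearization : ∀ θ, |ahat n ω θ - g θ - ∑ q, (populationGram μ (u n θ) (W n θ))⁻¹ 0 q *
    sampleMoment n (m n) (fun i j => T i j ω) (u n θ) (W n θ)
      (fun i j k => ζ (pairData ξ T U ω i j k)) q| ≤ C * (ρ n ^ 2 + bw n ^ 2)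

/-- The deterministic least-squares bounds are applied on the almost sure event where the Gram
entries and the noise moments deviate by `O(ρ)`. Since `ρ` tends to zero, coercivity is eventually
inherited by the sample matrices. The linearization error consists of the bias `bw²` and of `ρ (ρ +
bw²)`, which is at most `ρ² + bw²` once `ρ ≤ 1`. -/
theorem ae_localFitRate {d : ℕ} {Θ : Type*} {u : ℕ → Θ → Fin (d + 1) → ℝ × ℝ → ℝ}
    {W : ℕ → Θ → ℝ × ℝ → ℝ} {Z : Ω → ℕ → ℕ → ℕ → ℝ} {β : ℕ → Θ → Fin (d + 1) → ℝ} {g : Θ → ℝ}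
    {ahat : ℕ → Ω → Θ → ℝ} {μ : Measure (ℝ × ℝ)} {c B w : ℝ} (hc : 0 < c) (hB : 0 ≤ B)
    (hρ : Tendsto ρ atTop (𝓝 0)) (hρ0 : ∀ n, 0 ≤ ρ n)
    (hcoer : ∀ᶠ n in atTop, ∀ θ, Coercive (populationGram μ (u n θ) (W n θ)) c)
    (hW : ∀ n θ x, 0 ≤ W n θ x) (huW : ∀ n θ p x, |u n θ p x| * W n θ x ≤ W n θ x)
    (hu0 : ∀ n θ x, u n θ 0 x = 1) (hw : ∀ n θ, ∫ x, W n θ x ∂μ ≤ w)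
    (hgram : ∀ p q, ∀ᵐ ω ∂P, ∃ C : ℝ, ∀ᶠ n in atTop, ∀ θ,
      |sampleGram n (m n) (fun i j => T i j ω) (u n θ) (W n θ) p q -
        populationGram μ (u n θ) (W n θ) p q| ≤ C * ρ n)
    (hnoise : ∀ p, ∀ᵐ ω ∂P, ∃ C : ℝ, ∀ᶠ n in atTop, ∀ θ,
      |sampleMoment n (m n) (fun i j => T i j ω) (u n θ) (W n θ)
        (fun i j k => ζ (pairData ξ T U ω i j k)) p| ≤ C * ρ n)
    (hβ : ∀ n θ, β n θ 0 = g θ)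
    (hexp : ∀ᵐ ω ∂P, ∀ n θ i j k, |Z ω i j k - ∑ q, β n θ q * u n θ q (T i j ω, T i k ω) -
      ζ (pairData ξ T U ω i j k)| * W n θ (T i j ω, T i k ω) ≤
        B * bw n ^ 2 * W n θ (T i j ω, T i k ω))
    (hfit : ∀ n ω θ, ∃ η : Fin (d + 1) → ℝ, η 0 = ahat n ω θ ∧
      (sampleGram n (m n) (fun i j => T i j ω) (u n θ) (W n θ)).mulVec η =
        sampleMoment n (m n) (fun i j => T i j ω) (u n θ) (W n θ) (Z ω)) :
    ∀ᵐ ω ∂P, ∃ C : ℝ, ∀ᶠ n in atTop, LocalFitRate ξ T U m μ u W ζ g bw ρ ahat (c / 2) C n ω := by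
  filter_upwards [ae_all_iff.2 fun p => ae_all_iff.2 fun q => hgram p q, ae_all_iff.2 hnoise, hexp]
    with ω hgram hnoise hexp
  choose C₁ hC₁ using hgram
  choose C₂ hC₂ using hnoise
  set C : ℝ := ∑ p, ∑ q, |C₁ p q| + ∑ p, |C₂ p| with hC
  have hC0 : 0 ≤ C := by positivity
  have hle₁ : ∀ p q, C₁ p q ≤ C := fun p q => by
    have h1 : |C₁ p q| ≤ ∑ q, |C₁ p q| :=
      Finset.single_le_sum (f := fun q => |C₁ p q|) (fun _ _ => abs_nonneg _) (Finset.mem_univ q)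
    have h2 : ∑ q, |C₁ p q| ≤ ∑ p, ∑ q, |C₁ p q| :=
      Finset.single_le_sum (f := fun p => ∑ q, |C₁ p q|)
        (fun _ _ => Finset.sum_nonneg fun _ _ => abs_nonneg _) (Finset.mem_univ p)
    have h3 : 0 ≤ ∑ p, |C₂ p| := Finset.sum_nonneg fun _ _ => abs_nonneg _
    linarith [le_abs_self (C₁ p q)]
  have hle₂ : ∀ p, C₂ p ≤ C := fun p => by
    have h1 : |C₂ p| ≤ ∑ p, |C₂ p| :=
      Finset.single_le_sum (f := fun p => |C₂ p|) (fun _ _ => abs_nonneg _) (Finset.mem_univ p)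
    have h3 : 0 ≤ ∑ p, ∑ q, |C₁ p q| :=
      Finset.sum_nonneg fun _ _ => Finset.sum_nonneg fun _ _ => abs_nonneg _
    linarith [le_abs_self (C₂ p)]
  set D : ℝ := ((d + 1 : ℕ) : ℝ) with hD
  have hD0 : 0 < D := by positivity
  have hsmall : ∀ᶠ n in atTop, D * (C * ρ n) ≤ c / 2 ∧ C * ρ n ≤ 1 ∧ ρ n ≤ 1 := by
    have t1 : Tendsto (fun n => D * (C * ρ n)) atTop (𝓝 0) := by
      simpa using (hρ.const_mul C).const_mul D
    have t2 : Tendsto (fun n => C * ρ n) atTop (𝓝 0) := by simpa using hρ.const_mul C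
    filter_upwards [t1.eventually_le_const (half_pos hc), t2.eventually_le_const one_pos,
      hρ.eventually_le_const one_pos] with n h1 h2 h3
    exact ⟨h1, h2, h3⟩
  set w' := |w| + 1 with hw'
  set E := D * (C + B * w') / (c / 2) with hE
  have hE0 : 0 ≤ E := by positivity
  set F := D * (D / c * (B * w' + D * (C * E))) with hF
  have hF0 : 0 ≤ F := by positivity
  refine ⟨E + F, ?_⟩
  filter_upwards [hcoer, hsmall, eventually_all.2 fun p => eventually_all.2 fun q => hC₁ p q,
    eventually_all.2 hC₂] with n hcoer ⟨hs1, hs2, hs3⟩ hC₁ hC₂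
  have hρn := hρ0 n
  have hG : ∀ θ p q, |sampleGram n (m n) (fun i j => T i j ω) (u n θ) (W n θ) p q -
      populationGram μ (u n θ) (W n θ) p q| ≤ C * ρ n := fun θ p q =>
    (hC₁ p q θ).trans (mul_le_mul_of_nonneg_right (hle₁ p q) hρn)
  have hN : ∀ θ p, |sampleMoment n (m n) (fun i j => T i j ω) (u n θ) (W n θ)
        (fun i j k => ζ (pairData ξ T U ω i j k)) p| ≤ C * ρ n := fun θ p =>
    (hC₂ p θ).trans (mul_le_mul_of_nonneg_right (hle₂ p) hρn)
  have hkey : ∀ θ, |ahat n ω θ - g θ| ≤ D * (C * ρ n + B * bw n ^ 2 * w') / (c / 2) ∧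
      |ahat n ω θ - g θ - ∑ q, (populationGram μ (u n θ) (W n θ))⁻¹ 0 q *
        sampleMoment n (m n) (fun i j => T i j ω) (u n θ) (W n θ)
          (fun i j k => ζ (pairData ξ T U ω i j k)) q| ≤ D * (D / c * (B * bw n ^ 2 * w' +
            D * (C * ρ n * (D * (C * ρ n + B * bw n ^ 2 * w') / (c / 2))))) := fun θ => by
    obtain ⟨η, hη0, hη⟩ := hfit n ω θ
    rw [← hη0, ← hβ n θ]
    -- Because the zeroth regressor is constant one, the total weight is the `(0,0)` entry of the
    -- Gram matrix and is controlled by its deviation.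
    have hwb : curveAvg n (m n) (fun i j k => W n θ (T i j ω, T i k ω)) ≤ w' := by
      have e1 := (abs_le.1 (hG θ 0 0)).2
      have e2 : sampleGram n (m n) (fun i j => T i j ω) (u n θ) (W n θ) 0 0 =
          curveAvg n (m n) (fun i j k => W n θ (T i j ω, T i k ω)) := by
        simp [sampleGram, gramMatrix, hu0]
      have e3 : populationGram μ (u n θ) (W n θ) 0 0 = ∫ x, W n θ x ∂μ := by
        simp [populationGram, hu0]
      rw [e2, e3] at e1
      linarith [hw n θ, le_abs_self w]
    exact least_squares_error hη (hexp n θ) (fun p i j k => huW n θ p _) (by positivity) (hcoer θ)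
      hc (hG θ) hs1 (hN θ) hwb fun i j k => hW n θ _
  have hb1 : D * (C * ρ n + B * bw n ^ 2 * w') / (c / 2) ≤ E * (ρ n + bw n ^ 2) := by
    rw [hE, div_mul_eq_mul_div]
    refine div_le_div_of_nonneg_right ?_ (by positivity)
    rw [mul_assoc D (C + B * w')]
    refine mul_le_mul_of_nonneg_left ?_ hD0.le
    have h1 : 0 ≤ C * bw n ^ 2 := by positivity
    have h2 : 0 ≤ B * w' * ρ n := by positivity
    nlinarith
  refine ⟨fun θ => (hcoer θ).perturb (hG θ) hs1, fun θ => (hkey θ).1.trans (hb1.trans ?_),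
    fun θ => (hkey θ).2.trans ?_⟩
  · gcongr
    linarith
  · have h1 : C * ρ n * (D * (C * ρ n + B * bw n ^ 2 * w') / (c / 2)) ≤
        C * E * (ρ n ^ 2 + bw n ^ 2) := by
      calc _ ≤ C * ρ n * (E * (ρ n + bw n ^ 2)) := by gcongr
        _ = C * E * (ρ n ^ 2 + ρ n * bw n ^ 2) := by ring
        _ ≤ C * E * (ρ n ^ 2 + bw n ^ 2) := by
            gcongr
            exact mul_le_of_le_one_left (sq_nonneg _) hs3
    have h2 : B * bw n ^ 2 * w' ≤ B * w' * (ρ n ^ 2 + bw n ^ 2) := by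
      have : 0 ≤ B * w' * ρ n ^ 2 := by positivity
      nlinarith
    calc D * (D / c * (B * bw n ^ 2 * w' +
            D * (C * ρ n * (D * (C * ρ n + B * bw n ^ 2 * w') / (c / 2)))))
        ≤ D * (D / c * (B * w' * (ρ n ^ 2 + bw n ^ 2) +
            D * (C * E * (ρ n ^ 2 + bw n ^ 2)))) := by gcongr
      _ = F * (ρ n ^ 2 + bw n ^ 2) := by rw [hF]; ring
      _ ≤ (E + F) * (ρ n ^ 2 + bw n ^ 2) := by gcongr; linarith

lemma pow_mul_scaledKernel_le (hK : KernelCond K) {h : ℝ} (hh : 0 < h) (p : ℕ) (u : ℝ) :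
    |(u / h) ^ p| * scaledKernel K h u ≤ scaledKernel K h u := by
  have := abs_scaledMoment_le hK hh p u
  rwa [scaledMoment, abs_mul, abs_of_nonneg (scaledKernel_nonneg hK hh u), mul_comm] at this

/-- The rate of a univariate local-linear fit of `g`. -/
theorem ae_univariate_fit (h : ObservationModel P ν a b σ f X ξ T U) (hab : a < b)
    (hm : ∀ n, ∀ i < n, 2 ≤ m n i) (hK : KernelCond K) {mT MT : ℝ}
    (hτ : DesignLaw a b mT MT (timeLaw P T))
    (hlaw : FamilyLaw P ν ξ T U m (SingleClass (timeLaw P T) bw) env ρ) (henv : Measurable env)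
    (henv1 : ∀ y, 1 ≤ env y)
    (henvi : Integrable env (ν.prod ((errorLaw P U).prod (errorLaw P U))))
    (hζ : Measurable ζ) (hζe : ∀ z, |ζ z| ≤ env z.1) (hζc : IsCentered P ν U ζ)
    (hbw : ∀ n, 0 < bw n) (hbw0 : Tendsto bw atTop (𝓝 0))
    (hnh : ∀ᶠ n : ℕ in atTop, 1 ≤ n * bw n) (hρ : ∀ᶠ n : ℕ in atTop, (n : ℝ)⁻¹ ≤ ρ n)
    (hρ0 : ∀ n, 0 ≤ ρ n) (hρlim : Tendsto ρ atTop (𝓝 0))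
    {g g' : ℝ → ℝ} {Bg : ℝ} (hBg : 0 ≤ Bg)
    (hg : ∀ t ∈ Icc a b, ∀ x ∈ Icc a b, |g x - g t - g' t * (x - t)| ≤ Bg * (x - t) ^ 2)
    {Z : Ω → ℕ → ℕ → ℝ}
    (hZ : ∀ᵐ ω ∂P, ∀ i j k, T i j ω ∈ Icc a b ∧
      Z ω i j = g (T i j ω) + ζ (pairData ξ T U ω i j k))
    {ahat : ℕ → Ω → ℝ → ℝ}
    (hfit : ∀ n ω, ∀ t ∈ Icc a b,
      IsLocalLinearFit₁ K (bw n) n (m n) (fun i j => T i j ω) (Z ω) t (ahat n ω t)) :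
    ∃ c : ℝ, 0 < c ∧ (∀ᶠ n in atTop, ∀ t ∈ Icc a b, Coercive (populationGram
        ((timeLaw P T).prod (timeLaw P T)) (regressor₁ (bw n) t) (weight₁ K (bw n) t)) c) ∧
      ∀ᵐ ω ∂P, ∃ C : ℝ, ∀ᶠ n in atTop, LocalFitRate (Θ := Icc a b) ξ T U m
        ((timeLaw P T).prod (timeLaw P T)) (fun n t => regressor₁ (bw n) t)
        (fun n t => weight₁ K (bw n) t) ζ (fun t => g t) bw ρ (fun n ω t => ahat n ω t)
        (c / 2) C n ω := by
  have := h.isProbabilityMeasure_errorLaw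
  have := h.isProbabilityMeasure_timeLaw
  obtain ⟨c, hc, hcoer⟩ := exists_coercive₁ hK hτ
  have henv0 : ∀ y, 0 ≤ env y := fun y => zero_le_one.trans (henv1 y)
  have hsm : ∀ᶠ n in atTop, bw n ≤ (b - a) / 2 :=
    hbw0.eventually_le_const (half_pos (sub_pos.2 hab))
  have hcoer' : ∀ᶠ n in atTop, ∀ t ∈ Icc a b, Coercive (populationGram
        ((timeLaw P T).prod (timeLaw P T)) (regressor₁ (bw n) t) (weight₁ K (bw n) t)) c := by
    filter_upwards [hsm] with n hn t ht
    exact hcoer (bw n) (hbw n) hn t ht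
  refine ⟨c, hc, hcoer', ?_⟩
  -- `β` holds the Taylor coefficients of `g` at `t` with respect to the rescaled regressors, which
  -- accounts for the factor `bw n` in the slope.
  refine ae_localFitRate (Z := fun ω i j _ => Z ω i j)
    (β := fun n (t : Icc a b) => ![g t, g' t * bw n]) (w := MT) hc hBg hρlim hρ0 ?_
    (fun n t x => scaledKernel_nonneg hK (hbw n) _)
    (fun n t p x => pow_mul_scaledKernel_le hK (hbw n) _ _)
    (fun n t x => by simp [regressor₁]) (fun n t => ?_) (fun p q => ?_) (fun p => ?_)
    (fun n t => rfl) ?_ (fun n ω t => ?_)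
  · filter_upwards [hcoer'] with n hn t
    exact hn t t.2
  · simp only [weight₁]
    rw [integral_fun_fst (fun x => scaledKernel K (bw n) (x - t))]
    simpa using hτ.integral_scaledKernel_le hK (hbw n) t
  -- Gram entries are kernel averages of the constant `1`; the envelope is assumed at least one so
  -- that the same family law covers them.
  · filter_upwards [hlaw.ae_uniform_single h hab hK hτ henv henv0 henvi (ζ := fun _ => 1)
      measurable_const (fun z => by simpa using henv1 z.1) hbw hnh hρ (p + q)] with ω ⟨C, hC⟩
    refine ⟨C, ?_⟩
    filter_upwards [hC] with n hn t
    have e := hn t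
    have e2 := integral_env_mul h (fun _ => (1 : ℝ))
      (fun w => scaledMoment K (bw n) (p + q) (w.1 - t))
    rw [e2] at e
    simp only [one_mul, integral_const, probReal_univ, one_smul, pairData] at e
    simp only [sampleGram, gramMatrix, populationGram, Matrix.of_apply, regressor₁_mul_weight]
    exact e
  · filter_upwards [hlaw.ae_uniform_single h hab hK hτ henv henv0 henvi hζ hζe hbw hnh hρ p]
      with ω ⟨C, hC⟩
    refine ⟨C, ?_⟩
    filter_upwards [hC] with n hn t
    have e := hn t
    have e2 := hζc.integral_mul_eq_zero h (g := fun w => scaledMoment K (bw n) p (w.1 - t)) (by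
      refine integrable_env_mul henvi (g := fun w => |scaledMoment K (bw n) p (w.1 - t)|)
        ((integrable_scaledMoment hK (hbw n) p t).comp_fst _).abs
        (hζ.mul ((measurable_scaledMoment hK _ p).comp (measurable_snd.fst.sub_const _)))
        fun z => ?_
      rw [abs_mul]
      exact mul_le_mul_of_nonneg_right (hζe z) (abs_nonneg _))
    rw [e2, sub_zero] at e
    refine le_trans (le_of_eq ?_) e
    simp only [sampleMoment, crossMoment]
    congr 2; ext i j k
    simp only [regressor₁, weight₁, scaledMoment, pairData]; ring
  · filter_upwards [hZ] with ω hω n t i j k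
    obtain ⟨hT, hZe⟩ := hω i j k
    -- The Taylor bound is needed only within distance `bw` of the point; farther away the weight
    -- vanishes.
    rcases le_or_gt |T i j ω - t| (bw n) with hle | hgt
    · refine mul_le_mul_of_nonneg_right ?_ (scaledKernel_nonneg hK (hbw n) _)
      have e : Z ω i j - ∑ q, ![g t, g' t * bw n] q * regressor₁ (bw n) t q (T i j ω, T i k ω) -
          ζ (pairData ξ T U ω i j k) = g (T i j ω) - g t - g' t * (T i j ω - t) := by
        rw [hZe, Fin.sum_univ_two]
        simp only [regressor₁, Matrix.cons_val_zero, Matrix.cons_val_one, Fin.val_zero,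
          Fin.val_one, pow_zero, pow_one, mul_one]
        have := (hbw n).ne'
        field_simp
        ring
      rw [e]
      refine (hg t t.2 _ hT).trans ?_
      rw [← sq_abs (T i j ω - t)]
      gcongr
    · have : weight₁ K (bw n) t (T i j ω, T i k ω) = 0 := scaledKernel_eq_zero hK (hbw n) hgt
      simp only [this, mul_zero, le_refl]
  · obtain ⟨η, h1, h2⟩ := (hfit n ω t t.2).normal_equations (hbw n).ne' (hm n)
    exact ⟨η, h1, h2⟩

/-- The rate of a bivariate local-linear fit of `g`. -/
theorem ae_bivariate_fit (h : ObservationModel P ν a b σ f X ξ T U) (hab : a < b)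
    (hK : KernelCond K) {mT MT : ℝ}
    (hτ : DesignLaw a b mT MT (timeLaw P T))
    (hlaw : FamilyLaw P ν ξ T U m (PairClass (timeLaw P T) bw) env ρ) (henv : Measurable env)
    (henv1 : ∀ y, 1 ≤ env y)
    (henvi : Integrable env (ν.prod ((errorLaw P U).prod (errorLaw P U))))
    (hζ : Measurable ζ) (hζe : ∀ z, |ζ z| ≤ env z.1) (hζc : IsCentered P ν U ζ)
    (hbw : ∀ n, 0 < bw n) (hbw0 : Tendsto bw atTop (𝓝 0))
    (hnh : ∀ᶠ n : ℕ in atTop, 1 ≤ n * bw n) (hρ : ∀ᶠ n : ℕ in atTop, (n : ℝ)⁻¹ ≤ ρ n)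
    (hρ0 : ∀ n, 0 ≤ ρ n) (hρlim : Tendsto ρ atTop (𝓝 0))
    {g g₁ g₂ : ℝ → ℝ → ℝ} {Bg : ℝ} (hBg : 0 ≤ Bg)
    (hg : ∀ s ∈ Icc a b, ∀ t ∈ Icc a b, ∀ x ∈ Icc a b, ∀ y ∈ Icc a b,
      |g x y - g s t - g₁ s t * (x - s) - g₂ s t * (y - t)| ≤ Bg * ((x - s) ^ 2 + (y - t) ^ 2))
    {Z : Ω → ℕ → ℕ → ℝ}
    (hZ : ∀ᵐ ω ∂P, ∀ i j k, T i j ω ∈ Icc a b ∧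
      Z ω i j * Z ω i k = g (T i j ω) (T i k ω) + ζ (pairData ξ T U ω i j k))
    {ahat : ℕ → Ω → ℝ → ℝ → ℝ}
    (hfit : ∀ n ω, ∀ s ∈ Icc a b, ∀ t ∈ Icc a b,
      IsLocalLinearFit₂ K (bw n) n (m n) (fun i j => T i j ω) (Z ω) s t (ahat n ω s t)) :
    ∃ c : ℝ, 0 < c ∧ (∀ᶠ n in atTop, ∀ s ∈ Icc a b, ∀ t ∈ Icc a b, Coercive (populationGram
        ((timeLaw P T).prod (timeLaw P T)) (regressor₂ (bw n) s t) (weight₂ K (bw n) s t)) c) ∧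
      ∀ᵐ ω ∂P, ∃ C : ℝ, ∀ᶠ n in atTop, LocalFitRate (Θ := Icc a b × Icc a b) ξ T U m
        ((timeLaw P T).prod (timeLaw P T)) (fun n θ => regressor₂ (bw n) θ.1 θ.2)
        (fun n θ => weight₂ K (bw n) θ.1 θ.2) ζ (fun θ => g θ.1 θ.2) bw ρ
        (fun n ω θ => ahat n ω θ.1 θ.2) (c / 2) C n ω := by
  have := h.isProbabilityMeasure_errorLaw
  have := h.isProbabilityMeasure_timeLaw
  obtain ⟨c, hc, hcoer⟩ := exists_coercive₂ hK hτ
  have henv0 : ∀ y, 0 ≤ env y := fun y => zero_le_one.trans (henv1 y)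
  have hsm : ∀ᶠ n in atTop, bw n ≤ (b - a) / 2 :=
    hbw0.eventually_le_const (half_pos (sub_pos.2 hab))
  have hcoer' : ∀ᶠ n in atTop, ∀ s ∈ Icc a b, ∀ t ∈ Icc a b, Coercive (populationGram
        ((timeLaw P T).prod (timeLaw P T)) (regressor₂ (bw n) s t) (weight₂ K (bw n) s t)) c := by
    filter_upwards [hsm] with n hn s hs t ht
    exact hcoer (bw n) (hbw n) hn s hs t ht
  refine ⟨c, hc, hcoer', ?_⟩
  have hW0 : ∀ n (θ : Icc a b × Icc a b) x, 0 ≤ weight₂ K (bw n) θ.1 θ.2 x := fun n θ x =>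
    mul_nonneg (scaledKernel_nonneg hK (hbw n) _) (scaledKernel_nonneg hK (hbw n) _)
  refine ae_localFitRate (Z := fun ω i j k => Z ω i j * Z ω i k)
    (β := fun n (θ : Icc a b × Icc a b) =>
      ![g θ.1 θ.2, g₁ θ.1 θ.2 * bw n, g₂ θ.1 θ.2 * bw n]) (w := MT * MT) (B := 2 * Bg) hc
    (by positivity) hρlim hρ0 ?_ hW0 (fun n θ p x => ?_)
    (fun n t x => by simp [regressor₂]) (fun n θ => ?_) (fun p q => ?_) (fun p => ?_)
    (fun n t => rfl) ?_ (fun n ω θ => ?_)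
  · filter_upwards [hcoer'] with n hn θ
    exact hn θ.1 θ.1.2 θ.2 θ.2.2
  · simp only [regressor₂, weight₂]
    rw [abs_mul, mul_mul_mul_comm]
    exact mul_le_mul (pow_mul_scaledKernel_le hK (hbw n) _ _)
      (pow_mul_scaledKernel_le hK (hbw n) _ _)
      (mul_nonneg (abs_nonneg _) (scaledKernel_nonneg hK (hbw n) _))
      (scaledKernel_nonneg hK (hbw n) _)
  · simp only [weight₂]
    rw [integral_prod_mul (fun x => scaledKernel K (bw n) (x - θ.1))
      (fun x => scaledKernel K (bw n) (x - θ.2))]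
    exact mul_le_mul (hτ.integral_scaledKernel_le hK (hbw n) _)
      (hτ.integral_scaledKernel_le hK (hbw n) _)
      (integral_nonneg fun x => scaledKernel_nonneg hK (hbw n) _) hτ.MT_pos.le
  · filter_upwards [hlaw.ae_uniform_pair h hab hK hτ henv henv0 henvi (ζ := fun _ => 1)
      measurable_const (fun z => by simpa using henv1 z.1) hbw hnh hρ
      ((![0, 1, 0] p : ℕ) + (![0, 1, 0] q : ℕ)) ((![0, 0, 1] p : ℕ) + (![0, 0, 1] q : ℕ))]
      with ω ⟨C, hC⟩
    refine ⟨C, ?_⟩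
    filter_upwards [hC] with n hn θ
    have e := hn θ
    have e2 := integral_env_mul h (fun _ => (1 : ℝ))
      (fun w => scaledMoment K (bw n) ((![0, 1, 0] p : ℕ) + (![0, 1, 0] q : ℕ)) (w.1 - θ.1) *
        scaledMoment K (bw n) ((![0, 0, 1] p : ℕ) + (![0, 0, 1] q : ℕ)) (w.2 - θ.2))
    rw [e2] at e
    simp only [one_mul, integral_const, probReal_univ, one_smul, pairData] at e
    simp only [sampleGram, gramMatrix, populationGram, Matrix.of_apply, regressor₂_mul_weight]
    exact e
  · filter_upwards [hlaw.ae_uniform_pair h hab hK hτ henv henv0 henvi hζ hζe hbw hnh hρ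
      (![0, 1, 0] p : ℕ) (![0, 0, 1] p : ℕ)] with ω ⟨C, hC⟩
    refine ⟨C, ?_⟩
    filter_upwards [hC] with n hn θ
    have e := hn θ
    have e2 := hζc.integral_mul_eq_zero h (g := fun w =>
        scaledMoment K (bw n) (![0, 1, 0] p : ℕ) (w.1 - θ.1) *
          scaledMoment K (bw n) (![0, 0, 1] p : ℕ) (w.2 - θ.2)) (by
      refine integrable_env_mul henvi (g := fun w =>
        |scaledMoment K (bw n) (![0, 1, 0] p : ℕ) (w.1 - θ.1) *
          scaledMoment K (bw n) (![0, 0, 1] p : ℕ) (w.2 - θ.2)|)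
        ((integrable_scaledMoment hK (hbw n) _ _).mul_prod
          (integrable_scaledMoment hK (hbw n) _ _)).abs
        (hζ.mul (((measurable_scaledMoment hK _ _).comp (measurable_snd.fst.sub_const _)).mul
          ((measurable_scaledMoment hK _ _).comp (measurable_snd.snd.sub_const _))))
        fun z => ?_
      rw [abs_mul]
      exact mul_le_mul_of_nonneg_right (hζe z) (abs_nonneg _))
    rw [e2, sub_zero] at e
    refine le_trans (le_of_eq ?_) e
    simp only [sampleMoment, crossMoment]
    congr 2; ext i j k
    simp only [regressor₂, weight₂, scaledMoment, pairData]; ring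
  · filter_upwards [hZ] with ω hω n θ i j k
    obtain ⟨hT, hZe⟩ := hω i j k
    have hT' := (hω i k k).1
    rcases le_or_gt |T i j ω - θ.1| (bw n) with hle | hgt
    · rcases le_or_gt |T i k ω - θ.2| (bw n) with hle' | hgt'
      · refine mul_le_mul_of_nonneg_right ?_ (hW0 n θ _)
        have e : Z ω i j * Z ω i k - ∑ q, ![g θ.1 θ.2, g₁ θ.1 θ.2 * bw n, g₂ θ.1 θ.2 * bw n] q *
            regressor₂ (bw n) θ.1 θ.2 q (T i j ω, T i k ω) - ζ (pairData ξ T U ω i j k) =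
            g (T i j ω) (T i k ω) - g θ.1 θ.2 - g₁ θ.1 θ.2 * (T i j ω - θ.1) -
              g₂ θ.1 θ.2 * (T i k ω - θ.2) := by
          rw [hZe, Fin.sum_univ_three]
          simp only [regressor₂, Matrix.cons_val_zero, Matrix.cons_val_one, Matrix.cons_val,
            pow_zero, pow_one, mul_one, one_mul]
          have := (hbw n).ne'
          field_simp
          ring
        rw [e]
        refine (hg _ θ.1.2 _ θ.2.2 _ hT _ hT').trans ?_
        rw [← sq_abs (T i j ω - θ.1), ← sq_abs (T i k ω - θ.2)]
        have h1 : |T i j ω - θ.1| ^ 2 ≤ bw n ^ 2 := by gcongr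
        have h2 : |T i k ω - θ.2| ^ 2 ≤ bw n ^ 2 := by gcongr
        nlinarith
      · have : weight₂ K (bw n) θ.1 θ.2 (T i j ω, T i k ω) = 0 := by
          rw [weight₂, scaledKernel_eq_zero hK (hbw n) hgt', mul_zero]
        simp only [this, mul_zero, le_refl]
    · have : weight₂ K (bw n) θ.1 θ.2 (T i j ω, T i k ω) = 0 := by
        rw [weight₂, scaledKernel_eq_zero hK (hbw n) hgt, zero_mul]
      simp only [this, mul_zero, le_refl]
  · obtain ⟨η, h1, h2⟩ := (hfit n ω θ.1 θ.1.2 θ.2 θ.2.2).normal_equations (hbw n).ne'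
    exact ⟨η, h1, h2⟩

end LocalFit

/-! ## Taylor expansions -/

section Taylor

variable {a b : ℝ}

lemma abs_sub_le_of_hasDerivWithinAt {g g' : ℝ → ℝ} {B x t : ℝ} (hx : x ∈ Icc a b)
    (ht : t ∈ Icc a b) (hg : ∀ y ∈ uIcc t x, HasDerivWithinAt g (g' y) (Icc a b) y)
    (hB : ∀ y ∈ uIcc t x, |g' y| ≤ B) : |g x - g t| ≤ B * |x - t| := by
  have hsub : uIcc t x ⊆ Icc a b := uIcc_subset_Icc ht hx
  have := Convex.norm_image_sub_le_of_norm_hasDerivWithin_le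
    (fun y hy => (hg y hy).mono hsub) (fun y hy => hB y hy) (convex_uIcc t x) left_mem_uIcc
    right_mem_uIcc
  simpa [Real.norm_eq_abs] using this

/-- The mean value inequality is used twice, for the derivative and then for the remainder.
Continuity of the second derivative is not needed; the constant is `B` instead of `B / 2`. -/
lemma taylor_of_hasDerivWithinAt {g g' g'' : ℝ → ℝ} {B : ℝ}
    (h : ∀ t ∈ Icc a b, HasDerivWithinAt g (g' t) (Icc a b) t ∧
      HasDerivWithinAt g' (g'' t) (Icc a b) t ∧ |g'' t| ≤ B) {t x : ℝ} (ht : t ∈ Icc a b)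
    (hx : x ∈ Icc a b) : |g x - g t - g' t * (x - t)| ≤ B * (x - t) ^ 2 := by
  have hB : 0 ≤ B := (abs_nonneg _).trans (h t ht).2.2
  have hsub : uIcc t x ⊆ Icc a b := uIcc_subset_Icc ht hx
  have hφ : ∀ y ∈ uIcc t x,
      HasDerivWithinAt (fun y => g y - g t - g' t * (y - t)) (g' y - g' t) (Icc a b) y :=
    fun y hy => by
      have h1 := ((h y (hsub hy)).1.sub_const (g t)).sub
        (((hasDerivWithinAt_id y (Icc a b)).sub_const t).const_mul (g' t))
      rw [mul_one] at h1
      exact h1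
  have hb : ∀ y ∈ uIcc t x, |g' y - g' t| ≤ B * |x - t| := fun y hy => by
    refine (abs_sub_le_of_hasDerivWithinAt (hsub hy) ht (g' := g'') (B := B)
      (fun z hz => (h z (uIcc_subset_Icc ht (hsub hy) hz)).2.1)
      fun z hz => (h z (uIcc_subset_Icc ht (hsub hy) hz)).2.2).trans ?_
    exact mul_le_mul_of_nonneg_left (abs_sub_left_of_mem_uIcc hy) hB
  have := abs_sub_le_of_hasDerivWithinAt hx ht hφ hb
  simp only [sub_self, mul_zero, sub_zero] at this
  rw [mul_assoc, ← sq, sq_abs] at this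
  exact this

lemma FunctionalData.TwiceDiffBounded.exists_taylor (hab : a < b) {g : ℝ → ℝ}
    (hg : TwiceDiffBounded a b g) :
    ∃ (g' : ℝ → ℝ) (B : ℝ), 0 ≤ B ∧ ∀ t ∈ Icc a b, ∀ x ∈ Icc a b,
      |g x - g t - g' t * (x - t)| ≤ B * (x - t) ^ 2 := by
  obtain ⟨g', g'', B, h⟩ := hg
  exact ⟨g', B, (abs_nonneg _).trans (h a (left_mem_Icc.2 hab.le)).2.2, fun t ht x hx =>
    taylor_of_hasDerivWithinAt h ht hx⟩

/-- The expansion runs along the two sides from `(s,t)` through `(s,y)` to `(x,y)`, so one-variable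
expansions suffice. The coefficient `F₁ s y` is exchanged for `F₁ s t` with the help of the mixed
derivative, at the cost of a term `|y - t| |x - s|`. -/
lemma FunctionalData.SecondPartialsBounded.exists_taylor (hab : a < b) {F : ℝ → ℝ → ℝ}
    (hF : SecondPartialsBounded a b F) :
    ∃ (F₁ F₂ : ℝ → ℝ → ℝ) (B : ℝ), 0 ≤ B ∧ ∀ s ∈ Icc a b, ∀ t ∈ Icc a b, ∀ x ∈ Icc a b,
      ∀ y ∈ Icc a b, |F x y - F s t - F₁ s t * (x - s) - F₂ s t * (y - t)| ≤
        B * ((x - s) ^ 2 + (y - t) ^ 2) := by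
  obtain ⟨F₁, F₂, F₁₁, F₁₂, F₂₁, F₂₂, B, h⟩ := hF
  have ha := left_mem_Icc.2 hab.le
  have hB : 0 ≤ B := (abs_nonneg _).trans (h a ha a ha).2.2.2.2.2.2.1
  refine ⟨F₁, F₂, 2 * B, by positivity, fun s hs t ht x hx y hy => ?_⟩
  have e1 := taylor_of_hasDerivWithinAt (g := fun u => F u y) (g' := fun u => F₁ u y)
    (g'' := fun u => F₁₁ u y) (B := B) (fun u hu => ⟨(h u hu y hy).1, (h u hu y hy).2.2.1,
      (h u hu y hy).2.2.2.2.2.2.1⟩) hs hx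
  have e2 := taylor_of_hasDerivWithinAt (g := fun v => F s v) (g' := fun v => F₂ s v)
    (g'' := fun v => F₂₂ s v) (B := B) (fun v hv => ⟨(h s hs v hv).2.1, (h s hs v hv).2.2.2.2.2.1,
      (h s hs v hv).2.2.2.2.2.2.2.2.2⟩) ht hy
  have e3 := abs_sub_le_of_hasDerivWithinAt (g := fun v => F₁ s v) (g' := fun v => F₁₂ s v)
    (B := B) hy ht (fun v hv => (h s hs v (uIcc_subset_Icc ht hy hv)).2.2.2.1)
    fun v hv => (h s hs v (uIcc_subset_Icc ht hy hv)).2.2.2.2.2.2.2.1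
  have e : F x y - F s t - F₁ s t * (x - s) - F₂ s t * (y - t) =
      (F x y - F s y - F₁ s y * (x - s)) + (F s y - F s t - F₂ s t * (y - t)) +
        (F₁ s y - F₁ s t) * (x - s) := by ring
  rw [e]
  have e4 : |(F₁ s y - F₁ s t) * (x - s)| ≤ B * ((x - s) ^ 2 + (y - t) ^ 2) := by
    rw [abs_mul]
    calc |F₁ s y - F₁ s t| * |x - s| ≤ B * |y - t| * |x - s| := by gcongr
      _ = B * (|y - t| * |x - s|) := by ring
      _ ≤ B * ((x - s) ^ 2 + (y - t) ^ 2) := by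
          gcongr
          rw [← sq_abs (x - s), ← sq_abs (y - t)]
          nlinarith [sq_nonneg (|y - t| - |x - s|), sq_nonneg |y - t|, sq_nonneg |x - s|]
  have t1 := abs_add_le ((F x y - F s y - F₁ s y * (x - s)) +
    (F s y - F s t - F₂ s t * (y - t))) ((F₁ s y - F₁ s t) * (x - s))
  have t2 := abs_add_le (F x y - F s y - F₁ s y * (x - s)) (F s y - F s t - F₂ s t * (y - t))
  linarith

lemma SecondPartialsBounded_add {F G : ℝ → ℝ → ℝ} (hF : SecondPartialsBounded a b F)
    (hG : SecondPartialsBounded a b G) : SecondPartialsBounded a b fun s t => F s t + G s t := by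
  obtain ⟨F₁, F₂, F₁₁, F₁₂, F₂₁, F₂₂, B, hF⟩ := hF
  obtain ⟨G₁, G₂, G₁₁, G₁₂, G₂₁, G₂₂, B', hG⟩ := hG
  refine ⟨fun s t => F₁ s t + G₁ s t, fun s t => F₂ s t + G₂ s t, fun s t => F₁₁ s t + G₁₁ s t,
    fun s t => F₁₂ s t + G₁₂ s t, fun s t => F₂₁ s t + G₂₁ s t, fun s t => F₂₂ s t + G₂₂ s t,
    B + B', fun s hs t ht => ?_⟩
  obtain ⟨f1, f2, f3, f4, f5, f6, f7, f8, f9, f10⟩ := hF s hs t ht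
  obtain ⟨g1, g2, g3, g4, g5, g6, g7, g8, g9, g10⟩ := hG s hs t ht
  exact ⟨f1.add g1, f2.add g2, f3.add g3, f4.add g4, f5.add g5, f6.add g6,
    (abs_add_le _ _).trans (add_le_add f7 g7), (abs_add_le _ _).trans (add_le_add f8 g8),
    (abs_add_le _ _).trans (add_le_add f9 g9), (abs_add_le _ _).trans (add_le_add f10 g10)⟩

/-- The functions `g` and `g'` are continuous on a compact interval and hence bounded, so all
second-order products are bounded. This transfers smoothness from the covariance to `E X(s) X(t)`.
-/
lemma SecondPartialsBounded_mul_self (hab : a < b) {g : ℝ → ℝ} (hg : TwiceDiffBounded a b g) :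
    SecondPartialsBounded a b fun s t => g s * g t := by
  obtain ⟨g', g'', B, h⟩ := hg
  have ha := left_mem_Icc.2 hab.le
  have hB : 0 ≤ B := (abs_nonneg _).trans (h a ha).2.2
  have h1 : ∃ A, ∀ t ∈ Icc a b, |g' t| ≤ A :=
    isCompact_Icc.exists_bound_of_continuousOn fun t ht => (h t ht).2.1.continuousWithinAt
  have h0 : ∃ A, ∀ t ∈ Icc a b, |g t| ≤ A :=
    isCompact_Icc.exists_bound_of_continuousOn fun t ht => (h t ht).1.continuousWithinAt
  obtain ⟨A₁, h1⟩ := h1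
  obtain ⟨A₀, h0⟩ := h0
  set A := max B (max A₁ A₀) with hA
  have hA0 : 0 ≤ A := hB.trans (le_max_left _ _)
  have k0 : ∀ t ∈ Icc a b, |g t| ≤ A := fun t ht =>
    (h0 t ht).trans ((le_max_right _ _).trans (le_max_right _ _))
  have k1 : ∀ t ∈ Icc a b, |g' t| ≤ A := fun t ht =>
    (h1 t ht).trans ((le_max_left _ _).trans (le_max_right _ _))
  have k2 : ∀ t ∈ Icc a b, |g'' t| ≤ A := fun t ht => (h t ht).2.2.trans (le_max_left _ _)
  have kmul : ∀ {x y : ℝ}, |x| ≤ A → |y| ≤ A → |x * y| ≤ A * A := fun hx hy => by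
    rw [abs_mul]; exact mul_le_mul hx hy (abs_nonneg _) hA0
  refine ⟨fun s t => g' s * g t, fun s t => g s * g' t, fun s t => g'' s * g t,
    fun s t => g' s * g' t, fun s t => g' s * g' t, fun s t => g s * g'' t, A * A,
    fun s hs t ht => ?_⟩
  exact ⟨(h s hs).1.mul_const _, (h t ht).1.const_mul _, (h s hs).2.1.mul_const _,
    (h t ht).1.const_mul _, (h s hs).1.mul_const _, (h t ht).2.1.const_mul _,
    kmul (k2 s hs) (k0 t ht), kmul (k1 s hs) (k1 t ht), kmul (k1 s hs) (k1 t ht),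
    kmul (k0 s hs) (k2 t ht)⟩

end Taylor

/-! ## The moments of the enveloped process -/

section Moments

variable {S : Type*} [MeasurableSpace S] {ν : Measure S} [IsProbabilityMeasure ν]
  {a b : ℝ} {X Y : S → ℝ → ℝ} {B : S → ℝ}

lemma meanFun_congr (h : ∀ᵐ x ∂ν, ∀ t ∈ Icc a b, Y x t = X x t) {t : ℝ} (ht : t ∈ Icc a b) :
    meanFun ν Y t = meanFun ν X t :=
  integral_congr_ae (h.mono fun _ hx => hx t ht)

lemma covFun_eq (hY : EnvelopedPaths ν Y B) (h : ∀ᵐ x ∂ν, ∀ t ∈ Icc a b, Y x t = X x t)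
    {s t : ℝ} (hs : s ∈ Icc a b) (ht : t ∈ Icc a b) :
    covFun ν X s t = secondMoment ν Y s t - meanFun ν Y s * meanFun ν Y t := by
  have hL : ∀ t, MemLp (fun x => Y x t) 2 ν := fun t => by
    rw [memLp_two_iff_integrable_sq (hY.measurable_section t).aestronglyMeasurable]
    simpa only [sq] using hY.integrable_mul t t
  have e : covFun ν X s t = covFun ν Y s t := by
    unfold covFun covariance
    have e1 := meanFun_congr h hs
    have e2 := meanFun_congr h ht
    unfold meanFun at e1 e2
    rw [e1, e2]
    exact integral_congr_ae (h.mono fun x hx => by simp only [hx s hs, hx t ht])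
  rw [e, covFun, covariance_eq_sub (hL s) (hL t)]
  rfl

end Moments

/-! ## Integrals of the local fits -/

section Integrated

variable {Ω S : Type*} [MeasurableSpace Ω] [MeasurableSpace S]
  {P : Measure Ω} [IsProbabilityMeasure P] {ν : Measure S} [IsProbabilityMeasure ν]
  {a b σ : ℝ} {f : ℝ → ℝ} {X : S → ℝ → ℝ} {ξ : ℕ → Ω → S} {T U : ℕ → ℕ → Ω → ℝ}
  {m : ℕ → ℕ → ℕ} {env : S × ℝ × ℝ → ℝ} {ρ v : ℕ → ℝ} {K : ℝ → ℝ} {bw : ℕ → ℝ}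
  {ζ : (S × ℝ × ℝ) × ℝ × ℝ → ℝ} {d : ℕ}

lemma integral_curveAvg {n : ℕ} {m : ℕ → ℕ} {φ : ℝ → ℕ → ℕ → ℕ → ℝ}
    (h : ∀ i j k, IntervalIntegrable (fun t => φ t i j k) volume a b) :
    ∫ t in a..b, curveAvg n m (φ t) = curveAvg n m fun i j k => ∫ t in a..b, φ t i j k := by
  have hs : ∀ i j, IntervalIntegrable
      (fun t => ∑ k ∈ (Finset.range (m i)).erase j, φ t i j k) volume a b := fun i j =>
    by simpa only [Finset.sum_fn] using IntervalIntegrable.sum _ fun k _ => h i j k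
  have hss : ∀ i, IntervalIntegrable (fun t => ∑ j ∈ Finset.range (m i),
      ∑ k ∈ (Finset.range (m i)).erase j, φ t i j k) volume a b := fun i =>
    by simpa only [Finset.sum_fn] using IntervalIntegrable.sum _ fun j _ => hs i j
  simp only [curveAvg, pairAvg]
  rw [intervalIntegral.integral_const_mul, intervalIntegral.integral_finsetSum
    fun i _ => (hss i).const_mul _]
  congr 1
  refine Finset.sum_congr rfl fun i _ => ?_
  rw [intervalIntegral.integral_const_mul, intervalIntegral.integral_finsetSum
    fun j _ => hs i j]
  congr 1
  exact Finset.sum_congr rfl fun j _ => intervalIntegral.integral_finsetSum fun k _ => h i j k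

lemma measurable_curveAvg {α : Type*} [MeasurableSpace α] {n : ℕ} {m : ℕ → ℕ}
    {φ : α → ℕ → ℕ → ℕ → ℝ} (h : ∀ i j k, Measurable fun t => φ t i j k) :
    Measurable fun t => curveAvg n m (φ t) :=
  Measurable.const_mul (Finset.measurable_fun_sum _ fun i _ => Measurable.const_mul
    (Finset.measurable_fun_sum _ fun j _ => Finset.measurable_fun_sum _ fun k _ => h i j k) _) _

/-- Regressors and weights that depend measurably on the point of the fit; the weights are
nonnegative and bounded, and the regressors at most `1` where the weights do not vanish. -/
structure DesignFamily (u : ℝ → Fin (d + 1) → ℝ × ℝ → ℝ) (W : ℝ → ℝ × ℝ → ℝ) (B : ℝ) : Prop where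
  measurable_regressor : ∀ p, Measurable fun y : ℝ × ℝ × ℝ => u y.1 p y.2
  measurable_weight : Measurable fun y : ℝ × ℝ × ℝ => W y.1 y.2
  nonneg : ∀ t x, 0 ≤ W t x
  le : ∀ t x, W t x ≤ B
  abs_mul_le : ∀ t p x, |u t p x| * W t x ≤ W t x

namespace DesignFamily

variable {u : ℝ → Fin (d + 1) → ℝ × ℝ → ℝ} {W : ℝ → ℝ × ℝ → ℝ} {B : ℝ} (hD : DesignFamily u W B)
include hD

lemma measurable_populationGram_inv (μ : Measure (ℝ × ℝ)) [SFinite μ] (p q : Fin (d + 1)) :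
    Measurable fun t => (populationGram μ (u t) (W t))⁻¹ p q := by
  refine measurable_matrix_inv (fun r s => ?_) p q
  have h1 : Measurable fun y : (ℝ × ℝ) × ℝ => u y.2 r y.1 * u y.2 s y.1 * W y.2 y.1 :=
    (((hD.measurable_regressor r).comp measurable_swap).mul
      ((hD.measurable_regressor s).comp measurable_swap)).mul
      (hD.measurable_weight.comp measurable_swap)
  have : StronglyMeasurable fun t => ∫ w, u t r w * u t s w * W t w ∂μ :=
    StronglyMeasurable.integral_prod_left (f := fun w t => u t r w * u t s w * W t w)
      h1.stronglyMeasurable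
  exact this.measurable

lemma measurable_regressor_section (p : Fin (d + 1)) (x : ℝ × ℝ) : Measurable fun t => u t p x :=
  (hD.measurable_regressor p).comp (measurable_id.prodMk measurable_const)

lemma measurable_weight_section (x : ℝ × ℝ) : Measurable fun t => W t x :=
  hD.measurable_weight.comp (measurable_id.prodMk measurable_const)

lemma measurable_sampleGram_inv (n : ℕ) (m : ℕ → ℕ) (τ : ℕ → ℕ → ℝ) (p q : Fin (d + 1)) :
    Measurable fun t => (sampleGram n m τ (u t) (W t))⁻¹ p q :=
  measurable_matrix_inv (fun r s => measurable_curveAvg fun _ _ _ =>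
    ((hD.measurable_regressor_section r _).mul (hD.measurable_regressor_section s _)).mul
      (hD.measurable_weight_section _)) p q

lemma measurable_sampleMoment (n : ℕ) (m : ℕ → ℕ) (τ : ℕ → ℕ → ℝ) (Z : ℕ → ℕ → ℕ → ℝ)
    (p : Fin (d + 1)) : Measurable fun t => sampleMoment n m τ (u t) (W t) Z p :=
  measurable_curveAvg fun _ _ _ =>
    ((hD.measurable_regressor_section p _).const_mul _).mul (hD.measurable_weight_section _)

lemma integral_weight_prod_le (hab : a ≤ b) {μ : Measure (ℝ × ℝ)} [IsFiniteMeasure μ] {w : ℝ}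
    (hw : ∀ t, ∫ x, W t x ∂μ ≤ w) : ∫ x, (∫ t in a..b, W t x) ∂μ ≤ (b - a) * w := by
  have hm : Measurable fun y : (ℝ × ℝ) × ℝ => W y.2 y.1 := hD.measurable_weight.comp measurable_swap
  have hB : ∀ t x, ‖W t x‖ ≤ B := fun t x => by
    rw [Real.norm_of_nonneg (hD.nonneg t x)]; exact hD.le t x
  have hint : Integrable (Function.uncurry fun (x : ℝ × ℝ) t => W t x)
      (μ.prod (volume.restrict (Ioc a b))) :=
    Integrable.of_bound hm.aestronglyMeasurable B (ae_of_all _ fun y => hB y.2 y.1)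
  simp only [intervalIntegral.integral_of_le hab]
  rw [integral_integral_swap hint]
  have hle : ∫ t in Ioc a b, ∫ x, W t x ∂μ ≤ ∫ _t in Ioc a b, w :=
    integral_mono hint.integral_prod_right (integrable_const _) hw
  refine hle.trans (le_of_eq ?_)
  simp [hab]

/-- A local fit is integrable if its normal equations are nonsingular. -/
lemma intervalIntegrable_fit (hab : a ≤ b) {n : ℕ} {m : ℕ → ℕ} {τ : ℕ → ℕ → ℝ}
    {Z : ℕ → ℕ → ℕ → ℝ} {ahat g : ℝ → ℝ} {c C : ℝ} (hc : 0 < c)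
    (hcoer : ∀ t ∈ Icc a b, Coercive (sampleGram n m τ (u t) (W t)) c)
    (hfit : ∀ t ∈ Icc a b, ∃ η : Fin (d + 1) → ℝ, η 0 = ahat t ∧
      (sampleGram n m τ (u t) (W t)).mulVec η = sampleMoment n m τ (u t) (W t) Z)
    (hg : IntegrableOn g (Icc a b)) (hC : ∀ t ∈ Icc a b, |ahat t - g t| ≤ C) :
    IntervalIntegrable ahat volume a b := by
  -- The estimator is an arbitrary choice of minimizers and carries no measurability by itself.
  -- Where the normal equations are nonsingular it coincides with this explicit formula, which is
  -- measurable in `t`.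
  set F : ℝ → ℝ := fun t => ∑ q, (sampleGram n m τ (u t) (W t))⁻¹ 0 q *
    sampleMoment n m τ (u t) (W t) Z q with hF
  have hFm : Measurable F := Finset.measurable_fun_sum _ fun q _ =>
    (hD.measurable_sampleGram_inv n m τ 0 q).mul (hD.measurable_sampleMoment n m τ Z q)
  have hFe : ∀ t ∈ Icc a b, F t = ahat t := fun t ht => by
    obtain ⟨η, h0, h1⟩ := hfit t ht
    have h2 : (sampleGram n m τ (u t) (W t))⁻¹.mulVec
        ((sampleGram n m τ (u t) (W t)).mulVec η) = η := by
      rw [Matrix.mulVec_mulVec, Matrix.nonsing_inv_mul _ ((hcoer t ht).isUnit_det hc),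
        Matrix.one_mulVec]
    rw [h1] at h2
    rw [← h0, ← congrFun h2 0]
    rfl
  rw [intervalIntegrable_iff_integrableOn_Icc_of_le hab]
  have : IntegrableOn F (Icc a b) := by
    refine Integrable.mono' (hg.abs.add (integrable_const C)) hFm.aestronglyMeasurable ?_
    filter_upwards [ae_restrict_mem measurableSet_Icc] with t ht
    rw [hFe t ht, Real.norm_eq_abs, Pi.add_apply]
    have := abs_sub_abs_le_abs_sub (ahat t) (g t)
    linarith [hC t ht]
  exact this.congr_fun hFe measurableSet_Icc

end DesignFamily

/-- The integrals of the linear parts of the local fits are averages of the noise with weights in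
`BoundedClass`. -/
theorem ae_integrated_noise_le (h : ObservationModel P ν a b σ f X ξ T U) (hab : a ≤ b)
    (hlaw : FamilyLaw P ν ξ T U m (BoundedClass (timeLaw P T) v) env ρ)
    (henvi : Integrable env (ν.prod ((errorLaw P U).prod (errorLaw P U))))
    (hζ : Measurable ζ) (hζe : ∀ z, |ζ z| ≤ env z.1) (hζc : IsCentered P ν U ζ)
    {u : ℕ → ℝ → Fin (d + 1) → ℝ × ℝ → ℝ} {W : ℕ → ℝ → ℝ × ℝ → ℝ} {B : ℕ → ℝ}
    (hD : ∀ n, DesignFamily (u n) (W n) (B n)) {c w C₁ : ℝ} (hc : 0 < c)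
    (hcoer : ∀ᶠ n in atTop, ∀ t ∈ Icc a b, Coercive
      (populationGram ((timeLaw P T).prod (timeLaw P T)) (u n t) (W n t)) c)
    (hw : ∀ n t, ∫ x, W n t x ∂((timeLaw P T).prod (timeLaw P T)) ≤ w)
    (hb : ∀ᶠ n in atTop, 0 ≤ v n ∧ ∀ x, ∫ t in a..b, W n t x ≤ C₁ * v n) :
    ∀ᵐ ω ∂P, ∃ C : ℝ, ∀ᶠ n in atTop, |∫ t in a..b, ∑ q,
      (populationGram ((timeLaw P T).prod (timeLaw P T)) (u n t) (W n t))⁻¹ 0 q *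
        sampleMoment n (m n) (fun i j => T i j ω) (u n t) (W n t)
          (fun i j k => ζ (pairData ξ T U ω i j k)) q| ≤ C * ρ n := by
  have := h.isProbabilityMeasure_errorLaw
  have := h.isProbabilityMeasure_timeLaw
  set μ := (timeLaw P T).prod (timeLaw P T) with hμ
  set D : ℝ := ((d + 1 : ℕ) : ℝ) with hDdef
  have hD0 : 0 ≤ D := Nat.cast_nonneg _
  set A : ℕ → Fin (d + 1) → ℝ → ℝ := fun n q t => (populationGram μ (u n t) (W n t))⁻¹ 0 q with hA
  have hAm : ∀ n q, Measurable (A n q) := fun n q => (hD n).measurable_populationGram_inv μ 0 q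
  -- Interchanging the integral over `t` with the finite averages turns the integrated linear part
  -- into an average of the noise with the single weight `G`, the integral of `φ`. No supremum over
  -- `t` remains, and the smaller bound of the integrated weight improves the rate.
  set φ : ℕ → ℝ → ℝ × ℝ → ℝ := fun n t x => ∑ q, A n q t * (u n t q x * W n t x) with hφ
  set G : ℕ → ℝ × ℝ → ℝ := fun n x => ∫ t in a..b, φ n t x with hG
  set H : ℕ → ℝ × ℝ → ℝ := fun n x => D * (D / c) * ∫ t in a..b, W n t x with hH
  have hφm : ∀ n, Measurable fun y : ℝ × ℝ × ℝ => φ n y.1 y.2 := fun n =>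
    Finset.measurable_fun_sum _ fun q _ => ((hAm n q).comp measurable_fst).mul
      (((hD n).measurable_regressor q).mul (hD n).measurable_weight)
  have hGm : ∀ n, Measurable (G n) := fun n => by
    have : StronglyMeasurable fun x => ∫ t in Ioc a b, φ n t x :=
      StronglyMeasurable.integral_prod_left (f := fun t x => φ n t x) (hφm n).stronglyMeasurable
    simp only [hG, intervalIntegral.integral_of_le hab]
    exact this.measurable
  have hHm : ∀ n, Measurable (H n) := fun n => by
    have : StronglyMeasurable fun x => ∫ t in Ioc a b, W n t x :=
      StronglyMeasurable.integral_prod_left (f := fun t x => W n t x)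
        (hD n).measurable_weight.stronglyMeasurable
    simp only [hH, intervalIntegral.integral_of_le hab]
    exact this.measurable.const_mul _
  have hWi : ∀ n x, IntervalIntegrable (fun t => W n t x) volume a b := fun n x => by
    rw [intervalIntegrable_iff_integrableOn_Icc_of_le hab]
    exact Integrable.of_bound ((hD n).measurable_weight_section x).aestronglyMeasurable (B n)
      (ae_of_all _ fun t => by
        rw [Real.norm_of_nonneg ((hD n).nonneg t x)]; exact (hD n).le t x)
  have hH0 : ∀ n x, 0 ≤ H n x := fun n x => mul_nonneg (by positivity)
    (intervalIntegral.integral_nonneg hab fun t _ => (hD n).nonneg t x)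
  have hφb : ∀ᶠ n in atTop, ∀ t ∈ Icc a b, ∀ x, |φ n t x| ≤ D * (D / c) * W n t x := by
    filter_upwards [hcoer] with n hn t ht x
    refine (Finset.abs_sum_le_sum_abs _ _).trans
      ((Finset.sum_le_sum (g := fun _ => D / c * W n t x) fun q _ => ?_).trans (le_of_eq ?_))
    · rw [abs_mul, abs_mul, abs_of_nonneg ((hD n).nonneg t x)]
      exact mul_le_mul ((hn t ht).abs_inv_le hc 0 q) ((hD n).abs_mul_le t q x)
        (mul_nonneg (abs_nonneg _) ((hD n).nonneg t x)) (by positivity)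
    · simp [hDdef]; ring
  have hφi : ∀ᶠ n in atTop, ∀ x, IntervalIntegrable (fun t => φ n t x) volume a b := by
    filter_upwards [hφb] with n hn x
    have hWx := (hWi n x).const_mul (D * (D / c))
    rw [intervalIntegrable_iff_integrableOn_Icc_of_le hab] at hWx ⊢
    refine Integrable.mono' hWx
      ((hφm n).comp (measurable_id.prodMk measurable_const)).aestronglyMeasurable ?_
    filter_upwards [ae_restrict_mem measurableSet_Icc] with t ht
    exact hn t ht x
  have hGH : ∀ᶠ n in atTop, ∀ x, |G n x| ≤ H n x := by
    filter_upwards [hφb, hφi] with n hn hi x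
    have : |G n x| ≤ ∫ t in a..b, D * (D / c) * W n t x := by
      simp only [hG]
      refine (intervalIntegral.abs_integral_le_integral_abs hab).trans ?_
      exact intervalIntegral.integral_mono_on hab (hi x).abs ((hWi n x).const_mul _)
        fun t ht => hn t ht x
    rwa [intervalIntegral.integral_const_mul] at this
  set κ : ℝ := D * (D / c) * (|C₁| + (b - a) * |w|) with hκ
  have hba : 0 ≤ b - a := sub_nonneg.2 hab
  have hHc : ∀ᶠ n in atTop, H n ∈ BoundedClass (timeLaw P T) v κ n := by
    filter_upwards [hb] with n ⟨hv, hn⟩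
    refine ⟨hHm n, hH0 n, fun x => ?_, ?_⟩
    · simp only [hH, hκ]
      rw [mul_assoc (D * (D / c))]
      refine mul_le_mul_of_nonneg_left ?_ (by positivity)
      refine (hn x).trans (mul_le_mul_of_nonneg_right ?_ hv)
      have : 0 ≤ (b - a) * |w| := by positivity
      linarith [le_abs_self C₁]
    · simp only [hH, hκ]
      rw [integral_const_mul]
      refine mul_le_mul_of_nonneg_left ?_ (by positivity)
      refine ((hD n).integral_weight_prod_le hab (hw n)).trans ?_
      have := mul_le_mul_of_nonneg_left (le_abs_self w) hba
      linarith [abs_nonneg C₁]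
  have hFH : ∀ᶠ n in atTop, ∀ z : (S × ℝ × ℝ) × ℝ × ℝ, |ζ z * G n z.2| ≤ env z.1 * H n z.2 := by
    filter_upwards [hGH] with n hn z
    rw [abs_mul]
    exact mul_le_mul (hζe z) (hn z.2) (abs_nonneg _) ((abs_nonneg _).trans (hζe z))
  -- Only one statistic is involved for each `n`, so the family has a single, arbitrary index.
  have hmain := hlaw (fun _ => {((0 : ℕ), (0 : ℕ))}) 1 (by
    filter_upwards [eventually_ge_atTop 1] with n hn
    simpa using hn) (fun n _ z => ζ z * G n z.2) (fun n _ => H n) κ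
    (fun n _ => hζ.mul ((hGm n).comp measurable_snd)) (by
      filter_upwards [hHc, hFH] with n h1 h2 l _
      exact ⟨h1, h2⟩)
  filter_upwards [hmain] with ω ⟨C, hC⟩
  refine ⟨C, ?_⟩
  filter_upwards [hC, hHc, hFH, hφi] with n hn hHc hFH hφi
  have e := hn (0, 0) (Finset.mem_singleton_self _)
  have hint : Integrable (fun z => ζ z * G n z.2) (pairLaw P ν T U) := by
    refine integrable_env_mul henvi (g := H n) ?_ (hζ.mul ((hGm n).comp measurable_snd)) hFH
    exact Integrable.of_bound (hHm n).aestronglyMeasurable (κ * v n) (ae_of_all _ fun x => by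
      rw [Real.norm_of_nonneg (hH0 n x)]; exact hHc.2.2.1 x)
  rw [hζc.integral_mul_eq_zero h hint, sub_zero] at e
  refine le_trans (le_of_eq ?_) e
  congr 1
  have e1 : ∀ t, ∑ q, (populationGram μ (u n t) (W n t))⁻¹ 0 q *
      sampleMoment n (m n) (fun i j => T i j ω) (u n t) (W n t)
        (fun i j k => ζ (pairData ξ T U ω i j k)) q =
      curveAvg n (m n) fun i j k => ζ (pairData ξ T U ω i j k) *
        φ n t (pairData ξ T U ω i j k).2 := fun t => by
    simp only [hφ, Finset.mul_sum]
    rw [curveAvg_finsetSum]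
    refine Finset.sum_congr rfl fun q _ => ?_
    rw [sampleMoment, crossMoment, ← curveAvg_const_mul]
    congr 1; ext i j k
    simp only [hA, pairData]; ring
  simp only [e1]
  rw [integral_curveAvg fun i j k => (hφi _).const_mul _]
  congr 1; ext i j k
  rw [intervalIntegral.integral_const_mul]

lemma designFamily₁ (hK : KernelCond K) {B : ℝ} (hKB : ∀ u, K u ≤ B) {h : ℝ} (hh : 0 < h) :
    DesignFamily (regressor₁ h) (weight₁ K h) (B / h) where
  measurable_regressor p := by unfold regressor₁; fun_prop
  measurable_weight := (measurable_scaledKernel hK h).comp (measurable_snd.fst.sub measurable_fst)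
  nonneg t x := scaledKernel_nonneg hK hh _
  le t x := scaledKernel_le hKB hh _
  abs_mul_le t p x := pow_mul_scaledKernel_le hK hh _ _

lemma designFamily₂ (hK : KernelCond K) {B : ℝ} (hKB : ∀ u, K u ≤ B) {h : ℝ} (hh : 0 < h) :
    DesignFamily (fun t => regressor₂ h t t) (fun t => weight₂ K h t t) (B / h * (B / h)) where
  measurable_regressor p := by unfold regressor₂; fun_prop
  measurable_weight := ((measurable_scaledKernel hK h).comp
    (measurable_snd.fst.sub measurable_fst)).mul ((measurable_scaledKernel hK h).comp
    (measurable_snd.snd.sub measurable_fst))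
  nonneg t x := mul_nonneg (scaledKernel_nonneg hK hh _) (scaledKernel_nonneg hK hh _)
  le t x := mul_le_mul (scaledKernel_le hKB hh _) (scaledKernel_le hKB hh _)
    (scaledKernel_nonneg hK hh _) ((scaledKernel_nonneg hK hh 0).trans (scaledKernel_le hKB hh 0))
  abs_mul_le t p x := by
    simp only [regressor₂, weight₂]
    rw [abs_mul, mul_mul_mul_comm]
    exact mul_le_mul (pow_mul_scaledKernel_le hK hh _ _) (pow_mul_scaledKernel_le hK hh _ _)
      (mul_nonneg (abs_nonneg _) (scaledKernel_nonneg hK hh _)) (scaledKernel_nonneg hK hh _)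

lemma integral_scaledKernel_sub_le (hK : KernelCond K) (hab : a ≤ b) {h : ℝ} (hh : 0 < h) (x : ℝ) :
    ∫ t in a..b, scaledKernel K h (x - t) ≤ 1 := by
  have hi : Integrable fun t => scaledKernel K h (t - x) :=
    integrable_scaledKernel_comp_sub hK hh x
  have e : ∀ t, scaledKernel K h (x - t) = scaledKernel K h (t - x) := fun t => by
    rw [scaledKernel, scaledKernel, ← neg_sub t x, neg_div, hK.symm]
  simp only [e]
  rw [intervalIntegral.integral_of_le hab, ← integral_scaledKernel_comp_sub hK hh x]
  exact setIntegral_le_integral hi (ae_of_all _ fun t => scaledKernel_nonneg hK hh _)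

/-- Along the diagonal one kernel factor is integrated and the other bounded by `B / h`. The size
thus drops from `h⁻²` to `h⁻¹`, which is the gain of `σ̂²` over the pointwise rate of `Ĉ`. -/
lemma integral_weight₂_diag_le (hK : KernelCond K) {B : ℝ} (hKB : ∀ u, K u ≤ B) (hab : a ≤ b)
    {h : ℝ} (hh : 0 < h) (x : ℝ × ℝ) : ∫ t in a..b, weight₂ K h t t x ≤ B / h := by
  have hi : ∀ x, IntervalIntegrable (fun t => scaledKernel K h (x - t)) volume a b := fun x => by
    rw [intervalIntegrable_iff_integrableOn_Icc_of_le hab]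
    exact Integrable.of_bound ((measurable_scaledKernel hK h).comp
      (measurable_const.sub measurable_id)).aestronglyMeasurable (B / h) (ae_of_all _ fun t => by
        rw [Real.norm_of_nonneg (scaledKernel_nonneg hK hh _)]; exact scaledKernel_le hKB hh _)
  have hBh : 0 ≤ B / h := (scaledKernel_nonneg hK hh 0).trans (scaledKernel_le hKB hh 0)
  have hi2 : IntervalIntegrable (fun t => weight₂ K h t t x) volume a b := by
    rw [intervalIntegrable_iff_integrableOn_Icc_of_le hab]
    exact Integrable.of_bound ((designFamily₂ hK hKB hh).measurable_weight_section
      x).aestronglyMeasurable (B / h * (B / h)) (ae_of_all _ fun t => by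
        rw [Real.norm_of_nonneg ((designFamily₂ hK hKB hh).nonneg t x)]
        exact (designFamily₂ hK hKB hh).le t x)
  calc ∫ t in a..b, weight₂ K h t t x ≤ ∫ t in a..b, scaledKernel K h (x.1 - t) * (B / h) :=
        intervalIntegral.integral_mono_on hab hi2 ((hi x.1).mul_const _) fun t _ =>
          mul_le_mul_of_nonneg_left (scaledKernel_le hKB hh _) (scaledKernel_nonneg hK hh _)
    _ = (∫ t in a..b, scaledKernel K h (x.1 - t)) * (B / h) :=
        intervalIntegral.integral_mul_const _ _
    _ ≤ 1 * (B / h) := by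
        gcongr
        exact integral_scaledKernel_sub_le hK hab hh x.1
    _ = B / h := one_mul _

end Integrated

/-! ## The estimators of the moments -/

section Envelopes

variable {Ω S : Type*} [MeasurableSpace Ω] [MeasurableSpace S]
  {P : Measure Ω} [IsProbabilityMeasure P] {ν : Measure S} [IsProbabilityMeasure ν]
  {a b σ : ℝ} {f : ℝ → ℝ} {X Y : S → ℝ → ℝ} {ξ : ℕ → Ω → S} {T U : ℕ → ℕ → Ω → ℝ} {B : S → ℝ}

lemma add_three_rpow_le {x y z p : ℝ} (hx : 0 ≤ x) (hy : 0 ≤ y) (hz : 0 ≤ z) (hp : 0 ≤ p) :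
    (x + y + z) ^ p ≤ 3 ^ p * (x ^ p + y ^ p + z ^ p) := by
  have hx' := Real.rpow_nonneg hx p
  have hy' := Real.rpow_nonneg hy p
  have hz' := Real.rpow_nonneg hz p
  have key : ∀ w : ℝ, 0 ≤ w → x + y + z ≤ 3 * w → w ^ p ≤ x ^ p + y ^ p + z ^ p →
      (x + y + z) ^ p ≤ 3 ^ p * (x ^ p + y ^ p + z ^ p) := fun w hw h1 h2 =>
    calc (x + y + z) ^ p ≤ (3 * w) ^ p := Real.rpow_le_rpow (by positivity) h1 hp
      _ = 3 ^ p * w ^ p := Real.mul_rpow (by norm_num) hw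
      _ ≤ _ := by gcongr
  rcases le_total x y with h1 | h1
  · rcases le_total y z with h2 | h2
    · exact key z hz (by linarith) (by linarith)
    · exact key y hy (by linarith) (by linarith)
  · rcases le_total x z with h2 | h2
    · exact key z hz (by linarith) (by linarith)
    · exact key x hx (by linarith) (by linarith)

/-- The envelope of a single observation. -/
noncomputable def singleEnv (ν : Measure S) (σ : ℝ) (B : S → ℝ) (y : S × ℝ × ℝ) : ℝ :=
  obsBound ν σ B y.1 y.2.1

/-- The envelope of the square of a single observation. -/
noncomputable def squareEnv (ν : Measure S) (σ : ℝ) (B : S → ℝ) (y : S × ℝ × ℝ) : ℝ :=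
  obsBound ν σ B y.1 y.2.1 ^ 2

/-- The envelope of the product of two observations. -/
noncomputable def crossEnv (ν : Measure S) (σ : ℝ) (B : S → ℝ) (y : S × ℝ × ℝ) : ℝ :=
  obsBound ν σ B y.1 y.2.1 * obsBound ν σ B y.1 y.2.2

variable (h : ObservationModel P ν a b σ f X ξ T U) (hY : EnvelopedPaths ν Y B)

section Basic

include hY

lemma one_le_singleEnv (y : S × ℝ × ℝ) : 1 ≤ singleEnv ν σ B y := one_le_obsBound hY σ _ _

lemma one_le_squareEnv (y : S × ℝ × ℝ) : 1 ≤ squareEnv ν σ B y :=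
  one_le_pow₀ (one_le_obsBound hY σ _ _)

lemma one_le_crossEnv (y : S × ℝ × ℝ) : 1 ≤ crossEnv ν σ B y :=
  one_le_mul_of_one_le_of_one_le (one_le_obsBound hY σ _ _) (one_le_obsBound hY σ _ _)

lemma measurable_singleEnv : Measurable (singleEnv ν σ B) :=
  (measurable_obsBound hY σ).comp (measurable_fst.prodMk measurable_snd.fst)

lemma measurable_squareEnv : Measurable (squareEnv ν σ B) :=
  (measurable_singleEnv hY).pow_const 2

lemma measurable_crossEnv : Measurable (crossEnv ν σ B) :=
  (measurable_singleEnv hY).mul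
    ((measurable_obsBound hY σ).comp (measurable_fst.prodMk measurable_snd.snd))

lemma one_le_obsBound_const : 1 ≤ 1 + (∫ y, B y ∂ν) + (∫ y, B y ^ 2 ∂ν) + σ ^ 2 := by
  have h1 : 0 ≤ ∫ y, B y ∂ν := integral_nonneg hY.nonneg
  have h2 : 0 ≤ ∫ y, B y ^ 2 ∂ν := integral_nonneg fun y => sq_nonneg _
  have := sq_nonneg σ
  linarith

end Basic

include h hY

lemma integrable_obsBound_rpow {p : ℝ} (hp : 0 ≤ p) (hB : Integrable (fun x => B x ^ p) ν)
    (hU : Integrable (fun u => |u| ^ p) (errorLaw P U)) :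
    Integrable (fun y : S × ℝ × ℝ => obsBound ν σ B y.1 y.2.1 ^ p)
      (ν.prod ((errorLaw P U).prod (errorLaw P U))) ∧
    Integrable (fun y : S × ℝ × ℝ => obsBound ν σ B y.1 y.2.2 ^ p)
      (ν.prod ((errorLaw P U).prod (errorLaw P U))) := by
  have := h.isProbabilityMeasure_errorLaw
  set c := 1 + (∫ y, B y ∂ν) + (∫ y, B y ^ 2 ∂ν) + σ ^ 2 with hc
  have hc1 : 1 ≤ c := one_le_obsBound_const hY
  have hle : ∀ x u, ‖obsBound ν σ B x u ^ p‖ ≤ 3 ^ p * (c ^ p + B x ^ p + |u| ^ p) := fun x u => by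
    have h1 := one_le_obsBound hY σ x u
    rw [Real.norm_of_nonneg (Real.rpow_nonneg (by linarith) p)]
    exact add_three_rpow_le (by linarith) (hY.nonneg x) (abs_nonneg u) hp
  have hm1 : Measurable fun y : S × ℝ × ℝ => obsBound ν σ B y.1 y.2.1 ^ p :=
    ((measurable_obsBound hY σ).comp (measurable_fst.prodMk measurable_snd.fst)).pow_const p
  have hm2 : Measurable fun y : S × ℝ × ℝ => obsBound ν σ B y.1 y.2.2 ^ p :=
    ((measurable_obsBound hY σ).comp (measurable_fst.prodMk measurable_snd.snd)).pow_const p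
  have iB : Integrable (fun y : S × ℝ × ℝ => B y.1 ^ p)
    (ν.prod ((errorLaw P U).prod (errorLaw P U))) := hB.comp_fst _
  have iU1 : Integrable (fun y : S × ℝ × ℝ => |y.2.1| ^ p)
    (ν.prod ((errorLaw P U).prod (errorLaw P U))) := (hU.comp_fst (errorLaw P U)).comp_snd ν
  have iU2 : Integrable (fun y : S × ℝ × ℝ => |y.2.2| ^ p)
    (ν.prod ((errorLaw P U).prod (errorLaw P U))) := (hU.comp_snd (errorLaw P U)).comp_snd ν
  exact ⟨((((integrable_const (c ^ p)).add iB).add iU1).const_mul (3 ^ p)).mono'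
      hm1.aestronglyMeasurable (ae_of_all _ fun y => hle _ _),
    ((((integrable_const (c ^ p)).add iB).add iU2).const_mul (3 ^ p)).mono'
      hm2.aestronglyMeasurable (ae_of_all _ fun y => hle _ _)⟩

lemma integrable_squareEnv_rpow {p : ℝ} (hp : 0 ≤ p) (hB : Integrable (fun x => B x ^ (2 * p)) ν)
    (hU : Integrable (fun u => |u| ^ (2 * p)) (errorLaw P U)) :
    Integrable (fun y => squareEnv ν σ B y ^ p)
      (ν.prod ((errorLaw P U).prod (errorLaw P U))) := by
  refine (integrable_obsBound_rpow h hY (by positivity) hB hU).1.congr (ae_of_all _ fun y => ?_)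
  have := one_le_obsBound hY σ y.1 y.2.1
  simp only [squareEnv]
  rw [Real.rpow_mul (by linarith), Real.rpow_two]

/-- The product of two bounds to the power `p` is at most the sum of their powers `2p`; hence the
moments of order `2 λ` in the assumptions. -/
lemma integrable_crossEnv_rpow {p : ℝ} (hp : 0 ≤ p) (hB : Integrable (fun x => B x ^ (2 * p)) ν)
    (hU : Integrable (fun u => |u| ^ (2 * p)) (errorLaw P U)) :
    Integrable (fun y => crossEnv ν σ B y ^ p)
      (ν.prod ((errorLaw P U).prod (errorLaw P U))) := by
  obtain ⟨h1, h2⟩ := integrable_obsBound_rpow h hY (by positivity) hB hU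
  refine (h1.add h2).mono' ((measurable_crossEnv hY).pow_const p).aestronglyMeasurable
    (ae_of_all _ fun y => ?_)
  have e1 : 0 ≤ obsBound ν σ B y.1 y.2.1 := zero_le_one.trans (one_le_obsBound hY σ y.1 y.2.1)
  have e2 : 0 ≤ obsBound ν σ B y.1 y.2.2 := zero_le_one.trans (one_le_obsBound hY σ y.1 y.2.2)
  simp only [crossEnv, Pi.add_apply]
  rw [Real.norm_of_nonneg (Real.rpow_nonneg (mul_nonneg e1 e2) p), Real.mul_rpow e1 e2, mul_comm 2 p,
    Real.rpow_mul e1, Real.rpow_mul e2, Real.rpow_two, Real.rpow_two]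
  nlinarith [sq_nonneg (obsBound ν σ B y.1 y.2.1 ^ p - obsBound ν σ B y.1 y.2.2 ^ p),
    sq_nonneg (obsBound ν σ B y.1 y.2.1 ^ p), sq_nonneg (obsBound ν σ B y.1 y.2.2 ^ p)]

lemma integrable_crossEnv : Integrable (crossEnv ν σ B)
    (ν.prod ((errorLaw P U).prod (errorLaw P U))) := by
  have := integrable_crossEnv_rpow h hY zero_le_one (p := 1)
    (by simpa using hY.integrable_sq) (by simpa using integrable_error_sq h)
  simpa using this

lemma integrable_squareEnv : Integrable (squareEnv ν σ B)
    (ν.prod ((errorLaw P U).prod (errorLaw P U))) := by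
  have := integrable_squareEnv_rpow h hY zero_le_one (p := 1)
    (by simpa using hY.integrable_sq) (by simpa using integrable_error_sq h)
  simpa using this

lemma integrable_singleEnv : Integrable (singleEnv ν σ B)
    (ν.prod ((errorLaw P U).prod (errorLaw P U))) := by
  have := (integrable_obsBound_rpow h hY zero_le_one (p := 1)
    (by simpa using hY.integrable) (by simpa using (integrable_error h).abs)).1
  simp only [Real.rpow_one] at this
  exact this

end Envelopes

/-! ### Rates of the fits and of their integrals -/

section Fits

variable {Ω S : Type*} [MeasurableSpace Ω] [MeasurableSpace S]
  {P : Measure Ω} [IsProbabilityMeasure P] {ν : Measure S} [IsProbabilityMeasure ν]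
  {a b σ : ℝ} {f : ℝ → ℝ} {X Y : S → ℝ → ℝ} {ξ : ℕ → Ω → S} {T U : ℕ → ℕ → Ω → ℝ} {B : S → ℝ}
  {m : ℕ → ℕ → ℕ} {K : ℝ → ℝ} {mT MT : ℝ}

/-- The elementary conditions on a bandwidth and the rate of the noise averages. -/
structure FitRates (bw ρ : ℕ → ℝ) : Prop where
  pos : ∀ n, 0 < bw n
  tendsto : Tendsto bw atTop (𝓝 0)
  one_le : ∀ᶠ n : ℕ in atTop, 1 ≤ n * bw n
  inv_le : ∀ᶠ n : ℕ in atTop, (n : ℝ)⁻¹ ≤ ρ n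
  rate_nonneg : ∀ n, 0 ≤ ρ n
  rate_tendsto : Tendsto ρ atTop (𝓝 0)

/-- The univariate fits `ahat` of `g` have the rate `ρ + bw²`. -/
def UnivariateRate (P : Measure Ω) (ξ : ℕ → Ω → S) (T U : ℕ → ℕ → Ω → ℝ) (m : ℕ → ℕ → ℕ) (a b : ℝ)
    (K : ℝ → ℝ) (bw ρ : ℕ → ℝ) (ζ : (S × ℝ × ℝ) × ℝ × ℝ → ℝ) (g : ℝ → ℝ)
    (ahat : ℕ → Ω → ℝ → ℝ) : Prop :=
  ∃ c : ℝ, 0 < c ∧ (∀ᶠ n in atTop, ∀ t ∈ Icc a b, Coercive (populationGram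
      ((timeLaw P T).prod (timeLaw P T)) (regressor₁ (bw n) t) (weight₁ K (bw n) t)) c) ∧
    ∀ᵐ ω ∂P, ∃ C : ℝ, ∀ᶠ n in atTop, LocalFitRate (Θ := Icc a b) ξ T U m
      ((timeLaw P T).prod (timeLaw P T)) (fun n t => regressor₁ (bw n) t)
      (fun n t => weight₁ K (bw n) t) ζ (fun t => g t) bw ρ (fun n ω t => ahat n ω t)
      (c / 2) C n ω

/-- The bivariate fits `ahat` of `g` have the rate `ρ + bw²`. -/
def BivariateRate (P : Measure Ω) (ξ : ℕ → Ω → S) (T U : ℕ → ℕ → Ω → ℝ) (m : ℕ → ℕ → ℕ) (a b : ℝ)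
    (K : ℝ → ℝ) (bw ρ : ℕ → ℝ) (ζ : (S × ℝ × ℝ) × ℝ × ℝ → ℝ) (g : ℝ → ℝ → ℝ)
    (ahat : ℕ → Ω → ℝ → ℝ → ℝ) : Prop :=
  ∃ c : ℝ, 0 < c ∧ (∀ᶠ n in atTop, ∀ s ∈ Icc a b, ∀ t ∈ Icc a b, Coercive (populationGram
      ((timeLaw P T).prod (timeLaw P T)) (regressor₂ (bw n) s t) (weight₂ K (bw n) s t)) c) ∧
    ∀ᵐ ω ∂P, ∃ C : ℝ, ∀ᶠ n in atTop, LocalFitRate (Θ := Icc a b × Icc a b) ξ T U m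
      ((timeLaw P T).prod (timeLaw P T)) (fun n θ => regressor₂ (bw n) θ.1 θ.2)
      (fun n θ => weight₂ K (bw n) θ.1 θ.2) ζ (fun θ => g θ.1 θ.2) bw ρ
      (fun n ω θ => ahat n ω θ.1 θ.2) (c / 2) C n ω

section Rates

variable (h : ObservationModel P ν a b σ f X ξ T U) (hab : a < b)
  (hm : ∀ n, ∀ i < n, 2 ≤ m n i) (hK : KernelCond K) (hτ : DesignLaw a b mT MT (timeLaw P T))
  (hY : EnvelopedPaths ν Y B)
  (hobs : ∀ᵐ ω ∂P, ∀ i j, T i j ω ∈ Icc a b ∧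
    obs X ξ T U ω i j = Y (ξ i ω) (T i j ω) + U i j ω)
  {bw ρ : ℕ → ℝ} (hr : FitRates bw ρ)
include h hab hK hτ hY hobs hr

include hm in
lemma univariateRate_mean
    (hlaw : FamilyLaw P ν ξ T U m (SingleClass (timeLaw P T) bw) (singleEnv ν σ B) ρ)
    {g' : ℝ → ℝ} {Bg : ℝ} (hBg : 0 ≤ Bg) (hg : ∀ t ∈ Icc a b, ∀ x ∈ Icc a b,
      |meanFun ν Y x - meanFun ν Y t - g' t * (x - t)| ≤ Bg * (x - t) ^ 2)
    {μhat : ℕ → Ω → ℝ → ℝ} (hfit : ∀ n ω, ∀ t ∈ Icc a b, IsLocalLinearFit₁ K (bw n) n (m n)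
      (fun i j => T i j ω) (obs X ξ T U ω) t (μhat n ω t)) :
    UnivariateRate P ξ T U m a b K bw ρ (meanNoise ν Y) (meanFun ν Y) μhat :=
  ae_univariate_fit h hab hm hK hτ hlaw (measurable_singleEnv hY) (one_le_singleEnv hY)
    (integrable_singleEnv h hY) hY.measurable_meanNoise (fun z => abs_meanNoise_le hY σ z)
    (isCentered_meanNoise h hY) hr.pos hr.tendsto hr.one_le hr.inv_le hr.rate_nonneg
    hr.rate_tendsto hBg hg (hobs.mono fun ω hω i j k => ⟨(hω i j).1, by
      rw [(hω i j).2]; simp only [meanNoise, pairData]; ring⟩) hfit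

include hm in
lemma univariateRate_square
    (hlaw : FamilyLaw P ν ξ T U m (SingleClass (timeLaw P T) bw) (squareEnv ν σ B) ρ)
    {g' : ℝ → ℝ} {Bg : ℝ} (hBg : 0 ≤ Bg) (hg : ∀ t ∈ Icc a b, ∀ x ∈ Icc a b,
      |(secondMoment ν Y x x + σ ^ 2) - (secondMoment ν Y t t + σ ^ 2) - g' t * (x - t)| ≤
        Bg * (x - t) ^ 2)
    {Vhat : ℕ → Ω → ℝ → ℝ} (hfit : ∀ n ω, ∀ t ∈ Icc a b, IsLocalLinearFit₁ K (bw n) n (m n)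
      (fun i j => T i j ω) (fun i j => obs X ξ T U ω i j ^ 2) t (Vhat n ω t)) :
    UnivariateRate P ξ T U m a b K bw ρ (squareNoise ν σ Y)
      (fun t => secondMoment ν Y t t + σ ^ 2) Vhat :=
  ae_univariate_fit h hab hm hK hτ hlaw (measurable_squareEnv hY) (one_le_squareEnv hY)
    (integrable_squareEnv h hY) (hY.measurable_squareNoise σ) (fun z => abs_squareNoise_le hY σ z)
    (isCentered_squareNoise h hY) hr.pos hr.tendsto hr.one_le hr.inv_le hr.rate_nonneg
    hr.rate_tendsto hBg (g := fun t => secondMoment ν Y t t + σ ^ 2) hg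
    (Z := fun ω i j => obs X ξ T U ω i j ^ 2) (hobs.mono fun ω hω i j k => ⟨(hω i j).1, by
      rw [(hω i j).2]; simp only [squareNoise, pairData]; ring⟩) hfit

lemma bivariateRate_cross
    (hlaw : FamilyLaw P ν ξ T U m (PairClass (timeLaw P T) bw) (crossEnv ν σ B) ρ)
    {g₁ g₂ : ℝ → ℝ → ℝ} {Bg : ℝ} (hBg : 0 ≤ Bg) (hg : ∀ s ∈ Icc a b, ∀ t ∈ Icc a b,
      ∀ x ∈ Icc a b, ∀ y ∈ Icc a b,
      |secondMoment ν Y x y - secondMoment ν Y s t - g₁ s t * (x - s) - g₂ s t * (y - t)| ≤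
        Bg * ((x - s) ^ 2 + (y - t) ^ 2))
    {Chat : ℕ → Ω → ℝ → ℝ → ℝ} (hfit : ∀ n ω, ∀ s ∈ Icc a b, ∀ t ∈ Icc a b,
      IsLocalLinearFit₂ K (bw n) n (m n) (fun i j => T i j ω) (obs X ξ T U ω) s t
        (Chat n ω s t)) :
    BivariateRate P ξ T U m a b K bw ρ (crossNoise ν Y) (secondMoment ν Y) Chat :=
  ae_bivariate_fit h hab hK hτ hlaw (measurable_crossEnv hY) (one_le_crossEnv hY)
    (integrable_crossEnv h hY) hY.measurable_crossNoise (fun z => abs_crossNoise_le hY σ z)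
    (isCentered_crossNoise h hY) hr.pos hr.tendsto hr.one_le hr.inv_le hr.rate_nonneg
    hr.rate_tendsto hBg hg (hobs.mono fun ω hω i j k => ⟨(hω i j).1, by
      rw [(hω i j).2, (hω i k).2]; simp only [crossNoise, pairData]; ring⟩) hfit

end Rates

/-! ## The covariance estimator -/

/-- The rate of the covariance estimator. -/
theorem ae_covEst_le (hY : EnvelopedPaths ν Y B)
    (hYX : ∀ᵐ x ∂ν, ∀ t ∈ Icc a b, Y x t = X x t) {bw ρ bw' ρ' : ℕ → ℝ} (hr : FitRates bw ρ)
    (hr' : FitRates bw' ρ') {ζ ζ' : (S × ℝ × ℝ) × ℝ × ℝ → ℝ} {μhat : ℕ → Ω → ℝ → ℝ} {Chat : ℕ → Ω → ℝ → ℝ → ℝ}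
    (hμ : UnivariateRate P ξ T U m a b K bw ρ ζ (meanFun ν Y) μhat)
    (hC : BivariateRate P ξ T U m a b K bw' ρ' ζ' (secondMoment ν Y) Chat) :
    ∀ᵐ ω ∂P, ∃ C : ℝ, ∀ᶠ n in atTop, ∀ s ∈ Icc a b, ∀ t ∈ Icc a b,
      |covEst μhat Chat n ω s t - covFun ν X s t| ≤
        C * (ρ n + bw n ^ 2) + C * (ρ' n + bw' n ^ 2) := by
  obtain ⟨_, _, _, hμ⟩ := hμ
  obtain ⟨_, _, _, hC⟩ := hC
  filter_upwards [hμ, hC] with ω ⟨C₁, h1⟩ ⟨C₂, h2⟩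
  set A := ∫ x, B x ∂ν with hA
  have hA0 : 0 ≤ A := integral_nonneg hY.nonneg
  refine ⟨|C₁| * (2 * A + |C₁|) + |C₂|, ?_⟩
  have hlim : Tendsto (fun n => ρ n + bw n ^ 2) atTop (𝓝 0) := by
    simpa using hr.rate_tendsto.add (hr.tendsto.pow 2)
  filter_upwards [h1, h2, hlim.eventually_le_const one_pos] with n h1 h2 hn s hs t ht
  set e := ρ n + bw n ^ 2 with he
  have he0 : 0 ≤ e := add_nonneg (hr.rate_nonneg n) (sq_nonneg _)
  have hb1 : ∀ t ∈ Icc a b, |μhat n ω t - meanFun ν Y t| ≤ |C₁| * e := fun t ht =>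
    (h1.rate ⟨t, ht⟩).trans (mul_le_mul_of_nonneg_right (le_abs_self _) he0)
  have hb2 : |Chat n ω s t - secondMoment ν Y s t| ≤ C₂ * (ρ' n + bw' n ^ 2) :=
    h2.rate (⟨s, hs⟩, ⟨t, ht⟩)
  have hm : ∀ t, |meanFun ν Y t| ≤ A := fun t => hY.abs_meanFun_le t
  have hmh : |μhat n ω t| ≤ A + |C₁| := by
    have := abs_sub_abs_le_abs_sub (μhat n ω t) (meanFun ν Y t)
    have := hb1 t ht
    have : |C₁| * e ≤ |C₁| := mul_le_of_le_one_right (abs_nonneg _) hn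
    linarith [hm t]
  rw [covFun_eq hY hYX hs ht, covEst]
  have e1 : Chat n ω s t - μhat n ω s * μhat n ω t -
      (secondMoment ν Y s t - meanFun ν Y s * meanFun ν Y t) =
      (Chat n ω s t - secondMoment ν Y s t) - ((μhat n ω s - meanFun ν Y s) * μhat n ω t +
        meanFun ν Y s * (μhat n ω t - meanFun ν Y t)) := by ring
  rw [e1]
  have e2 : |(μhat n ω s - meanFun ν Y s) * μhat n ω t +
      meanFun ν Y s * (μhat n ω t - meanFun ν Y t)| ≤ |C₁| * (2 * A + |C₁|) * e := by
    refine (abs_add_le _ _).trans ?_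
    rw [abs_mul, abs_mul]
    calc _ ≤ |C₁| * e * (A + |C₁|) + A * (|C₁| * e) :=
          add_le_add (mul_le_mul (hb1 s hs) hmh (abs_nonneg _) (by positivity))
            (mul_le_mul (hm s) (hb1 t ht) (abs_nonneg _) hA0)
      _ = _ := by ring
  have he'0 : 0 ≤ ρ' n + bw' n ^ 2 := add_nonneg (hr'.rate_nonneg n) (sq_nonneg _)
  have e3 : 0 ≤ |C₂| * e := by positivity
  have e4 : 0 ≤ |C₁| * (2 * A + |C₁|) * (ρ' n + bw' n ^ 2) := by positivity
  have e5 := mul_le_mul_of_nonneg_right (le_abs_self C₂) he'0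
  refine (abs_sub _ _).trans ?_
  linarith

/-! ## The error variance estimator -/

/-- The integral of `ahat n ω - g` has the rate `r` almost surely. -/
def IntegralRate (P : Measure Ω) (a b : ℝ) (ahat : ℕ → Ω → ℝ → ℝ) (g : ℝ → ℝ) (r : ℕ → ℝ) : Prop :=
  ∀ᵐ ω ∂P, ∃ C : ℝ, ∀ᶠ n in atTop, IntervalIntegrable (ahat n ω) volume a b ∧
    |∫ t in a..b, (ahat n ω t - g t)| ≤ C * r n

lemma IntegralRate.mono {ahat : ℕ → Ω → ℝ → ℝ} {g : ℝ → ℝ} {r r' : ℕ → ℝ}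
    (hi : IntegralRate P a b ahat g r) (hr : r =O[atTop] r') (h0 : ∀ᶠ n in atTop, 0 ≤ r n)
    (h0' : ∀ᶠ n in atTop, 0 ≤ r' n) : IntegralRate P a b ahat g r' := by
  obtain ⟨c, hc⟩ := hr.bound
  filter_upwards [hi] with ω ⟨C, hC⟩
  refine ⟨|C| * c, ?_⟩
  filter_upwards [hC, hc, h0, h0'] with n ⟨h1, h2⟩ h3 h4 h5
  rw [Real.norm_of_nonneg h4, Real.norm_of_nonneg h5] at h3
  refine ⟨h1, h2.trans ?_⟩
  calc C * r n ≤ |C| * r n := mul_le_mul_of_nonneg_right (le_abs_self C) h4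
    _ ≤ |C| * (c * r' n) := mul_le_mul_of_nonneg_left h3 (abs_nonneg C)
    _ = _ := by ring

lemma abs_integral_sub_le {φ L : ℝ → ℝ} (hab : a ≤ b) (hφ : IntervalIntegrable φ volume a b)
    (hL : Measurable L) {C₁ C₂ : ℝ} (h1 : ∀ t ∈ Icc a b, |φ t| ≤ C₁)
    (h2 : ∀ t ∈ Icc a b, |φ t - L t| ≤ C₂) :
    |∫ t in a..b, φ t| ≤ (b - a) * C₂ + |∫ t in a..b, L t| := by
  have hLi : IntervalIntegrable L volume a b := by
    rw [intervalIntegrable_iff_integrableOn_Icc_of_le hab]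
    refine Integrable.mono' (integrable_const (C₁ + C₂)) hL.aestronglyMeasurable ?_
    filter_upwards [ae_restrict_mem measurableSet_Icc] with t ht
    have := abs_sub_abs_le_abs_sub (L t) (φ t)
    rw [abs_sub_comm] at this
    rw [Real.norm_eq_abs]
    linarith [h1 t ht, h2 t ht]
  -- The difference between the error and its linear part is bounded pointwise, whereas the linear
  -- part is kept inside the integral, where averaging improves its rate.
  have e : ∫ t in a..b, φ t = (∫ t in a..b, (φ t - L t)) + ∫ t in a..b, L t := by
    rw [← intervalIntegral.integral_add (hφ.sub hLi) hLi]
    simp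
  rw [e]
  refine (abs_add_le _ _).trans (add_le_add_left ?_ _)
  have := intervalIntegral.norm_integral_le_of_norm_le_const (f := fun t => φ t - L t) (C := C₂)
    (a := a) (b := b) fun t ht => h2 t (by
      rw [uIoc_of_le hab] at ht; exact Ioc_subset_Icc_self ht)
  rw [Real.norm_eq_abs, abs_of_nonneg (sub_nonneg.2 hab), mul_comm] at this
  exact this

/-- The rate of the integrals of local fits. -/
lemma integralRate_of_localFit {d : ℕ} (hab : a ≤ b) {u : ℕ → ℝ → Fin (d + 1) → ℝ × ℝ → ℝ}
    {W : ℕ → ℝ → ℝ × ℝ → ℝ} {B : ℕ → ℝ} (hD : ∀ n, DesignFamily (u n) (W n) (B n))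
    {μ : Measure (ℝ × ℝ)} [SFinite μ] {ζ : (S × ℝ × ℝ) × ℝ × ℝ → ℝ} {Z : Ω → ℕ → ℕ → ℕ → ℝ}
    {ahat : ℕ → Ω → ℝ → ℝ} {g : ℝ → ℝ} {c : ℝ} (hc : 0 < c) (hg : IntegrableOn g (Icc a b))
    {r r₁ ρ₁ : ℕ → ℝ}
    (hfit : ∀ n ω, ∀ t ∈ Icc a b, ∃ η : Fin (d + 1) → ℝ, η 0 = ahat n ω t ∧
      (sampleGram n (m n) (fun i j => T i j ω) (u n t) (W n t)).mulVec η =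
        sampleMoment n (m n) (fun i j => T i j ω) (u n t) (W n t) (Z ω))
    (hrate : ∀ᵐ ω ∂P, ∃ C : ℝ, ∀ᶠ n in atTop, ∀ t ∈ Icc a b,
      Coercive (sampleGram n (m n) (fun i j => T i j ω) (u n t) (W n t)) c ∧
      |ahat n ω t - g t| ≤ C * r n ∧
      |ahat n ω t - g t - ∑ q, (populationGram μ (u n t) (W n t))⁻¹ 0 q *
        sampleMoment n (m n) (fun i j => T i j ω) (u n t) (W n t)
          (fun i j k => ζ (pairData ξ T U ω i j k)) q| ≤ C * r₁ n) :
    IntegralRate P a b ahat g r ∧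
    ((∀ n, 0 ≤ r₁ n) → (∀ n, 0 ≤ ρ₁ n) →
      (∀ᵐ ω ∂P, ∃ C : ℝ, ∀ᶠ n in atTop, |∫ t in a..b, ∑ q,
        (populationGram μ (u n t) (W n t))⁻¹ 0 q *
          sampleMoment n (m n) (fun i j => T i j ω) (u n t) (W n t)
            (fun i j k => ζ (pairData ξ T U ω i j k)) q| ≤ C * ρ₁ n) →
      IntegralRate P a b ahat g fun n => r₁ n + ρ₁ n) := by
  have hba : 0 ≤ b - a := sub_nonneg.2 hab
  have hgi : IntervalIntegrable g volume a b := by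
    rwa [intervalIntegrable_iff_integrableOn_Icc_of_le hab]
  have hint : ∀ n ω, ∀ C : ℝ, (∀ t ∈ Icc a b,
      Coercive (sampleGram n (m n) (fun i j => T i j ω) (u n t) (W n t)) c ∧
        |ahat n ω t - g t| ≤ C) → IntervalIntegrable (ahat n ω) volume a b := fun n ω C hC =>
    (hD n).intervalIntegrable_fit hab hc (fun t ht => (hC t ht).1) (hfit n ω) hg
      fun t ht => (hC t ht).2
  refine ⟨?_, fun hr₁ hρ₁ hnoise => ?_⟩
  · filter_upwards [hrate] with ω ⟨C, hC⟩
    refine ⟨(b - a) * C, ?_⟩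
    filter_upwards [hC] with n hn
    have hi := hint n ω (C * r n) fun t ht => ⟨(hn t ht).1, (hn t ht).2.1⟩
    refine ⟨hi, ?_⟩
    have := abs_integral_sub_le (L := fun _ => 0) (C₁ := C * r n) (C₂ := C * r n) hab (hi.sub hgi)
      measurable_const (fun t ht => (hn t ht).2.1) (fun t ht => by simpa using (hn t ht).2.1)
    simpa [mul_assoc] using this
  · filter_upwards [hrate, hnoise] with ω ⟨C, hC⟩ ⟨C', hC'⟩
    refine ⟨(b - a) * |C| + |C'|, ?_⟩
    filter_upwards [hC, hC'] with n hn hn'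
    have hi := hint n ω (C * r n) fun t ht => ⟨(hn t ht).1, (hn t ht).2.1⟩
    refine ⟨hi, ?_⟩
    have := abs_integral_sub_le (C₁ := C * r n) (C₂ := C * r₁ n) hab (hi.sub hgi)
      (Finset.measurable_fun_sum Finset.univ fun q _ =>
        ((hD n).measurable_populationGram_inv μ 0 q).mul
          ((hD n).measurable_sampleMoment n (m n) (fun i j => T i j ω)
            (fun i j k => ζ (pairData ξ T U ω i j k)) q))
      (fun t ht => (hn t ht).2.1) (fun t ht => (hn t ht).2.2)
    refine this.trans ((add_le_add_right hn' _).trans ?_)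
    have e1 : C * r₁ n ≤ |C| * r₁ n := mul_le_mul_of_nonneg_right (le_abs_self C) (hr₁ n)
    have e2 : C' * ρ₁ n ≤ |C'| * ρ₁ n := mul_le_mul_of_nonneg_right (le_abs_self C') (hρ₁ n)
    have e3 : 0 ≤ |C'| * r₁ n := mul_nonneg (abs_nonneg _) (hr₁ n)
    have e4 : 0 ≤ (b - a) * |C| * ρ₁ n := mul_nonneg (by positivity) (hρ₁ n)
    have e5 := mul_le_mul_of_nonneg_left e1 hba
    linarith

/-- The rate of `σ̂²` follows from those of the two integrals. -/
theorem errVarEst_bigO (hab : a < b) {Chat : ℕ → Ω → ℝ → ℝ → ℝ} {Vhat : ℕ → Ω → ℝ → ℝ}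
    {V G : ℝ → ℝ} {r : ℕ → ℝ} (hr : ∀ᶠ n in atTop, 0 ≤ r n)
    (hV : IntegralRate P a b Vhat V r) (hC : IntegralRate P a b (fun n ω t => Chat n ω t t) G r)
    (hVi : IntervalIntegrable V volume a b) (hGi : IntervalIntegrable G volume a b)
    (hVG : ∀ t, V t = G t + σ ^ 2) : ErrVarBigOAlmostSurely P a b σ Chat Vhat r := by
  have hba : 0 < b - a := sub_pos.2 hab
  filter_upwards [hV, hC] with ω ⟨C₁, h1⟩ ⟨C₂, h2⟩
  refine ⟨?_, ?_⟩
  · filter_upwards [h1, h2] with n h1 h2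
    exact h1.1.sub h2.1
  · refine IsBigO.of_bound ((b - a)⁻¹ * (C₁ + C₂)) ?_
    filter_upwards [h1, h2, hr] with n ⟨i1, e1⟩ ⟨i2, e2⟩ h0
    have e : errVarEst a b Chat Vhat n ω - σ ^ 2 = (b - a)⁻¹ *
        ((∫ t in a..b, (Vhat n ω t - V t)) - ∫ t in a..b, (Chat n ω t t - G t)) := by
      have hVint : ∫ t in a..b, V t = (∫ t in a..b, G t) + (b - a) * σ ^ 2 := by
        simp only [hVG]
        rw [intervalIntegral.integral_add hGi (by simp)]
        simp
      rw [errVarEst, intervalIntegral.integral_sub i1 i2, intervalIntegral.integral_sub i1 hVi,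
        intervalIntegral.integral_sub i2 hGi, hVint]
      field_simp
      ring
    rw [e, Real.norm_eq_abs, Real.norm_of_nonneg h0, abs_mul, abs_of_pos (inv_pos.2 hba), mul_assoc]
    refine mul_le_mul_of_nonneg_left ?_ (inv_nonneg.2 hba.le)
    refine (abs_sub _ _).trans ?_
    linarith

end Fits

/-! ## The model with an enveloped process -/

section RegularModel

variable {Ω S : Type*} [MeasurableSpace Ω] [MeasurableSpace S]
  {P : Measure Ω} [IsProbabilityMeasure P] {ν : Measure S} [IsProbabilityMeasure ν]
  {a b σ : ℝ} {f : ℝ → ℝ} {X Y : S → ℝ → ℝ} {ξ : ℕ → Ω → S} {T U : ℕ → ℕ → Ω → ℝ} {B : S → ℝ}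
  {m : ℕ → ℕ → ℕ} {K : ℝ → ℝ} {mT MT : ℝ}

/-- The observation model under the regularity conditions, together with a version `Y` of the
process on `[a,b]` that is dominated by a square integrable envelope `B`. -/
structure RegularModel (P : Measure Ω) (ν : Measure S) (a b σ : ℝ) (f : ℝ → ℝ) (X Y : S → ℝ → ℝ)
    (ξ : ℕ → Ω → S) (T U : ℕ → ℕ → Ω → ℝ) (B : S → ℝ) (m : ℕ → ℕ → ℕ) (K : ℝ → ℝ)
    (mT MT : ℝ) : Prop where
  model : ObservationModel P ν a b σ f X ξ T U
  lt : a < b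
  two_le : ∀ n, ∀ i < n, 2 ≤ m n i
  kernel : KernelCond K
  design : DesignLaw a b mT MT (timeLaw P T)
  process : EnvelopedPaths ν Y B
  path_eq : ∀ᵐ x ∂ν, ∀ t ∈ Icc a b, Y x t = X x t
  mean_smooth : TwiceDiffBounded a b (meanFun ν X)
  cov_smooth : SecondPartialsBounded a b (covFun ν X)

/-- For almost every curve the clipped process agrees with `X` on `[a,b]`, so moments and
observations are unchanged, while measurability and domination by the envelope hold everywhere. The
envelope does not depend on the moment order, so one version serves all three moment conditions. -/
lemma exists_regularModel (h : ObservationModel P ν a b σ f X ξ T U) (hab : a < b)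
    (hm : ∀ n, ∀ i < n, 2 ≤ m n i) (hf : DensityCond a b f) (hK : KernelCond K)
    (hmean : TwiceDiffBounded a b (meanFun ν X)) (hcov : SecondPartialsBounded a b (covFun ν X))
    {p₀ : ℝ} (hp₀ : 2 < p₀) (hmom : MomentCond P ν a b X U p₀) :
    ∃ Y B mT MT, RegularModel P ν a b σ f X Y ξ T U B m K mT MT ∧
      ∀ p : ℝ, 0 < p → MomentCond P ν a b X U p →
        Integrable (fun x => B x ^ p) ν ∧ Integrable (fun u => |u| ^ p) (errorLaw P U) := by
  obtain ⟨B, hBm, hB0, hXB, hBp⟩ := exists_path_envelope h.aemeasurable_pathSup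
    (by linarith : 0 < p₀) hmom.2
  obtain ⟨mT, MT, hτ⟩ := h.exists_designLaw hab hf
  have hBi := hBp p₀ (by linarith) hmom.2
  refine ⟨clippedPath a b X B, B, mT, MT, ⟨h, hab, hm, hK, hτ,
    ⟨measurable_clippedPath h.measurable_process hBm, hBm, abs_clippedPath_le hB0, ?_, ?_⟩,
    hXB.mono fun x hx t ht => clippedPath_eq hx ht, hmean, hcov⟩, fun p hp hmp => ⟨hBp p hp hmp.2, ?_⟩⟩
  · simpa using integrable_rpow_of_le hBm hB0 (q := 1) zero_le_one (by linarith) hBi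
  · simpa using integrable_rpow_of_le hBm hB0 (q := 2) (by norm_num) hp₀.le hBi
  · have hp : Measurable fun u : ℝ => |u| ^ p := measurable_id.abs.pow_const p
    rw [errorLaw, integrable_map_measure hp.aestronglyMeasurable
      (h.measurable_error 0 0).aemeasurable]
    exact hmp.1 0 0

namespace RegularModel

variable (R : RegularModel P ν a b σ f X Y ξ T U B m K mT MT)
include R

lemma ae_obs_eq : ∀ᵐ ω ∂P, ∀ i j, T i j ω ∈ Icc a b ∧
    obs X ξ T U ω i j = Y (ξ i ω) (T i j ω) + U i j ω := by
  have h1 : ∀ᵐ ω ∂P, ∀ i, ∀ t ∈ Icc a b, Y (ξ i ω) t = X (ξ i ω) t := ae_all_iff.2 fun i => by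
    have := R.path_eq
    rw [← R.model.law_curve i] at this
    exact ae_of_ae_map (R.model.measurable_curve i).aemeasurable this
  have h2 : ∀ᵐ ω ∂P, ∀ i j, T i j ω ∈ Icc a b := ae_all_iff.2 fun i => ae_all_iff.2 fun j => by
    have := R.design.ae_mem
    rw [← R.model.map_time i j] at this
    exact ae_of_ae_map (R.model.measurable_time i j).aemeasurable this
  filter_upwards [h1, h2] with ω h1 h2 i j
  exact ⟨h2 i j, by rw [obs, h1 i _ (h2 i j)]⟩

lemma exists_mean_taylor : ∃ (g' : ℝ → ℝ) (A : ℝ), 0 ≤ A ∧ ∀ t ∈ Icc a b, ∀ x ∈ Icc a b,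
    |meanFun ν Y x - meanFun ν Y t - g' t * (x - t)| ≤ A * (x - t) ^ 2 := by
  obtain ⟨g', A, hA, hg⟩ := R.mean_smooth.exists_taylor R.lt
  exact ⟨g', A, hA, fun t ht x hx => by
    rw [meanFun_congr R.path_eq ht, meanFun_congr R.path_eq hx]; exact hg t ht x hx⟩

/-- On the square `E Y(s) Y(t)` equals the covariance plus the product of the means, and both terms
have bounded second-order partial derivatives. -/
lemma exists_secondMoment_taylor : ∃ (g₁ g₂ : ℝ → ℝ → ℝ) (A : ℝ), 0 ≤ A ∧
    ∀ s ∈ Icc a b, ∀ t ∈ Icc a b, ∀ x ∈ Icc a b, ∀ y ∈ Icc a b,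
      |secondMoment ν Y x y - secondMoment ν Y s t - g₁ s t * (x - s) - g₂ s t * (y - t)| ≤
        A * ((x - s) ^ 2 + (y - t) ^ 2) := by
  obtain ⟨g₁, g₂, A, hA, hg⟩ := (SecondPartialsBounded_add R.cov_smooth
    (SecondPartialsBounded_mul_self R.lt R.mean_smooth)).exists_taylor R.lt
  have e : ∀ s ∈ Icc a b, ∀ t ∈ Icc a b,
      secondMoment ν Y s t = covFun ν X s t + meanFun ν X s * meanFun ν X t := fun s hs t ht => by
    rw [covFun_eq R.process R.path_eq hs ht, meanFun_congr R.path_eq hs,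
      meanFun_congr R.path_eq ht]
    ring
  exact ⟨g₁, g₂, A, hA, fun s hs t ht x hx y hy => by
    rw [e s hs t ht, e x hx y hy]; exact hg s hs t ht x hx y hy⟩

variable {bw ρ : ℕ → ℝ} (hr : FitRates bw ρ)

section Fits

include hr

lemma univariateRate_mean
    (hlaw : FamilyLaw P ν ξ T U m (SingleClass (timeLaw P T) bw) (singleEnv ν σ B) ρ)
    {μhat : ℕ → Ω → ℝ → ℝ} (hfit : ∀ n ω, ∀ t ∈ Icc a b, IsLocalLinearFit₁ K (bw n) n (m n)
      (fun i j => T i j ω) (obs X ξ T U ω) t (μhat n ω t)) :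
    UnivariateRate P ξ T U m a b K bw ρ (meanNoise ν Y) (meanFun ν Y) μhat := by
  obtain ⟨g', A, hA, hg⟩ := R.exists_mean_taylor
  exact _root_.univariateRate_mean R.model R.lt R.two_le R.kernel R.design R.process R.ae_obs_eq hr
    hlaw hA hg hfit

lemma univariateRate_square
    (hlaw : FamilyLaw P ν ξ T U m (SingleClass (timeLaw P T) bw) (squareEnv ν σ B) ρ)
    {Vhat : ℕ → Ω → ℝ → ℝ} (hfit : ∀ n ω, ∀ t ∈ Icc a b, IsLocalLinearFit₁ K (bw n) n (m n)
      (fun i j => T i j ω) (fun i j => obs X ξ T U ω i j ^ 2) t (Vhat n ω t)) :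
    UnivariateRate P ξ T U m a b K bw ρ (squareNoise ν σ Y)
      (fun t => secondMoment ν Y t t + σ ^ 2) Vhat := by
  obtain ⟨g₁, g₂, A, hA, hg⟩ := R.exists_secondMoment_taylor
  -- Restricting the bivariate expansion to the diagonal adds up the two slopes and doubles the
  -- quadratic remainder; the constant `σ²` cancels.
  refine _root_.univariateRate_square (g' := fun t => g₁ t t + g₂ t t) (Bg := 2 * A)
    R.model R.lt R.two_le R.kernel R.design R.process R.ae_obs_eq hr hlaw (by positivity)
    (fun t ht x hx => ?_) hfit
  convert hg t ht t ht x hx x hx using 1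
  · congr 1; ring
  · ring

lemma bivariateRate_cross
    (hlaw : FamilyLaw P ν ξ T U m (PairClass (timeLaw P T) bw) (crossEnv ν σ B) ρ)
    {Chat : ℕ → Ω → ℝ → ℝ → ℝ} (hfit : ∀ n ω, ∀ s ∈ Icc a b, ∀ t ∈ Icc a b,
      IsLocalLinearFit₂ K (bw n) n (m n) (fun i j => T i j ω) (obs X ξ T U ω) s t
        (Chat n ω s t)) :
    BivariateRate P ξ T U m a b K bw ρ (crossNoise ν Y) (secondMoment ν Y) Chat := by
  obtain ⟨g₁, g₂, A, hA, hg⟩ := R.exists_secondMoment_taylor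
  exact _root_.bivariateRate_cross R.model R.lt R.kernel R.design R.process R.ae_obs_eq hr hlaw
    hA hg hfit

end Fits

lemma integrableOn_secondMoment_diag (c : ℝ) :
    IntegrableOn (fun t => secondMoment ν Y t t + c) (Icc a b) := by
  refine Integrable.add (Integrable.of_bound (C := ∫ x, B x ^ 2 ∂ν) ?_ (ae_of_all _ fun t =>
    R.process.abs_secondMoment_le t t)) (integrable_const c)
  exact (R.process.measurable_secondMoment.comp (measurable_id.prodMk measurable_id)).aestronglyMeasurable

section Integrals

include hr

/-- The rates of the integral of `V̂`. -/
lemma integralRate_square {Vhat : ℕ → Ω → ℝ → ℝ}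
    (hfit : ∀ n ω, ∀ t ∈ Icc a b, IsLocalLinearFit₁ K (bw n) n (m n)
      (fun i j => T i j ω) (fun i j => obs X ξ T U ω i j ^ 2) t (Vhat n ω t))
    (hV : UnivariateRate P ξ T U m a b K bw ρ (squareNoise ν σ Y)
      (fun t => secondMoment ν Y t t + σ ^ 2) Vhat) :
    IntegralRate P a b Vhat (fun t => secondMoment ν Y t t + σ ^ 2) (fun n => ρ n + bw n ^ 2) ∧
    ∀ v ρ₁ : ℕ → ℝ, FamilyLaw P ν ξ T U m (BoundedClass (timeLaw P T) v) (squareEnv ν σ B) ρ₁ →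
      (∀ n, 0 ≤ ρ₁ n) → (∀ᶠ n in atTop, 1 ≤ v n) →
      IntegralRate P a b Vhat (fun t => secondMoment ν Y t t + σ ^ 2)
        (fun n => ρ n ^ 2 + bw n ^ 2 + ρ₁ n) := by
  have := R.model.isProbabilityMeasure_timeLaw
  obtain ⟨B₀, hB₀, hKB⟩ := kernel_bounded R.kernel
  obtain ⟨c, hc, hcoer, hV⟩ := hV
  have hD := fun n => designFamily₁ R.kernel hKB (hr.pos n)
  have key := fun ρ₁ : ℕ → ℝ => integralRate_of_localFit (P := P) (T := T) (U := U) (ξ := ξ)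
    (m := m) (ζ := squareNoise ν σ Y) (μ := (timeLaw P T).prod (timeLaw P T)) (ρ₁ := ρ₁)
    (r := fun n => ρ n + bw n ^ 2) (r₁ := fun n => ρ n ^ 2 + bw n ^ 2)
    (Z := fun ω i j _ => obs X ξ T U ω i j ^ 2) R.lt.le hD (half_pos hc)
    (R.integrableOn_secondMoment_diag (σ ^ 2))
    (fun n ω t ht => (hfit n ω t ht).normal_equations (hr.pos n).ne' (R.two_le n)) (by
      filter_upwards [hV] with ω ⟨C, hC⟩
      refine ⟨C, ?_⟩
      filter_upwards [hC] with n hn t ht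
      exact ⟨hn.coercive ⟨t, ht⟩, hn.rate ⟨t, ht⟩, hn.linearization ⟨t, ht⟩⟩)
  refine ⟨(key 0).1, fun v ρ₁ hlaw hρ₁ hv => (key ρ₁).2 (fun n => by positivity) hρ₁ ?_⟩
  refine ae_integrated_noise_le (w := MT) (C₁ := 1) R.model R.lt.le hlaw
    (integrable_squareEnv R.model R.process) (R.process.measurable_squareNoise σ)
    (fun z => abs_squareNoise_le R.process σ z) (isCentered_squareNoise R.model R.process)
    hD hc hcoer (fun n t => ?_) ?_
  · simp only [weight₁]
    rw [integral_fun_fst (fun x => scaledKernel K (bw n) (x - t))]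
    simpa using R.design.integral_scaledKernel_le R.kernel (hr.pos n) t
  -- The integrated weights are at most one, so every level `v ≥ 1` is admissible. For sparse data
  -- this freedom is used to give the integral of `V̂` the level `1 / h_R`.
  · filter_upwards [hv] with n hn
    refine ⟨zero_le_one.trans hn, fun x => ?_⟩
    rw [one_mul]
    exact (integral_scaledKernel_sub_le R.kernel R.lt.le (hr.pos n) x.1).trans hn

/-- The rates of the integral of `Ĉ` along the diagonal. -/
lemma integralRate_cross {Chat : ℕ → Ω → ℝ → ℝ → ℝ}
    (hfit : ∀ n ω, ∀ s ∈ Icc a b, ∀ t ∈ Icc a b, IsLocalLinearFit₂ K (bw n) n (m n)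
      (fun i j => T i j ω) (obs X ξ T U ω) s t (Chat n ω s t))
    (hC : BivariateRate P ξ T U m a b K bw ρ (crossNoise ν Y) (secondMoment ν Y) Chat) :
    IntegralRate P a b (fun n ω t => Chat n ω t t) (fun t => secondMoment ν Y t t)
      (fun n => ρ n + bw n ^ 2) ∧
    ∀ ρ₁ : ℕ → ℝ, FamilyLaw P ν ξ T U m (BoundedClass (timeLaw P T) fun n => 1 / bw n)
        (crossEnv ν σ B) ρ₁ → (∀ n, 0 ≤ ρ₁ n) →
      IntegralRate P a b (fun n ω t => Chat n ω t t) (fun t => secondMoment ν Y t t)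
        (fun n => ρ n ^ 2 + bw n ^ 2 + ρ₁ n) := by
  have := R.model.isProbabilityMeasure_timeLaw
  obtain ⟨B₀, hB₀, hKB⟩ := kernel_bounded R.kernel
  obtain ⟨c, hc, hcoer, hC⟩ := hC
  have hD := fun n => designFamily₂ R.kernel hKB (hr.pos n)
  have key := fun ρ₁ : ℕ → ℝ => integralRate_of_localFit (P := P) (T := T) (U := U) (ξ := ξ)
    (m := m) (ζ := crossNoise ν Y) (μ := (timeLaw P T).prod (timeLaw P T)) (ρ₁ := ρ₁)
    (r := fun n => ρ n + bw n ^ 2) (r₁ := fun n => ρ n ^ 2 + bw n ^ 2)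
    (ahat := fun n ω t => Chat n ω t t) (g := fun t => secondMoment ν Y t t)
    (Z := fun ω i j k => obs X ξ T U ω i j * obs X ξ T U ω i k) R.lt.le hD (half_pos hc)
    (by simpa using R.integrableOn_secondMoment_diag 0)
    (fun n ω t ht => (hfit n ω t ht t ht).normal_equations (hr.pos n).ne') (by
      filter_upwards [hC] with ω ⟨C, hC⟩
      refine ⟨C, ?_⟩
      filter_upwards [hC] with n hn t ht
      exact ⟨hn.coercive (⟨t, ht⟩, ⟨t, ht⟩), hn.rate (⟨t, ht⟩, ⟨t, ht⟩),
        hn.linearization (⟨t, ht⟩, ⟨t, ht⟩)⟩)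
  refine ⟨(key 0).1, fun ρ₁ hlaw hρ₁ => (key ρ₁).2 (fun n => by positivity) hρ₁ ?_⟩
  refine ae_integrated_noise_le (w := MT * MT) (C₁ := B₀) R.model R.lt.le hlaw
    (integrable_crossEnv R.model R.process) R.process.measurable_crossNoise
    (fun z => abs_crossNoise_le R.process σ z) (isCentered_crossNoise R.model R.process)
    hD hc (hcoer.mono fun n hn t ht => hn t ht t ht) (fun n t => ?_) (Eventually.of_forall fun n => ?_)
  · simp only [weight₂]
    rw [integral_prod_mul (fun x => scaledKernel K (bw n) (x - t))
      fun x => scaledKernel K (bw n) (x - t)]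
    have h1 := R.design.integral_scaledKernel_le R.kernel (hr.pos n) t
    exact mul_le_mul h1 h1 (integral_nonneg fun x => scaledKernel_nonneg R.kernel (hr.pos n) _)
      R.design.MT_pos.le
  · refine ⟨(one_div_pos.2 (hr.pos n)).le, fun x => ?_⟩
    rw [mul_one_div]
    exact integral_weight₂_diag_le R.kernel hKB R.lt.le (hr.pos n) x

end Integrals

/-- The rate of `σ̂²` follows from those of the integrals of `V̂` and `Ĉ`. -/
lemma errVarBigO {Chat : ℕ → Ω → ℝ → ℝ → ℝ} {Vhat : ℕ → Ω → ℝ → ℝ} {r : ℕ → ℝ}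
    (h0 : ∀ᶠ n in atTop, 0 ≤ r n)
    (hV : IntegralRate P a b Vhat (fun t => secondMoment ν Y t t + σ ^ 2) r)
    (hC : IntegralRate P a b (fun n ω t => Chat n ω t t) (fun t => secondMoment ν Y t t) r) :
    ErrVarBigOAlmostSurely P a b σ Chat Vhat r := by
  refine errVarEst_bigO R.lt h0 hV hC ?_ ?_ fun t => rfl
  · rw [intervalIntegrable_iff_integrableOn_Icc_of_le R.lt.le]
    exact R.integrableOn_secondMoment_diag _
  · rw [intervalIntegrable_iff_integrableOn_Icc_of_le R.lt.le]
    simpa using R.integrableOn_secondMoment_diag 0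

end RegularModel

end RegularModel

/-! ## Bandwidths -/

section Bandwidths

variable {m : ℕ → ℕ → ℕ} {lam : ℝ} {h v : ℕ → ℝ}

lemma logRatio_nonneg (n : ℕ) : 0 ≤ logRatio n :=
  div_nonneg (Real.log_natCast_nonneg n) (Nat.cast_nonneg n)

lemma logRatio_le_one (n : ℕ) : logRatio n ≤ 1 :=
  div_le_one_of_le₀ (Real.log_le_self n.cast_nonneg)
    n.cast_nonneg

lemma inv_le_logRatio : ∀ᶠ n : ℕ in atTop, (n : ℝ)⁻¹ ≤ logRatio n := by
  have h1 : Tendsto (fun n : ℕ => Real.log n) atTop atTop :=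
    Real.tendsto_log_atTop.comp tendsto_natCast_atTop_atTop
  filter_upwards [h1.eventually_ge_atTop 1] with n hn
  rw [logRatio, inv_eq_one_div]
  exact div_le_div_of_nonneg_right hn n.cast_nonneg

lemma logRatio_le_rpow (hlam : 2 < lam) (n : ℕ) : logRatio n ≤ logRatio n ^ (1 - 2 / lam) := by
  have h2 : 0 < 2 / lam := by positivity
  have h3 : 2 / lam < 1 := by rw [div_lt_one (by linarith)]; exact hlam
  rcases (logRatio_nonneg n).eq_or_lt with h0 | h0
  · rw [← h0]; exact Real.rpow_nonneg le_rfl _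
  · exact (Real.rpow_one _).symm.le.trans
      (Real.rpow_le_rpow_of_exponent_ge h0 (logRatio_le_one n) (by linarith))

/-- The product is a bounded quantity times the positive power `2 / λ` of the log ratio, which tends
to zero. -/
lemma tendsto_mul_logRatio (hlam : 2 < lam) (hv : ∀ᶠ n in atTop, 0 ≤ v n) {C : ℝ}
    (hC : ∀ᶠ n in atTop, v n * logRatio n ^ (1 - 2 / lam) ≤ C) :
    Tendsto (fun n => v n * logRatio n) atTop (𝓝 0) := by
  have h2 : 0 < 2 / lam := by positivity
  have h1 : Tendsto (fun n => logRatio n ^ (2 / lam)) atTop (𝓝 0) := by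
    have := (Real.continuousAt_rpow_const 0 (2 / lam) (Or.inr h2.le)).tendsto.comp tendsto_logRatio
    simpa [Function.comp_def, Real.zero_rpow h2.ne'] using this
  refine squeeze_zero' (g := fun n => C * logRatio n ^ (2 / lam)) ?_ ?_ (by simpa using h1.const_mul C)
  · filter_upwards [hv] with n hn
    exact mul_nonneg hn (logRatio_nonneg n)
  · filter_upwards [hC, eventually_ge_atTop 2] with n hn h2
    have e : logRatio n = logRatio n ^ (1 - 2 / lam) * logRatio n ^ (2 / lam) := by
      rw [← Real.rpow_add (logRatio_pos h2)]; simp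
    conv_lhs => rw [e, ← mul_assoc]
    exact mul_le_mul_of_nonneg_right hn (Real.rpow_nonneg (logRatio_nonneg n) _)

/-- Since `1/n ≤ r` for the log ratio `r`, the inequality `1/h ≤ v` gives `1/(n h) ≤ v r`, which
tends to zero; hence `n h ≥ 1`. Likewise `n⁻² ≤ n⁻¹ ≤ r ≤ v r`, so brackets of mean `1/n` are finer
than the rate. -/
lemma fitRates_sparse (hh : ∀ n, 0 < h n) (hlim : Tendsto h atTop (𝓝 0)) (hlam : 2 < lam)
    (hv : ∀ᶠ n in atTop, 1 / h n ≤ v n) {C : ℝ}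
    (hC : ∀ᶠ n in atTop, v n * logRatio n ^ (1 - 2 / lam) ≤ C) :
    FitRates h fun n => √(v n * logRatio n) := by
  have hv0 : ∀ᶠ n in atTop, 1 ≤ v n := by
    filter_upwards [hv, hlim.eventually_le_const one_pos] with n h1 h2
    exact (one_le_one_div (hh n) h2).trans h1
  have hlim2 := tendsto_mul_logRatio hlam (hv0.mono fun n hn => zero_le_one.trans hn) hC
  refine ⟨hh, hlim, ?_, ?_, fun n => Real.sqrt_nonneg _, ?_⟩
  · filter_upwards [hv, hlim2.eventually_le_const one_pos, inv_le_logRatio, eventually_gt_atTop 0]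
      with n h1 h2 h3 hn
    have hn' : (0 : ℝ) < n := Nat.cast_pos.2 hn
    have h4 : 1 / h n * (n : ℝ)⁻¹ ≤ 1 := le_trans (mul_le_mul h1 h3 (by positivity)
      ((one_div_pos.2 (hh n)).le.trans h1)) h2
    rw [one_div, ← mul_inv, mul_comm] at h4
    exact (inv_le_one₀ (by have := hh n; positivity)).1 h4
  · filter_upwards [hv0, inv_le_logRatio, eventually_gt_atTop 0] with n h1 h2 hn
    have hn' : (1 : ℝ) ≤ n := Nat.one_le_cast.2 hn
    refine Real.le_sqrt_of_sq_le ?_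
    have h3 : ((n : ℝ)⁻¹) ^ 2 ≤ (n : ℝ)⁻¹ :=
      pow_le_of_le_one (by positivity) (inv_le_one_of_one_le₀ hn') two_ne_zero
    have h4 : logRatio n ≤ v n * logRatio n := le_mul_of_one_le_left (logRatio_nonneg n) h1
    linarith
  · have := (Real.continuous_sqrt.tendsto 0).comp hlim2
    simpa [Function.comp_def] using this

lemma inv_harmonicMean (k n : ℕ) : (harmonicMean m k n)⁻¹ =
    (n : ℝ)⁻¹ * ∑ i ∈ Finset.range n, ((m n i : ℝ) ^ k)⁻¹ := by
  rw [harmonicMean, inv_inv]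

lemma inv_harmonicMean_nonneg (k n : ℕ) : 0 ≤ (harmonicMean m k n)⁻¹ := by
  rw [inv_harmonicMean]; positivity

lemma inv_harmonicMean_le {k n : ℕ} {c : ℝ} (hc : 0 ≤ c) (h : ∀ i < n, ((m n i : ℝ) ^ k)⁻¹ ≤ c) :
    (harmonicMean m k n)⁻¹ ≤ c := by
  rw [inv_harmonicMean]
  calc (n : ℝ)⁻¹ * ∑ i ∈ Finset.range n, ((m n i : ℝ) ^ k)⁻¹
      ≤ (n : ℝ)⁻¹ * ∑ _i ∈ Finset.range n, c := by
        gcongr with i hi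
        exact h i (Finset.mem_range.1 hi)
    _ = (n : ℝ)⁻¹ * n * c := by simp; ring
    _ ≤ 1 * c := by gcongr; exact inv_mul_le_one
    _ = c := one_mul c

lemma inv_harmonicMean_le_one (hm : ∀ n, ∀ i < n, 2 ≤ m n i) (k n : ℕ) :
    (harmonicMean m k n)⁻¹ ≤ 1 :=
  inv_harmonicMean_le zero_le_one fun i hi => inv_le_one_of_one_le₀ (one_le_pow₀ (by
    have := hm n i hi
    exact_mod_cast (by omega : 1 ≤ m n i)))

/-- The inverse harmonic means are at most one and eventually `h ≤ 1`, so `h² + h/γ ≤ 2h`: the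
condition yields the truncation bound at level `1/h`. -/
lemma BandwidthRate₁_le (hm : ∀ n, ∀ i < n, 2 ≤ m n i) (hh : ∀ n, 0 < h n)
    (hlim : Tendsto h atTop (𝓝 0)) (hrate : BandwidthRate₁ m lam h) :
    ∀ᶠ n in atTop, 1 / h n * logRatio n ^ (1 - 2 / lam) ≤ 2 := by
  filter_upwards [hlim.eventually_le_const one_pos, hrate.eventually_le_const one_pos]
    with n h1 h2
  have hn := hh n
  have h3 := inv_harmonicMean_le_one hm 1 n
  have h4 := inv_harmonicMean_nonneg (m := m) 1 n
  rw [div_eq_mul_inv, inv_mul_le_iff₀ (by positivity), mul_one] at h2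
  rw [one_div, inv_mul_le_iff₀ hn]
  nlinarith

/-- Each of the three terms of the denominator is at most `h²` once `h ≤ 1`, which yields the
truncation bound at level `1/h²`. -/
lemma BandwidthRate₂_le (hm : ∀ n, ∀ i < n, 2 ≤ m n i) (hh : ∀ n, 0 < h n)
    (hlim : Tendsto h atTop (𝓝 0)) (hrate : BandwidthRate₂ m lam h) :
    ∀ᶠ n in atTop, 1 / h n ^ 2 * logRatio n ^ (1 - 2 / lam) ≤ 3 := by
  filter_upwards [hlim.eventually_le_const one_pos, hrate.eventually_le_const one_pos]
    with n h1 h2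
  have hn := hh n
  have h3 := inv_harmonicMean_le_one hm 1 n
  have h4 := inv_harmonicMean_nonneg (m := m) 1 n
  have h5 := inv_harmonicMean_le_one hm 2 n
  have h6 := inv_harmonicMean_nonneg (m := m) 2 n
  rw [div_eq_mul_inv, div_eq_mul_inv, inv_mul_le_iff₀ (by positivity), mul_one] at h2
  rw [one_div, inv_mul_le_iff₀ (by positivity)]
  have e1 : h n ^ 4 ≤ h n ^ 2 := pow_le_pow_of_le_one hn.le h1 (by norm_num)
  have e2 : h n ^ 3 * (harmonicMean m 1 n)⁻¹ ≤ h n ^ 2 * 1 :=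
    mul_le_mul (pow_le_pow_of_le_one hn.le h1 (by norm_num)) h3 h4 (by positivity)
  have e3 : h n ^ 2 * (harmonicMean m 2 n)⁻¹ ≤ h n ^ 2 * 1 := by gcongr
  linarith

/-- The consequences of the conditions on a bandwidth for dense data. -/
lemma dense_bandwidth {M : ℕ → ℝ} (hM : ∀ n, 0 < M n) (hMm : ∀ n, ∀ i < n, M n ≤ m n i)
    (hh : ∀ n, 0 < h n) (hlim : Tendsto h atTop (𝓝 0)) (hlam : 2 < lam)
    (hrate : BandwidthRate₁ m lam h) (hMh : (fun n => (M n)⁻¹) =O[atTop] h)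
    (hle : h =O[atTop] fun n => logRatio n ^ (1 / 4 : ℝ)) :
    4 < lam ∧ FitRates h (fun n => √(logRatio n)) ∧
      (∃ c₀ : ℝ, 0 < c₀ ∧ ∀ᶠ n in atTop, ∀ i < n, c₀ ≤ m n i * h n) ∧
      (∀ᶠ n : ℕ in atTop, (1 : ℝ) * (n : ℝ) ^ (-(1 / 2) : ℝ) ≤ h n) ∧
      (fun n => h n ^ 2) =O[atTop] fun n => logRatio n ^ (1 / 2 : ℝ) := by
  obtain ⟨C, hC, hMC⟩ := hMh.exists_pos
  obtain ⟨D, hD, hleD⟩ := hle.exists_pos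
  have hMC' : ∀ᶠ n in atTop, (M n)⁻¹ ≤ C * h n := by
    filter_upwards [hMC.bound] with n hn
    rwa [Real.norm_of_nonneg (inv_pos.2 (hM n)).le, Real.norm_of_nonneg (hh n).le] at hn
  have hleD' : ∀ᶠ n in atTop, h n ^ 2 ≤ D ^ 2 * logRatio n ^ (1 / 2 : ℝ) := by
    filter_upwards [hleD.bound] with n hn
    have h0 := Real.rpow_nonneg (logRatio_nonneg n) (1 / 4)
    rw [Real.norm_of_nonneg (hh n).le, Real.norm_of_nonneg h0] at hn
    have e : logRatio n ^ (1 / 2 : ℝ) = (logRatio n ^ (1 / 4 : ℝ)) ^ 2 := by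
      rw [← Real.rpow_natCast, ← Real.rpow_mul (logRatio_nonneg n)]; norm_num
    rw [e, ← mul_pow]
    exact pow_le_pow_left₀ (hh n).le hn 2
  -- The lower bound on the `m_i` makes `1/γ` of order `h` at most, so the denominator `h² + h/γ` is
  -- comparable with `h²`.
  have hlow : Tendsto (fun n => logRatio n ^ (1 - 2 / lam) / h n ^ 2) atTop (𝓝 0) := by
    have h1 : Tendsto (fun n => (1 + C) * ((h n ^ 2 + h n / harmonicMean m 1 n)⁻¹ *
      logRatio n ^ (1 - 2 / lam))) atTop (𝓝 0) := by simpa using hrate.const_mul (1 + C)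
    refine squeeze_zero' (Eventually.of_forall fun n => div_nonneg
      (Real.rpow_nonneg (logRatio_nonneg n) _) (sq_nonneg _)) ?_ h1
    filter_upwards [hMC'] with n hn
    have hn0 := hh n
    have h2 : (harmonicMean m 1 n)⁻¹ ≤ C * h n := inv_harmonicMean_le (by positivity) fun i hi => by
      rw [pow_one]
      exact (inv_anti₀ (hM n) (hMm n i hi)).trans hn
    have h3 := inv_harmonicMean_nonneg (m := m) 1 n
    have h4 := Real.rpow_nonneg (logRatio_nonneg n) (1 - 2 / lam)
    rw [div_eq_mul_inv (h n), ← div_eq_inv_mul, ← mul_div_assoc,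
      div_le_div_iff₀ (by positivity) (by positivity)]
    have h5 : h n ^ 2 + h n * (harmonicMean m 1 n)⁻¹ ≤ (1 + C) * h n ^ 2 := by nlinarith
    calc _ ≤ logRatio n ^ (1 - 2 / lam) * ((1 + C) * h n ^ 2) := by gcongr
      _ = _ := by ring
  have hroot : ∀ᶠ n in atTop, √(logRatio n) ≤ h n := by
    filter_upwards [hlow.eventually_le_const one_pos] with n hn
    have hn0 := hh n
    rw [div_le_one (by positivity)] at hn
    exact Real.sqrt_le_iff.2 ⟨hn0.le, (logRatio_le_rpow hlam n).trans hn⟩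
  have hhalf : ∀ᶠ n : ℕ in atTop, (n : ℝ) ^ (-(1 / 2) : ℝ) ≤ h n := by
    filter_upwards [hroot, inv_le_logRatio] with n h1 h2
    rw [Real.rpow_neg n.cast_nonneg, ← Real.sqrt_eq_rpow, ← Real.sqrt_inv]
    exact (Real.sqrt_le_sqrt h2).trans h1
  refine ⟨?_, ⟨hh, hlim, ?_, ?_, fun n => Real.sqrt_nonneg _, ?_⟩, ⟨C⁻¹, inv_pos.2 hC, ?_⟩, ?_, ?_⟩
  -- If `λ ≤ 4`, then `r ^ (1 - 2/λ) ≥ r ^ (1/2)`, and the latter is at least `h² / D²`; this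
  -- contradicts the limit in `hlow`. Thus the bandwidth conditions force the stronger moments that
  -- dense data require.
  · by_contra! hcon
    have hp : 0 < lam := by linarith
    have hexp : 1 - 2 / lam ≤ 1 / 2 := by
      have : 1 / 2 ≤ 2 / lam := by rw [div_le_div_iff₀ two_pos hp]; linarith
      linarith
    have hsmall := hlow.eventually_lt_const (show (0 : ℝ) < 1 / D ^ 2 by positivity)
    obtain ⟨n, h1, h2, h3⟩ := (hsmall.and (hleD'.and (eventually_ge_atTop 2))).exists
    have hn0 := hh n
    have h4 : logRatio n ^ (1 / 2 : ℝ) ≤ logRatio n ^ (1 - 2 / lam) :=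
      Real.rpow_le_rpow_of_exponent_ge (logRatio_pos h3) (logRatio_le_one n) hexp
    rw [div_lt_div_iff₀ (by positivity) (by positivity)] at h1
    nlinarith [sq_nonneg D]
  · filter_upwards [hhalf, eventually_gt_atTop 0] with n h1 hn
    have hn' : (1 : ℝ) ≤ n := Nat.one_le_cast.2 hn
    have hn0 : (0 : ℝ) < n := by linarith
    calc (1 : ℝ) ≤ (n : ℝ) ^ (1 / 2 : ℝ) := Real.one_le_rpow hn' (by norm_num)
      _ = n * (n : ℝ) ^ (-(1 / 2) : ℝ) := by
        rw [← Real.rpow_one_add' hn0.le (by norm_num)]; norm_num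
      _ ≤ n * h n := by gcongr
  · filter_upwards [inv_le_logRatio] with n h1
    exact Real.le_sqrt_of_sq_le ((
      pow_le_of_le_one (by positivity) (Nat.cast_inv_le_one n) two_ne_zero).trans h1)
  · simpa [Function.comp_def] using (Real.continuous_sqrt.tendsto 0).comp tendsto_logRatio
  · filter_upwards [hMC'] with n hn i hi
    have hn0 := hh n
    rw [inv_le_iff_one_le_mul₀ (hM n)] at hn
    rw [inv_le_iff_one_le_mul₀ hC]
    have h1 : h n * C * M n ≤ h n * C * m n i := by gcongr; exact hMm n i hi
    linarith
  · simpa using hhalf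
  · refine IsBigO.of_bound (D ^ 2) ?_
    filter_upwards [hleD'] with n hn
    rwa [Real.norm_of_nonneg (sq_nonneg _), Real.norm_of_nonneg
      (Real.rpow_nonneg (logRatio_nonneg n) _)]

end Bandwidths

/-! ## The laws of large numbers for the envelopes -/

section Laws

variable {Ω S : Type*} [MeasurableSpace Ω] [MeasurableSpace S]
  {P : Measure Ω} [IsProbabilityMeasure P] {ν : Measure S} [IsProbabilityMeasure ν]
  {a b σ : ℝ} {f : ℝ → ℝ} {X Y : S → ℝ → ℝ} {ξ : ℕ → Ω → S} {T U : ℕ → ℕ → Ω → ℝ} {B : S → ℝ}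
  {m : ℕ → ℕ → ℕ} {K : ℝ → ℝ} {mT MT lam : ℝ} {bw v : ℕ → ℝ} {M : ℕ} {C c₀ c₁ : ℝ}

lemma integrable_const_add_rpow {g : S → ℝ} (hg : Measurable g) (hg0 : ∀ x, 0 ≤ g x) {c p : ℝ}
    (hc : 0 ≤ c) (hp : 0 ≤ p) (hi : Integrable (fun x => g x ^ p) ν) :
    Integrable (fun x => (c + g x) ^ p) ν := by
  refine (((integrable_const (c ^ p)).add hi).add (integrable_const ((0 : ℝ) ^ p))).const_mul
    (3 ^ p) |>.mono' ((hg.const_add c).pow_const p).aestronglyMeasurable (ae_of_all _ fun x => ?_)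
  rw [Real.norm_of_nonneg (Real.rpow_nonneg (add_nonneg hc (hg0 x)) p)]
  have := add_three_rpow_le hc (hg0 x) le_rfl hp
  rwa [add_zero] at this

namespace RegularModel

variable (R : RegularModel P ν a b σ f X Y ξ T U B m K mT MT)
include R

lemma familyLaw_single_sparse (hM : ∀ n, ∀ i < n, m n i ≤ M) (hlam : 2 < lam)
    (hB : Integrable (fun x => B x ^ lam) ν) (hU : Integrable (fun u => |u| ^ lam) (errorLaw P U))
    (hbw : ∀ n, 0 < bw n) (hC : ∀ᶠ n in atTop, 1 / bw n * logRatio n ^ (1 - 2 / lam) ≤ C) :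
    FamilyLaw P ν ξ T U m (SingleClass (timeLaw P T) bw) (singleEnv ν σ B)
      fun n => √(1 / bw n * logRatio n) := by
  have := R.model.isProbabilityMeasure_timeLaw
  refine (familyLaw_sparse R.model R.two_le hM hlam (measurable_singleEnv R.process)
    (fun y => zero_le_one.trans (one_le_singleEnv R.process y))
    (integrable_obsBound_rpow R.model R.process (by linarith) hB hU).1
    (fun n => one_div_pos.2 (hbw n)) hC).mono_class fun c => ⟨c, fun n => ?_⟩
  exact singleClass_subset_boundedClass bw c n

lemma familyLaw_square_sparse (hM : ∀ n, ∀ i < n, m n i ≤ M) (hlam : 2 < lam)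
    (hB : Integrable (fun x => B x ^ (2 * lam)) ν)
    (hU : Integrable (fun u => |u| ^ (2 * lam)) (errorLaw P U))
    (hv : ∀ n, 0 < v n) (hC : ∀ᶠ n in atTop, v n * logRatio n ^ (1 - 2 / lam) ≤ C) :
    FamilyLaw P ν ξ T U m (BoundedClass (timeLaw P T) v) (squareEnv ν σ B)
      fun n => √(v n * logRatio n) :=
  familyLaw_sparse R.model R.two_le hM hlam (measurable_squareEnv R.process)
    (fun y => zero_le_one.trans (one_le_squareEnv R.process y))
    (integrable_squareEnv_rpow R.model R.process (by linarith) hB hU) hv hC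

lemma familyLaw_cross_sparse (hM : ∀ n, ∀ i < n, m n i ≤ M) (hlam : 2 < lam)
    (hB : Integrable (fun x => B x ^ (2 * lam)) ν)
    (hU : Integrable (fun u => |u| ^ (2 * lam)) (errorLaw P U))
    (hv : ∀ n, 0 < v n) (hC : ∀ᶠ n in atTop, v n * logRatio n ^ (1 - 2 / lam) ≤ C) :
    FamilyLaw P ν ξ T U m (BoundedClass (timeLaw P T) v) (crossEnv ν σ B)
      fun n => √(v n * logRatio n) :=
  familyLaw_sparse R.model R.two_le hM hlam (measurable_crossEnv R.process)
    (fun y => zero_le_one.trans (one_le_crossEnv R.process y))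
    (integrable_crossEnv_rpow R.model R.process (by linarith) hB hU) hv hC

section Dense

variable (hbw : ∀ n, 0 < bw n) (hc₀ : 0 < c₀)
  (hmh : ∀ᶠ n in atTop, ∀ i < n, c₀ ≤ m n i * bw n)
  (hh : ∀ᶠ n : ℕ in atTop, (1 : ℝ) * (n : ℝ) ^ (-(1 / 2) : ℝ) ≤ bw n)
include hbw hc₀ hmh hh

lemma familyLaw_single_dense (hlam : 4 < lam)
    (hB : Integrable (fun x => B x ^ lam) ν) (hU : Integrable (fun u => |u| ^ lam) (errorLaw P U)) :
    FamilyLaw P ν ξ T U m (SingleClass (timeLaw P T) bw) (singleEnv ν σ B)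
      fun n => √(logRatio n) := by
  have hc := zero_le_one.trans (one_le_obsBound_const (σ := σ) R.process)
  exact familyLaw_dense_single R.model R.two_le
    (s := fun x => 1 + (∫ y, B y ∂ν) + (∫ y, B y ^ 2 ∂ν) + σ ^ 2 + B x) (V := fun u => |u|)
    (R.process.measurable_bound.const_add _) (fun x => add_nonneg hc (R.process.nonneg x))
    measurable_id.abs (fun u => abs_nonneg u) hlam
    (integrable_const_add_rpow R.process.measurable_bound R.process.nonneg hc (by linarith) hB) hU
    hbw hc₀ one_pos hmh hh

/-- The squared envelope is not a sum of a curve part and an error part, but `(x + |u|)² ≤ 2x² +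
2u²` is. Its moments of order `λ` are moments of order `2 λ` of the observation. -/
lemma familyLaw_square_dense (hlam : 4 < lam)
    (hB : Integrable (fun x => B x ^ (2 * lam)) ν)
    (hU : Integrable (fun u => |u| ^ (2 * lam)) (errorLaw P U)) :
    FamilyLaw P ν ξ T U m (SingleClass (timeLaw P T) bw) (squareEnv ν σ B)
      fun n => √(logRatio n) := by
  set c := 1 + (∫ y, B y ∂ν) + (∫ y, B y ^ 2 ∂ν) + σ ^ 2 with hcdef
  have hc : 0 ≤ c := zero_le_one.trans (one_le_obsBound_const R.process)
  have e : ∀ w : ℝ, 0 ≤ w → (2 * w ^ 2) ^ lam = 2 ^ lam * w ^ (2 * lam) := fun w hw => by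
    rw [Real.mul_rpow two_pos.le (sq_nonneg w), Real.rpow_mul hw, Real.rpow_two]
  refine (familyLaw_dense_single R.model R.two_le
    (s := fun x => 2 * (c + B x) ^ 2) (V := fun u => 2 * |u| ^ 2)
    (((R.process.measurable_bound.const_add _).pow_const 2).const_mul 2) (fun x => by positivity)
    ((measurable_id.abs.pow_const 2).const_mul 2) (fun u => by positivity) hlam ?_ ?_
    hbw hc₀ one_pos hmh hh).mono_env (fun y => ?_) ?_
  · simp only [e _ (add_nonneg hc (R.process.nonneg _))]
    exact (integrable_const_add_rpow R.process.measurable_bound R.process.nonneg hc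
      (by linarith) hB).const_mul _
  · simp only [e _ (abs_nonneg _)]
    exact hU.const_mul _
  · change (c + B y.1 + |y.2.1|) ^ 2 ≤ _
    nlinarith [sq_nonneg (c + B y.1 - |y.2.1|)]
  · rintro c n g ⟨φ, hφ, hg⟩ w
    rw [hg]
    exact hφ.2.1 _

lemma familyLaw_cross_dense (hlam : 4 < lam)
    (hB : Integrable (fun x => B x ^ (2 * lam)) ν)
    (hU : Integrable (fun u => |u| ^ (2 * lam)) (errorLaw P U)) :
    FamilyLaw P ν ξ T U m (PairClass (timeLaw P T) bw) (crossEnv ν σ B)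
      fun n => √(logRatio n) := by
  have hc := zero_le_one.trans (one_le_obsBound_const (σ := σ) R.process)
  exact familyLaw_dense_pair R.model R.two_le
    (s := fun x => 1 + (∫ y, B y ∂ν) + (∫ y, B y ^ 2 ∂ν) + σ ^ 2 + B x) (V := fun u => |u|)
    (R.process.measurable_bound.const_add _) (fun x => add_nonneg hc (R.process.nonneg x))
    measurable_id.abs (fun u => abs_nonneg u) (by linarith : 8 < 2 * lam)
    (integrable_const_add_rpow R.process.measurable_bound R.process.nonneg hc (by linarith) hB) hU
    hbw hc₀ one_pos hmh hh

end Dense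

end RegularModel

end Laws

/-! ## The rates for sparse and dense data -/

section Main

variable {Ω S : Type*} [MeasurableSpace Ω] [MeasurableSpace S]
  {P : Measure Ω} [IsProbabilityMeasure P] {ν : Measure S} [IsProbabilityMeasure ν]
  {a b σ : ℝ} {f : ℝ → ℝ} {X Y : S → ℝ → ℝ} {ξ : ℕ → Ω → S} {T U : ℕ → ℕ → Ω → ℝ} {B : S → ℝ}
  {m : ℕ → ℕ → ℕ} {K : ℝ → ℝ} {mT MT lamμ lamR lamV : ℝ} {hμ hR hV : ℕ → ℝ}
  {μhat : ℕ → Ω → ℝ → ℝ} {Chat : ℕ → Ω → ℝ → ℝ → ℝ} {Vhat : ℕ → Ω → ℝ → ℝ}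

lemma isBigO_sqrt_of_sq {g₁ g₂ : ℕ → ℝ} (h0 : ∀ n, 0 ≤ g₂ n)
    (h : (fun n => g₁ n ^ 2) =O[atTop] g₂) : g₁ =O[atTop] fun n => √(g₂ n) := by
  refine IsBigO.of_pow two_ne_zero ?_
  have e : ((fun n => √(g₂ n)) ^ 2) = g₂ := funext fun n => Real.sq_sqrt (h0 n)
  rw [e]
  exact h

lemma isBigO_of_le_mul {g₁ g₂ : ℕ → ℝ} {D : ℝ} (h0 : ∀ n, 0 ≤ g₁ n) (h0' : ∀ n, 0 ≤ g₂ n)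
    (h : ∀ᶠ n in atTop, g₁ n ≤ D * g₂ n) : g₁ =O[atTop] g₂ := by
  refine IsBigO.of_bound D ?_
  filter_upwards [h] with n hn
  rwa [Real.norm_of_nonneg (h0 n), Real.norm_of_nonneg (h0' n)]

lemma exists_le_mul_of_isBigO {g₁ g₂ : ℕ → ℝ} (h0 : ∀ n, 0 ≤ g₁ n) (h0' : ∀ n, 0 ≤ g₂ n)
    (h : g₁ =O[atTop] g₂) : ∃ D : ℝ, 0 < D ∧ ∀ᶠ n in atTop, g₁ n ≤ D * g₂ n := by
  obtain ⟨D, hD, h⟩ := h.exists_pos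
  refine ⟨D, hD, ?_⟩
  filter_upwards [h.bound] with n hn
  rwa [Real.norm_of_nonneg (h0 n), Real.norm_of_nonneg (h0' n)] at hn

lemma supBigO_of_le {D : ℕ → Ω → ℝ → ℝ → ℝ} {r₁ r₂ r : ℕ → ℝ}
    (h : ∀ᵐ ω ∂P, ∃ C : ℝ, ∀ᶠ n in atTop, ∀ s ∈ Icc a b, ∀ t ∈ Icc a b,
      |D n ω s t| ≤ C * r₁ n + C * r₂ n) (h1 : r₁ =O[atTop] r) (h2 : r₂ =O[atTop] r)
    (h01 : ∀ n, 0 ≤ r₁ n) (h02 : ∀ n, 0 ≤ r₂ n) (h0 : ∀ n, 0 ≤ r n) :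
    SupBigOAlmostSurely P a b D r := by
  obtain ⟨D₁, -, h1⟩ := exists_le_mul_of_isBigO h01 h0 h1
  obtain ⟨D₂, -, h2⟩ := exists_le_mul_of_isBigO h02 h0 h2
  filter_upwards [h] with ω ⟨C, hC⟩
  refine ⟨|C| * (D₁ + D₂), ?_⟩
  filter_upwards [hC, h1, h2] with n hn h1 h2 s hs t ht
  refine (hn s hs t ht).trans ?_
  calc C * r₁ n + C * r₂ n ≤ |C| * r₁ n + |C| * r₂ n :=
        add_le_add (mul_le_mul_of_nonneg_right (le_abs_self C) (h01 n))
          (mul_le_mul_of_nonneg_right (le_abs_self C) (h02 n))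
    _ ≤ |C| * (D₁ * r n) + |C| * (D₂ * r n) := by gcongr
    _ = _ := by ring

lemma rpow_half_eq_sqrt (x : ℝ) (n : ℕ) :
    (Real.log n / (n * x)) ^ (1 / 2 : ℝ) = √(1 / x * logRatio n) := by
  rw [← Real.sqrt_eq_rpow, logRatio, div_mul_div_comm, one_mul, mul_comm x]

lemma one_div_mul_logRatio_nonneg {h : ℕ → ℝ} (hh : ∀ n, 0 < h n) (n : ℕ) :
    0 ≤ 1 / h n * logRatio n :=
  mul_nonneg (one_div_pos.2 (hh n)).le (logRatio_nonneg n)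

lemma one_div_le_one_div_sq {h : ℕ → ℝ} (hh : ∀ n, 0 < h n) (hlim : Tendsto h atTop (𝓝 0)) :
    ∀ᶠ n in atTop, 1 / h n ≤ 1 / h n ^ 2 := by
  filter_upwards [hlim.eventually_le_const one_pos] with n hn
  have := hh n
  exact one_div_le_one_div_of_le (by positivity) (by nlinarith)

namespace RegularModel

variable (R : RegularModel P ν a b σ f X Y ξ T U B m K mT MT)
include R

lemma bivariateRate_sparse (hest : AreLocalLinearEstimators a b K m hμ hR hV X ξ T U μhat Chat Vhat)
    {M : ℕ} (hM : ∀ n, ∀ i < n, m n i ≤ M) (hlamR : 2 < lamR)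
    (hBR : Integrable (fun x => B x ^ (2 * lamR)) ν)
    (hUR : Integrable (fun u => |u| ^ (2 * lamR)) (errorLaw P U))
    (hR_pos : ∀ n, 0 < hR n) (hR_lim : Tendsto hR atTop (𝓝 0)) (hR_rate : BandwidthRate₂ m lamR hR) :
    FitRates hR (fun n => √(1 / hR n ^ 2 * logRatio n)) ∧
    BivariateRate P ξ T U m a b K hR (fun n => √(1 / hR n ^ 2 * logRatio n)) (crossNoise ν Y)
      (secondMoment ν Y) Chat := by
  have := R.model.isProbabilityMeasure_timeLaw
  have hC := BandwidthRate₂_le R.two_le hR_pos hR_lim hR_rate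
  have hr := fitRates_sparse hR_pos hR_lim hlamR (one_div_le_one_div_sq hR_pos hR_lim) hC
  refine ⟨hr, R.bivariateRate_cross hr ?_ hest.cross⟩
  exact (R.familyLaw_cross_sparse hM hlamR hBR hUR
    (fun n => one_div_pos.2 (pow_pos (hR_pos n) 2)) hC).mono_class
    fun c => ⟨c ^ 2, fun n => pairClass_subset_boundedClass hR c n⟩

/-- The rate of `R̂` for sparse data. -/
theorem covEst_sparse (hest : AreLocalLinearEstimators a b K m hμ hR hV X ξ T U μhat Chat Vhat)
    {M : ℕ} (hM : ∀ n, ∀ i < n, m n i ≤ M) (hlamμ : 2 < lamμ) (hlamR : 2 < lamR)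
    (hBμ : Integrable (fun x => B x ^ lamμ) ν)
    (hUμ : Integrable (fun u => |u| ^ lamμ) (errorLaw P U))
    (hBR : Integrable (fun x => B x ^ (2 * lamR)) ν)
    (hUR : Integrable (fun u => |u| ^ (2 * lamR)) (errorLaw P U))
    (hμ_pos : ∀ n, 0 < hμ n) (hμ_lim : Tendsto hμ atTop (𝓝 0)) (hμ_rate : BandwidthRate₁ m lamμ hμ)
    (hR_pos : ∀ n, 0 < hR n) (hR_lim : Tendsto hR atTop (𝓝 0)) (hR_rate : BandwidthRate₂ m lamR hR)
    (hRμ : (fun n => hR n ^ 2) =O[atTop] hμ) (hμR : hμ =O[atTop] hR) :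
    SupBigOAlmostSurely P a b (fun n ω s t => covEst μhat Chat n ω s t - covFun ν X s t)
      (fun n => hR n ^ 2 + √(1 / hR n ^ 2 * logRatio n)) := by
  have hCμ := BandwidthRate₁_le R.two_le hμ_pos hμ_lim hμ_rate
  have hrμ := fitRates_sparse hμ_pos hμ_lim hlamμ (Eventually.of_forall fun n => le_rfl) hCμ
  have hfμ := R.univariateRate_mean hrμ
    (R.familyLaw_single_sparse hM hlamμ hBμ hUμ hμ_pos hCμ) hest.mean
  obtain ⟨hrR, hfR⟩ := R.bivariateRate_sparse hest hM hlamR hBR hUR hR_pos hR_lim hR_rate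
  have h2 : ∀ n, 0 < hR n ^ 2 := fun n => pow_pos (hR_pos n) 2
  have hb : ∀ n, 0 ≤ hR n ^ 2 + √(1 / hR n ^ 2 * logRatio n) := fun n =>
    add_nonneg (h2 n).le (Real.sqrt_nonneg _)
  have o1 : (fun n => hR n ^ 2) =O[atTop] fun n => hR n ^ 2 + √(1 / hR n ^ 2 * logRatio n) :=
    isBigO_of_le_mul (D := 1) (fun n => (h2 n).le) hb (Eventually.of_forall fun n => by
      have := Real.sqrt_nonneg (1 / hR n ^ 2 * logRatio n); linarith)
  have o2 : (fun n => √(1 / hR n ^ 2 * logRatio n)) =O[atTop]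
      fun n => hR n ^ 2 + √(1 / hR n ^ 2 * logRatio n) :=
    isBigO_of_le_mul (D := 1) (fun n => Real.sqrt_nonneg _) hb (Eventually.of_forall fun n => by
      have := (h2 n).le; linarith)
  -- After squaring, the comparison of the two noise rates is `1/h_μ ≲ 1/h_R²`, that is, `h_R² ≲
  -- h_μ`.
  have o3 : (fun n => √(1 / hμ n * logRatio n)) =O[atTop] fun n => √(1 / hR n ^ 2 * logRatio n) := by
    refine isBigO_sqrt_of_sq (one_div_mul_logRatio_nonneg h2) ?_
    simp only [Real.sq_sqrt (one_div_mul_logRatio_nonneg hμ_pos _)]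
    refine IsBigO.mul ?_ (isBigO_refl _ _)
    simp only [one_div]
    exact hRμ.inv_rev (Eventually.of_forall fun n h0 => absurd h0 (h2 n).ne')
  exact supBigO_of_le (ae_covEst_le R.process R.path_eq hrμ hrR hfμ hfR)
    ((o3.trans o2).add ((hμR.pow 2).trans o1)) (o2.add o1)
    (fun n => add_nonneg (Real.sqrt_nonneg _) (sq_nonneg _))
    (fun n => add_nonneg (Real.sqrt_nonneg _) (sq_nonneg _)) hb

/-- The rate of `σ̂²` for sparse data. -/
theorem errVarEst_sparse (hest : AreLocalLinearEstimators a b K m hμ hR hV X ξ T U μhat Chat Vhat)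
    {M : ℕ} (hM : ∀ n, ∀ i < n, m n i ≤ M) (hlamR : 2 < lamR) (hlamV : 2 < lamV)
    (hBR : Integrable (fun x => B x ^ (2 * lamR)) ν)
    (hUR : Integrable (fun u => |u| ^ (2 * lamR)) (errorLaw P U))
    (hBV : Integrable (fun x => B x ^ (2 * lamV)) ν)
    (hUV : Integrable (fun u => |u| ^ (2 * lamV)) (errorLaw P U))
    (hR_pos : ∀ n, 0 < hR n) (hR_lim : Tendsto hR atTop (𝓝 0)) (hR_rate : BandwidthRate₂ m lamR hR)
    (hV_pos : ∀ n, 0 < hV n) (hV_lim : Tendsto hV atTop (𝓝 0)) (hV_rate : BandwidthRate₁ m lamV hV)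
    (hVR : (fun n => hV n + logRatio n ^ (1 / 3 : ℝ)) =O[atTop] hR)
    (hRV : hR =O[atTop] fun n => hV n ^ 2 * n / Real.log n) :
    ErrVarBigOAlmostSurely P a b σ Chat Vhat (fun n => hR n ^ 2 + √(1 / hR n * logRatio n)) := by
  have := R.model.isProbabilityMeasure_timeLaw
  have hCV := BandwidthRate₁_le R.two_le hV_pos hV_lim hV_rate
  have hrV := fitRates_sparse hV_pos hV_lim hlamV (Eventually.of_forall fun n => le_rfl) hCV
  have hlawV := R.familyLaw_square_sparse hM hlamV hBV hUV (fun n => one_div_pos.2 (hV_pos n)) hCV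
  have hfV := R.univariateRate_square hrV
    (hlawV.mono_class fun c => ⟨c, fun n => singleClass_subset_boundedClass hV c n⟩) hest.square
  obtain ⟨hrR, hfR⟩ := R.bivariateRate_sparse hest hM hlamR hBR hUR hR_pos hR_lim hR_rate
  have hsum : ∀ n, 0 ≤ hV n + logRatio n ^ (1 / 3 : ℝ) := fun n =>
    add_nonneg (hV_pos n).le (Real.rpow_nonneg (logRatio_nonneg n) _)
  obtain ⟨D, hD, hVR'⟩ := exists_le_mul_of_isBigO hsum (fun n => (hR_pos n).le) hVR
  have hVle : ∀ᶠ n in atTop, hV n ≤ D * hR n := hVR'.mono fun n hn => by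
    have := Real.rpow_nonneg (logRatio_nonneg n) (1 / 3); linarith
  -- The cube of `r ^ (1/3) ≲ h_R`, with `r` the log ratio.
  have hLle : ∀ᶠ n in atTop, logRatio n ≤ D ^ 3 * hR n ^ 3 := hVR'.mono fun n hn => by
    have h0 := Real.rpow_nonneg (logRatio_nonneg n) (1 / 3)
    have h1 : logRatio n ^ (1 / 3 : ℝ) ≤ D * hR n := by linarith [hV_pos n]
    have h2 := pow_le_pow_left₀ h0 h1 3
    rw [← Real.rpow_natCast, ← Real.rpow_mul (logRatio_nonneg n), mul_pow] at h2
    norm_num at h2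
    exact h2
  obtain ⟨E, hE, hRV'⟩ := exists_le_mul_of_isBigO (fun n => (hR_pos n).le) (fun n => div_nonneg
    (mul_nonneg (sq_nonneg (hV n)) n.cast_nonneg) (Real.log_natCast_nonneg n)) hRV
  -- The upper condition on `h_R` in product form; the start at `n = 2` keeps the logarithm
  -- positive.
  have hRle : ∀ᶠ n in atTop, hR n * logRatio n ≤ E * hV n ^ 2 := by
    filter_upwards [hRV', eventually_ge_atTop 2] with n hn h2
    have hl := logRatio_pos h2
    have e : hV n ^ 2 * n / Real.log n = hV n ^ 2 / logRatio n := by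
      rw [logRatio, div_div_eq_mul_div]
    rwa [e, ← mul_div_assoc, le_div_iff₀ hl] at hn
  -- The integral of `V̂` is treated at level `1/h_R` instead of `1/h_V`. As `h_V ≲ h_R`, this level
  -- is smaller up to a constant, so the truncation condition carries over.
  have hCI : ∀ᶠ n in atTop, 1 / hR n * logRatio n ^ (1 - 2 / lamV) ≤ D * 2 := by
    filter_upwards [hCV, hVle] with n h1 h2
    have hVn := hV_pos n
    have hRn := hR_pos n
    have h3 : 1 / hR n ≤ D * (1 / hV n) := by
      rw [mul_one_div, div_le_div_iff₀ hRn hVn, one_mul]; exact h2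
    calc 1 / hR n * logRatio n ^ (1 - 2 / lamV)
        ≤ D * (1 / hV n) * logRatio n ^ (1 - 2 / lamV) :=
          mul_le_mul_of_nonneg_right h3 (Real.rpow_nonneg (logRatio_nonneg n) _)
      _ = D * (1 / hV n * logRatio n ^ (1 - 2 / lamV)) := by ring
      _ ≤ D * 2 := by gcongr
  have hCI' : ∀ᶠ n in atTop, 1 / hR n * logRatio n ^ (1 - 2 / lamR) ≤ 3 := by
    filter_upwards [BandwidthRate₂_le R.two_le hR_pos hR_lim hR_rate,
      one_div_le_one_div_sq hR_pos hR_lim] with n h1 h2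
    exact (mul_le_mul_of_nonneg_right h2 (Real.rpow_nonneg (logRatio_nonneg n) _)).trans h1
  have hone : ∀ᶠ n in atTop, 1 ≤ 1 / hR n := by
    filter_upwards [hR_lim.eventually_le_const one_pos] with n hn
    exact one_le_one_div (hR_pos n) hn
  have iV := (R.integralRate_square hrV hest.square hfV).2 _ _
    (R.familyLaw_square_sparse hM hlamV hBV hUV (fun n => one_div_pos.2 (hR_pos n)) hCI)
    (fun n => Real.sqrt_nonneg _) hone
  have iR := (R.integralRate_cross hrR hest.cross hfR).2 _
    (R.familyLaw_cross_sparse hM hlamR hBR hUR (fun n => one_div_pos.2 (hR_pos n)) hCI')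
    (fun n => Real.sqrt_nonneg _)
  have hb : ∀ n, 0 ≤ hR n ^ 2 + √(1 / hR n * logRatio n) := fun n =>
    add_nonneg (sq_nonneg _) (Real.sqrt_nonneg _)
  have o1 : (fun n => hR n ^ 2) =O[atTop] fun n => hR n ^ 2 + √(1 / hR n * logRatio n) :=
    isBigO_of_le_mul (D := 1) (fun n => sq_nonneg _) hb (Eventually.of_forall fun n => by
      have := Real.sqrt_nonneg (1 / hR n * logRatio n); linarith)
  have o2 : (fun n => √(1 / hR n * logRatio n)) =O[atTop]
      fun n => hR n ^ 2 + √(1 / hR n * logRatio n) :=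
    isBigO_of_le_mul (D := 1) (fun n => Real.sqrt_nonneg _) hb (Eventually.of_forall fun n => by
      have := sq_nonneg (hR n); linarith)
  have hl0 := one_div_mul_logRatio_nonneg hR_pos
  -- The quadratic remainder of `V̂` is `r/h_V`; it is at most of order `√(r/h_R)` exactly when `r
  -- h_R ≲ h_V²`.
  have oV : (fun n => √(1 / hV n * logRatio n) ^ 2) =O[atTop]
      fun n => √(1 / hR n * logRatio n) := by
    simp only [Real.sq_sqrt (one_div_mul_logRatio_nonneg hV_pos _)]
    refine isBigO_sqrt_of_sq hl0 (isBigO_of_le_mul (D := E) (fun n => sq_nonneg _) hl0 ?_)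
    filter_upwards [hRle] with n hn
    have hVn := hV_pos n
    have hRn := hR_pos n
    have hln := logRatio_nonneg n
    rw [one_div_mul_eq_div, one_div_mul_eq_div, div_pow, ← mul_div_assoc,
      div_le_div_iff₀ (by positivity) hRn]
    calc logRatio n ^ 2 * hR n = hR n * logRatio n * logRatio n := by ring
      _ ≤ E * hV n ^ 2 * logRatio n := by gcongr
      _ = _ := by ring
  -- The quadratic remainder of `Ĉ` is `r/h_R²`; it is at most of order `√(r/h_R)` exactly when `r ≲
  -- h_R³`.
  have oR : (fun n => √(1 / hR n ^ 2 * logRatio n) ^ 2) =O[atTop]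
      fun n => √(1 / hR n * logRatio n) := by
    simp only [Real.sq_sqrt (one_div_mul_logRatio_nonneg (fun n => pow_pos (hR_pos n) 2) _)]
    refine isBigO_sqrt_of_sq hl0 (isBigO_of_le_mul (D := D ^ 3) (fun n => sq_nonneg _) hl0 ?_)
    filter_upwards [hLle] with n hn
    have hRn := hR_pos n
    have hln := logRatio_nonneg n
    rw [one_div_mul_eq_div, one_div_mul_eq_div, div_pow, ← mul_div_assoc,
      div_le_div_iff₀ (by positivity) hRn]
    calc logRatio n ^ 2 * hR n = logRatio n * (logRatio n * hR n) := by ring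
      _ ≤ D ^ 3 * hR n ^ 3 * (logRatio n * hR n) := by gcongr
      _ = _ := by ring
  have oV2 : (fun n => hV n ^ 2) =O[atTop] fun n => hR n ^ 2 :=
    (isBigO_of_le_mul (fun n => (hV_pos n).le) (fun n => (hR_pos n).le) hVle).pow 2
  refine R.errVarBigO (Eventually.of_forall hb)
    (iV.mono (((oV.trans o2).add (oV2.trans o1)).add o2) ?_ (Eventually.of_forall hb))
    (iR.mono (((oR.trans o2).add o1).add o2) ?_ (Eventually.of_forall hb))
  · exact Eventually.of_forall fun n => by positivity
  · exact Eventually.of_forall fun n => by positivity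

/-- The rates of `R̂` and `σ̂²` for dense data. -/
theorem rates_dense (hest : AreLocalLinearEstimators a b K m hμ hR hV X ξ T U μhat Chat Vhat)
    (hlamμ : 2 < lamμ) (hlamR : 2 < lamR) (hlamV : 2 < lamV)
    (hBμ : Integrable (fun x => B x ^ lamμ) ν)
    (hUμ : Integrable (fun u => |u| ^ lamμ) (errorLaw P U))
    (hBR : Integrable (fun x => B x ^ (2 * lamR)) ν)
    (hUR : Integrable (fun u => |u| ^ (2 * lamR)) (errorLaw P U))
    (hBV : Integrable (fun x => B x ^ (2 * lamV)) ν)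
    (hUV : Integrable (fun u => |u| ^ (2 * lamV)) (errorLaw P U))
    (hμ_pos : ∀ n, 0 < hμ n) (hμ_lim : Tendsto hμ atTop (𝓝 0)) (hμ_rate : BandwidthRate₁ m lamμ hμ)
    (hR_pos : ∀ n, 0 < hR n) (hR_lim : Tendsto hR atTop (𝓝 0)) (hR_rate : BandwidthRate₁ m lamR hR)
    (hV_pos : ∀ n, 0 < hV n) (hV_lim : Tendsto hV atTop (𝓝 0)) (hV_rate : BandwidthRate₁ m lamV hV)
    {M : ℕ → ℝ} (hM : ∀ n, 0 < M n) (hMm : ∀ n, ∀ i < n, M n ≤ m n i)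
    (hMμ : (fun n => (M n)⁻¹) =O[atTop] hμ)
    (hμM : hμ =O[atTop] (fun n => logRatio n ^ (1 / 4 : ℝ)))
    (hMR : (fun n => (M n)⁻¹) =O[atTop] hR)
    (hRM : hR =O[atTop] (fun n => logRatio n ^ (1 / 4 : ℝ)))
    (hMV : (fun n => (M n)⁻¹) =O[atTop] hV)
    (hVM : hV =O[atTop] (fun n => logRatio n ^ (1 / 4 : ℝ))) :
    SupBigOAlmostSurely P a b (fun n ω s t => covEst μhat Chat n ω s t - covFun ν X s t)
      (fun n => logRatio n ^ (1 / 2 : ℝ)) ∧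
    ErrVarBigOAlmostSurely P a b σ Chat Vhat (fun n => logRatio n ^ (1 / 2 : ℝ)) := by
  obtain ⟨lμ, rμ, ⟨cμ, cμ0, mμ⟩, bμ, oμ⟩ :=
    dense_bandwidth hM hMm hμ_pos hμ_lim hlamμ hμ_rate hMμ hμM
  obtain ⟨lR, rR, ⟨cR, cR0, mR⟩, bR, oR⟩ :=
    dense_bandwidth hM hMm hR_pos hR_lim hlamR hR_rate hMR hRM
  obtain ⟨lV, rV, ⟨cV, cV0, mV⟩, bV, oV⟩ :=
    dense_bandwidth hM hMm hV_pos hV_lim hlamV hV_rate hMV hVM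
  have fμ := R.univariateRate_mean rμ
    (R.familyLaw_single_dense hμ_pos cμ0 mμ bμ lμ hBμ hUμ) hest.mean
  have fR := R.bivariateRate_cross rR
    (R.familyLaw_cross_dense hR_pos cR0 mR bR lR hBR hUR) hest.cross
  have fV := R.univariateRate_square rV
    (R.familyLaw_square_dense hV_pos cV0 mV bV lV hBV hUV) hest.square
  -- The noise rate is already `√r`, so integrating the uniform bounds loses nothing and the
  -- linearization is not required.
  have iV := (R.integralRate_square rV hest.square fV).1
  have iR := (R.integralRate_cross rR hest.cross fR).1
  simp only [← Real.sqrt_eq_rpow] at oμ oR oV ⊢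
  have o := isBigO_refl (fun n => √(logRatio n)) atTop
  have h0 : ∀ n, 0 ≤ √(logRatio n) := fun n => Real.sqrt_nonneg _
  have hs : ∀ h : ℕ → ℝ, ∀ n, 0 ≤ √(logRatio n) + h n ^ 2 := fun h n =>
    add_nonneg (h0 n) (sq_nonneg _)
  exact ⟨supBigO_of_le (ae_covEst_le R.process R.path_eq rμ rR fμ fR) (o.add oμ) (o.add oR)
      (hs hμ) (hs hR) h0,
    R.errVarBigO (Eventually.of_forall h0)
      (iV.mono (o.add oV) (Eventually.of_forall (hs hV)) (Eventually.of_forall h0))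
      (iR.mono (o.add oR) (Eventually.of_forall (hs hR)) (Eventually.of_forall h0))⟩

end RegularModel

end Main

/-! ### The corollary -/

theorem corollary3p5 {Ω S : Type*} [MeasurableSpace Ω] [MeasurableSpace S]
    (P : Measure Ω) [IsProbabilityMeasure P] (ν : Measure S) [IsProbabilityMeasure ν]
    (a b σ : ℝ) (hab : a < b)
    -- the process, the realizations, the observation times and the errors
    (f : ℝ → ℝ) (X : S → ℝ → ℝ) (ξ : ℕ → Ω → S) (T U : ℕ → ℕ → Ω → ℝ)
    (hmodel : ObservationModel P ν a b σ f X ξ T U)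
    -- the numbers of observations per curve
    (m : ℕ → ℕ → ℕ) (hm : ∀ n, ∀ i < n, 2 ≤ m n i)
    -- the bandwidths
    (hμ hR hV : ℕ → ℝ) (hμ_pos : ∀ n, 0 < hμ n) (hR_pos : ∀ n, 0 < hR n)
    (hV_pos : ∀ n, 0 < hV n)
    -- density, kernel and smoothness
    (hf : DensityCond a b f) (K : ℝ → ℝ) (hK : KernelCond K)
    (hmean : TwiceDiffBounded a b (meanFun ν X))
    (hcov : SecondPartialsBounded a b (covFun ν X))
    -- moments and bandwidths (the rate condition on `hR` is stated in the two parts)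
    (lamμ lamR lamV : ℝ) (hlamμ : 2 < lamμ) (hlamR : 2 < lamR) (hlamV : 2 < lamV)
    (hμ_moment : MomentCond P ν a b X U lamμ)
    (hμ_lim : Tendsto hμ atTop (𝓝 0)) (hμ_rate : BandwidthRate₁ m lamμ hμ)
    (hR_moment : MomentCond P ν a b X U (2 * lamR))
    (hR_lim : Tendsto hR atTop (𝓝 0))
    (hV_moment : MomentCond P ν a b X U (2 * lamV))
    (hV_lim : Tendsto hV atTop (𝓝 0)) (hV_rate : BandwidthRate₁ m lamV hV)
    -- the estimators
    (μhat : ℕ → Ω → ℝ → ℝ) (Chat : ℕ → Ω → ℝ → ℝ → ℝ) (Vhat : ℕ → Ω → ℝ → ℝ)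
    (hest : AreLocalLinearEstimators a b K m hμ hR hV X ξ T U μhat Chat Vhat) :
    -- sparse data
    (BandwidthRate₂ m lamR hR → (∃ M : ℕ, ∀ n, ∀ i < n, m n i ≤ M) →
      (((fun n => hR n ^ 2) =O[atTop] hμ → hμ =O[atTop] hR →
        SupBigOAlmostSurely P a b
          (fun n ω s t => covEst μhat Chat n ω s t - covFun ν X s t)
          (fun n => hR n ^ 2 + (Real.log n / (n * hR n ^ 2)) ^ (1 / 2 : ℝ))) ∧
      ((fun n => hV n + logRatio n ^ (1 / 3 : ℝ)) =O[atTop] hR →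
        hR =O[atTop] (fun n => hV n ^ 2 * n / Real.log n) →
        ErrVarBigOAlmostSurely P a b σ Chat Vhat
          (fun n => hR n ^ 2 + (Real.log n / (n * hR n)) ^ (1 / 2 : ℝ))))) ∧
    -- dense data
    (BandwidthRate₁ m lamR hR → ∀ M : ℕ → ℝ, (∀ n, 0 < M n) → (∀ n, ∀ i < n, M n ≤ m n i) →
      (fun n => (M n)⁻¹) =O[atTop] hμ → hμ =O[atTop] (fun n => logRatio n ^ (1 / 4 : ℝ)) →
      (fun n => (M n)⁻¹) =O[atTop] hR → hR =O[atTop] (fun n => logRatio n ^ (1 / 4 : ℝ)) →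
      (fun n => (M n)⁻¹) =O[atTop] hV → hV =O[atTop] (fun n => logRatio n ^ (1 / 4 : ℝ)) →
      SupBigOAlmostSurely P a b
          (fun n ω s t => covEst μhat Chat n ω s t - covFun ν X s t)
          (fun n => logRatio n ^ (1 / 2 : ℝ)) ∧
        ErrVarBigOAlmostSurely P a b σ Chat Vhat (fun n => logRatio n ^ (1 / 2 : ℝ))) := by
  obtain ⟨Y, B, mT, MT, hreg, hint⟩ := exists_regularModel hmodel hab hm hf hK hmean hcov hlamμ
    hμ_moment
  obtain ⟨hBμ, hUμ⟩ := hint lamμ (by linarith) hμ_moment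
  obtain ⟨hBR, hUR⟩ := hint (2 * lamR) (by linarith) hR_moment
  obtain ⟨hBV, hUV⟩ := hint (2 * lamV) (by linarith) hV_moment
  simp only [rpow_half_eq_sqrt]
  refine ⟨fun hR_rate ⟨M, hM⟩ => ⟨fun hRμ hμR => ?_, fun hVR hRV => ?_⟩,
    fun hR_rate M hM hMm hMμ hμM hMR hRM hMV hVM => ?_⟩
  · exact hreg.covEst_sparse hest hM hlamμ hlamR hBμ hUμ hBR hUR hμ_pos hμ_lim hμ_rate hR_pos
      hR_lim hR_rate hRμ hμR
  · exact hreg.errVarEst_sparse hest hM hlamR hlamV hBR hUR hBV hUV hR_pos hR_lim hR_rate hV_pos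
      hV_lim hV_rate hVR hRV
  · exact hreg.rates_dense hest hlamμ hlamR hlamV hBμ hUμ hBR hUR hBV hUV hμ_pos hμ_lim hμ_rate
      hR_pos hR_lim hR_rate hV_pos hV_lim hV_rate hM hMm hMμ hμM hMR hRM hMV hVM
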